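/- **Setting.** A client (Alice) stores a dictionary on a server (Bob). A word takes one of $W$ values. Each I/O operation is a message by which the client fetches, or overwrites, the words at a list of server addresses; a message has at most $B$ words, addresses included. Contents are encrypted, so Bob observes exactly the kind (fetch or overwrite) and the addresses of every operation. The client is randomized and its local computation is free. The operations are $\mathsf{get}(k)$ (return and remove the value with key $k$, or return "not found") and $\mathsf{put}(k,v)$ (add the item, or report an error if the key is present). A workload is an initial set of items with distinct keys and an arbitrary sequence of $N$ operations during which the dictionary never has more than $n$ items; nothing else is assumed of the keys, so the sequence need not be isogrammic. Keys are words, values consist of $B'=\lfloor B^{1/4}\rfloor$ words. **The B-tree OS.** Let $D=4\lceil \log n/\log B\rceil$. A B-tree $F$ of depth $D$ with at most $B'$ entries per node (all leaves at depth $D$, the items one level below the leaves), together with blank cells and a singly linked list of $(D+2)\lceil\sqrt n\rceil$ dummy nodes, is stored in randomly permuted order in an array of cells of $O(B')$ words each. There is one cache per level, with $2\lceil\sqrt n\rceil$ cells. An access to a key $k$ follows the search path for $k$ or its predecessor from the root to an item. On each level it reads the whole cache, and then one cell of the array: the node sought if it is not in the cache, and otherwise the next node of the dummy list. Then the nodes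 on the path are updated ($\mathsf{get}$ deletes the entry of a found item without rebalancing; $\mathsf{put}$ inserts a new item, splitting nodes with more than $B'$ entries), and, from the bottom level up, exactly two cells per level (the updated node, and a new node or padding) are written to the cache. After every $\lceil\sqrt n\rceil$ accesses, $F$ and the dummy list are rebuilt and reshuffled. **Theorem.** For every $C>0$ there are constants $K$, $B_0$ and $c>1$ such that the following holds for all $B\ge B_0$, all $n$ with $2\le n\le C B^{3/2}$ and all $W\ge nB$. We have $\lceil\log n/\log B\rceil\le K$, and there are client programs for building $F$ from the initial items and for rebuilding it with which the B-tree OS has all of the following properties. 1. Every message has at most $B$ words, and the client needs a private memory of at most $KB$ words. 2. It implements the dictionary: for every workload all responses are correct, with probability 1. 3. After the setup and after each rebuild, the array contains a B-tree of depth $D$ for the current dictionary and a fresh dummy list, permuted by a permutation that is uniformly distributed and independent of everything that Bob has observed so far. 4. For every workload, the setup takes at most $K\lceil\sqrt n\,\rceil$ I/O operations with probability at least $1-n^{-c}$, and the $N$ accesses, including all rebuilds, take at most $K\cdot N\cdot\lceil\log n/\log B\rceil$ I/O operations in total with probability at least $1-n^{-c}$. That is, the I/O overhead is $O(\log n/\log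 B)=O(1)$ with high probability. 5. It is statistically secure: if one of two workloads with the same number $N$ of operations is chosen by a fair coin and simulated, then no (randomized, computationally unbounded) strategy of Bob guesses, from all that he observes during the setup and each of the accesses, which one was chosen with probability greater than $1/2$. -/

import Mathlib

/-! ## Client programs and what the server sees

Words are elements of `Fin W`. The server stores one word at each address in `Fin W`.
One I/O operation is a message by which the client fetches the words at a list of addresses, or
overwrites the words at a list of addresses. Contents are encrypted, so the server observes
exactly the kind of the operation and the addresses. Local computation is free. -/

namespace OS

/-- Server memory. -/
abbrev Mem (W : ℕ) := Fin W → Fin W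

/-- What the server observes of one I/O operation. -/
inductive Event (W : ℕ) : Type
  | read (addrs : List (Fin W))
  | write (addrs : List (Fin W))

/-- A randomized client program with result in `α`. -/
inductive Prog (W : ℕ) (α : Type) : Type
  | ret (a : α) : Prog W α
  | read (addrs : List (Fin W)) (next : (Fin addrs.length → Fin W) → Prog W α) : Prog W α
  | write (pairs : List (Fin W × Fin W)) (next : Prog W α) : Prog W α
  /-- draw a uniform element of `Fin (k + 1)` with fresh private coins -/
  | sample (k : ℕ) (next : Fin (k + 1) → Prog W α) : Prog W α

namespace Prog

variable {W : ℕ}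

def bind {α β : Type} : Prog W α → (α → Prog W β) → Prog W β
  | ret a, f => f a
  | read as k, f => read as fun r => (k r).bind f
  | write ps p, f => write ps (p.bind f)
  | sample k g, f => sample k fun i => (g i).bind f

instance : Monad (Prog W) where
  pure := ret
  bind := bind

/-- Run `f` on the entries of a list, from left to right. -/
def forList {ι β : Type} (f : ι → Prog W β) : List ι → Prog W (List β)
  | [] => ret []
  | i :: l => do
      let x ← f i
      let xs ← forList f l
      return x :: xs

/-- Fetch the words at a list of addresses in one operation. -/
def fetch (addrs : List (Fin W)) : Prog W (List (Fin W)) :=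
  read addrs fun r => ret (List.ofFn r)

/-- Overwrite words in one operation. -/
def store (pairs : List (Fin W × Fin W)) : Prog W Unit :=
  write pairs (ret ())

/-- Joint law of the result, the final server memory and the observed events. -/
noncomputable def run {α : Type} : Prog W α → Mem W → PMF (α × Mem W × List (Event W))
  | ret a, m => PMF.pure (a, m, [])
  | read as k, m =>
      (run (k fun i => m (as.get i)) m).map fun x => (x.1, x.2.1, Event.read as :: x.2.2)
  | write ps p, m =>
      (run p (ps.foldl (fun m' q => Function.update m' q.1 q.2) m)).map fun x =>
        (x.1, x.2.1, Event.write (ps.map Prod.fst) :: x.2.2)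
  | sample k f, m => (PMF.uniformOfFintype (Fin (k + 1))).bind fun i => run (f i) m

/-- Every message, addresses included, has at most `B` words. -/
def BlockBound {α : Type} (B : ℕ) : Prog W α → Prop
  | ret _ => True
  | read as k => as.length ≤ B ∧ ∀ r, BlockBound B (k r)
  | write ps p => 2 * ps.length ≤ B ∧ BlockBound B p
  | sample _ f => ∀ i, BlockBound B (f i)

/-- The configurations of the client: all the ways in which it may still have to continue,
whatever words the server returns and whatever the coins are. A client that has `M` words of
private memory between I/O operations has at most `W ^ M` configurations. -/
def configs {α : Type} : Prog W α → Set (Prog W α)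
  | ret a => {ret a}
  | read as k => insert (read as k) (⋃ r, configs (k r))
  | write ps p => insert (write ps p) (configs p)
  | sample k f => insert (sample k f) (⋃ i, configs (f i))

end Prog

/-! ## Parameters -/

/-- `W`: number of different words; `B`: message size in words; `n`: capacity. -/
structure Params where
  W : ℕ
  B : ℕ
  n : ℕ
  W_pos : 0 < W

namespace Params

variable (P : Params)

abbrev Word := Fin P.W

/-- The natural number `x` as a word. -/
def word (x : ℕ) : P.Word := ⟨x % P.W, Nat.mod_lt _ P.W_pos⟩

/-- `B' = B^{1/4}`: the branching factor, and the number of words of a value. -/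
noncomputable def branch : ℕ := ⌊(P.B : ℝ) ^ ((1 : ℝ) / 4)⌋₊

/-- `⌈log n / log B⌉`. -/
noncomputable def ratio : ℕ := ⌈Real.log P.n / Real.log P.B⌉₊

/-- The depth `D` of the B-tree: the root has depth `0`, the leaves have depth `D`. -/
noncomputable def depth : ℕ := 4 * P.ratio

/-- Levels `0, …, D` hold the B-tree nodes, level `D + 1` holds the items. -/
noncomputable def levels : ℕ := P.depth + 2

/-- `⌈√n⌉`: the number of accesses between two rebuilds. -/
noncomputable def epoch : ℕ := ⌈√(P.n : ℝ)⌉₊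

/-- Nodes, items and dummies occupy cells of `O(B')` consecutive words. -/
noncomputable def cellWords : ℕ := 2 * P.branch + 3

/-- Number of cells for nodes and items. -/
noncomputable def treeCells : ℕ := 2 * P.n + P.depth + 1

/-- Number of cells of the shuffled array: nodes, items and the dummy list, which has one dummy
per level and access. -/
noncomputable def arrayCells : ℕ := P.treeCells + P.levels * P.epoch

abbrev Val := Fin P.branch → P.Word

abbrev Item := P.Word × P.Val

end Params

/-! ## Dictionaries -/

inductive Op (P : Params) : Type
  | get (k : P.Word)
  | put (k : P.Word) (v : P.Val)

def Op.key {P : Params} : Op P → P.Word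
  | .get k => k
  | .put k _ => k

inductive Resp (P : Params) : Type
  | value (v : P.Val)
  | notFound
  | stored
  /-- error: there is already an item with this key -/
  | keyExists

abbrev Dict (P : Params) := P.Word → Option P.Val

namespace Dict

variable {P : Params}

def ofList (S : List P.Item) : Dict P := fun k => (S.find? fun x => x.1 = k).map Prod.snd

/-- `get` returns and removes the value; `put` adds an item with a new key. -/
def step (d : Dict P) : Op P → Resp P × Dict P
  | .get k =>
      match d k with
      | some v => (.value v, Function.update d k none)
      | none => (.notFound, d)
  | .put k v =>
      match d k with
      | some _ => (.keyExists, d)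
      | none => (.stored, Function.update d k (some v))

def responses (d : Dict P) : List (Op P) → List (Resp P)
  | [] => []
  | o :: os => (d.step o).1 :: responses (d.step o).2 os

/-- The dictionary after a sequence of operations. -/
def after (d : Dict P) : List (Op P) → Dict P
  | [] => d
  | o :: os => after (d.step o).2 os

noncomputable def size (d : Dict P) : ℕ := Set.ncard {k | (d k).isSome}

end Dict

/-- An initial set of items and an access sequence. -/
structure Workload (P : Params) where
  init : List P.Item
  ops : List (Op P)

/-- The keys of the initial items are distinct, and the dictionary never exceeds `n` items.
Nothing else is asked of the access sequence. -/
structure Workload.Valid {P : Params} (w : Workload P) : Prop where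
  nodup : (w.init.map Prod.fst).Nodup
  size_le : ∀ j, ((Dict.ofList w.init).after (w.ops.take j)).size ≤ P.n

/-! ## Cells -/

/-- Contents of a cell. -/
inductive Rec (P : Params) : Type
  | blank
  /-- a node of the B-tree: pairs of a separator and the name of a child; in a leaf, pairs of a
  key and the name of the item with this key -/
  | node (entries : List (P.Word × P.Word))
  | item (k : P.Word) (v : P.Val)
  /-- a node of the dummy list, with the name of the next one -/
  | dummy (next : P.Word)
  /-- an item that was removed -/
  | gone

namespace Rec

variable {P : Params}

def isBlank : Rec P → Bool
  | blank => true
  | _ => false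

/-- A cell with its name, in words. -/
noncomputable def encode (name : P.Word) (r : Rec P) : List P.Word :=
  let l := match r with
    | blank => [P.word 0, name]
    | node es => [P.word 1, name, P.word es.length] ++ es.flatMap fun e => [e.1, e.2]
    | item k v => [P.word 2, name, k] ++ List.ofFn v
    | dummy next => [P.word 3, name, next]
    | gone => [P.word 4, name]
  (l ++ List.replicate P.cellWords (P.word 0)).take P.cellWords

def pairs : List P.Word → List (P.Word × P.Word)
  | a :: b :: l => (a, b) :: pairs l
  | _ => []

/-- The name and the contents of a cell given in words. -/
noncomputable def decode : List P.Word → P.Word × Rec P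
  | tag :: name :: x :: l =>
      (name,
        if tag.val = 1 then node (pairs (l.take (2 * x.val)))
        else if tag.val = 2 then item x fun i => l.getD i (P.word 0)
        else if tag.val = 3 then dummy x
        else if tag.val = 4 then gone
        else blank)
  | _ => (P.word 0, blank)

end Rec

/-! ## The B-tree storage scheme

Server memory consists of the shuffled array (cells `0, …, arrayCells - 1`), then one cache of
`2 * epoch` cells for each level, then free space. A node or item that lies in the array has the
index of its cell as its name; those created during an epoch get new names. Each access appends
two cells to the cache of each level; the last cell with a given name is the valid one. -/

/-- What the client keeps between accesses: the names of the root and of the next unused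
dummy, and the number of accesses since the last rebuild. -/
structure State (P : Params) where
  root : P.Word
  next : P.Word
  time : P.Word

/-- What an access does to the node on the next higher level. -/
inductive Change (P : Params) : Type
  | keep
  | remove (k : P.Word)
  | insert (entry : P.Word × P.Word)

namespace BTree

variable (P : Params)

/-- First cell of the cache for level `i`. -/
noncomputable def cacheStart (i : ℕ) : ℕ := P.arrayCells + i * (2 * P.epoch)

/-- Name of the node that is created on level `i` by access number `t` of the epoch. -/
noncomputable def freshName (i t : ℕ) : P.Word := P.word (P.arrayCells + i * P.epoch + t)

noncomputable def cellAddrs (a : ℕ) : List P.Word :=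
  (List.range P.cellWords).map fun j => P.word (a * P.cellWords + j)

noncomputable def readCell (a : ℕ) : Prog P.W (P.Word × Rec P) := do
  let l ← Prog.fetch (cellAddrs P a)
  return Rec.decode l

/-- Read `len` consecutive words from `a` on, in messages of `B` words. -/
def readRange (a len : ℕ) : Prog P.W (List P.Word) := do
  let parts ← Prog.forList
    (fun j => Prog.fetch ((List.range (min P.B (len - j * P.B))).map fun x =>
      P.word (a + j * P.B + x)))
    (List.range ((len + P.B - 1) / P.B))
  return parts.flatten

/-- Read the whole cache of level `i`. -/
noncomputable def readCache (i : ℕ) : Prog P.W (List (P.Word × Rec P)) := do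
  let l ← readRange P (cacheStart P i * P.cellWords) (2 * P.epoch * P.cellWords)
  return (List.range (2 * P.epoch)).map fun j =>
    Rec.decode ((l.drop (j * P.cellWords)).take P.cellWords)

/-- Read the first unused dummy and return the name of the next one. -/
noncomputable def readDummy (a : P.Word) : Prog P.W P.Word := do
  let c ← readCell P a.val
  match c.2 with
  | .dummy x => return x
  | _ => return a

variable {P}

/-- The current version of `name` in a cache that has been written `t` times in this epoch. -/
def lookup (t : ℕ) (name : P.Word) (cache : List (P.Word × Rec P)) : Option (Rec P) :=
  ((cache.take (2 * t)).reverse.find? fun c => decide (c.1 = name) && !c.2.isBlank).map Prod.snd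

/-- Where the search for `k` goes next: the last entry whose separator is at most `k`. -/
def child (k : P.Word) : Rec P → Option P.Word
  | .node es => ((es.filter fun e => e.1 ≤ k).getLast?).map Prod.snd
  | _ => none

/-- Visit a level: read its whole cache, and then one cell of the array, namely the node `cur`
if it is not in the cache, and the next dummy otherwise. Returns the node with its name, and the
next unused dummy. -/
noncomputable def visit (t i : ℕ) (cur : Option P.Word) (next : P.Word) :
    Prog P.W (Option (P.Word × Rec P) × P.Word) := do
  let cache ← readCache P i
  let cached := cur.bind fun a => (lookup t a cache).map fun r => (a, r)
  match cached, cur with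
  | none, some a =>
      let c ← readCell P a.val
      return (some (a, c.2), next)
  | x, _ =>
      let next' ← readDummy P next
      return (x, next')

/-- The search for `k` through the given levels. Returns the nodes on the search path, with
their names, and the next unused dummy. -/
noncomputable def descend (k : P.Word) (t : ℕ) :
    List ℕ → Option P.Word → P.Word → Prog P.W (List (Option (P.Word × Rec P)) × P.Word)
  | [], _, next => return ([], next)
  | i :: is, cur, next => do
      let x ← visit t i cur next
      let rest ← descend k t is (x.1.bind fun c => child k c.2) x.2
      return (x.1 :: rest.1, rest.2)

def blankCell : P.Word × Rec P := (P.word 0, Rec.blank)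

/-- The response, the two cells to be written on the level of the items, and the change to the
leaf, when the search ended at `c`. -/
noncomputable def resolve (t : ℕ) (c : Option (P.Word × Rec P)) :
    Op P → Resp P × ((P.Word × Rec P) × (P.Word × Rec P)) × Change P := fun o =>
  let hit : Option (P.Word × P.Val) := match c with
    | some (a, .item k v) => if k = o.key then some (a, v) else none
    | _ => none
  let same := c.getD blankCell
  match o, hit with
  | .get k, some (a, v) => (.value v, ((a, .gone), blankCell), .remove k)
  | .get _, none => (.notFound, (same, blankCell), .keep)
  | .put _ _, some _ => (.keyExists, (same, blankCell), .keep)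
  | .put k v, none =>
      let name := freshName P (P.depth + 1) t
      (.stored, (same, (name, .item k v)), .insert (k, name))

/-- Update the nodes of the search path from the leaf to the root, splitting nodes that get more
than `B'` entries. Returns for each level the two cells to be written to the cache. -/
noncomputable def climb (t : ℕ) :
    List (ℕ × Option (P.Word × Rec P)) → Change P →
      List (ℕ × (P.Word × Rec P) × (P.Word × Rec P))
  | [], _ => []
  | (i, some (a, .node es)) :: rest, ch =>
      let es' := match ch with
        | .keep => es
        | .remove k => es.filter fun e => e.1 ≠ k
        | .insert e => es.orderedInsert (fun x y => x.1 ≤ y.1) e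
      if es'.length ≤ P.branch then
        (i, (a, .node es'), blankCell) :: climb t rest .keep
      else
        let lo := es'.take (es'.length / 2)
        let hi := es'.drop (es'.length / 2)
        let name := freshName P i t
        (i, (a, .node lo), (name, .node hi)) ::
          climb t rest (match hi with
            | e :: _ => .insert (e.1, name)
            | [] => .keep)
  | (i, c) :: rest, _ => (i, c.getD blankCell, blankCell) :: climb t rest .keep

/-- Write two cells to the cache of level `i`, in one message. -/
noncomputable def writeCache (t : ℕ) (x : ℕ × (P.Word × Rec P) × (P.Word × Rec P)) :
    Prog P.W Unit :=
  let a := cacheStart P x.1 + 2 * t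
  Prog.store <|
    (cellAddrs P a).zip (Rec.encode x.2.1.1 x.2.1.2) ++
      (cellAddrs P (a + 1)).zip (Rec.encode x.2.2.1 x.2.2.2)

/-- One access: search, update the path, write it to the caches from the bottom up, and rebuild
after every `⌈√n⌉` accesses. -/
noncomputable def access (rebuild : State P → Prog P.W (State P)) (o : Op P) (s : State P) :
    Prog P.W (Resp P × State P) := do
  let t := s.time.val
  let (path, next) ← descend o.key t (List.range P.levels) (some s.root) s.next
  let (resp, cells, ch) := resolve t (path.getLast?.join) o
  let nodes := ((List.range (P.depth + 1)).zip path).reverse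
  let _ ← Prog.forList (writeCache t) ((P.depth + 1, cells) :: climb t nodes ch)
  let s' : State P := { root := s.root, next := next, time := P.word (t + 1) }
  if t + 1 = P.epoch then do
    let s'' ← rebuild s'
    return (resp, s'')
  else
    return (resp, s')

end BTree

/-! ## Oblivious storage schemes -/

/-- A scheme: a program that sets up the storage from the initial items, and a program for each
access. -/
structure Scheme (P : Params) where
  setup : Prog P.W (State P)
  access : Op P → State P → Prog P.W (Resp P × State P)

/-- The B-tree scheme, for given programs that build it and rebuild it. -/
noncomputable def bTreeOS {P : Params} (setup : Prog P.W (State P))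
    (rebuild : State P → Prog P.W (State P)) : Scheme P where
  setup := setup
  access := BTree.access rebuild

/-- Server memory at the beginning: the initial items in the first cells. -/
noncomputable def initMem {P : Params} (S : List P.Item) : Mem P.W := fun x =>
  (Rec.encode (P.word 0) (match S[x.val / P.cellWords]? with
    | some (k, v) => Rec.item k v
    | none => Rec.blank)).getD (x.val % P.cellWords) (P.word 0)

/-- The outcome of a simulation; `setupTrace` and `traces` are what the server observes during
setup and during each access. -/
structure Outcome (P : Params) where
  setupTrace : List (Event P.W)
  responses : List (Resp P)
  traces : List (List (Event P.W))
  state : State P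
  mem : Mem P.W

/-- Everything that the server sees. -/
def Outcome.view {P : Params} (x : Outcome P) : List (List (Event P.W)) :=
  x.setupTrace :: x.traces

namespace Scheme

variable {P : Params} (A : Scheme P)

noncomputable def runOps : List (Op P) → State P → Mem P.W →
    PMF (List (Resp P) × List (List (Event P.W)) × State P × Mem P.W)
  | [], s, m => PMF.pure ([], [], s, m)
  | o :: os, s, m =>
      ((A.access o s).run m).bind fun x =>
        (runOps os x.1.2 x.2.1).map fun y => (x.1.1 :: y.1, x.2.2 :: y.2.1, y.2.2.1, y.2.2.2)

/-- The law of the simulation of a workload. -/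
noncomputable def simulate (w : Workload P) : PMF (Outcome P) :=
  (A.setup.run (initMem w.init)).bind fun x =>
    (A.runOps w.ops x.1 x.2.1).map fun y => ⟨x.2.2, y.1, y.2.1, y.2.2.1, y.2.2.2⟩

/-- Messages have at most `B` words. -/
def BlockBound : Prop :=
  A.setup.BlockBound P.B ∧ ∀ o s, (A.access o s).BlockBound P.B

/-- `M` words of private memory suffice for the client. -/
def PrivateMemory (M : ℕ) : Prop :=
  A.setup.configs.encard ≤ (P.W ^ M : ℕ) ∧
    (⋃ (o : Op P) (s : State P), (A.access o s).configs).encard ≤ (P.W ^ M : ℕ)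

/-- All responses are those of the dictionary. -/
def Correct : Prop :=
  ∀ w : Workload P, w.Valid → ∀ x ∈ (A.simulate w).support,
    x.responses = (Dict.ofList w.init).responses w.ops

/-- With probability at least `p`, setting up takes at most `T` messages. -/
def SetupCost (T : ℕ) (p : ℝ) : Prop :=
  ∀ w : Workload P, w.Valid →
    ENNReal.ofReal p ≤ (A.simulate w).toOuterMeasure {x | x.setupTrace.length ≤ T}

/-- With probability at least `p`, simulating any `N` accesses takes at most `N * T` messages in
total, those of all rebuilds included. -/
def Overhead (T : ℕ) (p : ℝ) : Prop :=
  ∀ w : Workload P, w.Valid →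
    ENNReal.ofReal p ≤ (A.simulate w).toOuterMeasure
      {x | (x.traces.map List.length).sum ≤ w.ops.length * T}

/-- The security game: one of two workloads is chosen by a fair coin and simulated, and the
server guesses which one; the result is whether the guess is right. -/
noncomputable def game (w : Bool → Workload P) (guess : List (List (Event P.W)) → PMF Bool) :
    PMF Bool :=
  (PMF.uniformOfFintype Bool).bind fun c =>
    (A.simulate (w c)).bind fun x => (guess x.view).map fun g => g == c

/-- Statistical security: for two workloads with the same number of accesses, no server, even
a randomized and computationally unbounded one, guesses right with probability above `1/2`. -/
def Secure : Prop :=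
  ∀ w : Bool → Workload P, (∀ c, (w c).Valid) → (w true).ops.length = (w false).ops.length →
    ∀ guess, A.game w guess true ≤ 1 / 2

end Scheme

/-! ## Shuffled B-trees -/

namespace BTree

variable {P : Params}

/-- In the family `F` of cells, `a` is the root of a search tree of height `h`, in which all
nodes have at most `B'` entries, all items are at depth `h`, and which holds the items `l`
in this order. -/
def Spans (F : P.Word → Rec P) : ℕ → P.Word → List P.Item → Prop
  | 0, a, l => ∃ k v, F a = .item k v ∧ l = [(k, v)]
  | h + 1, a, l => ∃ (es : List (P.Word × P.Word)) (ls : List (List P.Item)),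
      F a = .node es ∧ es.length ≤ P.branch ∧ l = ls.flatten ∧
      List.Forall₂ (fun e l' => Spans F h e.2 l' ∧
        (∀ x ∈ l', e.1 ≤ x.1) ∧ (h = 0 → ∀ x ∈ l', x.1 = e.1)) es ls ∧
      (es.map Prod.fst).Pairwise (· < ·) ∧
      ∀ (i j : ℕ) (hi : i < ls.length) (hj : j < es.length), i < j →
        ∀ x ∈ ls[i], x.1 < (es[j]).1

/-- The cells of the tree of height `h` with root `a`. -/
def names (F : P.Word → Rec P) : ℕ → P.Word → List P.Word
  | 0, a => [a]
  | h + 1, a => a :: (match F a with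
      | .node es => es.flatMap fun e => names F h e.2
      | _ => [])

/-- Before shuffling: cells `0, …, treeCells - 1` hold a B-tree of depth `D` with root `0` for
the dictionary `d`, and blanks; the cells after them hold the dummy list. -/
structure IsLayout (F : P.Word → Rec P) (d : Dict P) : Prop where
  tree : ∃ l, Spans F (P.depth + 1) (P.word 0) l ∧ ∀ k v, (k, v) ∈ l ↔ d k = some v
  nodup : (names F (P.depth + 1) (P.word 0)).Nodup
  lt : ∀ a ∈ names F (P.depth + 1) (P.word 0), a.val < P.treeCells
  blank : ∀ a, a < P.treeCells → P.word a ∉ names F (P.depth + 1) (P.word 0) →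
    F (P.word a) = .blank
  dummies : ∀ j, P.treeCells ≤ j → j < P.arrayCells → F (P.word j) = .dummy (P.word (j + 1))

/-- The new name of the cell `x`. -/
noncomputable def rename (π : Equiv.Perm (Fin P.arrayCells)) (x : ℕ) : P.Word :=
  if h : x < P.arrayCells then P.word (π ⟨x, h⟩).val else P.word x

/-- A cell with all pointers renamed. -/
noncomputable def relabel (π : Equiv.Perm (Fin P.arrayCells)) : Rec P → Rec P
  | .node es => .node (es.map fun e => (e.1, rename π e.2.val))
  | .dummy x => .dummy (rename π x.val)
  | r => r

/-- The words of the array in which the cells of `F` have been permuted by `π`. -/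
noncomputable def shuffled (F : P.Word → Rec P) (π : Equiv.Perm (Fin P.arrayCells)) :
    Fin P.arrayCells → List P.Word := fun a =>
  Rec.encode (P.word a.val) (relabel π (F (P.word (π.symm a).val)))

/-- The client state at the beginning of an epoch. -/
noncomputable def startState (π : Equiv.Perm (Fin P.arrayCells)) : State P where
  root := rename π 0
  next := rename π P.treeCells
  time := P.word 0

/-- The words of the array in server memory. -/
noncomputable def arrayOf (m : Mem P.W) : Fin P.arrayCells → List P.Word := fun a =>
  (cellAddrs P a.val).map m

/-- After setup, and after each rebuild, the array holds a B-tree for the current dictionary and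
a fresh dummy list, shuffled by a permutation that is uniformly distributed and independent of
everything that the server has seen. -/
def Shuffles (A : Scheme P) : Prop :=
  ∀ w : Workload P, w.Valid → P.epoch ∣ w.ops.length →
    ∃ F : P.Word → Rec P, IsLayout F ((Dict.ofList w.init).after w.ops) ∧
      (A.simulate w).map (fun x => (x.view, arrayOf x.mem, x.state)) =
        ((A.simulate w).map Outcome.view).bind fun τ =>
          (PMF.uniformOfFintype (Equiv.Perm (Fin P.arrayCells))).map fun π =>
            (τ, shuffled F π, startState π)

end BTree

end OS

/-!
# The B-tree oblivious storage scheme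

The programs that build and rebuild the tree are the same program `Geom.build`, and all the bounds
hold with probability one: the addresses that `build` uses are fixed in advance, so only the cells
of the array that the searches read are random.

**Building.** The client can handle `O(B)` words at a time, which is `O(B ^ (3/4))` rows of
`O(B ^ (1/4))` words. Tables of up to `O(B ^ (3/2))` rows are sorted by columnsort, which sorts
large blocks in a fixed pattern of a constant number of passes (`SortNet.colSort`); with columnsort
as its own sorter of blocks it reaches the required size. The program collects the current versions
of the items from the array and the caches, sorts them, writes the nodes of the tree, whose shape
and names depend only on the number of items, and sorts everything by new names. The new names are
drawn bucket by bucket: one pass draws for each row the block that it moves to, with the right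
probabilities for the sizes of the blocks, and the rows within a block are permuted by private
coins. The permutation that results is uniform because its law has no atom of more than
`1 / arrayCells !` (`Shuffle.eq_uniform_of_le`). Since the pattern of addresses is fixed, `build`
produces the shuffled layout `layout l` of the sorted list `l` of items, coupled with a uniform
permutation (`Geom.coupled_build`).

**Accesses.** During an epoch the contents of the memory are described in terms of the names
before shuffling: `Rep` says that the memory is the shuffled form of a family of cells and of
caches, and every step of the client commutes with renaming (`run_access`). The invariant `Inv`
describes the tree level by level, as the list of the nodes of each level with their entries; an
access changes each of these lists locally (`Level.step`). A new tree has nodes that are at most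
half full, so a node must receive many entries before it is split; counting these as credits shows
that the root is never split, because an epoch has too few accesses. By the invariant the responses
are right, and each access reads, on each level, a cell of the array that has not been read before
in the epoch: a node that has been read lies in the cache, and dummies are used in order.

**Obliviousness.** Before shuffling, the cells that are read in an epoch form a list of distinct
cells. After shuffling by a uniform permutation, this list looks like the first cells of the array
shuffled by another uniform permutation (`exists_perm_extend`, `uniform_map_mul_right`). So what the
server observes of an epoch has a law that depends on nothing but its length, and the new shuffle
at its end is independent of it (`Geom.coupled_runOps`). All properties of the scheme follow from
this coupling (`Geom.coupled_simulate`). In particular the server's view is the same for any two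
workloads with the same number of accesses, so that every strategy guesses right with probability
exactly `1 / 2`.

The hypotheses `n ≤ C * B ^ (3/2)` and `n * B ≤ W` ensure that two levels of columnsort suffice and
that names and scratch space fit in the address space (`Params.Large.exists_geom`).
-/

/-! ### Client programs -/

namespace OS

namespace Prog

variable {W : ℕ} {α β γ : Type}

@[simp] theorem pure_eq_ret (a : α) : (pure a : Prog W α) = ret a := rfl

@[simp] theorem monad_bind_eq (p : Prog W α) (f : α → Prog W β) : (p >>= f) = p.bind f := rfl

@[simp] theorem ret_bind (a : α) (f : α → Prog W β) : (ret a).bind f = f a := rfl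

theorem run_bind (p : Prog W α) (f : α → Prog W β) (m : Mem W) :
    (p.bind f).run m = (p.run m).bind fun x =>
      ((f x.1).run x.2.1).map fun y => (y.1, y.2.1, x.2.2 ++ y.2.2) := by
  induction p generalizing m with
  | ret a =>
      simp only [bind, run, PMF.pure_bind, List.nil_append]
      exact (PMF.map_id _).symm
  | read as k ih =>
      simp only [bind, run]
      rw [ih, PMF.map_bind, PMF.bind_map]
      congr 1; funext x
      simp only [Function.comp, PMF.map_comp]
      rfl
  | write ps p ih =>
      simp only [bind, run]
      rw [ih, PMF.map_bind, PMF.bind_map]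
      congr 1; funext x
      simp only [Function.comp, PMF.map_comp]
      rfl
  | sample k f ih =>
      grind [bind, run, PMF.bind_bind]

theorem BlockBound.bind {B : ℕ} {p : Prog W α} {f : α → Prog W β} (hp : p.BlockBound B)
    (hf : ∀ a, (f a).BlockBound B) : (p.bind f).BlockBound B := by
  induction p with
  | ret a => exact hf a
  | read as k ih => exact ⟨hp.1, fun r => ih r (hp.2 r)⟩
  | write ps p ih => exact ⟨hp.1, ih hp.2⟩
  | sample k f ih => exact fun i => ih i (hp i)

theorem BlockBound.forList {B : ℕ} {ι : Type} {f : ι → Prog W β} {l : List ι}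
    (h : ∀ i ∈ l, (f i).BlockBound B) : (forList f l).BlockBound B := by
  induction l with
  | nil => trivial
  | cons i l ih =>
      exact BlockBound.bind (h i (by simp)) fun x =>
        BlockBound.bind (ih fun j hj => h j (by simp [hj])) fun _ => trivial

theorem blockBound_fetch {B : ℕ} {as : List (Fin W)} (h : as.length ≤ B) :
    (fetch as).BlockBound B := ⟨h, fun _ => trivial⟩

theorem blockBound_store {B : ℕ} {ps : List (Fin W × Fin W)} (h : 2 * ps.length ≤ B) :
    (store ps).BlockBound B := ⟨h, trivial⟩

/-- All results that a program can have, whatever the server returns and whatever the coins. -/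
def results : Prog W α → Set α
  | ret a => {a}
  | read _ k => ⋃ r, results (k r)
  | write _ p => results p
  | sample _ f => ⋃ i, results (f i)

theorem results_bind (p : Prog W α) (f : α → Prog W β) :
    (p.bind f).results = ⋃ a ∈ p.results, (f a).results := by
  induction p with
  | ret a => simp [bind, results]
  | read as k ih => simp only [bind, results, ih]; ext x; simp; tauto
  | write ps p ih => simp only [bind, results, ih]
  | sample k f ih => simp only [bind, results, ih]; ext x; simp; tauto

theorem configs_bind_subset (p : Prog W α) (f : α → Prog W β) :
    (p.bind f).configs ⊆ (fun q => q.bind f) '' p.configs ∪ ⋃ a ∈ p.results, (f a).configs := by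
  induction p with
  | ret a => intro x hx; right; simpa [results] using hx
  | read as k ih =>
      intro x hx
      simp only [bind, configs, Set.mem_insert_iff, Set.mem_iUnion] at hx
      rcases hx with rfl | ⟨r, hr⟩
      · left; exact ⟨read as k, by simp [configs], rfl⟩
      · rcases ih r hr with ⟨q, hq, rfl⟩ | h
        · left; exact ⟨q, by simp only [configs]; right; exact Set.mem_iUnion.2 ⟨r, hq⟩, rfl⟩
        · right
          simp only [results, Set.mem_iUnion] at h ⊢
          grind
  | write ps p ih =>
      intro x hx
      simp only [bind, configs, Set.mem_insert_iff] at hx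
      rcases hx with rfl | hr
      · left; exact ⟨write ps p, by simp [configs], rfl⟩
      · rcases ih hr with ⟨q, hq, rfl⟩ | h
        · left; exact ⟨q, by simp only [configs]; right; exact hq, rfl⟩
        · right; exact h
  | sample k g ih =>
      intro x hx
      simp only [bind, configs, Set.mem_insert_iff, Set.mem_iUnion] at hx
      rcases hx with rfl | ⟨r, hr⟩
      · left; exact ⟨sample k g, by simp [configs], rfl⟩
      · rcases ih r hr with ⟨q, hq, rfl⟩ | h
        · left; exact ⟨q, by simp only [configs]; right; exact Set.mem_iUnion.2 ⟨r, hq⟩, rfl⟩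
        · right
          simp only [results, Set.mem_iUnion] at h ⊢
          grind

theorem encard_biUnion_le_mul {S : Set α} {g : α → Set β} {a c : ℕ}
    (hS : S.encard ≤ (a : ℕ∞)) (hg : ∀ x ∈ S, (g x).encard ≤ (c : ℕ∞)) :
    (⋃ x ∈ S, g x).encard ≤ ((a * c : ℕ) : ℕ∞) := by
  have hfin : S.Finite := Set.finite_of_encard_le_coe hS
  have h1 : (⋃ x ∈ S, g x) = ⋃ x ∈ hfin.toFinset, g x := by ext; simp
  rw [h1]
  refine (Finset.set_encard_biUnion_le _ _).trans ?_
  refine (Finset.sum_le_card_nsmul _ _ (c : ℕ∞) fun x hx => hg x (by simpa using hx)).trans ?_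
  have h2 : hfin.toFinset.card ≤ a := by
    rw [hfin.encard_eq_coe_toFinset_card] at hS
    simp_all
  rw [nsmul_eq_mul]
  exact_mod_cast Nat.mul_le_mul_right c h2

/-- `p` has at most `W ^ c` configurations and at most `W ^ r` results: `c` words of private
memory suffice for running it, and `r` words for its result. -/
structure Small (p : Prog W α) (c r : ℕ) : Prop where
  configs_le : p.configs.encard ≤ ((W ^ c : ℕ) : ℕ∞)
  results_le : p.results.encard ≤ ((W ^ r : ℕ) : ℕ∞)

theorem Small.mono {p : Prog W α} {c r c' r' : ℕ} (hW : 2 ≤ W) (h : Small p c r) (hc : c ≤ c')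
    (hr : r ≤ r') : Small p c' r' :=
  ⟨h.1.trans (by exact_mod_cast Nat.pow_le_pow_right (by omega) hc),
    h.2.trans (by exact_mod_cast Nat.pow_le_pow_right (by omega) hr)⟩

theorem small_ret (a : α) (c r : ℕ) (hW : 2 ≤ W) : Small (ret a : Prog W α) c r :=
  Small.mono (c := 0) (r := 0) hW ⟨by simp [configs], by simp [results]⟩ (by omega) (by omega)

theorem two_mul_pow_le {W a : ℕ} (hW : 2 ≤ W) : 2 * W ^ a ≤ W ^ (a + 1) := by
  rw [pow_succ, mul_comm]; exact Nat.mul_le_mul_left _ hW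

theorem pow_add_pow_le {W a b c : ℕ} (hW : 2 ≤ W) (ha : a ≤ c) (hb : b ≤ c) :
    W ^ a + W ^ b ≤ W ^ (c + 1) := by
  have h1 := Nat.pow_le_pow_right (n := W) (by omega) ha
  have h2 := Nat.pow_le_pow_right (n := W) (by omega) hb
  have := two_mul_pow_le (a := c) hW
  omega

theorem Small.bind {p : Prog W α} {f : α → Prog W β} {c r c' r' : ℕ} (hW : 2 ≤ W)
    (hp : Small p c r) (hf : ∀ a ∈ p.results, Small (f a) c' r') :
    Small (p.bind f) (c + r + c' + 1) (r + r') := by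
  constructor
  · refine (Set.encard_le_encard (configs_bind_subset p f)).trans ?_
    refine (Set.encard_union_le _ _).trans ?_
    have h1 := (Set.encard_image_le (fun q => q.bind f) p.configs).trans hp.1
    have h2 := encard_biUnion_le_mul hp.2 fun a ha => (hf a ha).1
    refine (add_le_add h1 h2).trans ?_
    rw [← pow_add]
    exact_mod_cast pow_add_pow_le hW (by omega) (by omega)
  · rw [results_bind, pow_add]
    exact encard_biUnion_le_mul hp.2 fun a ha => (hf a ha).2

theorem encard_iUnion_le_mul {ι : Type} [Fintype ι] {g : ι → Set β} {c : ℕ}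
    (hg : ∀ x, (g x).encard ≤ (c : ℕ∞)) :
    (⋃ x, g x).encard ≤ ((Fintype.card ι * c : ℕ) : ℕ∞) := by
  have := encard_biUnion_le_mul (S := (Set.univ : Set ι)) (g := g) (a := Fintype.card ι) (c := c)
    (by simp [Set.encard_univ, ENat.card_eq_coe_fintype_card]) (fun x _ => hg x)
  simp_all

theorem small_fetch (hW : 2 ≤ W) (as : List (Fin W)) :
    Small (fetch as) (as.length + 1) as.length := by
  have hc : Fintype.card (Fin as.length → Fin W) = W ^ as.length := by simp
  constructor
  · simp only [fetch, configs]
    refine (Set.encard_insert_le _ _).trans ?_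
    refine (add_le_add_left (encard_iUnion_le_mul (c := 1) fun r => by simp) 1).trans ?_
    rw [hc, mul_one]
    have := pow_add_pow_le (a := as.length) (b := 0) (c := as.length) hW le_rfl (by omega)
    rw [pow_zero] at this
    exact_mod_cast this
  · simp only [fetch, results]
    refine (encard_iUnion_le_mul (c := 1) fun r => by simp).trans ?_
    simp

theorem small_store (hW : 2 ≤ W) (ps : List (Fin W × Fin W)) : Small (store ps) 1 0 := by
  constructor
  · simp only [store, configs, pow_one]
    refine (Set.encard_insert_le _ _).trans ?_
    simp only [Set.encard_singleton]
    exact_mod_cast hW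
  · simp [store, results]

theorem small_forList {ι : Type} {f : ι → Prog W β} {c r Q : ℕ} (hW : 2 ≤ W) {l : List ι}
    (h : ∀ i ∈ l, Small (f i) c r) (hl : l.length ≤ Q) :
    Small (forList f l) (l.length * (c + r + Q * r + 2)) (l.length * r) := by
  induction l with
  | nil => exact small_ret _ _ _ hW
  | cons i l ih =>
      simp only [List.length_cons] at hl ⊢
      have ih := ih (fun j hj => h j (by simp [hj])) (by omega)
      have h1 := Small.bind hW (h i (by simp)) (f := fun x => (forList f l).bind fun xs =>
        ret (x :: xs)) fun a _ => Small.bind hW ih fun b _ => small_ret _ 0 0 hW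
      refine h1.mono hW ?_ ?_
      · have : l.length * r ≤ Q * r := Nat.mul_le_mul_right r (by omega)
        nlinarith
      · nlinarith

/-! ### Deterministic runs -/

theorem run_fetch (as : List (Fin W)) (m : Mem W) :
    (fetch as).run m = PMF.pure (as.map m, m, [Event.read as]) := by
  simp [fetch, run, PMF.pure_map]

theorem run_store (ps : List (Fin W × Fin W)) (m : Mem W) :
    (store ps).run m = PMF.pure ((), ps.foldl (fun m' q => Function.update m' q.1 q.2) m,
      [Event.write (ps.map Prod.fst)]) := by
  simp [store, run, PMF.pure_map]

theorem run_bind_of_pure {p : Prog W α} {f : α → Prog W β} {m m' : Mem W} {a : α}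
    {tr : List (Event W)} (h : p.run m = PMF.pure (a, m', tr)) :
    (p.bind f).run m = ((f a).run m').map fun y => (y.1, y.2.1, tr ++ y.2.2) := by
  rw [run_bind, h, PMF.pure_bind]

theorem run_bind_pure {p : Prog W α} {f : α → Prog W β} {m m' m'' : Mem W} {a : α} {b : β}
    {tr tr' : List (Event W)} (h : p.run m = PMF.pure (a, m', tr))
    (h' : (f a).run m' = PMF.pure (b, m'', tr')) :
    (p.bind f).run m = PMF.pure (b, m'', tr ++ tr') := by
  rw [run_bind_of_pure h, h', PMF.pure_map]

theorem run_ret (a : α) (m : Mem W) : (ret a : Prog W α).run m = PMF.pure (a, m, []) := rfl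

theorem run_forList_read {ι : Type} {f : ι → Prog W β} {g : ι → β} {tr : ι → List (Event W)}
    {m : Mem W} {l : List ι} (h : ∀ i ∈ l, (f i).run m = PMF.pure (g i, m, tr i)) :
    (forList f l).run m = PMF.pure (l.map g, m, l.flatMap tr) := by
  induction l with
  | nil => rfl
  | cons i l ih =>
      have := run_bind_pure (h i (by simp)) (f := fun x => (forList f l).bind fun xs =>
        ret (x :: xs)) (run_bind_pure (ih fun j hj => h j (by simp [hj])) (run_ret _ _))
      simpa [forList] using this

theorem run_forList_write {ι : Type} {f : ι → Prog W Unit} {g : ι → Mem W → Mem W}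
    {tr : ι → List (Event W)} {l : List ι}
    (h : ∀ i ∈ l, ∀ m, (f i).run m = PMF.pure ((), g i m, tr i)) (m : Mem W) :
    (forList f l).run m =
      PMF.pure (List.replicate l.length (), l.foldl (fun m i => g i m) m, l.flatMap tr) := by
  induction l generalizing m with
  | nil => rfl
  | cons i l ih =>
      have := run_bind_pure (h i (by simp) m) (f := fun x => (forList f l).bind fun xs =>
        ret (x :: xs)) (run_bind_pure (ih (fun j hj => h j (by simp [hj])) _) (run_ret _ _))
      simpa [forList, List.replicate_succ] using this

end Prog

/-! ### Couplings -/

/-- `p` and `q` are the marginals of a joint law that is concentrated on the relation `Φ`. -/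
def Coupled {α β : Type*} (Φ : α → β → Prop) (p : PMF α) (q : PMF β) : Prop :=
  ∃ r : PMF (α × β), r.map Prod.fst = p ∧ r.map Prod.snd = q ∧ ∀ z ∈ r.support, Φ z.1 z.2

namespace Coupled

variable {α β γ δ : Type*} {Φ : α → β → Prop} {Ψ : γ → δ → Prop} {p : PMF α} {q : PMF β}

theorem pure {a : α} {b : β} (h : Φ a b) : Coupled Φ (PMF.pure a) (PMF.pure b) :=
  ⟨PMF.pure (a, b), by simp [PMF.pure_map], by simp [PMF.pure_map], by
    simp_all⟩

theorem bind {f : α → PMF γ} {g : β → PMF δ} (h : Coupled Φ p q)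
    (hfg : ∀ a b, Φ a b → Coupled Ψ (f a) (g b)) : Coupled Ψ (p.bind f) (q.bind g) := by
  classical
  obtain ⟨r, rfl, rfl, hr⟩ := h
  choose k hk1 hk2 hk3 using hfg
  refine ⟨r.bindOnSupport fun z hz => k z.1 z.2 (hr z hz), ?_, ?_, ?_⟩
  · rw [PMF.bind_map]
    ext c
    simp only [PMF.map, PMF.bind_apply, PMF.bindOnSupport_apply, Function.comp]
    simp only [← ENNReal.tsum_mul_right, mul_assoc]
    rw [ENNReal.tsum_comm]
    refine tsum_congr fun z => ?_
    rw [ENNReal.tsum_mul_left]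
    by_cases hz : r z = 0
    · simp [hz]
    · rw [← hk1 z.1 z.2 (hr z ((PMF.mem_support_iff _ _).2 hz))]
      simp [hz, PMF.map, PMF.bind_apply]
  · rw [PMF.bind_map]
    ext c
    simp only [PMF.map, PMF.bind_apply, PMF.bindOnSupport_apply, Function.comp]
    simp only [← ENNReal.tsum_mul_right, mul_assoc]
    rw [ENNReal.tsum_comm]
    refine tsum_congr fun z => ?_
    rw [ENNReal.tsum_mul_left]
    by_cases hz : r z = 0
    · simp [hz]
    · rw [← hk2 z.1 z.2 (hr z ((PMF.mem_support_iff _ _).2 hz))]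
      simp [hz, PMF.map, PMF.bind_apply]
  grind [PMF.mem_support_bindOnSupport_iff]

theorem refl (p : PMF α) : Coupled (fun a b => a = b ∧ a ∈ p.support) p p := by
  refine ⟨p.map fun a => (a, a), ?_, ?_, ?_⟩
  · rw [PMF.map_comp]; exact PMF.map_id _
  · rw [PMF.map_comp]; exact PMF.map_id _
  simp

theorem map {f : α → γ} {g : β → δ} (h : Coupled Φ p q) (hfg : ∀ a b, Φ a b → Ψ (f a) (g b)) :
    Coupled Ψ (p.map f) (q.map g) := by
  simp only [PMF.map]
  exact h.bind fun a b hab => pure (hfg a b hab)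

theorem mono {Ψ : α → β → Prop} (h : Coupled Φ p q) (hΨ : ∀ a b, Φ a b → Ψ a b) :
    Coupled Ψ p q := by
  obtain ⟨r, h1, h2, h3⟩ := h
  exact ⟨r, h1, h2, fun z hz => hΨ _ _ (h3 z hz)⟩

/-- A relation between the left-hand side and a ghost variable survives any continuation on the
left-hand side all of whose outcomes respect it. -/
theorem post {Ψ : γ → β → Prop} {f : α → PMF γ} (h : Coupled Φ p q)
    (hf : ∀ a b, Φ a b → ∀ c ∈ (f a).support, Ψ c b) : Coupled Ψ (p.bind f) q := by
  rw [← PMF.bind_pure q]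
  refine h.bind fun a b hab => ?_
  have h1 := (refl (f a)).bind (Ψ := Ψ) (f := PMF.pure) (g := fun _ => PMF.pure b)
    fun c c' hc => pure (hf a b hab c hc.2)
  simp_all

theorem map_eq {f : α → γ} {g : β → γ} (h : Coupled Φ p q) (hfg : ∀ a b, Φ a b → f a = g b) :
    p.map f = q.map g := by
  obtain ⟨r, rfl, rfl, hr⟩ := h
  rw [PMF.map_comp, PMF.map_comp, ← PMF.bind_pure_comp, ← PMF.bind_pure_comp]
  ext c
  simp only [PMF.bind_apply]
  refine tsum_congr fun z => ?_
  by_cases hz : r z = 0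
  · simp [hz]
  · simp [hfg _ _ (hr z ((PMF.mem_support_iff _ _).2 hz))]

theorem exists_right (h : Coupled Φ p q) {a : α} (ha : a ∈ p.support) : ∃ b, Φ a b := by
  obtain ⟨r, rfl, rfl, hr⟩ := h
  grind [PMF.support_map]

end Coupled

end OS

/-! ### Sorting with a constant number of passes -/

namespace OS

namespace SortNet

variable {α : Type}

/-- Sort the values at the positions in `L` by the key `κ`; other positions are unchanged. -/
def sortOn (κ : α → ℕ) (L : List ℕ) (A : ℕ → α) : ℕ → α := fun p =>
  if p ∈ L then ((L.map A).mergeSort fun x y => decide (κ x ≤ κ y)).getD (L.idxOf p) (A p) else A p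

theorem sortOn_of_notMem {κ : α → ℕ} {L : List ℕ} {A : ℕ → α} {p : ℕ} (h : p ∉ L) :
    sortOn κ L A p = A p := by simp [sortOn, h]

theorem map_sortOn {κ : α → ℕ} {L : List ℕ} (hL : L.Nodup) (A : ℕ → α) :
    L.map (sortOn κ L A) = (L.map A).mergeSort fun x y => decide (κ x ≤ κ y) := by
  apply List.ext_getElem
  · simp
  · intro i h1 h2
    simp only [List.length_map] at h1
    simp only [List.getElem_map, sortOn, List.getElem_mem, if_true]
    grind

/-- Sort on several lists of positions, one after the other. -/
def runNet (κ : α → ℕ) (ns : List (List ℕ)) (A : ℕ → α) : ℕ → α :=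
  ns.foldl (fun A L => sortOn κ L A) A

theorem runNet_append (κ : α → ℕ) (ns ns' : List (List ℕ)) (A : ℕ → α) :
    runNet κ (ns ++ ns') A = runNet κ ns' (runNet κ ns A) := by simp [runNet]

/-- The network `ns` sorts the positions in `L`, and touches no others. -/
def Sorts (κ : α → ℕ) (ns : List (List ℕ)) (L : List ℕ) : Prop :=
  ∀ A : ℕ → α, (∀ p, p ∉ L → runNet κ ns A p = A p) ∧
    (L.map (runNet κ ns A)).Perm (L.map A) ∧
    (L.map (runNet κ ns A)).Pairwise fun x y => κ x ≤ κ y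

theorem sorts_single (κ : α → ℕ) {L : List ℕ} (hL : L.Nodup) : Sorts κ [L] L := by
  intro A
  refine ⟨fun p hp => sortOn_of_notMem hp, ?_, ?_⟩
  · simp only [runNet, List.foldl]
    rw [map_sortOn hL]; exact List.mergeSort_perm _ _
  · simp only [runNet, List.foldl]
    rw [map_sortOn hL]
    have := List.pairwise_mergeSort (le := fun x y : α => decide (κ x ≤ κ y))
      (fun a b c h1 h2 => by simp at *; omega) (fun a b => by simp; omega) (L.map A)
    grind

theorem perm_of_perm_sub {L L' : List ℕ} (hL : L.Nodup) (hL' : L'.Nodup) (hsub : ∀ p ∈ L', p ∈ L)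
    {A A' : ℕ → α} (h : (L'.map A').Perm (L'.map A)) (hoff : ∀ p, p ∉ L' → A' p = A p) :
    (L.map A').Perm (L.map A) := by
  have hp : L.Perm (L' ++ L.filter (fun p => p ∉ L')) := by
    grind
  refine (hp.map A').trans (List.Perm.trans ?_ (hp.map A).symm)
  rw [List.map_append, List.map_append]
  refine h.append ?_
  rw [List.map_congr_left]
  grind

theorem lt_iff_lt_countP {κ : α → ℕ} {l : List α} (h : l.Pairwise fun x y => κ x ≤ κ y) (t : ℕ)
    (j : ℕ) (hj : j < l.length) : κ l[j] < t ↔ j < l.countP (fun x => κ x < t) := by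
  induction l generalizing j with
  | nil => simp at hj
  | cons a l ih =>
      rw [List.pairwise_cons] at h
      grind

/-- The positions `g 0, …, g (r - 1)` of the list `L`. -/
def sub (L : List ℕ) (r : ℕ) (g : ℕ → ℕ) : List ℕ := (List.range r).map fun j => L.getD (g j) 0

/-- Columnsort with sorters for `r` elements: sort the blocks, the residue classes modulo `s`, the
blocks again, and the blocks shifted by half a block. -/
def colSort (r s : ℕ) (srt : List ℕ → List (List ℕ)) (L : List ℕ) : List (List ℕ) :=
  ((List.range s).flatMap fun i => srt (sub L r fun j => i * r + j)) ++
  ((List.range s).flatMap fun c => srt (sub L r fun j => c + s * j)) ++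
  ((List.range s).flatMap fun i => srt (sub L r fun j => i * r + j)) ++
  ((List.range (s - 1)).flatMap fun k => srt (sub L r fun j => ((k + 1) * r - r / 2) + j))

section

variable {κ : α → ℕ} {L : List ℕ} {r : ℕ} {srt : List ℕ → List (List ℕ)}

theorem nodup_sub (hL : L.Nodup) {g : ℕ → ℕ} (hg : ∀ j < r, g j < L.length)
    (hinj : ∀ j < r, ∀ j' < r, g j = g j' → j = j') : (sub L r g).Nodup := by
  refine List.Nodup.map_on ?_ List.nodup_range
  intro x hx y hy hxy
  rw [List.mem_range] at hx hy
  rw [List.getD_eq_getElem _ _ (hg x hx), List.getD_eq_getElem _ _ (hg y hy)] at hxy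
  exact hinj x hx y hy ((hL.getElem_inj_iff).1 hxy)

theorem mem_sub (hL : L.Nodup) {g : ℕ → ℕ} (hg : ∀ j < r, g j < L.length) {p : ℕ}
    (hp : p < L.length) : L[p] ∈ sub L r g ↔ ∃ j < r, g j = p := by
  simp only [sub, List.mem_map, List.mem_range]
  constructor
  · rintro ⟨j, hj, h⟩
    rw [List.getD_eq_getElem _ _ (hg j hj)] at h
    exact ⟨j, hj, (hL.getElem_inj_iff).1 h⟩
  grind

/-- One pass of the sorter over disjoint sublists. In terms of a threshold `t`, the elements
below `t` move to the front of each sublist. -/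
theorem pass (hsrt : ∀ L' : List ℕ, L'.Nodup → L'.length = r → Sorts κ (srt L') L')
    (hL : L.Nodup) (q : ℕ) (g : ℕ → ℕ → ℕ) (hg : ∀ i < q, ∀ j < r, g i j < L.length)
    (hinj : ∀ i < q, ∀ j < r, ∀ i' < q, ∀ j' < r, g i j = g i' j' → i = i' ∧ j = j')
    (A : ℕ → α) :
    let A' := runNet κ ((List.range q).flatMap fun i => srt (sub L r (g i))) A
    (∀ p, p ∉ L → A' p = A p) ∧ (L.map A').Perm (L.map A) ∧
    (∀ p < L.length, (∀ i < q, ∀ j < r, g i j ≠ p) → A' (L.getD p 0) = A (L.getD p 0)) ∧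
    ∀ t, ∀ i < q, ∀ j < r, κ (A' (L.getD (g i j) 0)) < t ↔
      j < ((Finset.range r).filter fun j' => κ (A (L.getD (g i j') 0)) < t).card := by
  induction q with
  | zero => simp [runNet]
  | succ q ih =>
      have ih := ih (fun i hi => hg i (by omega))
        (fun i hi j hj i' hi' j' hj' => hinj i (by omega) j hj i' (by omega) j' hj')
      rw [List.range_succ, List.flatMap_append, runNet_append]
      simp only [List.flatMap_cons, List.flatMap_nil, List.append_nil]
      set A1 := runNet κ ((List.range q).flatMap fun i => srt (sub L r (g i))) A with hA1
      obtain ⟨h1, h2, h3, h4⟩ := ih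
      have hnd : (sub L r (g q)).Nodup := nodup_sub hL (hg q (by omega))
        fun j hj j' hj' h => (hinj q (by omega) j hj q (by omega) j' hj' h).2
      have hlen : (sub L r (g q)).length = r := by simp [sub]
      obtain ⟨s1, s2, s3⟩ := hsrt _ hnd hlen A1
      set A2 := runNet κ (srt (sub L r (g q))) A1 with hA2
      have hsubmem : ∀ p ∈ sub L r (g q), p ∈ L := by
        grind [sub]
      have hne : ∀ p (hp : p < L.length), (∀ j < r, g q j ≠ p) →
          A2 (L.getD p 0) = A1 (L.getD p 0) := by
        intro p hp h
        apply s1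
        rw [List.getD_eq_getElem _ _ hp, mem_sub hL (hg q (by omega)) hp]
        grind
      refine ⟨?_, ?_, ?_, ?_⟩
      · grind
      · exact (perm_of_perm_sub hL hnd hsubmem s2 s1).trans h2
      · grind
      · intro t i hi j hj
        rcases Nat.lt_succ_iff_lt_or_eq.1 hi with hi | rfl
        · rw [hne _ (hg i (by omega) j hj), h4 t i hi j hj]
          grind
        · have hl : j < ((sub L r (g i)).map A2).length := by simpa [hlen] using hj
          have e1 : ((sub L r (g i)).map A2)[j] = A2 (L.getD (g i j) 0) := by simp [sub]
          rw [← e1, lt_iff_lt_countP s3 t j hl, s2.countP_eq]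
          have e2 : ((sub L r (g i)).map A1).countP (fun x => decide (κ x < t)) =
              ((Finset.range r).filter fun j' => κ (A (L.getD (g i j') 0)) < t).card := by
            rw [List.countP_map, sub, List.countP_map]
            have : ∀ j' ∈ List.range r, A1 (L.getD (g i j') 0) = A (L.getD (g i j') 0) := by
              grind
            rw [List.countP_congr (q := fun j' => decide (κ (A (L.getD (g i j') 0)) < t))
              (by intro x hx; simp only [Function.comp, this x hx])]
            rw [List.countP_eq_length_filter, Finset.card, Finset.filter_val, Finset.range_val]
            rfl
          rw [e2]

end

/-! ### Columnsort of zeros and ones -/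

/-- All positions below `lo` are zeros and all positions from `hi` on are ones. -/
def Sandwich (N lo hi : ℕ) (z : ℕ → Prop) : Prop :=
  ∀ p < N, (p < lo → z p) ∧ (hi ≤ p → ¬ z p)

open Classical in
theorem Sandwich.windows {N lo hi r q : ℕ} {z z' : ℕ → Prop} {a : ℕ → ℕ}
    (h : Sandwich N lo hi z) (ha : ∀ i < q, ∀ j < r, a i + j < N)
    (h1 : ∀ p < N, (∀ i < q, ∀ j < r, a i + j ≠ p) → (z' p ↔ z p))
    (h2 : ∀ i < q, ∀ j < r, z' (a i + j) ↔
      j < ((Finset.range r).filter fun j' => z (a i + j')).card) :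
    Sandwich N lo hi z' := by
  intro p hp
  by_cases hc : ∃ i < q, ∃ j < r, a i + j = p
  · obtain ⟨i, hi', j, hj, rfl⟩ := hc
    rw [h2 i hi' j hj]
    constructor
    · intro hlo
      have : Finset.range (j + 1) ⊆ (Finset.range r).filter fun j' => z (a i + j') := by
        intro x hx
        rw [Finset.mem_range] at hx
        simp only [Finset.mem_filter, Finset.mem_range]
        exact ⟨by omega, (h _ (ha i hi' x (by omega))).1 (by omega)⟩
      have := Finset.card_le_card this
      grind
    · intro hhi
      have : (Finset.range r).filter (fun j' => z (a i + j')) ⊆ Finset.range j := by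
        intro x hx
        simp only [Finset.mem_filter, Finset.mem_range] at hx ⊢
        by_contra hx'
        exact (h _ (ha i hi' x hx.1)).2 (by omega) hx.2
      have := Finset.card_le_card this
      grind
  · push Not at hc
    rw [h1 p hp hc]
    exact h p hp

theorem card_filter_residue {r s c v : ℕ} (hs : 0 < s) (hc : c < s) (hv : v ≤ r * s) :
    ((Finset.range r).filter fun j => c + s * j < v).card = (v + (s - 1 - c)) / s := by
  have : ((Finset.range r).filter fun j => c + s * j < v) =
      Finset.range ((v + (s - 1 - c)) / s) := by
    ext j
    simp only [Finset.mem_filter, Finset.mem_range]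
    rw [Nat.lt_iff_add_one_le, Nat.lt_iff_add_one_le, Nat.lt_iff_add_one_le,
      Nat.le_div_iff_mul_le hs]
    constructor
    · grind
    · intro h
      have h2 : c + s * j + 1 ≤ v := by
        grind
      refine ⟨?_, h2⟩
      by_contra hj
      have : s * r ≤ s * j := Nat.mul_le_mul_left s (by omega)
      grind
  grind

/-- Two residue classes modulo `s` meet an interval in almost the same number of points. -/
theorem card_residue_interval_le {r s c c' u v : ℕ} (hs : 0 < s) (hc : c < s) (hc' : c' < s)
    (huv : u ≤ v) (hv : v ≤ r * s) :
    ((Finset.range r).filter fun j => u ≤ c + s * j ∧ c + s * j < v).card ≤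
      ((Finset.range r).filter fun j => u ≤ c' + s * j ∧ c' + s * j < v).card + 1 := by
  have key : ∀ c < s, ((Finset.range r).filter fun j => u ≤ c + s * j ∧ c + s * j < v).card +
      (u + (s - 1 - c)) / s = (v + (s - 1 - c)) / s := by
    intro c hc
    rw [← card_filter_residue hs hc hv, ← card_filter_residue hs hc (huv.trans hv),
      ← Finset.card_union_of_disjoint]
    · congr 1
      grind
    grind [Finset.disjoint_filter]
  have k1 := key c hc
  have k2 := key c' hc'
  obtain ⟨d, rfl⟩ := Nat.exists_eq_add_of_le huv
  rw [show u + d + (s - 1 - c) = u + (s - 1 - c) + d by omega,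
    Nat.add_div hs (a := u + (s - 1 - c))] at k1
  rw [show u + d + (s - 1 - c') = u + (s - 1 - c') + d by omega,
    Nat.add_div hs (a := u + (s - 1 - c'))] at k2
  grind

open Classical in
theorem columnsort_zero_one {r s : ℕ} (hs : 0 < s) (hrs : s * s ≤ r / 2)
    {z0 z1 z2 z3 z4 : ℕ → Prop}
    (h1 : ∀ i < s, ∀ j < r, z1 (i * r + j) ↔
      j < ((Finset.range r).filter fun j' => z0 (i * r + j')).card)
    (h2 : ∀ c < s, ∀ j < r, z2 (c + s * j) ↔
      j < ((Finset.range r).filter fun j' => z1 (c + s * j')).card)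
    (h3 : ∀ i < s, ∀ j < r, z3 (i * r + j) ↔
      j < ((Finset.range r).filter fun j' => z2 (i * r + j')).card)
    (h4 : ∀ k < s - 1, ∀ j < r, z4 ((k + 1) * r - r / 2 + j) ↔
      j < ((Finset.range r).filter fun j' => z3 ((k + 1) * r - r / 2 + j')).card)
    (h4' : ∀ p < r * s, (∀ k < s - 1, ∀ j < r, (k + 1) * r - r / 2 + j ≠ p) → (z4 p ↔ z3 p)) :
    ∀ p q, p ≤ q → q < r * s → z4 q → z4 p := by
  have hr : 0 < r := by
    rcases Nat.eq_zero_or_pos r with rfl | h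
    · simp_all
    · exact h
  have hblk : ∀ i < s, ∀ j < r, i * r + j < r * s := by
    intro i hi j hj
    have : (i + 1) * r ≤ s * r := Nat.mul_le_mul_right r hi
    nlinarith
  have hdec : ∀ p < r * s, p / r < s ∧ p % r < r ∧ p / r * r + p % r = p := by
    intro p hp
    exact ⟨Nat.div_lt_of_lt_mul hp, Nat.mod_lt _ hr, by rw [mul_comm]; exact Nat.div_add_mod p r⟩
  -- the numbers of zeros in the residue classes are almost equal
  set y : ℕ → ℕ := fun c => ((Finset.range r).filter fun j' => z1 (c + s * j')).card with hy
  set n : ℕ → ℕ := fun i => ((Finset.range r).filter fun j' => z0 (i * r + j')).card with hn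
  have hnr : ∀ i, n i ≤ r := fun i => (Finset.card_filter_le _ _).trans (by simp)
  have hres : ∀ c < s, ∀ j < r, c + s * j < r * s := by
    intro c hc j hj
    have : s * (j + 1) ≤ s * r := Nat.mul_le_mul_left s hj
    nlinarith
  have hysum : ∀ c < s, y c = ∑ i ∈ Finset.range s,
      ((Finset.range r).filter fun j => i * r ≤ c + s * j ∧ c + s * j < i * r + n i).card := by
    intro c hc
    rw [hy]
    simp only
    rw [Finset.card_eq_sum_card_fiberwise (f := fun j => (c + s * j) / r) (t := Finset.range s)]
    · refine Finset.sum_congr rfl fun i hi => ?_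
      rw [Finset.mem_range] at hi
      congr 1
      ext j
      simp only [Finset.mem_filter, Finset.mem_range]
      constructor
      · rintro ⟨⟨hj, hz⟩, hd⟩
        obtain ⟨d1, d2, d3⟩ := hdec _ (hres c hc j hj)
        rw [hd] at d1 d3
        rw [← d3, h1 i hi _ d2] at hz
        refine ⟨hj, by omega, ?_⟩
        grind
      · rintro ⟨hj, hu, hv⟩
        have hd : (c + s * j) / r = i := by
          apply Nat.div_eq_of_lt_le
          · exact hu
          grind
        refine ⟨⟨hj, ?_⟩, hd⟩
        obtain ⟨d1, d2, d3⟩ := hdec _ (hres c hc j hj)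
        grind
    · intro j hj
      simp only [Finset.coe_filter, Finset.mem_range, Set.mem_ofPred_eq] at hj
      grind
  have hyle : ∀ c < s, ∀ c' < s, y c ≤ y c' + s := by
    intro c hc c' hc'
    rw [hysum c hc, hysum c' hc']
    have h1s : ∀ g : ℕ → ℕ, ∑ i ∈ Finset.range s, g i + s = ∑ i ∈ Finset.range s, (g i + 1) := by
      simp [Finset.sum_add_distrib]
    rw [h1s]
    refine Finset.sum_le_sum fun i hi => ?_
    rw [Finset.mem_range] at hi
    refine card_residue_interval_le hs hc hc' (by omega) ?_
    have := hnr i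
    have : (i + 1) * r ≤ s * r := Nat.mul_le_mul_right r hi
    nlinarith
  -- after the second phase the zeros and ones mix only in a short window
  obtain ⟨c0, hc0, hmin⟩ := Finset.exists_min_image (Finset.range s) y ⟨0, by simpa using hs⟩
  rw [Finset.mem_range] at hc0
  set lo := y c0 * s with hlo
  set hi := lo + s * s with hhi
  have hS2 : Sandwich (r * s) lo hi z2 := by
    intro p hp
    have hm : p % s < s := Nat.mod_lt _ hs
    have hd : p / s < r := Nat.div_lt_of_lt_mul (by rwa [mul_comm] at hp)
    have e : p % s + s * (p / s) = p := Nat.mod_add_div p s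
    have hz := h2 (p % s) hm (p / s) hd
    rw [e] at hz
    rw [hz]
    change (_ → _ < y (p % s)) ∧ (_ → ¬ _ < y (p % s))
    constructor
    · intro h
      have h' : p / s < y c0 := Nat.div_lt_of_lt_mul (by rw [mul_comm]; exact h)
      exact h'.trans_le (hmin _ (by simpa using hm))
    · intro h
      have h' : y c0 + s ≤ p / s := by
        rw [Nat.le_div_iff_mul_le hs]; rw [hhi, hlo] at h; nlinarith
      grind
  have hS3 : Sandwich (r * s) lo hi z3 := by
    refine hS2.windows (q := s) (r := r) (a := fun i => i * r) hblk ?_ h3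
    grind
  have hwin : ∀ k < s - 1, ∀ j < r, (k + 1) * r - r / 2 + j < r * s := by
    intro k hk j hj
    have : (k + 1 + 1) * r ≤ s * r := Nat.mul_le_mul_right r (by omega)
    have h' : r / 2 ≤ (k + 1) * r := by
      grind
    grind
  by_cases hA : ∃ k < s - 1, lo < (k + 1) * r ∧ (k + 1) * r < hi
  · -- the window crosses a boundary between blocks, and lies in a shifted block
    obtain ⟨k, hk, hk1, hk2⟩ := hA
    have hS4 : Sandwich (r * s) lo hi z4 :=
      hS3.windows (q := s - 1) (r := r) (a := fun k => (k + 1) * r - r / 2) hwin h4' h4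
    intro p q hpq hq hz
    by_cases hp : p < lo
    · exact (hS4 p (by omega)).1 hp
    · have hq' : q < hi := by
        by_contra h
        exact (hS4 q hq).2 (by omega) hz
      obtain ⟨jp, hjp⟩ := Nat.exists_eq_add_of_le (show (k + 1) * r - r / 2 ≤ p by omega)
      obtain ⟨jq, hjq⟩ := Nat.exists_eq_add_of_le (show (k + 1) * r - r / 2 ≤ q by omega)
      rw [hjq, h4 k hk jq (by omega)] at hz
      rw [hjp, h4 k hk jp (by omega)]
      omega
  · -- the window lies in a block: everything is sorted already after the third phase
    push Not at hA
    have hmono : ∀ p q, p ≤ q → q < r * s → z3 q → z3 p := by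
      intro p q hpq hq hz
      by_cases hp : p < lo
      · exact (hS3 p (by omega)).1 hp
      · have hq' : q < hi := by
          by_contra h
          exact (hS3 q hq).2 (by omega) hz
        obtain ⟨p1, p2, p3⟩ := hdec p (by omega)
        obtain ⟨q1, q2, q3⟩ := hdec q hq
        have hle : p / r ≤ q / r := Nat.div_le_div_right hpq
        rcases hle.lt_or_eq with hlt | heq
        · exfalso
          obtain ⟨k, hk⟩ : ∃ k, q / r = k + 1 := ⟨q / r - 1, by generalize p / r = a at *; omega⟩
          rw [hk] at q3 q1 hlt
          have h5 : (p / r + 1) * r ≤ (k + 1) * r := Nat.mul_le_mul_right r (by omega)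
          have h6 : (p / r + 1) * r = p / r * r + r := by ring
          have := hA k (by omega) (by omega)
          omega
        grind
    have hx : ∃ x, Sandwich (r * s) x x z3 := by
      by_cases hall : ∃ p, p < r * s ∧ ¬ z3 p
      · refine ⟨Nat.find hall, fun p hp => ⟨fun h => ?_, fun h hz => ?_⟩⟩
        · have := Nat.find_min hall h
          push Not at this
          grind
        grind
      · push Not at hall
        exact ⟨r * s, fun p hp => ⟨fun _ => hall p hp, fun h => by omega⟩⟩
    obtain ⟨x, hx⟩ := hx
    have hS4 : Sandwich (r * s) x x z4 :=
      hx.windows (q := s - 1) (r := r) (a := fun k => (k + 1) * r - r / 2) hwin h4' h4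
    intro p q hpq hq hz
    by_contra hn'
    have hpx : ¬ p < x := fun h => hn' ((hS4 p (by omega)).1 h)
    exact (hS4 q hq).2 (by omega) hz

/-- Columnsort sorts: with sorters for `r ≥ 2 s²` elements it sorts `r s` elements. -/
theorem sorts_colSort {κ : α → ℕ} {L : List ℕ} {r s : ℕ} {srt : List ℕ → List (List ℕ)}
    (hsrt : ∀ L' : List ℕ, L'.Nodup → L'.length = r → Sorts κ (srt L') L')
    (hL : L.Nodup) (hlen : L.length = r * s) (hs : 0 < s) (hrs : s * s ≤ r / 2) :
    Sorts κ (colSort r s srt L) L := by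
  intro A
  have hr : 0 < r := by
    rcases Nat.eq_zero_or_pos r with rfl | h
    · simp_all
    · exact h
  have hblk : ∀ i < s, ∀ j < r, i * r + j < L.length := by
    intro i hi j hj
    have : (i + 1) * r ≤ s * r := Nat.mul_le_mul_right r hi
    grind
  have hblk' : ∀ i < s, ∀ j < r, ∀ i' < s, ∀ j' < r, i * r + j = i' * r + j' → i = i' ∧ j = j' := by
    intro i _ j hj i' _ j' hj' h
    have e1 : (i * r + j) / r = i := by
      rw [mul_comm, Nat.mul_add_div hr, Nat.div_eq_of_lt hj, add_zero]
    have e2 : (i' * r + j') / r = i' := by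
      rw [mul_comm, Nat.mul_add_div hr, Nat.div_eq_of_lt hj', add_zero]
    grind
  have hres : ∀ c < s, ∀ j < r, c + s * j < L.length := by
    intro c hc j hj
    have : s * (j + 1) ≤ s * r := Nat.mul_le_mul_left s hj
    grind
  have hres' : ∀ i < s, ∀ j < r, ∀ i' < s, ∀ j' < r, i + s * j = i' + s * j' → i = i' ∧ j = j' := by
    intro i hi j _ i' hi' j' _ h
    have e1 : (i + s * j) % s = i := by rw [Nat.add_mul_mod_self_left, Nat.mod_eq_of_lt hi]
    have e2 : (i' + s * j') % s = i' := by rw [Nat.add_mul_mod_self_left, Nat.mod_eq_of_lt hi']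
    have : i = i' := by rw [← e1, ← e2, h]
    subst this
    exact ⟨rfl, Nat.eq_of_mul_eq_mul_left hs (by omega)⟩
  have hhalf : ∀ k, r / 2 ≤ (k + 1) * r := by
    grind
  have hwin : ∀ k < s - 1, ∀ j < r, (k + 1) * r - r / 2 + j < L.length := by
    intro k hk j hj
    have h1 : (k + 1 + 1) * r ≤ s * r := Nat.mul_le_mul_right r (by omega)
    grind
  have hwin' : ∀ i < s - 1, ∀ j < r, ∀ i' < s - 1, ∀ j' < r,
      (i + 1) * r - r / 2 + j = (i' + 1) * r - r / 2 + j' → i = i' ∧ j = j' := by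
    intro i hi j hj i' hi' j' hj' h
    have h1 := hhalf i
    have h2 := hhalf i'
    have h3 : (i + 1) * r = i * r + r := by ring
    have h4 : (i' + 1) * r = i' * r + r := by ring
    exact hblk' i (by omega) j hj i' (by omega) j' hj' (by omega)
  rw [colSort, runNet_append, runNet_append, runNet_append]
  obtain ⟨a1, a2, -, a4⟩ := pass hsrt hL s (fun i j => i * r + j) hblk hblk' A
  set A1 := runNet κ ((List.range s).flatMap fun i => srt (sub L r fun j => i * r + j)) A
  obtain ⟨b1, b2, -, b4⟩ := pass hsrt hL s (fun c j => c + s * j) hres hres' A1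
  set A2 := runNet κ ((List.range s).flatMap fun c => srt (sub L r fun j => c + s * j)) A1
  obtain ⟨c1, c2, -, c4⟩ := pass hsrt hL s (fun i j => i * r + j) hblk hblk' A2
  set A3 := runNet κ ((List.range s).flatMap fun i => srt (sub L r fun j => i * r + j)) A2
  obtain ⟨d1, d2, d3, d4⟩ := pass hsrt hL (s - 1) (fun k j => (k + 1) * r - r / 2 + j) hwin hwin' A3
  set A4 := runNet κ ((List.range (s - 1)).flatMap fun k => srt (sub L r fun j =>
    (k + 1) * r - r / 2 + j)) A3
  refine ⟨fun p hp => by rw [d1 p hp, c1 p hp, b1 p hp, a1 p hp],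
    d2.trans (c2.trans (b2.trans a2)), ?_⟩
  rw [List.pairwise_iff_getElem]
  intro i j hi hj hij
  simp only [List.length_map] at hi hj
  simp only [List.getElem_map]
  by_contra hlt
  push Not at hlt
  set t := κ (A4 L[i]) with ht
  have := columnsort_zero_one (z0 := fun p => κ (A (L.getD p 0)) < t)
    (z1 := fun p => κ (A1 (L.getD p 0)) < t) (z2 := fun p => κ (A2 (L.getD p 0)) < t)
    (z3 := fun p => κ (A3 (L.getD p 0)) < t) (z4 := fun p => κ (A4 (L.getD p 0)) < t)
    hs hrs (by convert a4 t) (by convert b4 t) (by convert c4 t)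
    (by convert d4 t) (fun p hp h => by
      grind) i j hij.le (by rw [← hlen]; exact hj)
    (by rw [List.getD_eq_getElem _ _ hj]; exact hlt)
  grind

end SortNet

end OS

/-! ### Stages: fetch, compute with coins, overwrite -/

namespace OS

open Prog

theorem map_uniformOfFintype_equiv {α β : Type*} [Fintype α] [Nonempty α] [Fintype β] [Nonempty β]
    (e : α ≃ β) : (PMF.uniformOfFintype α).map e = PMF.uniformOfFintype β := by
  classical
  ext b
  rw [PMF.map_apply, tsum_eq_single (e.symm b)]
  · simp [Fintype.card_congr e]
  grind

/-- Cut a list into pieces of length `c`, the last of which may be shorter. -/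
def chunks {α : Type*} (c : ℕ) (l : List α) : List (List α) :=
  (List.range (l.length / c + 1)).map fun j => (l.drop (j * c)).take c

theorem flatten_range_chunks {α : Type*} (c q : ℕ) (l : List α) :
    ((List.range q).map fun j => (l.drop (j * c)).take c).flatten = l.take (q * c) := by
  induction q with
  | zero => simp
  | succ q ih =>
      simp [List.range_succ, List.map_append, List.flatten_append, ih, Nat.succ_mul, List.take_add]

theorem flatten_chunks {α : Type*} {c : ℕ} (hc : 0 < c) (l : List α) :
    (chunks c l).flatten = l := by
  rw [chunks, flatten_range_chunks, List.take_of_length_le]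
  have := Nat.lt_div_mul_add (a := l.length) hc
  grind

theorem chunks_map {α β : Type*} (c : ℕ) (f : α → β) (l : List α) :
    chunks c (l.map f) = (chunks c l).map (List.map f) := by
  simp [chunks, List.map_drop, List.map_take]

theorem length_chunks {α : Type*} (c : ℕ) (l : List α) :
    (chunks c l).length = l.length / c + 1 := by simp [chunks]

theorem length_le_of_mem_chunks {α : Type*} {c : ℕ} {l p : List α} (h : p ∈ chunks c l) :
    p.length ≤ c := by
  grind [chunks]

section

variable {W : ℕ}

/-- Fetch words at any number of addresses, in messages of at most `B` words. -/
def fetchAll (B : ℕ) (l : List (Fin W)) : Prog W (List (Fin W)) :=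
  (forList fetch (chunks B l)).bind fun parts => ret parts.flatten

/-- Overwrite any number of words, in messages of at most `B` words. -/
def storeAll (B : ℕ) (l : List (Fin W × Fin W)) : Prog W Unit :=
  (forList store (chunks (B / 2) l)).bind fun _ => ret ()

theorem run_fetchAll {B : ℕ} (hB : 0 < B) (l : List (Fin W)) (m : Mem W) :
    (fetchAll B l).run m = PMF.pure (l.map m, m, (chunks B l).map Event.read) := by
  have h1 := run_forList_read (f := fetch) (g := fun as : List (Fin W) => as.map m)
    (tr := fun as => [Event.read as]) (m := m) (l := chunks B l) fun as _ => run_fetch as m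
  have h2 := run_bind_pure h1 (f := fun parts : List (List (Fin W)) => ret parts.flatten)
    (run_ret _ _)
  rw [fetchAll, h2, ← chunks_map, flatten_chunks hB]
  simp [← List.map_eq_flatMap]

theorem run_storeAll {B : ℕ} (hB : 2 ≤ B) (l : List (Fin W × Fin W)) (m : Mem W) :
    (storeAll B l).run m = PMF.pure ((), l.foldl (fun m q => Function.update m q.1 q.2) m,
      (chunks (B / 2) (l.map Prod.fst)).map Event.write) := by
  have h1 := run_forList_write (f := store)
    (g := fun (ps : List (Fin W × Fin W)) m => ps.foldl (fun m q => Function.update m q.1 q.2) m)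
    (tr := fun ps => [Event.write (ps.map Prod.fst)]) (l := chunks (B / 2) l)
    (fun ps _ m => run_store ps m) m
  have h2 := run_bind_pure h1 (f := fun _ : List Unit => ret ()) (run_ret _ _)
  rw [storeAll, h2, ← List.foldl_flatten, flatten_chunks (by omega), chunks_map]
  simp [Function.comp_def, ← List.map_eq_flatMap]

theorem foldl_update_map (l : List (Fin W)) (g : Fin W → Fin W) (m : Mem W) (a : Fin W) :
    (l.map fun x => (x, g x)).foldl (fun m q => Function.update m q.1 q.2) m a =
      if a ∈ l then g a else m a := by
  induction l generalizing m with
  | nil => simp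
  | cons x l ih =>
      simp only [List.map_cons, List.foldl_cons, ih, List.mem_cons]
      grind

/-- A client program that fetches the words at the addresses `ins`, draws a coin, and overwrites
the words at the addresses `outs` by a function of the fetched words and the coin. The function is
given by the whole memory afterwards, in terms of the whole memory before. -/
structure Stage (W : ℕ) where
  ins : List (Fin W)
  outs : List (Fin W)
  Coin : Type
  [fin : Fintype Coin]
  [nonempty : Nonempty Coin]
  val : Coin → Mem W → Mem W

attribute [instance] Stage.fin Stage.nonempty

namespace Stage

/-- A memory in which only the words at the addresses `ins` are as in `m`. -/
def restrict (ins : List (Fin W)) (m : Mem W) : Mem W := fun x => if x ∈ ins then m x else x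

/-- Lookup in a list of fetched words. -/
def unfetch (ins l : List (Fin W)) : Mem W := fun x => l.getD (ins.idxOf x) x

theorem unfetch_map (ins : List (Fin W)) (m : Mem W) :
    unfetch ins (ins.map m) = restrict ins m := by
  grind [unfetch, restrict, List.getD_eq_default]

theorem restrict_of_mem {ins : List (Fin W)} {m : Mem W} {x : Fin W} (h : x ∈ ins) :
    restrict ins m x = m x := if_pos h

/-- The coins, numbered. -/
noncomputable def coinEquiv (s : Stage W) : Fin (Fintype.card s.Coin - 1 + 1) ≃ s.Coin :=
  (finCongr (Nat.sub_add_cancel Fintype.card_pos)).trans (Fintype.equivFin s.Coin).symm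

/-- The client program of a stage. It stores `B / 2` words at a time, since a message that overwrites
words also contains their addresses. -/
noncomputable def prog (B : ℕ) (s : Stage W) : Prog W Unit :=
  (fetchAll B s.ins).bind fun l =>
    (sample (Fintype.card s.Coin - 1) fun i =>
      ret (s.outs.map (s.val (s.coinEquiv i) (unfetch s.ins l)))).bind fun v =>
        storeAll B (s.outs.zip v)

/-- The memory after a stage. -/
def exec (s : Stage W) (ω : s.Coin) (m : Mem W) : Mem W := fun a =>
  if a ∈ s.outs then s.val ω (restrict s.ins m) a else m a

theorem exec_of_mem {s : Stage W} {ω : s.Coin} {m : Mem W} {a : Fin W} (h : a ∈ s.outs) :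
    s.exec ω m a = s.val ω (restrict s.ins m) a := if_pos h

theorem exec_of_notMem {s : Stage W} {ω : s.Coin} {m : Mem W} {a : Fin W} (h : a ∉ s.outs) :
    s.exec ω m a = m a := if_neg h

/-- What the server observes of a stage. It depends neither on the memory nor on the coins. -/
def trace (B : ℕ) (s : Stage W) : List (Event W) :=
  (chunks B s.ins).map Event.read ++ (chunks (B / 2) s.outs).map Event.write

theorem run_prog {B : ℕ} (hB : 2 ≤ B) (s : Stage W) (m : Mem W) :
    (s.prog B).run m =
      (PMF.uniformOfFintype s.Coin).map fun ω => ((), s.exec ω m, s.trace B) := by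
  rw [prog, run_bind_of_pure (run_fetchAll (by omega) _ _), run_bind, unfetch_map]
  simp only [run, PMF.bind_bind, PMF.pure_bind, PMF.map_bind]
  rw [← map_uniformOfFintype_equiv s.coinEquiv, PMF.map_comp, ← PMF.bind_pure_comp]
  congr 1
  funext i
  rw [run_storeAll hB]
  simp only [PMF.pure_map, Function.comp]
  have e : s.outs.zip (s.outs.map (s.val (s.coinEquiv i) (restrict s.ins m))) =
      s.outs.map fun a => (a, s.val (s.coinEquiv i) (restrict s.ins m) a) := by
    rw [List.zip_map_right, List.zip_eq_zipWith, List.zipWith_self]; simp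
  rw [e]
  congr 2
  ext1
  · funext a
    exact (foldl_update_map _ _ _ _).trans rfl
  · simp [trace, Function.comp_def]

theorem length_trace (B : ℕ) (s : Stage W) :
    (s.trace B).length = s.ins.length / B + 1 + (s.outs.length / (B / 2) + 1) := by
  simp [trace, length_chunks]

/-- The stage needs at most about `Q` messages in each direction. -/
structure Fits (B Q : ℕ) (s : Stage W) : Prop where
  ins_le : s.ins.length ≤ Q * (B / 2)
  outs_le : s.outs.length ≤ Q * (B / 2)

theorem Fits.length_trace_le {B Q : ℕ} {s : Stage W} (h : s.Fits B Q) :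
    (s.trace B).length ≤ 2 * Q + 2 := by
  rw [length_trace]
  have h1 : s.ins.length / B ≤ Q := by
    apply Nat.div_le_of_le_mul
    refine h.1.trans ?_
    rw [mul_comm]
    exact Nat.mul_le_mul_right Q (Nat.div_le_self _ _)
  have h2 : s.outs.length / (B / 2) ≤ Q := by
    apply Nat.div_le_of_le_mul
    rw [mul_comm]; exact h.2
  omega

theorem blockBound_prog (B : ℕ) (s : Stage W) : (s.prog B).BlockBound B := by
  refine BlockBound.bind (BlockBound.bind (BlockBound.forList fun p hp => ?_) fun _ => trivial)
    fun l => BlockBound.bind (fun _ => trivial) fun v =>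
      BlockBound.bind (BlockBound.forList fun p hp => ?_) fun _ => trivial
  · exact blockBound_fetch (length_le_of_mem_chunks hp)
  · have := length_le_of_mem_chunks hp
    exact blockBound_store (by omega)

theorem small_fetchAll {B q : ℕ} (hW : 2 ≤ W) {l : List (Fin W)} (hl : l.length / B + 1 ≤ q) :
    Small (fetchAll B l) (q * (2 * B + 3 + q * B) + q * B + 1) (q * B) := by
  have h1 : Small (forList fetch (chunks B l)) _ _ :=
    small_forList (c := B + 1) (r := B) (Q := q) hW (fun p hp =>
      (small_fetch hW p).mono hW (by have := length_le_of_mem_chunks hp; omega)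
        (length_le_of_mem_chunks hp)) (by rw [length_chunks]; exact hl)
  rw [length_chunks] at h1
  have h2 := Small.bind hW h1 (f := fun parts : List (List (Fin W)) => ret parts.flatten)
    fun a _ => small_ret _ 0 0 hW
  refine h2.mono hW ?_ ?_
  · have e1 := Nat.mul_le_mul_right (B + 1 + B + q * B + 2) hl
    have e2 := Nat.mul_le_mul_right B hl
    grind
  · simpa using Nat.mul_le_mul_right B hl

theorem small_storeAll {B q : ℕ} (hW : 2 ≤ W) {l : List (Fin W × Fin W)}
    (hl : l.length / (B / 2) + 1 ≤ q) : Small (storeAll B l) (3 * q + 1) 0 := by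
  have h1 : Small (forList store (chunks (B / 2) l)) _ _ :=
    small_forList (c := 1) (r := 0) (Q := q) hW (fun p _ => small_store hW p)
      (by rw [length_chunks]; exact hl)
  rw [length_chunks] at h1
  have h2 := Small.bind hW h1 (f := fun _ : List Unit => ret ()) fun a _ => small_ret _ 0 0 hW
  exact h2.mono hW (by omega) (by omega)

theorem encard_lists_le (l : List (Fin W)) (S : Set (List (Fin W)))
    (hS : ∀ v ∈ S, v.length = l.length) : S.encard ≤ ((W ^ l.length : ℕ) : ℕ∞) := by
  have h : S ⊆ ⋃ f : Fin l.length → Fin W, {List.ofFn f} := by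
    intro v hv
    rw [Set.mem_iUnion]
    refine ⟨fun i => v.get (i.cast (hS v hv).symm), ?_⟩
    rw [Set.mem_singleton_iff]
    apply List.ext_get
    · grind
    simp
  refine (Set.encard_le_encard h).trans ?_
  refine (encard_iUnion_le_mul (c := 1) fun f => by simp).trans ?_
  simp

theorem small_prog {B Q : ℕ} (hW : 2 ≤ W) (hB : 2 ≤ B) {s : Stage W} (h : s.Fits B Q) :
    Small (s.prog B) (20 * (Q + 1) ^ 2 * B) 0 := by
  have hq1 : s.ins.length / B + 1 ≤ Q + 1 := by
    have : s.ins.length / B ≤ Q := by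
      apply Nat.div_le_of_le_mul
      refine h.1.trans ?_
      rw [mul_comm]
      exact Nat.mul_le_mul_right Q (Nat.div_le_self _ _)
    omega
  have hout : s.outs.length ≤ Q * B := h.2.trans (Nat.mul_le_mul_left Q (Nat.div_le_self _ _))
  have hq2 : s.outs.length / (B / 2) + 1 ≤ Q + 1 := by
    have : s.outs.length / (B / 2) ≤ Q := by
      apply Nat.div_le_of_le_mul
      rw [mul_comm]; exact h.2
    omega
  have hsam : ∀ l : List (Fin W), Small (sample (Fintype.card s.Coin - 1) fun i =>
      (ret (s.outs.map (s.val (s.coinEquiv i) (unfetch s.ins l))) : Prog W _))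
      (s.outs.length + 1) s.outs.length := by
    intro l
    constructor
    · simp only [configs]
      have h1 : (⋃ i, {(ret (s.outs.map (s.val (s.coinEquiv i) (unfetch s.ins l))) :
          Prog W _)}) ⊆ ret '' (⋃ i, {s.outs.map (s.val (s.coinEquiv i) (unfetch s.ins l))}) := by
        grind [Set.mem_iUnion]
      refine (Set.encard_insert_le _ _).trans ?_
      refine (add_le_add_left ((Set.encard_le_encard h1).trans ((Set.encard_image_le _ _).trans
        (encard_lists_le s.outs _ ?_))) 1).trans ?_
      · simp
      · have := pow_add_pow_le (a := s.outs.length) (b := 0) (c := s.outs.length) hW le_rfl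
          (by omega)
        rw [pow_zero] at this
        exact_mod_cast this
    · simp only [results]
      refine encard_lists_le s.outs _ ?_
      simp
  have h1 := Small.bind hW (small_fetchAll hW hq1) fun l _ =>
    Small.bind hW (hsam l) fun v hv => small_storeAll (B := B) (q := Q + 1) hW
      (l := s.outs.zip v) (by
        simp only [results, Set.mem_iUnion, Set.mem_singleton_iff] at hv
        obtain ⟨i, rfl⟩ := hv
        simpa using hq2)
  constructor
  · refine (h1.mono hW (r' := _) ?_ le_rfl).1
    obtain ⟨B', rfl⟩ := Nat.exists_eq_add_of_le hB
    nlinarith [Nat.zero_le (Q * Q), Nat.zero_le (Q * Q * B'), Nat.zero_le (Q * B')]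
  · refine (Set.encard_le_one_iff.2 fun a b _ _ => rfl).trans ?_
    simp

end Stage

/-- The law of the memory after several stages. -/
noncomputable def execLaw : List (Stage W) → Mem W → PMF (Mem W)
  | [], m => PMF.pure m
  | s :: ss, m => (PMF.uniformOfFintype s.Coin).bind fun ω => execLaw ss (s.exec ω m)

theorem execLaw_append (ss ss' : List (Stage W)) (m : Mem W) :
    execLaw (ss ++ ss') m = (execLaw ss m).bind (execLaw ss') := by
  induction ss generalizing m with
  | nil => simp [execLaw]
  | cons s ss ih => simp [execLaw, ih]

/-- The client program for a list of stages. -/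
noncomputable def runStages (B : ℕ) : List (Stage W) → Prog W Unit
  | [] => ret ()
  | s :: ss => (s.prog B).bind fun _ => runStages B ss

theorem run_runStages {B : ℕ} (hB : 2 ≤ B) (ss : List (Stage W)) (m : Mem W) :
    (runStages B ss).run m =
      (execLaw ss m).map fun m' => ((), m', ss.flatMap (Stage.trace B)) := by
  induction ss generalizing m with
  | nil => simp [runStages, run, execLaw, PMF.pure_map]
  | cons s ss ih =>
      simp only [runStages, execLaw]
      rw [run_bind, s.run_prog hB, PMF.bind_map, PMF.map_bind]
      congr 1
      funext ω
      simp only [Function.comp, ih, PMF.map_comp]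
      rfl

theorem blockBound_runStages (B : ℕ) (ss : List (Stage W)) : (runStages B ss).BlockBound B := by
  induction ss with
  | nil => trivial
  | cons s ss ih => exact BlockBound.bind (s.blockBound_prog B) fun _ => ih

theorem small_runStages {B Q τ : ℕ} (hW : 2 ≤ W) (hB : 2 ≤ B) {ss : List (Stage W)}
    (h : ∀ s ∈ ss, s.Fits B Q) (hτ : ss.length + 1 ≤ W ^ τ) :
    Small (runStages B ss) (20 * (Q + 1) ^ 2 * B + τ) 0 := by
  constructor
  · have key : (runStages B ss).configs.encard ≤
        (((ss.length + 1) * W ^ (20 * (Q + 1) ^ 2 * B) : ℕ) : ℕ∞) := by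
      clear hτ
      induction ss with
      | nil =>
          simp only [runStages, configs, Set.encard_singleton]
          have : 1 ≤ W ^ (20 * (Q + 1) ^ 2 * B) := Nat.one_le_pow _ _ (by omega)
          exact_mod_cast (by simpa using this)
      | cons s ss ih =>
          have ih := ih fun s hs => h s (by simp [hs])
          refine (Set.encard_le_encard (configs_bind_subset _ _)).trans ?_
          refine (Set.encard_union_le _ _).trans ?_
          have h1 := (Set.encard_image_le (fun q => q.bind fun _ => runStages B ss)
            (s.prog B).configs).trans (Stage.small_prog hW hB (h s (by simp))).1
          have h2 : (⋃ a ∈ (s.prog B).results, (runStages B ss).configs).encard ≤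
              (((ss.length + 1) * W ^ (20 * (Q + 1) ^ 2 * B) : ℕ) : ℕ∞) := by
            refine (Set.encard_le_encard ?_).trans ih
            simp
          refine (add_le_add h1 h2).trans ?_
          rw [List.length_cons, ← Nat.cast_add]
          refine Nat.cast_le.2 ?_
          nlinarith
    refine key.trans ?_
    rw [pow_add, mul_comm]
    exact_mod_cast Nat.mul_le_mul_left _ hτ
  · refine (Set.encard_le_one_iff.2 fun a b _ _ => rfl).trans ?_
    simp

end

end OS

/-! ### Tables in server memory -/

namespace OS

open Prog

namespace Params

theorem word_val (P : Params) {x : ℕ} (h : x < P.W) : (P.word x).val = x := Nat.mod_eq_of_lt h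

theorem word_coe (P : Params) (a : P.Word) : P.word a.val = a :=
  Fin.ext (Nat.mod_eq_of_lt a.isLt)

theorem word_inj (P : Params) {x y : ℕ} (hx : x < P.W) (hy : y < P.W)
    (h : P.word x = P.word y) : x = y := by
  rw [← P.word_val hx, ← P.word_val hy, h]

end Params

variable {P : Params}

/-- A rectangular region of server memory: `len` rows of `w` words, from the address `base` on. -/
structure Table where
  base : ℕ
  w : ℕ
  len : ℕ

namespace Table

/-- First address after the table. -/
def limit (T : Table) : ℕ := T.base + T.len * T.w

variable (P) in
/-- The address of word `j` of row `p`. -/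
def addr (T : Table) (p j : ℕ) : P.Word := P.word (T.base + p * T.w + j)

variable (P) in
/-- The addresses of row `p`. -/
def rowAddrs (T : Table) (p : ℕ) : List P.Word := (List.range T.w).map (T.addr P p)

/-- The words of row `p`; the rows outside of the table are taken to be empty. -/
def row (T : Table) (m : Mem P.W) (p : ℕ) : List P.Word :=
  if p < T.len then (T.rowAddrs P p).map m else []

theorem lt_limit {T : Table} {p j : ℕ} (hp : p < T.len) (hj : j < T.w) :
    T.base + p * T.w + j < T.limit := by
  have : (p + 1) * T.w ≤ T.len * T.w := Nat.mul_le_mul_right _ hp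
  grind [limit]

theorem addr_val {T : Table} (hT : T.limit ≤ P.W) {p j : ℕ} (hp : p < T.len) (hj : j < T.w) :
    (T.addr P p j).val = T.base + p * T.w + j :=
  P.word_val ((lt_limit hp hj).trans_le hT)

theorem length_row {T : Table} {m : Mem P.W} {p : ℕ} (hp : p < T.len) :
    (T.row m p).length = T.w := by simp [row, hp, rowAddrs]

theorem row_eq {T : Table} {m : Mem P.W} {p : ℕ} (hp : p < T.len) :
    T.row m p = (List.range T.w).map fun j => m (T.addr P p j) := by
  simp [row, hp, rowAddrs, Function.comp_def]

theorem row_getD {T : Table} {m : Mem P.W} {p j : ℕ} (hp : p < T.len) (hj : j < T.w)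
    (d : P.Word) : (T.row m p).getD j d = m (T.addr P p j) := by
  rw [row_eq hp, List.getD_eq_getElem _ _ (by simpa using hj)]
  simp

theorem row_congr {T : Table} (hT : T.limit ≤ P.W) {m m' : Mem P.W}
    (h : ∀ a : P.Word, T.base ≤ a.val → a.val < T.limit → m a = m' a) : T.row m = T.row m' := by
  funext p
  by_cases hp : p < T.len
  · rw [row_eq hp, row_eq hp]
    refine List.map_congr_left fun j hj => ?_
    rw [List.mem_range] at hj
    have e := addr_val hT hp hj
    have := lt_limit hp hj
    grind
  · simp [row, hp]

theorem mem_rowAddrs {T : Table} (hT : T.limit ≤ P.W) {p q j : ℕ} (hp : p < T.len) (hq : q < T.len)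
    (hj : j < T.w) : T.addr P p j ∈ T.rowAddrs P q ↔ p = q := by
  constructor
  · intro h
    simp only [rowAddrs, List.mem_map, List.mem_range] at h
    obtain ⟨i, hi, h⟩ := h
    have h := congrArg Fin.val h
    rw [addr_val hT hq hi, addr_val hT hp hj] at h
    have hw : 0 < T.w := by omega
    have e1 : (p * T.w + j) / T.w = p := by
      rw [mul_comm, Nat.mul_add_div hw, Nat.div_eq_of_lt hj, add_zero]
    have e2 : (q * T.w + i) / T.w = q := by
      rw [mul_comm, Nat.mul_add_div hw, Nat.div_eq_of_lt hi, add_zero]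
    grind
  · rintro rfl
    exact List.mem_map.2 ⟨j, by simpa using hj, rfl⟩

/-- A stage that overwrites rows of the table. -/
def stage (T : Table) (ins : List P.Word) (rows : List ℕ) (Coin : Type) [Fintype Coin]
    [Nonempty Coin] (val : Coin → Mem P.W → ℕ → List P.Word) : Stage P.W where
  ins := ins
  outs := rows.flatMap (T.rowAddrs P)
  Coin := Coin
  val := fun ω m a => (val ω m ((a.val - T.base) / T.w)).getD ((a.val - T.base) % T.w) a

section

variable {T : Table} {ins : List P.Word} {rows : List ℕ} {Coin : Type} [Fintype Coin]
  [Nonempty Coin] {val : Coin → Mem P.W → ℕ → List P.Word}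

theorem row_exec_stage (hT : T.limit ≤ P.W) (hrows : ∀ q ∈ rows, q < T.len) (ω : Coin) (m : Mem P.W)
    (p : ℕ)
    (hval : p ∈ rows → (val ω (Stage.restrict ins m) p).length = T.w) :
    T.row ((T.stage ins rows Coin val).exec ω m) p =
      if p ∈ rows then val ω (Stage.restrict ins m) p else T.row m p := by
  by_cases hp : p < T.len
  · have hmem : ∀ j < T.w, (T.addr P p j ∈ rows.flatMap (T.rowAddrs P) ↔ p ∈ rows) := by
      intro j hj
      rw [List.mem_flatMap]
      constructor
      · rintro ⟨q, hq, h⟩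
        rw [mem_rowAddrs hT hp (hrows q hq) hj] at h
        grind
      · intro h
        exact ⟨p, h, (mem_rowAddrs hT hp hp hj).2 rfl⟩
    split_ifs with h
    · apply List.ext_getElem
      · rw [length_row hp, hval h]
      · intro j h1 h2
        rw [length_row hp] at h1
        have hw : 0 < T.w := by omega
        simp only [row_eq hp, List.getElem_map, List.getElem_range]
        refine (Stage.exec_of_mem ((hmem j h1).2 h)).trans ?_
        · simp only [stage, addr_val hT hp h1]
          rw [show T.base + p * T.w + j - T.base = p * T.w + j by omega, mul_comm,
            Nat.mul_add_div hw, Nat.div_eq_of_lt h1, add_zero, Nat.mul_add_mod,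
            Nat.mod_eq_of_lt h1, List.getD_eq_getElem _ _ h2]
    · rw [row_eq hp, row_eq hp]
      refine List.map_congr_left fun j hj => ?_
      rw [List.mem_range] at hj
      exact Stage.exec_of_notMem fun h' => h ((hmem j hj).1 h')
  · have : p ∉ rows := fun h => hp (hrows p h)
    simp [row, hp, this]

theorem exec_stage_outside (hT : T.limit ≤ P.W) (hrows : ∀ q ∈ rows, q < T.len) (ω : Coin)
    (m : Mem P.W) (a : P.Word) (ha : a.val < T.base ∨ T.limit ≤ a.val) :
    (T.stage ins rows Coin val).exec ω m a = m a := by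
  refine Stage.exec_of_notMem ?_
  simp only [stage, List.mem_flatMap, rowAddrs, List.mem_map, List.mem_range]
  rintro ⟨q, hq, j, hj, rfl⟩
  have h1 := addr_val hT (hrows q hq) hj
  have h2 := lt_limit (hrows q hq) hj
  omega

theorem row_restrict {p : ℕ} (m : Mem P.W) (h : ∀ a ∈ T.rowAddrs P p, a ∈ ins) :
    T.row (Stage.restrict ins m) p = T.row m p := by
  by_cases hp : p < T.len
  · rw [row, row, if_pos hp, if_pos hp]
    exact List.map_congr_left fun a ha => Stage.restrict_of_mem (h a ha)
  · simp [row, hp]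

end

/-- Sort the rows in `L` by the key `κ`. -/
def sortStage (T : Table) (κ : List P.Word → ℕ) (L : List ℕ) : Stage P.W :=
  T.stage (L.flatMap (T.rowAddrs P)) L Unit fun _ m p => SortNet.sortOn κ L (T.row m) p

theorem sortOn_congr {α : Type} {κ : α → ℕ} {L : List ℕ} {A A' : ℕ → α} {p : ℕ}
    (hL : ∀ q ∈ L, A q = A' q) (hp : A p = A' p) :
    SortNet.sortOn κ L A p = SortNet.sortOn κ L A' p := by
  simp only [SortNet.sortOn, hp]
  rw [List.map_congr_left hL]

theorem row_exec_sortStage {T : Table} (hT : T.limit ≤ P.W) {κ : List P.Word → ℕ} {L : List ℕ}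
    (hL : ∀ q ∈ L, q < T.len) (m : Mem P.W) :
    T.row ((T.sortStage κ L).exec () m) = SortNet.sortOn κ L (T.row m) := by
  have hr : ∀ q ∈ L, T.row (Stage.restrict (L.flatMap (T.rowAddrs P)) m) q = T.row m q :=
    fun q hq => row_restrict m fun a ha => List.mem_flatMap.2 ⟨q, hq, ha⟩
  funext p
  refine (row_exec_stage hT hL () m p ?_).trans ?_
  rotate_left
  · split_ifs with h
    · exact sortOn_congr hr (hr p h)
    · rw [SortNet.sortOn_of_notMem h]
  · intro h
    have : SortNet.sortOn κ L (T.row m) p ∈ L.map (T.row m) := by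
      rw [SortNet.sortOn, if_pos h, List.getD_eq_getElem]
      · exact (List.mergeSort_perm _ _).subset (List.getElem_mem _)
      · simpa using List.idxOf_lt_length_iff.2 h
    rw [sortOn_congr hr (hr p h)]
    rw [List.mem_map] at this
    obtain ⟨q, hq, e⟩ := this
    rw [← e, length_row (hL q hq)]

/-- The memories `m` and `m'` agree outside of the table. -/
def Frame (T : Table) (m m' : Mem P.W) : Prop :=
  ∀ a : P.Word, (a.val < T.base ∨ T.limit ≤ a.val) → m' a = m a

theorem Frame.refl (T : Table) (m : Mem P.W) : T.Frame m m := fun _ _ => rfl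

theorem Frame.trans {T : Table} {m m' m'' : Mem P.W} (h : T.Frame m m') (h' : T.Frame m' m'') :
    T.Frame m m'' := fun a ha => (h' a ha).trans (h a ha)

theorem Frame.row {T T' : Table} {m m' : Mem P.W} (h : T.Frame m m') (hT' : T'.limit ≤ P.W)
    (hd : T.limit ≤ T'.base ∨ T'.limit ≤ T.base) : T'.row m' = T'.row m :=
  row_congr hT' fun a h1 h2 => h a (by omega)

theorem execLaw_sortStages {T : Table} (hT : T.limit ≤ P.W) {κ : List P.Word → ℕ}
    {ns : List (List ℕ)} (hns : ∀ L ∈ ns, ∀ q ∈ L, q < T.len) (m : Mem P.W) :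
    ∀ m' ∈ (execLaw (ns.map (T.sortStage κ)) m).support,
      T.row m' = SortNet.runNet κ ns (T.row m) ∧ T.Frame m m' := by
  induction ns generalizing m with
  | nil =>
      intro m' hm'
      simp only [List.map_nil, execLaw, PMF.support_pure, Set.mem_singleton_iff] at hm'
      subst hm'
      exact ⟨rfl, Frame.refl _ _⟩
  | cons L ns ih =>
      intro m' hm'
      simp only [List.map_cons, execLaw, PMF.mem_support_bind_iff] at hm'
      obtain ⟨ω, -, hm'⟩ := hm'
      have h := ih (fun L hL => hns L (by simp [hL])) _ m' hm'
      have hω : ω = () := rfl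
      subst hω
      rw [row_exec_sortStage hT (hns L (by simp))] at h
      refine ⟨h.1, Frame.trans ?_ h.2⟩
      exact fun a ha => exec_stage_outside hT (hns L (by simp)) _ _ _ ha

end Table

end OS

/-! ### The B-tree of a sorted list of items -/

namespace OS

/-- The inequalities between the parameters that the scheme depends on. -/
structure Params.Good (P : Params) : Prop where
  two_le : 2 ≤ P.n
  fan : 3 ≤ P.branch / 2
  cap : P.n < (P.branch / 2) ^ (P.depth + 1)
  epoch_pos : 0 < P.epoch
  epoch_le : P.epoch ≤ P.n
  words : (P.arrayCells + P.levels * (2 * P.epoch)) * P.cellWords ≤ P.W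
  block : 4 * P.cellWords ≤ P.B

namespace BTree

variable (P : Params)

/-- The nodes of a new tree have at most half of the entries that they may have. -/
noncomputable def fan : ℕ := P.branch / 2

/-- Number of cells reserved for the nodes at height `h`; the items have height `0`. -/
noncomputable def levelLen (h : ℕ) : ℕ := P.n / fan P ^ h + 1

/-- The first cell for nodes at height `h`; the root comes first. -/
noncomputable def levelOff (h : ℕ) : ℕ := ∑ i ∈ Finset.Ico (h + 1) (P.depth + 2), levelLen P i

/-- The height of the node for which the cell `x` is reserved. -/
noncomputable def heightOf (x : ℕ) : Option ℕ :=
  (List.range (P.depth + 2)).find? fun h =>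
    decide (levelOff P h ≤ x ∧ x < levelOff P h + levelLen P h)

/-- Whether node number `q` at height `h` exists: its items are numbered from `q * fan ^ h` on, and
the first node of each level above the items always exists. -/
noncomputable def hasNode (live : ℕ → Bool) (h q : ℕ) : Bool :=
  live (q * fan P ^ h) || (decide (q = 0) && decide (1 ≤ h))

variable {P}

/-- The separator of node number `q` at height `h`: its first key, but the least word on the
leftmost path, so that no key is to the left of the tree. -/
noncomputable def sep (key : ℕ → P.Word) (h q : ℕ) : P.Word :=
  if q = 0 ∧ 1 ≤ h then P.word 0 else key (q * fan P ^ h)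

/-- The entries of node number `q` at height `h + 1`, when the cell `x` has the name `ptr x`. -/
noncomputable def kids (live : ℕ → Bool) (key ptr : ℕ → P.Word) (h q : ℕ) :
    List (P.Word × P.Word) :=
  ((List.range (fan P)).filter fun c => hasNode P live h (q * fan P + c)).map fun c =>
    (sep key h (q * fan P + c), ptr (levelOff P h + (q * fan P + c)))

/-- Contents of the cell for node number `q` at height `h`. -/
noncomputable def nodeAt (live : ℕ → Bool) (key : ℕ → P.Word) (val : ℕ → P.Val)
    (ptr : ℕ → P.Word) : ℕ → ℕ → Rec P
  | 0, q => if live q then .item (key q) (val q) else .blank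
  | h + 1, q => if hasNode P live (h + 1) q then .node (kids live key ptr h q) else .blank

/-- Contents of the cell `x`: a node, an item, a blank or a dummy. -/
noncomputable def cellAt (live : ℕ → Bool) (key : ℕ → P.Word) (val : ℕ → P.Val)
    (ptr : ℕ → P.Word) (x : ℕ) : Rec P :=
  if P.treeCells ≤ x then .dummy (ptr (x + 1))
  else match heightOf P x with
    | none => .blank
    | some h => nodeAt live key val ptr h (x - levelOff P h)

/-- Whether the list `l` has an item number `i`. -/
def liveOf (l : List P.Item) (i : ℕ) : Bool := decide (i < l.length)

/-- The key of item number `i`. -/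
def keyOf (l : List P.Item) (i : ℕ) : P.Word := ((l[i]?).map Prod.fst).getD (P.word 0)

/-- The value of item number `i`. -/
def valOf (l : List P.Item) (i : ℕ) : P.Val := ((l[i]?).map Prod.snd).getD fun _ => P.word 0

/-- The tree for a list of items, with the dummy list. -/
noncomputable def layout (l : List P.Item) (x : P.Word) : Rec P :=
  cellAt (liveOf l) (keyOf l) (valOf l) P.word x.val

section

theorem fan_pos (g : P.Good) : 0 < fan P := by have := g.fan; rw [fan]; omega

theorem levelOff_succ {h : ℕ} (hh : h < P.depth + 1) :
    levelOff P h = levelOff P (h + 1) + levelLen P (h + 1) := by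
  rw [levelOff, levelOff, Finset.sum_eq_sum_Ico_succ_bot (by omega), add_comm]

theorem levelOff_top : levelOff P (P.depth + 1) = 0 := by simp [levelOff]

theorem levelOff_add_le {h h' : ℕ} (hh : h < h') (hh' : h' ≤ P.depth + 1) :
    levelOff P h' + levelLen P h' ≤ levelOff P h := by
  obtain ⟨d, rfl⟩ := Nat.exists_eq_add_of_lt hh
  induction d with
  | zero => exact (levelOff_succ (by omega)).ge
  | succ d ih =>
      have h1 := ih (by omega) (by omega)
      have h2 := levelOff_succ (P := P) (h := h + d + 1) (by omega)
      grind

theorem sum_div_pow_le (f n k : ℕ) (hf : 3 ≤ f) (hn : 2 ≤ n) :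
    ∑ i ∈ Finset.Ico 1 (k + 1), n / f ^ i + 1 ≤ n := by
  have key : ∀ k, 2 * ∑ i ∈ Finset.Ico 1 (k + 1), n / f ^ i + n / f ^ k ≤ n := by
    intro k
    induction k with
    | zero => simp
    | succ k ih =>
        rw [Finset.sum_Ico_succ_top (by omega)]
        have h1 : 3 * (n / f ^ (k + 1)) ≤ n / f ^ k := by
          rw [pow_succ, ← Nat.div_div_eq_div_mul]
          have := Nat.div_mul_le_self (n / f ^ k) f
          nlinarith [Nat.mul_le_mul_left (n / f ^ k / f) hf]
        omega
  grind

theorem levelOff_zero_add_le (g : P.Good) : levelOff P 0 + levelLen P 0 ≤ P.treeCells := by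
  have h1 := sum_div_pow_le (fan P) P.n (P.depth + 1) g.fan g.two_le
  have h2 : levelOff P 0 = ∑ i ∈ Finset.Ico 1 (P.depth + 2), P.n / fan P ^ i + (P.depth + 1) := by
    simp [levelOff, levelLen, Finset.sum_add_distrib]
  rw [h2, levelLen, Params.treeCells]
  grind

theorem levelOff_add_le_treeCells (g : P.Good) {h : ℕ} (hh : h ≤ P.depth + 1) :
    levelOff P h + levelLen P h ≤ P.treeCells := by
  rcases Nat.eq_zero_or_pos h with rfl | h0
  · exact levelOff_zero_add_le g
  · have := levelOff_add_le h0 hh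
    have := levelOff_zero_add_le g
    omega

theorem treeCells_le : P.treeCells ≤ P.arrayCells := Nat.le_add_right _ _

theorem arrayCells_lt (g : P.Good) : P.arrayCells + P.levels * (2 * P.epoch) < P.W := by
  have h1 := g.words
  have h2 : 3 ≤ P.cellWords := by rw [Params.cellWords]; omega
  have h3 : 0 < P.arrayCells := by rw [Params.arrayCells, Params.treeCells]; omega
  nlinarith

theorem pos_inj {h h' q q' : ℕ} (hh : h ≤ P.depth + 1) (hh' : h' ≤ P.depth + 1)
    (hq : q < levelLen P h) (hq' : q' < levelLen P h')
    (e : levelOff P h + q = levelOff P h' + q') : h = h' ∧ q = q' := by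
  rcases lt_trichotomy h h' with hlt | rfl | hlt
  · have := levelOff_add_le hlt hh'; omega
  · omega
  · have := levelOff_add_le hlt hh; omega

theorem heightOf_pos {h q : ℕ} (hh : h ≤ P.depth + 1) (hq : q < levelLen P h) :
    heightOf P (levelOff P h + q) = some h := by
  rw [heightOf]
  cases hf : (List.range (P.depth + 2)).find? (fun h' =>
    decide (levelOff P h' ≤ levelOff P h + q ∧ levelOff P h + q < levelOff P h' + levelLen P h')) with
  | none =>
      grind
  | some h' =>
      have h1 := List.find?_some hf
      have h2 := List.mem_of_find?_eq_some hf
      rw [List.mem_range] at h2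
      simp only [decide_eq_true_eq] at h1
      have := (pos_inj (P := P) (h := h) (h' := h') (q := q)
        (q' := levelOff P h + q - levelOff P h') hh (by omega) hq (by omega) (by omega)).1
      rw [this]

theorem exists_of_heightOf {x h : ℕ} (hx : heightOf P x = some h) :
    h ≤ P.depth + 1 ∧ ∃ q < levelLen P h, x = levelOff P h + q := by
  have h1 := List.find?_some hx
  have h2 := List.mem_of_find?_eq_some hx
  rw [List.mem_range] at h2
  simp only [decide_eq_true_eq] at h1
  exact ⟨by omega, x - levelOff P h, by omega, by omega⟩

theorem cellAt_pos (g : P.Good) {live : ℕ → Bool} {key : ℕ → P.Word} {val : ℕ → P.Val}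
    {ptr : ℕ → P.Word} {h q : ℕ} (hh : h ≤ P.depth + 1) (hq : q < levelLen P h) :
    cellAt live key val ptr (levelOff P h + q) = nodeAt live key val ptr h q := by
  have := levelOff_add_le_treeCells g hh
  rw [cellAt, if_neg (by omega), heightOf_pos hh hq]
  simp

theorem word_pos_val (g : P.Good) {h q : ℕ} (hh : h ≤ P.depth + 1) (hq : q < levelLen P h) :
    (P.word (levelOff P h + q)).val = levelOff P h + q := by
  have h1 := levelOff_add_le_treeCells g hh
  have h2 := arrayCells_lt g
  have h3 := treeCells_le (P := P)
  exact P.word_val (by omega)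

theorem layout_pos (g : P.Good) (l : List P.Item) {h q : ℕ} (hh : h ≤ P.depth + 1)
    (hq : q < levelLen P h) : layout l (P.word (levelOff P h + q)) =
      nodeAt (liveOf l) (keyOf l) (valOf l) P.word h q := by
  rw [layout, word_pos_val g hh hq, cellAt_pos g hh hq]

variable {l : List P.Item}

theorem hasNode_iff {h q : ℕ} :
    hasNode P (liveOf l) h q = true ↔ q * fan P ^ h < l.length ∨ (q = 0 ∧ 1 ≤ h) := by
  simp [hasNode, liveOf]

theorem lt_levelLen (g : P.Good) (hl : l.length ≤ P.n) {h q : ℕ}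
    (hq : hasNode P (liveOf l) h q = true) : q < levelLen P h := by
  rw [hasNode_iff] at hq
  rw [levelLen]
  rcases hq with hq | ⟨rfl, -⟩
  · rw [Nat.lt_succ_iff, Nat.le_div_iff_mul_le (Nat.pow_pos (fan_pos g))]
    omega
  simp

theorem hasNode_div {h q : ℕ} (hq : hasNode P (liveOf l) h q = true) (k : ℕ) :
    hasNode P (liveOf l) (h + k) (q / fan P ^ k) = true := by
  rw [hasNode_iff] at hq ⊢
  rcases hq with hq | ⟨rfl, h1⟩
  · left
    rw [pow_add]
    have := Nat.div_mul_le_self q (fan P ^ k)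
    calc q / fan P ^ k * (fan P ^ h * fan P ^ k) = (q / fan P ^ k * fan P ^ k) * fan P ^ h := by ring
      _ ≤ q * fan P ^ h := Nat.mul_le_mul_right _ this
      _ < l.length := hq
  · right; simp; omega

theorem hasNode_parent (g : P.Good) {h q c : ℕ} (hc : c < fan P)
    (hq : hasNode P (liveOf l) h (q * fan P + c) = true) :
    hasNode P (liveOf l) (h + 1) q = true := by
  have := hasNode_div hq 1
  rwa [pow_one, mul_comm, Nat.mul_add_div (fan_pos g), Nat.div_eq_of_lt hc, add_zero] at this

theorem hasNode_root : hasNode P (liveOf l) (P.depth + 1) 0 = true := by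
  rw [hasNode_iff]; right; simp

theorem levelLen_top (g : P.Good) : levelLen P (P.depth + 1) = 1 := by
  rw [levelLen, fan, Nat.div_eq_of_lt g.cap]

/-- The items below node number `q` at height `h`. -/
noncomputable def seg (l : List P.Item) (h q : ℕ) : List P.Item :=
  (l.drop (q * fan P ^ h)).take (fan P ^ h)

theorem mem_seg {h q : ℕ} {x : P.Item} : x ∈ seg l h q ↔
    ∃ i, ∃ hi : i < l.length, q * fan P ^ h ≤ i ∧ i < (q + 1) * fan P ^ h ∧ x = l[i] := by
  simp only [seg, List.mem_iff_getElem, List.getElem_take, List.getElem_drop, List.length_take,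
    List.length_drop]
  constructor
  · grind
  · rintro ⟨i, hi, h1, h2, rfl⟩
    rw [Nat.add_mul] at h2
    refine ⟨i - q * fan P ^ h, by omega, ?_⟩
    grind

theorem seg_succ (h q : ℕ) :
    seg l (h + 1) q = ((List.range (fan P)).map fun c => seg l h (q * fan P + c)).flatten := by
  have := flatten_range_chunks (fan P ^ h) (fan P) (l.drop (q * fan P ^ (h + 1)))
  rw [seg, pow_succ, mul_comm (fan P ^ h) (fan P)]
  rw [pow_succ] at this
  rw [mul_comm (fan P ^ h) (fan P)] at this
  rw [← this]
  grind [List.drop_drop, seg]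

theorem keyOf_eq {i : ℕ} (hi : i < l.length) : keyOf l i = l[i].1 := by
  simp [keyOf, hi]

theorem valOf_eq {i : ℕ} (hi : i < l.length) : valOf l i = l[i].2 := by
  simp [valOf, hi]

theorem sep_le (hs : l.Pairwise fun x y => x.1 < y.1) {h q : ℕ} {x : P.Item}
    (hx : x ∈ seg l h q) : sep (keyOf l) h q ≤ x.1 := by
  obtain ⟨i, hi, h1, h2, rfl⟩ := mem_seg.1 hx
  rw [sep]
  split_ifs with h0
  · exact Fin.mk_le_of_le_val (by simp)
  · rw [keyOf_eq (by omega)]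
    rcases h1.eq_or_lt with h1 | h1
    · simp [h1]
    · exact (List.pairwise_iff_getElem.1 hs _ _ _ _ h1).le

theorem key_lt_sep (hs : l.Pairwise fun x y => x.1 < y.1) {h q i : ℕ}
    (hq : hasNode P (liveOf l) h q = true) (hi : i < l.length) (hiq : i < q * fan P ^ h) :
    l[i].1 < sep (keyOf l) h q := by
  rw [hasNode_iff] at hq
  have hq0 : q ≠ 0 := by rintro rfl; simp at hiq
  have hq : q * fan P ^ h < l.length := by tauto
  rw [sep, if_neg (by tauto), keyOf_eq hq]
  exact List.pairwise_iff_getElem.1 hs _ _ _ _ hiq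

theorem sep_lt_sep (g : P.Good) (hs : l.Pairwise fun x y => x.1 < y.1) {h q q' : ℕ}
    (hq' : hasNode P (liveOf l) h q' = true) (hqq : q < q') :
    sep (keyOf l) h q < sep (keyOf l) h q' := by
  have hq2 := hq'
  rw [hasNode_iff] at hq'
  have hq' : q' * fan P ^ h < l.length := by
    omega
  have hlt : q * fan P ^ h < q' * fan P ^ h :=
    Nat.mul_lt_mul_of_pos_right hqq (Nat.pow_pos (fan_pos g))
  have h1 := key_lt_sep hs hq2 (by omega) hlt
  rw [sep]
  split_ifs with h0
  · exact lt_of_le_of_lt (Fin.mk_le_of_le_val (by simp)) h1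
  · rwa [keyOf_eq (by omega)]

theorem seg_eq_nil {h q : ℕ} (hq : ¬ hasNode P (liveOf l) h q = true) :
    seg l h q = [] := by
  rw [hasNode_iff] at hq
  push Not at hq
  rw [seg, List.drop_eq_nil_of_le hq.1, List.take_nil]

theorem flatten_map_filter {α β : Type*} (L : List α) (p : α → Bool) (f : α → List β)
    (h : ∀ a, ¬ p a = true → f a = []) : ((L.filter p).map f).flatten = (L.map f).flatten := by
  induction L with
  | nil => rfl
  | cons a L ih =>
      grind

theorem length_kids_le (live : ℕ → Bool) (key ptr : ℕ → P.Word) (h q : ℕ) :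
    (kids live key ptr h q).length ≤ fan P := by
  grind [kids, List.length_map]

theorem spans_layout (g : P.Good) (hs : l.Pairwise fun x y => x.1 < y.1) (hl : l.length ≤ P.n)
    {h : ℕ} (hh : h ≤ P.depth + 1) {q : ℕ} (hq : hasNode P (liveOf l) h q = true) :
    Spans (layout l) h (P.word (levelOff P h + q)) (seg l h q) := by
  induction h generalizing q with
  | zero =>
      have hq' : q < l.length := by
        have := hasNode_iff.1 hq
        grind
      refine ⟨l[q].1, l[q].2, ?_, ?_⟩
      · rw [layout_pos g l hh (lt_levelLen g hl hq), nodeAt]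
        simp [liveOf, hq', keyOf_eq hq', valOf_eq hq']
      simp [seg, pow_zero, mul_one, List.take_one]
  | succ h ih =>
      refine ⟨kids (liveOf l) (keyOf l) P.word h q,
        ((List.range (fan P)).filter fun c => hasNode P (liveOf l) h (q * fan P + c)).map
          fun c => seg l h (q * fan P + c), ?_, ?_, ?_, ?_, ?_, ?_⟩
      · rw [layout_pos g l hh (lt_levelLen g hl hq), nodeAt, if_pos hq]
      · exact (length_kids_le _ _ _ _ _).trans (Nat.div_le_self _ _)
      · rw [seg_succ, flatten_map_filter]
        intro c hc
        exact seg_eq_nil hc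
      · rw [kids, List.forall₂_map_left_iff, List.forall₂_map_right_iff, List.forall₂_same]
        intro c hc
        rw [List.mem_filter, List.mem_range] at hc
        refine ⟨ih (by omega) hc.2, fun x hx => sep_le hs hx, ?_⟩
        rintro rfl x hx
        obtain ⟨i, hi, h1, h2, rfl⟩ := mem_seg.1 hx
        simp only [pow_zero, mul_one] at h1 h2
        have : i = q * fan P + c := by omega
        subst this
        simp only [sep]
        rw [if_neg (by omega), pow_zero, mul_one, keyOf_eq hi]
      · rw [kids, List.map_map, List.pairwise_map]
        refine List.Pairwise.imp_of_mem ?_ (List.Pairwise.filter _ List.pairwise_lt_range)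
        intro a c ha hc hac
        rw [List.mem_filter] at hc
        exact sep_lt_sep g hs hc.2 (by omega)
      · intro i j hi hj hij x hx
        simp only [List.getElem_map, List.length_map, kids] at hi hj hx ⊢
        have hlt := List.pairwise_iff_getElem.1
          (List.Pairwise.filter (fun c => hasNode P (liveOf l) h (q * fan P + c))
            (List.pairwise_lt_range (n := fan P))) i j hi hj hij
        have hmem := List.getElem_mem hj
        rw [List.mem_filter] at hmem
        obtain ⟨k, hk, h1, h2, rfl⟩ := mem_seg.1 hx
        refine key_lt_sep hs hmem.2 hk (h2.trans_le (Nat.mul_le_mul_right _ (by omega)))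

theorem mem_names_layout (g : P.Good) (hl : l.length ≤ P.n)
    {h : ℕ} (hh : h ≤ P.depth + 1) {q : ℕ} (hq : hasNode P (liveOf l) h q = true) (x : P.Word) :
    x ∈ names (layout l) h (P.word (levelOff P h + q)) ↔ ∃ k ≤ h, ∃ q',
      hasNode P (liveOf l) (h - k) q' = true ∧ q' / fan P ^ k = q ∧
        x = P.word (levelOff P (h - k) + q') := by
  induction h generalizing q with
  | zero =>
      simp only [names, List.mem_singleton]
      simp_all
  | succ h ih =>
      rw [names, layout_pos g l hh (lt_levelLen g hl hq), nodeAt, if_pos hq]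
      simp only [List.mem_cons, kids, List.flatMap_map, List.mem_flatMap, List.mem_filter,
        List.mem_range]
      constructor
      · rintro (rfl | ⟨c, ⟨hc, hn⟩, hx⟩)
        · exact ⟨0, by omega, q, hq, by simp, rfl⟩
        · rw [ih (by omega) hn] at hx
          obtain ⟨k, hk, q', h1, h2, rfl⟩ := hx
          refine ⟨k + 1, by omega, q', by rwa [Nat.add_sub_add_right], ?_, by
            simp⟩
          rw [pow_succ, ← Nat.div_div_eq_div_mul, h2, mul_comm, Nat.mul_add_div (fan_pos g),
            Nat.div_eq_of_lt hc, add_zero]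
      · rintro ⟨k, hk, q', h1, h2, hx⟩
        cases k with
        | zero =>
            grind
        | succ k =>
            right
            rw [Nat.add_sub_add_right] at h1 hx
            rw [pow_succ, ← Nat.div_div_eq_div_mul] at h2
            have e : q * fan P + q' / fan P ^ k % fan P = q' / fan P ^ k := by
              rw [← h2, mul_comm]; exact Nat.div_add_mod _ _
            have hn := hasNode_div h1 k
            rw [Nat.sub_add_cancel (by omega)] at hn
            refine ⟨q' / fan P ^ k % fan P, ⟨Nat.mod_lt _ (fan_pos g), by rwa [e]⟩, ?_⟩
            grind

theorem word_pos_inj (g : P.Good) {h h' q q' : ℕ} (hh : h ≤ P.depth + 1) (hh' : h' ≤ P.depth + 1)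
    (hq : q < levelLen P h) (hq' : q' < levelLen P h')
    (e : P.word (levelOff P h + q) = P.word (levelOff P h' + q')) : h = h' ∧ q = q' := by
  have := congrArg Fin.val e
  rw [word_pos_val g hh hq, word_pos_val g hh' hq'] at this
  exact pos_inj hh hh' hq hq' this

theorem nodup_names_layout (g : P.Good) (hl : l.length ≤ P.n)
    {h : ℕ} (hh : h ≤ P.depth + 1) {q : ℕ} (hq : hasNode P (liveOf l) h q = true) :
    (names (layout l) h (P.word (levelOff P h + q))).Nodup := by
  induction h generalizing q with
  | zero => simp [names]
  | succ h ih =>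
      rw [names, layout_pos g l hh (lt_levelLen g hl hq), nodeAt, if_pos hq]
      simp only [kids, List.flatMap_map]
      rw [List.nodup_cons]
      constructor
      · simp only [List.mem_flatMap, List.mem_filter]
        rintro ⟨c, ⟨hc, hn⟩, hx⟩
        rw [mem_names_layout g hl (by omega) hn] at hx
        obtain ⟨k, hk, q', h1, h2, h3⟩ := hx
        have := (word_pos_inj g hh (by omega) (lt_levelLen g hl hq) (lt_levelLen g hl h1) h3).1
        omega
      · rw [List.nodup_flatMap]
        constructor
        · grind
        · refine List.Pairwise.imp_of_mem ?_ (List.Pairwise.filter _ List.pairwise_lt_range)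
          intro a c ha hc hac
          rw [List.mem_filter] at ha hc
          rw [Function.onFun, List.disjoint_left]
          intro x hx hx'
          rw [mem_names_layout g hl (by omega) ha.2] at hx
          rw [mem_names_layout g hl (by omega) hc.2] at hx'
          obtain ⟨k, hk, q1, h1, h2, h3⟩ := hx
          obtain ⟨k', hk', q1', h1', h2', h3'⟩ := hx'
          have := word_pos_inj g (by omega) (by omega) (lt_levelLen g hl h1) (lt_levelLen g hl h1')
            (h3.symm.trans h3')
          grind

theorem word_zero_eq_pos : P.word 0 = P.word (levelOff P (P.depth + 1) + 0) := by
  rw [levelOff_top]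

/-- The layout of a sorted list of at most `n` items is a B-tree with its dummy list. -/
theorem isLayout_layout (g : P.Good) (hs : l.Pairwise fun x y => x.1 < y.1)
    (hl : l.length ≤ P.n) {d : Dict P} (hd : ∀ k v, (k, v) ∈ l ↔ d k = some v) :
    IsLayout (layout l) d := by
  have hroot : hasNode P (liveOf l) (P.depth + 1) 0 = true := hasNode_root
  have hseg : seg l (P.depth + 1) 0 = l := by
    rw [seg, zero_mul, List.drop_zero, List.take_of_length_le]
    have := g.cap
    rw [fan]; omega
  refine ⟨⟨l, ?_, hd⟩, ?_, ?_, ?_, ?_⟩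
  · have := spans_layout g hs hl le_rfl hroot
    rwa [hseg, ← word_zero_eq_pos] at this
  · rw [word_zero_eq_pos]
    exact nodup_names_layout g hl le_rfl hroot
  · intro a ha
    rw [word_zero_eq_pos, mem_names_layout g hl le_rfl hroot] at ha
    obtain ⟨k, hk, q, h1, h2, rfl⟩ := ha
    have hq := lt_levelLen g hl h1
    rw [word_pos_val g (by omega) hq]
    have := levelOff_add_le_treeCells g (P := P) (h := P.depth + 1 - k) (by omega)
    omega
  · intro a ha hna
    have hW := arrayCells_lt g
    have hT := treeCells_le (P := P)
    rw [layout, P.word_val (by omega), cellAt, if_neg (by omega)]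
    cases hh : heightOf P a with
    | none => rfl
    | some h =>
        obtain ⟨hle, q, hq, rfl⟩ := exists_of_heightOf hh
        have hnot : ¬ hasNode P (liveOf l) h q = true := by
          intro hn
          apply hna
          rw [word_zero_eq_pos, mem_names_layout g hl le_rfl hroot]
          refine ⟨P.depth + 1 - h, by omega, q, ?_, ?_, ?_⟩
          · grind
          · rw [Nat.div_eq_of_lt]
            rw [levelLen, Nat.lt_succ_iff, Nat.le_div_iff_mul_le (Nat.pow_pos (fan_pos g))] at hq
            have h1 := g.cap
            have h2 : (P.branch / 2) ^ (P.depth + 1) =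
                fan P ^ (P.depth + 1 - h) * fan P ^ h := by
              rw [← pow_add, Nat.sub_add_cancel hle]; rfl
            rw [h2] at h1
            exact Nat.lt_of_mul_lt_mul_right (lt_of_le_of_lt hq h1)
          grind
        simp only [Nat.add_sub_cancel_left]
        cases h with
        | zero =>
            rw [nodeAt, if_neg]
            intro hlive
            exact hnot (by simpa [hasNode] using hlive)
        | succ h => rw [nodeAt, if_neg hnot]
  · intro j h1 h2
    have hW := arrayCells_lt g
    rw [layout, P.word_val (by omega), cellAt, if_pos h1]

end

end BTree

end OS

/-! ### Drawing a uniform permutation bucket by bucket -/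

namespace OS

namespace Shuffle

open scoped ENNReal

theorem bind_map_apply_le {α β γ : Type*} {p : PMF α} {q : α → PMF β} {g : α → β → γ} {u v : ℝ≥0∞}
    (hp : ∀ a, p a ≤ u) (hq : ∀ a b, q a b ≤ v)
    (inj : ∀ a ∈ p.support, ∀ b ∈ (q a).support, ∀ a' ∈ p.support, ∀ b' ∈ (q a').support,
      g a b = g a' b' → a = a' ∧ b = b') (c : γ) :
    (p.bind fun a => (q a).map (g a)) c ≤ u * v := by
  classical
  by_cases h : ∃ a ∈ p.support, ∃ b ∈ (q a).support, g a b = c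
  · obtain ⟨a, ha, b, hb, rfl⟩ := h
    have h1 : ((q a).map (g a)) (g a b) = q a b := by
      rw [PMF.map_apply, tsum_eq_single b]
      · simp
      · intro b' hb'
        split_ifs with e
        · by_contra h0
          exact hb' (inj a ha b hb a ha b' ((PMF.mem_support_iff _ _).2 h0) e).2.symm
        · rfl
    rw [PMF.bind_apply, tsum_eq_single a]
    · rw [h1]
      exact mul_le_mul' (hp a) (hq a b)
    · intro a' ha'
      by_contra h0
      rw [mul_eq_zero, not_or] at h0
      have h2 := (PMF.mem_support_iff _ _).2 h0.2
      rw [PMF.support_map] at h2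
      obtain ⟨b', hb', e⟩ := h2
      exact ha' (inj a ha b hb a' ((PMF.mem_support_iff _ _).2 h0.1) b' hb' e.symm).1.symm
  · have : (p.bind fun a => (q a).map (g a)) c = 0 := by
      grind [PMF.apply_eq_zero_iff, PMF.mem_support_bind_iff, PMF.support_map]
    simp [this]

theorem eq_uniform_of_le {α : Type*} [Fintype α] [Nonempty α] {μ : PMF α}
    (h : ∀ a, μ a ≤ (Fintype.card α : ℝ≥0∞)⁻¹) : μ = PMF.uniformOfFintype α := by
  ext a
  rw [PMF.uniformOfFintype_apply]
  refine le_antisymm (h a) ?_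
  by_contra hlt
  push Not at hlt
  have h1 : ∑ b, μ b < ∑ _b : α, (Fintype.card α : ℝ≥0∞)⁻¹ := by
    classical
    rw [← Finset.add_sum_erase _ _ (Finset.mem_univ a),
      ← Finset.add_sum_erase _ (fun _ => (Fintype.card α : ℝ≥0∞)⁻¹) (Finset.mem_univ a)]
    refine ENNReal.add_lt_add_of_lt_of_le ?_ hlt (Finset.sum_le_sum fun b _ => h b)
    exact (ENNReal.sum_lt_top.2 fun b _ => lt_of_le_of_lt (μ.coe_le_one b) ENNReal.one_lt_top).ne
  have h2 : ∑ b, μ b = 1 := by rw [← tsum_fintype (L := .unconditional _)]; exact μ.tsum_coe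
  rw [h2, Finset.sum_const, Finset.card_univ, nsmul_eq_mul, ENNReal.mul_inv_cancel] at h1
  · grind
  · simp
  simp


/-- The uniform law on sequences of numbers, the `j`-th of which is at most `k j`. -/
noncomputable def seqUnif : ℕ → (ℕ → ℕ) → PMF (List ℕ)
  | 0, _ => PMF.pure []
  | q + 1, k => (PMF.uniformOfFintype (Fin (k 0 + 1))).bind fun u =>
      (seqUnif q fun j => k (j + 1)).map fun us => u.val :: us

theorem uniform_prod (α β : Type*) [Fintype α] [Nonempty α] [Fintype β] [Nonempty β] :
    PMF.uniformOfFintype (α × β) = (PMF.uniformOfFintype α).bind fun a =>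
      (PMF.uniformOfFintype β).map fun b => (a, b) := by
  symm
  apply eq_uniform_of_le
  intro c
  refine (bind_map_apply_le (u := (Fintype.card α : ℝ≥0∞)⁻¹) (v := (Fintype.card β : ℝ≥0∞)⁻¹)
    (fun a => by rw [PMF.uniformOfFintype_apply]) (fun a b => by rw [PMF.uniformOfFintype_apply])
    (fun a _ b _ a' _ b' _ h => by simpa using h) c).trans ?_
  simp [Fintype.card_prod, Nat.cast_mul, ENNReal.mul_inv]

theorem map_uniform_coins (q : ℕ) (k : ℕ → ℕ) :
    (PMF.uniformOfFintype ((j : Fin q) → Fin (k j + 1))).map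
      (fun ω => List.ofFn fun j => (ω j).val) = seqUnif q k := by
  induction q generalizing k with
  | zero =>
      have : (fun ω : (j : Fin 0) → Fin (k j + 1) => List.ofFn fun j => (ω j).val) =
          fun _ => [] := by funext ω; simp
      rw [this, seqUnif]
      exact PMF.map_const _ _
  | succ q ih =>
      rw [seqUnif, ← ih]
      rw [← map_uniformOfFintype_equiv (Fin.consEquiv fun j : Fin (q + 1) => Fin (k j + 1)),
        uniform_prod, PMF.map_comp, PMF.map_bind]
      congr 1
      funext u
      rw [PMF.map_comp, PMF.map_comp]
      congr 1
      funext ω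
      simp only [Fin.consEquiv, List.ofFn_succ, Function.comp]
      rfl

/-- Number of places that are left in the first `K` buckets. -/
def tot (K : ℕ) (c : ℕ → ℕ) : ℕ := ∑ i ∈ Finset.range K, c i

/-- The bucket of place number `u`, when `c j` places are left in bucket `j`. -/
def pick (K : ℕ) (c : ℕ → ℕ) (u : ℕ) : ℕ :=
  ((List.range K).find? fun j => decide (u < ∑ i ∈ Finset.range (j + 1), c i)).getD 0

theorem pick_spec {K : ℕ} {c : ℕ → ℕ} {u : ℕ} (hu : u < tot K c) :
    pick K c u < K ∧ ∑ i ∈ Finset.range (pick K c u), c i ≤ u ∧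
      u < ∑ i ∈ Finset.range (pick K c u + 1), c i := by
  have hK : 0 < K := by
    rcases Nat.eq_zero_or_pos K with rfl | h
    · simp [tot] at hu
    · exact h
  rw [pick]
  cases hf : (List.range K).find? (fun j => decide (u < ∑ i ∈ Finset.range (j + 1), c i)) with
  | none =>
      rw [List.find?_eq_none] at hf
      have := hf (K - 1) (by simp; omega)
      rw [Nat.sub_add_cancel hK] at this
      simp only [decide_eq_true_eq] at this
      exact absurd hu this
  | some j =>
      rw [List.find?_range_eq_some] at hf
      obtain ⟨h1, h2, h3⟩ := hf
      simp only [decide_eq_true_eq, List.mem_range] at h1 h2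
      refine ⟨h2, ?_, h1⟩
      simp only [Option.getD_some]
      cases j with
      | zero => simp
      | succ j => grind

/-- The places that are left after the draw of block `j`. -/
def dec (c : ℕ → ℕ) (j : ℕ) : ℕ → ℕ := fun i => c i - if i = j then 1 else 0

/-- The places that are left after the draws `β`. -/
def less (c : ℕ → ℕ) (β : List ℕ) : ℕ → ℕ := fun j => c j - β.count j

theorem less_nil (c : ℕ → ℕ) : less c [] = c := by funext j; simp [less]

theorem less_cons (c : ℕ → ℕ) (j : ℕ) (β : List ℕ) : less c (j :: β) = less (dec c j) β := by
  funext i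
  simp only [less, dec, List.count_cons, beq_iff_eq]
  grind

theorem less_append (c : ℕ → ℕ) (β β' : List ℕ) : less c (β ++ β') = less (less c β) β' := by
  grind [less]

theorem pick_pos {K : ℕ} {c : ℕ → ℕ} {u : ℕ} (hu : u < tot K c) : 0 < c (pick K c u) := by
  obtain ⟨-, h2, h3⟩ := pick_spec hu
  grind [Finset.sum_range_succ]

theorem tot_dec {K : ℕ} {c : ℕ → ℕ} {j : ℕ} (hj : j < K) (hc : 0 < c j) :
    tot K (dec c j) + 1 = tot K c := by
  simp only [tot]
  rw [← Finset.add_sum_erase _ _ (Finset.mem_range.2 hj),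
    ← Finset.add_sum_erase _ c (Finset.mem_range.2 hj)]
  have : ∑ x ∈ (Finset.range K).erase j, dec c j x = ∑ x ∈ (Finset.range K).erase j, c x := by
    refine Finset.sum_congr rfl fun x hx => ?_
    grind [dec]
  rw [this]
  simp [dec]; omega

/-- The buckets of places that are drawn one after the other without replacement. -/
def draws (K : ℕ) : (ℕ → ℕ) → List ℕ → List ℕ
  | _, [] => []
  | c, u :: us => pick K c u :: draws K (dec c (pick K c u)) us

/-- The law of the buckets of `q` places that are drawn without replacement. -/
noncomputable def draw (K : ℕ) : ℕ → (ℕ → ℕ) → PMF (List ℕ)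
  | 0, _ => PMF.pure []
  | q + 1, c => (PMF.uniformOfFintype (Fin (tot K c - 1 + 1))).bind fun u =>
      (draw K q (dec c (pick K c u))).map fun β => pick K c u :: β

theorem seqUnif_succ {q t : ℕ} {k : ℕ → ℕ} (h : k 0 = t) :
    seqUnif (q + 1) k = (PMF.uniformOfFintype (Fin (t + 1))).bind fun u =>
      (seqUnif q fun j => k (j + 1)).map fun us => u.val :: us := by
  subst h; rfl

theorem map_draws_seqUnif {K q : ℕ} {k c : ℕ → ℕ} (hk : ∀ j < q, k j = tot K c - 1 - j)
    (hq : q ≤ tot K c) : (seqUnif q k).map (draws K c) = draw K q c := by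
  induction q generalizing k c with
  | zero => simp [seqUnif, draw, PMF.pure_map, draws]
  | succ q ih =>
      have hk0 : k 0 = tot K c - 1 := hk 0 (by omega)
      rw [seqUnif_succ hk0, draw, PMF.map_bind]
      congr 1
      funext u
      have hu : u.val < tot K c := by have := u.isLt; omega
      have ht := tot_dec (pick_spec hu).1 (pick_pos hu)
      rw [PMF.map_comp, ← ih (k := fun j => k (j + 1)) (c := dec c (pick K c u)) ?_ (by omega),
        PMF.map_comp]
      · rfl
      · grind

theorem draw_add (K p q : ℕ) (c : ℕ → ℕ) :
    draw K (p + q) c = (draw K p c).bind fun β => (draw K q (less c β)).map fun β' => β ++ β' := by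
  induction p generalizing c with
  | zero =>
      simp only [draw, Nat.zero_add, PMF.pure_bind, less_nil, List.nil_append]
      exact (PMF.map_id _).symm
  | succ p ih =>
      rw [show p + 1 + q = (p + q) + 1 by omega]
      simp only [draw]
      rw [PMF.bind_bind]
      congr 1
      funext u
      rw [ih, PMF.map_bind, PMF.bind_map]
      congr 1
      funext β
      simp only [Function.comp, PMF.map_comp, less_cons, List.cons_append]
      rfl

theorem card_pick_le (K : ℕ) (c : ℕ → ℕ) (j t : ℕ) (ht : t ≤ tot K c) :
    (Finset.univ.filter fun u : Fin t => pick K c u = j).card ≤ c j := by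
  have h : (Finset.univ.filter fun u : Fin t => pick K c u = j).map Fin.valEmbedding ⊆
      Finset.Ico (∑ i ∈ Finset.range j, c i) (∑ i ∈ Finset.range (j + 1), c i) := by
    intro x hx
    simp only [Finset.mem_map, Finset.mem_filter, Finset.mem_univ, true_and] at hx
    obtain ⟨u, rfl, rfl⟩ := hx
    have := pick_spec (K := K) (c := c) (u := u.val) (by omega)
    simp_all
  have := Finset.card_le_card h
  grind [Finset.card_map, Nat.card_Ico, Finset.sum_range_succ]

theorem draw_apply_le {K q : ℕ} {c : ℕ → ℕ} (hq : tot K c = q) (β : List ℕ) :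
    draw K q c β * (q.factorial : ℝ≥0∞) ≤
      ((∏ j ∈ Finset.range K, (c j).factorial : ℕ) : ℝ≥0∞) := by
  classical
  induction q generalizing c β with
  | zero =>
      have h1 : 1 ≤ ∏ j ∈ Finset.range K, (c j).factorial :=
        Finset.one_le_prod' fun j _ => Nat.factorial_pos _
      have h1' : (1 : ℝ≥0∞) ≤ ((∏ j ∈ Finset.range K, (c j).factorial : ℕ) : ℝ≥0∞) := by
        exact_mod_cast h1
      simpa using (PMF.coe_le_one (draw K 0 c) β).trans h1'
  | succ q ih =>
      have hn : tot K c - 1 + 1 = q + 1 := by omega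
      have hinv : ((tot K c - 1 + 1 : ℕ) : ℝ≥0∞)⁻¹ = ((q + 1 : ℕ) : ℝ≥0∞)⁻¹ := by rw [hn]
      rw [draw, PMF.bind_apply]
      have hterm : ∀ u : Fin (tot K c - 1 + 1),
          ((draw K q (dec c (pick K c u))).map fun β => pick K c u :: β) β =
          if β.head? = some (pick K c u) then draw K q (dec c (pick K c u)) β.tail else 0 := by
        intro u
        rw [PMF.map_apply]
        cases β with
        | nil => simp
        | cons j β =>
            simp only [List.cons.injEq, List.head?_cons, Option.some.injEq, List.tail_cons]
            by_cases h : j = pick K c u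
            · simp [h]
            · simp [h]
      simp only [hterm, PMF.uniformOfFintype_apply, Fintype.card_fin, hinv]
      rw [tsum_fintype]
      cases β with
      | nil => simp
      | cons j β =>
          simp only [List.head?_cons, Option.some.injEq, List.tail_cons]
          by_cases hj : ∃ u : Fin (tot K c - 1 + 1), pick K c u = j
          · obtain ⟨u0, hu0⟩ := hj
            have hu : u0.val < tot K c := by have := u0.isLt; omega
            have hjK := (pick_spec hu).1
            have hjc := pick_pos hu
            rw [hu0] at hjK hjc
            have h1 : ∀ u : Fin (tot K c - 1 + 1), (((q + 1 : ℕ) : ℝ≥0∞)⁻¹ *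
                if j = pick K c u then draw K q (dec c (pick K c u)) β else 0) =
                if pick K c u = j then ((q + 1 : ℕ) : ℝ≥0∞)⁻¹ * draw K q (dec c j) β else 0 := by
                  grind
            rw [Finset.sum_congr rfl fun u _ => h1 u, ← Finset.sum_filter, Finset.sum_const,
              nsmul_eq_mul]
            have hcard := card_pick_le K c j (tot K c - 1 + 1) (by omega)
            have hD := ih (c := dec c j) (by have := tot_dec hjK hjc; omega) β
            set D := draw K q (dec c j) β
            have hprod : c j * ∏ i ∈ Finset.range K, (dec c j i).factorial =
                ∏ i ∈ Finset.range K, (c i).factorial := by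
              rw [← Finset.mul_prod_erase _ _ (Finset.mem_range.2 hjK),
                ← Finset.mul_prod_erase _ (fun i => (c i).factorial) (Finset.mem_range.2 hjK)]
              have : ∏ x ∈ (Finset.range K).erase j, (dec c j x).factorial =
                  ∏ x ∈ (Finset.range K).erase j, (c x).factorial := by
                refine Finset.prod_congr rfl fun x hx => ?_
                grind [dec]
              rw [this, ← mul_assoc]
              congr 1
              simp only [dec, if_true]
              exact Nat.mul_factorial_pred (by omega)
            have hq1 : ((q + 1 : ℕ) : ℝ≥0∞)⁻¹ * ((q + 1 : ℕ) : ℝ≥0∞) = 1 :=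
              ENNReal.inv_mul_cancel (by simp) (ENNReal.natCast_ne_top _)
            have e : ∀ x : ℝ≥0∞, x * (((q + 1 : ℕ) : ℝ≥0∞)⁻¹ * D) * ((q + 1).factorial : ℝ≥0∞) =
                x * (D * (q.factorial : ℝ≥0∞)) := by
              intro x
              rw [Nat.factorial_succ, Nat.cast_mul]
              calc x * (((q + 1 : ℕ) : ℝ≥0∞)⁻¹ * D) * (((q + 1 : ℕ) : ℝ≥0∞) * (q.factorial : ℝ≥0∞))
                  = (((q + 1 : ℕ) : ℝ≥0∞)⁻¹ * ((q + 1 : ℕ) : ℝ≥0∞)) *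
                    (x * (D * (q.factorial : ℝ≥0∞))) := by ring
                _ = _ := by rw [hq1, one_mul]
            rw [e, ← hprod, Nat.cast_mul]
            exact mul_le_mul' (by exact_mod_cast hcard) hD
          · push Not at hj
            rw [Finset.sum_eq_zero]
            · simp
            · grind

theorem draw_support {K q : ℕ} {c : ℕ → ℕ} (hq : q ≤ tot K c) {β : List ℕ}
    (hβ : β ∈ (draw K q c).support) :
    β.length = q ∧ (∀ x ∈ β, x < K) ∧ ∀ j, β.count j ≤ c j := by
  induction q generalizing c β with
  | zero =>
      grind [draw, PMF.support_pure]
  | succ q ih =>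
      simp only [draw, PMF.mem_support_bind_iff, PMF.support_map, Set.mem_image] at hβ
      obtain ⟨u, -, β', hβ', rfl⟩ := hβ
      have hu : u.val < tot K c := by have := u.isLt; omega
      have h1 := (pick_spec hu).1
      have h2 := pick_pos hu
      have h3 := tot_dec h1 h2
      obtain ⟨i1, i2, i3⟩ := ih (c := dec c (pick K c u)) (by omega) hβ'
      refine ⟨by simp [i1], ?_, ?_⟩
      · grind
      · intro j
        have := i3 j
        rw [List.count_cons]
        simp only [dec, beq_iff_eq] at this ⊢
        grind

theorem draw_count {K : ℕ} {c : ℕ → ℕ} {β : List ℕ}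
    (hβ : β ∈ (draw K (tot K c) c).support) : ∀ j < K, β.count j = c j := by
  obtain ⟨h1, h2, h3⟩ := draw_support le_rfl hβ
  have hsum : ∑ j ∈ Finset.range K, β.count j = ∑ j ∈ Finset.range K, c j := by
    change _ = tot K c
    rw [← h1]
    have := Multiset.sum_count_eq_card (s := Finset.range K) (m := (β : Multiset ℕ))
      (by simpa using h2)
    simp_all
  intro j hj
  exact (Finset.sum_eq_sum_iff_of_le fun j _ => h3 j).1 hsum j (Finset.mem_range.2 hj)

/-! ### Buckets that are blocks of consecutive places -/

section

variable (A r : ℕ)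

/-- Number of places in bucket `j`. -/
def size (j : ℕ) : ℕ := min r (A - j * r)

theorem sum_size (i : ℕ) : ∑ j ∈ Finset.range i, size A r j = min (i * r) A := by
  induction i with
  | zero => simp
  | succ i ih =>
      rw [Finset.sum_range_succ, ih, size, Nat.succ_mul]
      omega

/-- The law of independent uniform permutations of the first `i` buckets, as a list of places. -/
noncomputable def permDraw : ℕ → PMF (List ℕ)
  | 0 => PMF.pure []
  | i + 1 => (permDraw i).bind fun δ =>
      (PMF.uniformOfFintype (Equiv.Perm (Fin (size A r i)))).map fun ω =>
        δ ++ List.ofFn fun j => i * r + (ω j).val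

theorem permDraw_apply_le (i : ℕ) (δ : List ℕ) :
    permDraw A r i δ ≤ ∏ j ∈ Finset.range i, ((size A r j).factorial : ℝ≥0∞)⁻¹ := by
  induction i generalizing δ with
  | zero => simpa using PMF.coe_le_one _ _
  | succ i ih =>
      rw [permDraw, Finset.prod_range_succ]
      refine bind_map_apply_le ih (fun a b => ?_) ?_ δ
      · rw [PMF.uniformOfFintype_apply, Fintype.card_perm, Fintype.card_fin]
      · intro a _ b _ a' _ b' _ h
        obtain ⟨h1, h2⟩ := List.append_inj' h (by simp)
        refine ⟨h1, ?_⟩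
        rw [List.ofFn_inj] at h2
        ext j
        have := congrFun h2 j
        omega

theorem permDraw_support {r : ℕ} (hr : 0 < r) {i : ℕ} {δ : List ℕ}
    (hδ : δ ∈ (permDraw A r i).support) :
    δ.length = min (i * r) A ∧ δ.Nodup ∧ (∀ y ∈ δ, y < min (i * r) A) ∧
      ∀ p (hp : p < δ.length), δ[p] / r = p / r := by
  induction i generalizing δ with
  | zero =>
      grind [permDraw, PMF.support_pure]
  | succ i ih =>
      simp only [permDraw, PMF.mem_support_bind_iff, PMF.support_map, Set.mem_image] at hδ
      obtain ⟨δ, hδ, ω, -, rfl⟩ := hδ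
      obtain ⟨h1, h2, h3, h4⟩ := ih hδ
      have hsz : size A r i = min r (A - i * r) := rfl
      have e : (i + 1) * r = i * r + r := by ring
      refine ⟨?_, ?_, ?_, ?_⟩
      · grind
      · refine h2.append ?_ ?_
        · rw [List.nodup_ofFn]
          intro a b hab
          simp only [Nat.add_left_cancel_iff] at hab
          exact ω.injective (Fin.ext hab)
        · intro y hy hy'
          grind
      · grind
      · intro p hp
        by_cases hpl : p < δ.length
        · grind
        · simp only [List.length_append, List.length_ofFn] at hp
          rw [List.getElem_append_right (by omega), List.getElem_ofFn]
          have h5 := (ω ⟨p - δ.length, by omega⟩).isLt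
          have hl : δ.length = i * r := by omega
          obtain ⟨y, hy⟩ : ∃ y, p = i * r + y := ⟨p - i * r, by omega⟩
          have hy2 : y < r := by omega
          have e1 : ∀ x < r, (i * r + x) / r = i := fun x hx => by
            rw [mul_comm i r, Nat.mul_add_div hr, Nat.div_eq_of_lt hx, Nat.add_zero]
          simp_all

variable (K M : ℕ)

/-- Sort key: first the bucket, then the number. -/
def key (β : List ℕ) (x : ℕ) : ℕ := β.getD x K * M + x

/-- The numbers below `r * K`, sorted by bucket; those without a bucket come last. -/
def byBucket (β : List ℕ) : List ℕ :=
  (List.range (r * K)).mergeSort fun x y => decide (key K M β x ≤ key K M β y)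

theorem byBucket_perm (β : List ℕ) : (byBucket r K M β).Perm (List.range (r * K)) :=
  List.mergeSort_perm _ _

theorem byBucket_pairwise (β : List ℕ) :
    (byBucket r K M β).Pairwise fun x y => key K M β x ≤ key K M β y := by
  have := List.pairwise_mergeSort (le := fun x y : ℕ => decide (key K M β x ≤ key K M β y))
    (fun a b c h1 h2 => by simp at *; omega) (fun a b => by simp; omega) (List.range (r * K))
  grind [byBucket]

theorem length_byBucket (β : List ℕ) : (byBucket r K M β).length = r * K := by
  simp [byBucket]

variable {A r K M}

/-- Sorting by bucket brings every number to a place of its bucket. -/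
theorem getD_byBucket (hr : 0 < r) (hA : A ≤ r * K) (hM : r * K ≤ M) {β : List ℕ}
    (hβ : β ∈ (draw K A (size A r)).support) (p : ℕ) (hp : p < (byBucket r K M β).length) :
    β.getD (byBucket r K M β)[p] K = if p < A then p / r else K := by
  have htot : tot K (size A r) = A := by rw [tot, sum_size]; rw [mul_comm] at hA; omega
  have hβ' : β ∈ (draw K (tot K (size A r)) (size A r)).support := by rwa [htot]
  obtain ⟨hlen, hlt, -⟩ := draw_support le_rfl hβ'
  have hcount := draw_count hβ'
  rw [htot] at hlen
  have hmap : (List.range (r * K)).map (fun x => β.getD x K) =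
      β ++ List.replicate (r * K - A) K := by
    apply List.ext_getElem
    · grind
    · grind
  have h1 : ((byBucket r K M β).map fun x => β.getD x K) =
      (List.range (r * K)).map fun p => if p < A then p / r else K := by
    refine List.Perm.eq_of_pairwise (le := (· ≤ ·)) (fun a b _ _ => le_antisymm) ?_ ?_ ?_
    · rw [List.pairwise_map]
      refine List.Pairwise.imp_of_mem ?_ (byBucket_pairwise r K M β)
      intro a b ha hb hab
      have ha' := (byBucket_perm r K M β).mem_iff.1 ha
      have hb' := (byBucket_perm r K M β).mem_iff.1 hb
      rw [List.mem_range] at ha' hb'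
      simp only [key] at hab
      by_contra hlt
      push Not at hlt
      have := Nat.mul_le_mul_right M hlt
      grind
    · rw [List.pairwise_map]
      refine List.Pairwise.imp_of_mem ?_ List.pairwise_lt_range
      intro a b ha hb hab
      rw [List.mem_range] at ha hb
      have hlt' : ∀ x < r * K, x / r < K := fun x hx => Nat.div_lt_of_lt_mul hx
      split_ifs with h1 h2 h2
      · exact Nat.div_le_div_right hab.le
      · grind
      · omega
      omega
    · refine ((byBucket_perm r K M β).map _).trans ?_
      rw [hmap, List.perm_iff_count]
      intro j
      rw [List.count_append, List.count_replicate, List.count, List.countP_map,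
        ← Nat.sub_add_cancel hA, Nat.add_comm (r * K - A), List.range_add, List.countP_append,
        List.countP_map]
      congr 1
      · have e1 : List.countP ((fun x => x == j) ∘ fun p => if p < A then p / r else K)
            (List.range A) = List.countP (fun p => decide (p / r = j)) (List.range A) := by
          refine List.countP_congr fun x hx => ?_
          grind
        rw [e1]
        change List.count j β = _
        by_cases hj : j < K
        · rw [hcount j hj]
          have e2 : List.countP (fun p => decide (p / r = j)) (List.range A) =
              ((Finset.range A).filter fun p => p / r = j).card := by
            rw [List.countP_eq_length_filter, Finset.card, Finset.filter_val, Finset.range_val]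
            rfl
          have e3 : ((Finset.range A).filter fun p => p / r = j) =
              Finset.Ico (j * r) (j * r + size A r j) := by
            ext p
            simp only [Finset.mem_filter, Finset.mem_range, Finset.mem_Ico, size]
            rw [Nat.div_eq_iff hr]
            omega
          simp_all
        · rw [List.count_eq_zero_of_not_mem fun h => hj (hlt j h), eq_comm, List.countP_eq_zero]
          intro p hp'
          rw [List.mem_range] at hp'
          simp only [decide_eq_true_eq]
          have : p / r < K := Nat.div_lt_of_lt_mul (by omega)
          omega
      · have e1 : List.countP (((fun x => x == j) ∘ fun p => if p < A then p / r else K) ∘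
            fun x => A + x) (List.range (r * K - A)) =
            List.countP (fun _ => K == j) (List.range (r * K - A)) := by
          refine List.countP_congr fun x hx => ?_
          simp
        rw [e1]
        simp only [Nat.add_sub_cancel_left]
        by_cases h : K = j
        · simp [h]
        · grind
  have h2 := congrArg (fun L : List ℕ => L[p]?) h1
  grind

variable (r K M) in
/-- The place of `x`, when the numbers are sorted by bucket and permuted by `δ` in the buckets. -/
def placeOf (β δ : List ℕ) (x : ℕ) : ℕ := δ.getD ((byBucket r K M β).idxOf x) 0

variable (A r K M) in
open Classical in
/-- The permutation that is given by buckets `β` and permutations of the buckets `δ`. -/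
noncomputable def permOf (β δ : List ℕ) : Equiv.Perm (Fin A) :=
  let f : Fin A → Fin A := fun x =>
    if h : placeOf r K M β δ x.val < A then ⟨placeOf r K M β δ x.val, h⟩ else x
  if h : Function.Bijective f then Equiv.ofBijective f h else Equiv.refl _

theorem idxOf_byBucket_lt {β : List ℕ} {x : ℕ} (hx : x < r * K) :
    (byBucket r K M β).idxOf x < (byBucket r K M β).length :=
  List.idxOf_lt_length_iff.2 ((byBucket_perm r K M β).mem_iff.2 (List.mem_range.2 hx))

theorem length_of_draw (hA : A ≤ r * K) {β : List ℕ}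
    (hβ : β ∈ (draw K A (size A r)).support) : β.length = A ∧ ∀ x ∈ β, x < K := by
  have htot : tot K (size A r) = A := by rw [tot, sum_size]; rw [mul_comm] at hA; omega
  obtain ⟨h1, h2, -⟩ := draw_support (by rw [htot]) hβ
  grind

theorem idxOf_byBucket_lt_places (hr : 0 < r) (hA : A ≤ r * K) (hM : r * K ≤ M) {β : List ℕ}
    (hβ : β ∈ (draw K A (size A r)).support) {x : ℕ} (hx : x < A) :
    (byBucket r K M β).idxOf x < A ∧ β.getD x K = (byBucket r K M β).idxOf x / r := by
  have h1 := idxOf_byBucket_lt (M := M) (β := β) (hx.trans_le hA)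
  have h2 := getD_byBucket hr hA hM hβ _ h1
  rw [List.getElem_idxOf h1] at h2
  obtain ⟨hl, hlt⟩ := length_of_draw hA hβ
  have h3 : β.getD x K < K := by
    rw [List.getD_eq_getElem _ _ (by omega)]
    exact hlt _ (List.getElem_mem _)
  grind

theorem getElem_byBucket_lt (hr : 0 < r) (hA : A ≤ r * K) (hM : r * K ≤ M) {β : List ℕ}
    (hβ : β ∈ (draw K A (size A r)).support) {p : ℕ} (hp : p < A)
    (hp' : p < (byBucket r K M β).length) : (byBucket r K M β)[p] < A := by
  have h2 := getD_byBucket hr hA hM hβ p hp'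
  rw [if_pos hp] at h2
  by_contra h
  rw [List.getD_eq_default _ _ (by rw [(length_of_draw hA hβ).1]; omega)] at h2
  have : p / r < K := Nat.div_lt_of_lt_mul (by omega)
  omega

theorem placeOf_lt (hr : 0 < r) (hA : A ≤ r * K) (hM : r * K ≤ M) {β δ : List ℕ}
    (hβ : β ∈ (draw K A (size A r)).support) (hδ : δ ∈ (permDraw A r K).support) {x : ℕ}
    (hx : x < A) : ∃ h : (byBucket r K M β).idxOf x < δ.length,
      placeOf r K M β δ x = δ[(byBucket r K M β).idxOf x] ∧ placeOf r K M β δ x < A := by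
  obtain ⟨h1, h2, h3, h4⟩ := permDraw_support A hr hδ
  obtain ⟨h5, h6⟩ := idxOf_byBucket_lt_places hr hA hM hβ hx
  have hl : δ.length = A := by rw [mul_comm] at hA; omega
  refine ⟨by omega, ?_, ?_⟩
  · rw [placeOf, List.getD_eq_getElem]
  · rw [placeOf, List.getD_eq_getElem _ _ (by omega)]
    simp_all

theorem permOf_apply (hr : 0 < r) (hA : A ≤ r * K) (hM : r * K ≤ M) {β δ : List ℕ}
    (hβ : β ∈ (draw K A (size A r)).support) (hδ : δ ∈ (permDraw A r K).support) (x : Fin A) :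
    (permOf A r K M β δ x).val = placeOf r K M β δ x.val := by
  have hf : Function.Bijective (fun x : Fin A =>
      if h : placeOf r K M β δ x.val < A then (⟨placeOf r K M β δ x.val, h⟩ : Fin A) else x) := by
    rw [Function.Bijective.eq_1, and_iff_left_of_imp Finite.surjective_of_injective]
    intro x y hxy
    obtain ⟨a1, a2, a3⟩ := placeOf_lt hr hA hM hβ hδ x.isLt
    obtain ⟨b1, b2, b3⟩ := placeOf_lt hr hA hM hβ hδ y.isLt
    simp only [a3, b3, dif_pos, Fin.mk.injEq] at hxy
    rw [a2, b2] at hxy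
    have h := ((permDraw_support A hr hδ).2.1.getElem_inj_iff).1 hxy
    have e1 := List.getElem_idxOf (idxOf_byBucket_lt (M := M) (β := β) (x.isLt.trans_le hA))
    grind
  obtain ⟨-, -, a3⟩ := placeOf_lt hr hA hM hβ hδ x.isLt
  grind [permOf]

theorem permOf_injective (hr : 0 < r) (hA : A ≤ r * K) (hM : r * K ≤ M) {β δ β' δ' : List ℕ}
    (hβ : β ∈ (draw K A (size A r)).support) (hδ : δ ∈ (permDraw A r K).support)
    (hβ' : β' ∈ (draw K A (size A r)).support) (hδ' : δ' ∈ (permDraw A r K).support)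
    (h : permOf A r K M β δ = permOf A r K M β' δ') : β = β' ∧ δ = δ' := by
  have hp : ∀ x < A, placeOf r K M β δ x = placeOf r K M β' δ' x := by
    intro x hx
    rw [← permOf_apply hr hA hM hβ hδ ⟨x, hx⟩, ← permOf_apply hr hA hM hβ' hδ' ⟨x, hx⟩, h]
  have hb : ∀ {β δ : List ℕ}, β ∈ (draw K A (size A r)).support →
      δ ∈ (permDraw A r K).support → ∀ x < A, β.getD x K = placeOf r K M β δ x / r := by
    intro β δ hβ hδ x hx
    obtain ⟨a1, a2, a3⟩ := placeOf_lt hr hA hM hβ hδ hx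
    rw [(idxOf_byBucket_lt_places hr hA hM hβ hx).2, a2, (permDraw_support A hr hδ).2.2.2 _ a1]
  have hββ : β = β' := by
    have l1 := (length_of_draw hA hβ).1
    have l2 := (length_of_draw hA hβ').1
    apply List.ext_getElem
    · rw [l1, l2]
    · grind
  subst hββ
  refine ⟨rfl, ?_⟩
  have l1 := (permDraw_support A hr hδ).1
  have l2 := (permDraw_support A hr hδ').1
  apply List.ext_getElem
  · rw [l1, l2]
  · intro p h1 h2
    have hpA : p < A := by omega
    have hpl : p < (byBucket r K M β).length := by rw [length_byBucket]; omega
    have hnd : (byBucket r K M β).Nodup := (byBucket_perm r K M β).nodup_iff.2 List.nodup_range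
    have := hp _ (getElem_byBucket_lt hr hA hM hβ hpA hpl)
    grind [placeOf]

/-- Buckets that are drawn without replacement and uniform permutations of the buckets together
give a uniform permutation: each permutation arises in just one way, and all ways are equally
likely. -/
theorem bind_permOf (hr : 0 < r) (hA : A ≤ r * K) (hM : r * K ≤ M) :
    ((draw K A (size A r)).bind fun β => (permDraw A r K).map (permOf A r K M β)) =
      PMF.uniformOfFintype (Equiv.Perm (Fin A)) := by
  apply eq_uniform_of_le
  intro π
  have htot : tot K (size A r) = A := by rw [tot, sum_size]; rw [mul_comm] at hA; omega
  set F : ℝ≥0∞ := ((∏ j ∈ Finset.range K, (size A r j).factorial : ℕ) : ℝ≥0∞) with hF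
  have hF0 : F ≠ 0 := by
    rw [hF]
    exact_mod_cast (Finset.prod_pos fun j _ => Nat.factorial_pos _).ne'
  have hFt : F ≠ ⊤ := ENNReal.natCast_ne_top _
  refine (bind_map_apply_le (u := F * (A.factorial : ℝ≥0∞)⁻¹) (v := F⁻¹) ?_ ?_ ?_ π).trans ?_
  · intro β
    rw [← div_eq_mul_inv, ENNReal.le_div_iff_mul_le]
    · exact draw_apply_le htot β
    · left; exact_mod_cast Nat.factorial_ne_zero _
    simp
  · intro β δ
    refine (permDraw_apply_le A r K δ).trans ?_
    rw [hF, Nat.cast_prod, ENNReal.prod_inv_distrib]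
    intro i _ j _ _
    left; exact_mod_cast Nat.factorial_ne_zero _
  · intro β hβ δ hδ β' hβ' δ' hδ' h
    exact permOf_injective hr hA hM hβ hδ hβ' hδ' h
  · rw [Fintype.card_perm, Fintype.card_fin, mul_comm F, mul_assoc, ENNReal.mul_inv_cancel hF0 hFt,
      mul_one]

end

end Shuffle

end OS

/-! ### Block-wise programs on tables -/

namespace OS

/-- The dimensions of the scratch memory of the program that builds the tree: tables of
`r * (s2 * s1)` rows, which are handled in blocks of `r` rows. A block fits in a bounded number of
messages, and the other factors are small enough for columnsort. -/
structure Geom (P : Params) where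
  r : ℕ
  s2 : ℕ
  s1 : ℕ
  Q : ℕ
  good : P.Good
  s2_pos : 0 < s2
  s1_pos : 0 < s1
  inner : s2 * s2 ≤ r / 2
  outer : s1 * s1 ≤ r * s2 / 2
  slots : P.arrayCells + 2 * P.epoch ≤ r * (s2 * s1)
  words : (P.arrayCells + P.levels * (2 * P.epoch)) * P.cellWords +
    3 * ((r * (s2 * s1) + s2 * s1) * (P.cellWords + 1)) ≤ P.W
  fits : 4 * (r + s2 * s1 + 2 * P.epoch) * (P.cellWords + 1) ≤ Q * (P.B / 2)

variable {P : Params}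

/-- The words `l`, followed by zeros, `w` words in total. -/
def pad (w : ℕ) (l : List P.Word) : List P.Word := (l ++ List.replicate w (P.word 0)).take w

theorem length_pad (w : ℕ) (l : List P.Word) : (pad w l).length = w := by
  simp [pad]

theorem pad_getD {w : ℕ} {l : List P.Word} {j : ℕ} (hj : j < w) :
    (pad w l).getD j (P.word 0) = l.getD j (P.word 0) := by
  grind [pad, List.getD_eq_getElem, List.getD_eq_default]

theorem pad_of_length {w : ℕ} {l : List P.Word} (h : l.length = w) : pad w l = l := by
  grind [pad]

namespace Geom

variable (G : Geom P)

/-- Number of blocks. -/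
def K : ℕ := G.s2 * G.s1

/-- Number of rows in all blocks. -/
def N : ℕ := G.r * G.K

theorem r_pos : 0 < G.r := by
  have h1 := G.inner
  have h2 := Nat.mul_pos G.s2_pos G.s2_pos
  omega

theorem K_pos : 0 < G.K := Nat.mul_pos G.s2_pos G.s1_pos

theorem N_pos : 0 < G.N := Nat.mul_pos G.r_pos G.K_pos

/-- The rows of block `i` that are below `lim`. -/
def blockRows (lim i : ℕ) : List ℕ :=
  ((List.range G.r).map fun j => i * G.r + j).filter fun p => decide (p < lim)

theorem mem_blockRows {lim i p : ℕ} : p ∈ G.blockRows lim i ↔ p < lim ∧ p / G.r = i := by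
  simp only [blockRows, List.mem_filter, List.mem_map, List.mem_range, decide_eq_true_eq]
  rw [Nat.div_eq_iff G.r_pos]
  have := G.r_pos
  constructor
  · omega
  · rintro ⟨h, h1, h2⟩
    exact ⟨⟨p - i * G.r, by omega, by omega⟩, h⟩

theorem length_blockRows_le (lim i : ℕ) : (G.blockRows lim i).length ≤ G.r := by
  refine (List.length_filter_le _ _).trans ?_
  simp

theorem div_lt_K {p : ℕ} (hp : p < G.N) : p / G.r < G.K := Nat.div_lt_of_lt_mul hp

/-- Overwrite the rows below `lim` of the table, block by block. -/
def fill (T : Table) (lim : ℕ) (ins : ℕ → List P.Word) (val : Mem P.W → ℕ → List P.Word) :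
    List (Stage P.W) :=
  (List.range G.K).map fun i => T.stage (ins i) (G.blockRows lim i) Unit fun _ => val

theorem execLaw_fill {T : Table} (hT : T.limit ≤ P.W) {lim : ℕ} (hN : lim ≤ G.N)
    (hlim : lim ≤ T.len) {ins : ℕ → List P.Word} {val : Mem P.W → ℕ → List P.Word} {m : Mem P.W}
    (hlen : ∀ p < lim, (val m p).length = T.w)
    (hval : ∀ m', T.Frame m m' → ∀ p < lim, val (Stage.restrict (ins (p / G.r)) m') p = val m p) :
    ∀ m' ∈ (execLaw (G.fill T lim ins val) m).support,
      (∀ p, T.row m' p = if p < lim then val m p else T.row m p) ∧ T.Frame m m' := by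
  have key : ∀ k, ∀ m' ∈ (execLaw ((List.range k).map fun i =>
      T.stage (ins i) (G.blockRows lim i) Unit fun _ => val) m).support,
      (∀ p, T.row m' p = if p < lim ∧ p / G.r < k then val m p else T.row m p) ∧
        T.Frame m m' := by
    intro k
    induction k with
    | zero =>
        intro m' hm'
        simp only [List.range_zero, List.map_nil, execLaw, PMF.support_pure,
          Set.mem_singleton_iff] at hm'
        subst hm'
        exact ⟨fun p => by simp, Table.Frame.refl _ _⟩
    | succ k ih =>
        intro m' hm'
        rw [List.range_succ, List.map_append, execLaw_append, PMF.mem_support_bind_iff] at hm'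
        obtain ⟨m1, hm1, hm'⟩ := hm'
        obtain ⟨h1, h2⟩ := ih m1 hm1
        simp only [List.map_cons, List.map_nil, execLaw, PMF.mem_support_bind_iff,
          PMF.support_pure, Set.mem_singleton_iff] at hm'
        obtain ⟨ω, -, rfl⟩ := hm'
        have hrows : ∀ q ∈ G.blockRows lim k, q < T.len := fun q hq =>
          (G.mem_blockRows.1 hq).1.trans_le hlim
        have hv : ∀ p ∈ G.blockRows lim k, val (Stage.restrict (ins k) m1) p = val m p := by
          intro p hp
          obtain ⟨a, b⟩ := G.mem_blockRows.1 hp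
          grind
        refine ⟨fun p => ?_, h2.trans fun a ha => Table.exec_stage_outside hT hrows _ _ _ ha⟩
        refine (Table.row_exec_stage hT hrows ω m1 p fun hp => ?_).trans ?_
        · rw [hv p hp]; exact hlen p (G.mem_blockRows.1 hp).1
        · by_cases hp : p ∈ G.blockRows lim k
          · obtain ⟨a, b⟩ := G.mem_blockRows.1 hp
            grind
          · rw [if_neg hp, h1]
            rw [G.mem_blockRows] at hp
            grind
  intro m' hm'
  obtain ⟨h1, h2⟩ := key G.K m' hm'
  refine ⟨fun p => ?_, h2⟩
  rw [h1]
  by_cases hp : p < lim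
  · rw [if_pos hp, if_pos ⟨hp, G.div_lt_K (hp.trans_le hN)⟩]
  grind

/-- Columnsort with two levels of recursion, as a list of blocks of rows to be sorted. -/
def net : List (List ℕ) :=
  SortNet.colSort (G.r * G.s2) G.s1 (SortNet.colSort G.r G.s2 fun L => [L]) (List.range G.N)

theorem sorts_net {α : Type} (κ : α → ℕ) : SortNet.Sorts κ G.net (List.range G.N) := by
  refine SortNet.sorts_colSort (fun L hL hlen => ?_) List.nodup_range ?_ G.s1_pos G.outer
  · exact SortNet.sorts_colSort (fun L' hL' _ => SortNet.sorts_single κ hL') hL hlen G.s2_pos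
      G.inner
  · rw [List.length_range, N, K, mul_assoc]

theorem colSort_forall {r s : ℕ} {srt : List ℕ → List (List ℕ)} {L : List ℕ} {Φ Ψ : List ℕ → Prop}
    (hsub : ∀ g : ℕ → ℕ, Ψ (SortNet.sub L r g)) (hsrt : ∀ L', Ψ L' → ∀ L'' ∈ srt L', Φ L'') :
    ∀ L'' ∈ SortNet.colSort r s srt L, Φ L'' := by
  intro L'' h
  simp only [SortNet.colSort, List.mem_append, List.mem_flatMap] at h
  grind

theorem length_colSort_le {r s q : ℕ} {srt : List ℕ → List (List ℕ)} {L : List ℕ}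
    (hsrt : ∀ L', (srt L').length ≤ q) : (SortNet.colSort r s srt L).length ≤ 4 * (s * q) := by
  have h : ∀ (t : ℕ) (g : ℕ → List ℕ), ((List.range t).flatMap fun i => srt (g i)).length ≤
      t * q := by
    intro t g
    rw [List.length_flatMap]
    refine (List.sum_le_card_nsmul _ q ?_).trans (by simp)
    grind
  rw [SortNet.colSort]
  simp only [List.length_append]
  have h1 := h s fun i => SortNet.sub L r fun j => i * r + j
  have h2 := h s fun i => SortNet.sub L r fun j => i + s * j
  have h3 := h (s - 1) fun i => SortNet.sub L r fun j => ((i + 1) * r - r / 2) + j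
  have h4 : (s - 1) * q ≤ s * q := Nat.mul_le_mul_right _ (Nat.sub_le _ _)
  omega

theorem mem_sub_lt {r M : ℕ} (hM : 0 < M) {L : List ℕ} (hL : ∀ q ∈ L, q < M) (g : ℕ → ℕ) :
    ∀ q ∈ SortNet.sub L r g, q < M := by
  intro q hq
  simp only [SortNet.sub, List.mem_map] at hq
  obtain ⟨j, -, rfl⟩ := hq
  by_cases h : g j < L.length
  · simp_all
  grind

theorem net_spec : ∀ L ∈ G.net, L.length = G.r ∧ ∀ q ∈ L, q < G.N := by
  refine colSort_forall (Ψ := fun L => ∀ q ∈ L, q < G.N)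
    (fun g => mem_sub_lt G.N_pos (fun q hq => List.mem_range.1 hq) g) fun L hL => ?_
  refine colSort_forall (Ψ := fun L => L.length = G.r ∧ ∀ q ∈ L, q < G.N)
    (fun g => ⟨by simp [SortNet.sub], mem_sub_lt G.N_pos hL g⟩) fun L' hL' L'' h => ?_
  grind

theorem length_net_le : G.net.length ≤ 16 * G.K := by
  refine (length_colSort_le (q := 4 * (G.s2 * 1)) fun L => length_colSort_le fun L' => le_rfl).trans
    (le_of_eq ?_)
  rw [K]; ring

/-- Sort the rows of the table by the key `κ`. -/
def sortTable (T : Table) (κ : List P.Word → ℕ) : List (Stage P.W) := G.net.map (T.sortStage κ)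

theorem execLaw_sortTable {T : Table} (hT : T.limit ≤ P.W) (hN : G.N ≤ T.len)
    {κ : List P.Word → ℕ} {m : Mem P.W} {C : List (List P.Word)}
    (hC : C.Perm ((List.range G.N).map (T.row m))) (hs : C.Pairwise fun x y => κ x ≤ κ y)
    (hinj : ∀ x ∈ C, ∀ y ∈ C, κ x = κ y → x = y) :
    ∀ m' ∈ (execLaw (G.sortTable T κ) m).support,
      (∀ p < G.N, T.row m' p = C.getD p []) ∧ (∀ p, G.N ≤ p → T.row m' p = T.row m p) ∧
        T.Frame m m' := by
  intro m' hm'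
  obtain ⟨h1, h2⟩ := Table.execLaw_sortStages hT
    (fun L hL q hq => ((G.net_spec L hL).2 q hq).trans_le hN) m m' hm'
  obtain ⟨s1, s2, s3⟩ := G.sorts_net κ (T.row m)
  rw [← h1] at s1 s2 s3
  have e : C = (List.range G.N).map (T.row m') := by
    refine List.Perm.eq_of_pairwise (le := fun x y => κ x ≤ κ y) ?_ hs s3 (hC.trans s2.symm)
    grind
  grind

/-- If the row `τ y` has the key `y`, then sorting brings it to the place `y`. -/
theorem execLaw_sortTable_of_key_eq {T : Table} (hT : T.limit ≤ P.W) (hN : G.N ≤ T.len)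
    {κ : List P.Word → ℕ} {m : Mem P.W} {τ : ℕ → ℕ} (hτ : ∀ y < G.N, τ y < G.N)
    (hκ : ∀ y < G.N, κ (T.row m (τ y)) = y) :
    ∀ m' ∈ (execLaw (G.sortTable T κ) m).support,
      (∀ y < G.N, T.row m' y = T.row m (τ y)) ∧ (∀ p, G.N ≤ p → T.row m' p = T.row m p) ∧
        T.Frame m m' := by
  intro m' hm'
  have hnd : ((List.range G.N).map τ).Nodup := by
    refine List.Nodup.map_on ?_ List.nodup_range
    grind
  have hperm : ((List.range G.N).map τ).Perm (List.range G.N) := by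
    refine List.Subperm.perm_of_length_le (hnd.subperm ?_) (by simp)
    grind
  have h := G.execLaw_sortTable hT hN (κ := κ) (m := m)
    (C := (List.range G.N).map fun y => T.row m (τ y)) ?_ ?_ ?_ m' hm'
  · grind
  · have := hperm.map (T.row m)
    rwa [List.map_map] at this
  · rw [List.pairwise_map]
    refine List.Pairwise.imp_of_mem ?_ List.pairwise_lt_range
    grind
  simp_all

end Geom

end OS

/-! ### Drawing the permutation obliviously -/

namespace OS

namespace Shuffle

theorem tot_less {K q : ℕ} {c : ℕ → ℕ} (hq : q ≤ tot K c) {β : List ℕ}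
    (hβ : β ∈ (draw K q c).support) : tot K (less c β) + q = tot K c := by
  induction q generalizing c β with
  | zero =>
      grind [draw, PMF.support_pure, less_nil]
  | succ q ih =>
      simp only [draw, PMF.mem_support_bind_iff, PMF.support_map, Set.mem_image] at hβ
      obtain ⟨u, -, β', hβ', rfl⟩ := hβ
      have hu : u.val < tot K c := by have := u.isLt; omega
      have h3 := tot_dec (pick_spec hu).1 (pick_pos hu)
      grind [less_cons]

theorem append_mem_draw {K p q : ℕ} {c : ℕ → ℕ} {β β' : List ℕ} (hβ : β ∈ (draw K p c).support)
    (hβ' : β' ∈ (draw K q (less c β)).support) : β ++ β' ∈ (draw K (p + q) c).support := by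
  rw [draw_add, PMF.mem_support_bind_iff]
  exact ⟨β, hβ, (PMF.mem_support_map_iff _ _ _).2 ⟨β', hβ', rfl⟩⟩

/-- A uniform coin gives the next buckets. -/
theorem map_coins_draws {K A r i : ℕ} (hA : A ≤ K * r) {β : List ℕ}
    (hβ : β ∈ (draw K (min (i * r) A) (size A r)).support) :
    (PMF.uniformOfFintype ((j : Fin (size A r i)) → Fin (A - (i * r + j) - 1 + 1))).map
      (fun ω => draws K (less (size A r) β) (List.ofFn fun j => (ω j).val)) =
      draw K (size A r i) (less (size A r) β) := by
  have htot : tot K (size A r) = A := by rw [tot, sum_size]; omega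
  have h1 := tot_less (by rw [htot]; omega) hβ
  have hsz : size A r i = min r (A - i * r) := rfl
  rw [← map_draws_seqUnif (k := fun j => A - (i * r + j) - 1), ← map_uniform_coins, PMF.map_comp]
  · rfl
  · omega
  · omega

end Shuffle

theorem Coupled.pure_right {α β : Type*} {Φ : α → β → Prop} {p : PMF α} {b : β}
    (h : ∀ a ∈ p.support, Φ a b) : Coupled Φ p (PMF.pure b) := by
  have := (Coupled.pure (Φ := fun (_ : Unit) b' => b' = b) (a := ()) rfl).post (f := fun _ => p)
    (Ψ := Φ) fun _ b' hb' c hc => hb' ▸ h c hc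
  simp_all

variable {P : Params}

namespace Geom

open Shuffle

variable (G : Geom P)

/-- The array and the caches. -/
noncomputable def arr : Table := ⟨0, P.cellWords, P.arrayCells + P.levels * (2 * P.epoch)⟩

/-- Scratch table number `i`; its rows have room for a cell and a sort key. -/
noncomputable def tab (i : ℕ) : Table :=
  ⟨(P.arrayCells + P.levels * (2 * P.epoch)) * P.cellWords +
    i * ((G.N + G.K) * (P.cellWords + 1)), P.cellWords + 1, G.N + G.K⟩

theorem arr_limit : (arr (P := P)).limit =
    (P.arrayCells + P.levels * (2 * P.epoch)) * P.cellWords := by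
  simp [arr, Table.limit]

theorem arr_limit_le (g : P.Good) : (arr (P := P)).limit ≤ P.W := by
  rw [arr_limit]
  exact g.words

theorem tab_limit (i : ℕ) : (G.tab i).limit = (G.tab (i + 1)).base := by
  grind [tab, Table.limit]

theorem tab_stop_le {i : ℕ} (hi : i < 3) : (G.tab i).limit ≤ P.W := by
  have h1 := G.words
  have h2 : (i + 1) * ((G.N + G.K) * (P.cellWords + 1)) ≤
      3 * ((G.N + G.K) * (P.cellWords + 1)) := Nat.mul_le_mul_right _ hi
  grind [tab_limit, tab, N, K]

theorem tab_disj {i j : ℕ} (h : i ≠ j) :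
    (G.tab i).limit ≤ (G.tab j).base ∨ (G.tab j).limit ≤ (G.tab i).base := by
  rw [tab_limit, tab_limit]
  simp only [tab]
  rcases lt_or_gt_of_ne h with h | h
  · left
    exact Nat.add_le_add_left (Nat.mul_le_mul_right _ h) _
  · right
    exact Nat.add_le_add_left (Nat.mul_le_mul_right _ h) _

theorem arr_disj (j : ℕ) : (arr (P := P)).limit ≤ (G.tab j).base := by
  rw [arr_limit]; exact Nat.le_add_right _ _

theorem frame_row_tab {i j : ℕ} (hj : j < 3) (h : i ≠ j) {m m' : Mem P.W}
    (hf : (G.tab i).Frame m m') : (G.tab j).row m' = (G.tab j).row m :=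
  hf.row (G.tab_stop_le hj) (G.tab_disj h)

theorem frame_row_arr {i : ℕ} {m m' : Mem P.W} (hf : (G.tab i).Frame m m') :
    (arr (P := P)).row m' = (arr (P := P)).row m := hf.row (arr_limit_le G.good) (Or.inr (G.arr_disj i))

theorem slots_le : P.arrayCells ≤ G.N := by
  have h1 := G.slots
  rw [N, K]; omega

theorem rows_lt : G.N + G.K < P.W := by
  have h1 := G.words
  have h2 : 0 < (G.N + G.K) * P.cellWords := by
    have := G.N_pos
    refine Nat.mul_pos (by omega) ?_
    rw [Params.cellWords]; omega
  have h3 : (G.N + G.K) * (P.cellWords + 1) = (G.N + G.K) * P.cellWords + (G.N + G.K) := by ring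
  grind [N, K]

theorem two_le_cellWords : 2 ≤ P.cellWords := by rw [Params.cellWords]; omega

/-- A padded row of a scratch table. -/
noncomputable def wrap (l : List P.Word) : List P.Word := pad (P.cellWords + 1) l

theorem wrap_getD {l : List P.Word} {j : ℕ} (hj : j < 3) :
    (wrap l).getD j (P.word 0) = l.getD j (P.word 0) := by
  have := two_le_cellWords (P := P)
  exact pad_getD (by omega)

/-- Sort key: the first word. -/
def key1 (l : List P.Word) : ℕ := (l.getD 0 (P.word 0)).val

/-- Sort key: the first two words. -/
def key2 (l : List P.Word) : ℕ := (l.getD 0 (P.word 0)).val * P.W + (l.getD 1 (P.word 0)).val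

/-- Table 1 has a counter for each bucket after the other rows. -/
noncomputable def initCounters : Stage P.W :=
  (G.tab 1).stage [] ((List.range G.K).map fun j => G.N + j) Unit fun _ _ p =>
    wrap [P.word (size P.arrayCells G.r (p - G.N))]

/-- The counters in table 1. -/
noncomputable def counters (m : Mem P.W) (j : ℕ) : ℕ := key1 ((G.tab 1).row m (G.N + j))

/-- Draw buckets for the numbers in block `i`. -/
noncomputable def drawStage (i : ℕ) : Stage P.W :=
  (G.tab 1).stage (((List.range G.K).map fun j => G.N + j).flatMap ((G.tab 1).rowAddrs P))
    (G.blockRows G.N i ++ (List.range G.K).map fun j => G.N + j)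
    ((j : Fin (size P.arrayCells G.r i)) → Fin (P.arrayCells - (i * G.r + j) - 1 + 1))
    fun ω m p =>
      let β := draws G.K (G.counters m) (List.ofFn fun j => (ω j).val)
      if p < G.N then wrap [P.word (β.getD (p - i * G.r) G.K), P.word p]
      else wrap [P.word (less (G.counters m) β (p - G.N))]

/-- The rows of table 1 and the buckets of the first `i` blocks. -/
structure Drawn (m : Mem P.W) (i : ℕ) (m' : Mem P.W) (β : List ℕ) : Prop where
  mem : β ∈ (draw G.K (min (i * G.r) P.arrayCells) (size P.arrayCells G.r)).support
  rows : ∀ p < G.N, p / G.r < i →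
    (G.tab 1).row m' p = wrap [P.word (β.getD p G.K), P.word p]
  counts : ∀ j < G.K, (G.tab 1).row m' (G.N + j) =
    wrap [P.word (less (size P.arrayCells G.r) β j)]
  frame : (G.tab 1).Frame m m'

theorem exec_initCounters (m : Mem P.W) : G.Drawn m 0 (G.initCounters.exec () m) [] := by
  have hrows : ∀ q ∈ (List.range G.K).map fun j => G.N + j, q < (G.tab 1).len := by
    simp [List.mem_map, List.mem_range, tab]
  refine ⟨by simp [draw], fun p _ h => absurd h (Nat.not_lt_zero _), fun j hj => ?_, fun a ha =>
    Table.exec_stage_outside (G.tab_stop_le (by omega)) hrows _ _ _ ha⟩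
  refine (Table.row_exec_stage (G.tab_stop_le (by omega)) hrows _ _ _
    (fun _ => length_pad _ _)).trans ?_
  rw [if_pos (List.mem_map.2 ⟨j, List.mem_range.2 hj, rfl⟩)]
  simp [less_nil]

theorem size_lt (i : ℕ) : size P.arrayCells G.r i < P.W := by
  have h1 : size P.arrayCells G.r i ≤ G.r := Nat.min_le_left _ _
  have h2 : G.r ≤ G.N := Nat.le_mul_of_pos_right _ G.K_pos
  have h3 := G.rows_lt
  omega

theorem size_add (A r i : ℕ) : min ((i + 1) * r) A = min (i * r) A + size A r i := by
  rw [size, Nat.succ_mul]; omega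

theorem Drawn.counters_eq {G : Geom P} {m m' : Mem P.W} {i : ℕ} {β : List ℕ}
    (h : G.Drawn m i m' β) : G.counters m' = less (size P.arrayCells G.r) β := by
  funext j
  by_cases hj : j < G.K
  · rw [counters, key1, h.counts j hj, wrap_getD (by omega)]
    simp only [List.getD_cons_zero]
    apply P.word_val
    have := G.size_lt j
    grind [less]
  · have h1 : less (size P.arrayCells G.r) β j = 0 := by
      have h2 := G.slots_le
      have h3 : G.K * G.r ≤ j * G.r := Nat.mul_le_mul_right _ (by omega)
      grind [N, mul_comm, less, size]
    rw [h1, counters, key1, Table.row, if_neg (by simp only [tab]; omega)]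
    simp only [List.getD_nil]
    exact P.word_val P.W_pos

theorem Drawn.step {G : Geom P} {m m' : Mem P.W} {i : ℕ} {β : List ℕ}
    (h : G.Drawn m i m' β) (hi : i < G.K)
    (ω : (j : Fin (size P.arrayCells G.r i)) → Fin (P.arrayCells - (i * G.r + j) - 1 + 1))
    (hω : draws G.K (less (size P.arrayCells G.r) β) (List.ofFn fun j => (ω j).val) ∈
      (draw G.K (size P.arrayCells G.r i) (less (size P.arrayCells G.r) β)).support) :
    G.Drawn m (i + 1) ((G.drawStage i).exec ω m')
      (β ++ draws G.K (less (size P.arrayCells G.r) β) (List.ofFn fun j => (ω j).val)) := by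
  have hrows : ∀ q ∈ G.blockRows G.N i ++ (List.range G.K).map fun j => G.N + j,
      q < (G.tab 1).len := by
    intro q hq
    simp only [tab]
    rcases List.mem_append.1 hq with hq | hq
    · have := (G.mem_blockRows.1 hq).1; omega
    grind
  have hT := G.tab_stop_le (i := 1) (by omega)
  have hc : G.counters (Stage.restrict
      (((List.range G.K).map fun j => G.N + j).flatMap ((G.tab 1).rowAddrs P)) m') =
      less (size P.arrayCells G.r) β := by
    rw [← h.counters_eq]
    grind [counters, Table.row_restrict, Table.row, tab]
  set β' := draws G.K (less (size P.arrayCells G.r) β) (List.ofFn fun j => (ω j).val) with hβ'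
  have hrow : ∀ p, (G.tab 1).row ((G.drawStage i).exec ω m') p =
      if p ∈ G.blockRows G.N i ++ (List.range G.K).map fun j => G.N + j then
        (if p < G.N then wrap [P.word (β'.getD (p - i * G.r) G.K), P.word p]
        else wrap [P.word (less (less (size P.arrayCells G.r) β) β' (p - G.N))])
      else (G.tab 1).row m' p := by
    intro p
    refine (Table.row_exec_stage hT hrows ω m' p (fun _ => ?_)).trans ?_
    · simp only
      split_ifs <;> exact length_pad _ _
    grind
  have hsz : size P.arrayCells G.r i = min G.r (P.arrayCells - i * G.r) := rfl
  have htot : tot G.K (size P.arrayCells G.r) = P.arrayCells := by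
    have h2 := G.slots_le
    grind [N, mul_comm, tot, sum_size]
  have hlen := (draw_support (by rw [htot]; omega) h.mem).1
  have hlen' := (draw_support (by have := tot_less (by rw [htot]; omega) h.mem; omega) hω).1
  refine ⟨?_, fun p hp hpi => ?_, fun j hj => ?_, h.frame.trans fun a ha =>
    Table.exec_stage_outside hT hrows _ _ _ ha⟩
  · rw [size_add]; exact append_mem_draw h.mem hω
  · rw [hrow]
    by_cases hb : p / G.r = i
    · rw [if_pos (List.mem_append_left _ (G.mem_blockRows.2 ⟨hp, hb⟩)), if_pos hp]
      rw [Nat.div_eq_iff G.r_pos] at hb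
      grind
    · rw [if_neg, h.rows p hp (by omega)]
      · have h3 : p < i * G.r := by
          rw [← Nat.div_lt_iff_lt_mul G.r_pos]; omega
        grind
      · intro h3
        rcases List.mem_append.1 h3 with h3 | h3
        · exact hb (G.mem_blockRows.1 h3).2
        grind
  · rw [hrow, if_pos (List.mem_append_right _ (List.mem_map.2 ⟨j, List.mem_range.2 hj, rfl⟩)),
      if_neg (by omega), Nat.add_sub_cancel_left, less_append]

/-- Set up the counters, and draw a bucket for each number. -/
noncomputable def drawStages : List (Stage P.W) :=
  G.initCounters :: (List.range G.K).map G.drawStage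

theorem coupled_drawStages (m : Mem P.W) :
    Coupled (G.Drawn m G.K) (execLaw G.drawStages m)
      (draw G.K P.arrayCells (size P.arrayCells G.r)) := by
  have h2 := G.slots_le
  rw [N, mul_comm] at h2
  have key : ∀ i ≤ G.K, Coupled (G.Drawn m i)
      (execLaw (G.initCounters :: (List.range i).map G.drawStage) m)
      (draw G.K (min (i * G.r) P.arrayCells) (size P.arrayCells G.r)) := by
    intro i
    induction i with
    | zero =>
        intro _
        simp only [List.range_zero, List.map_nil, execLaw, zero_mul, Nat.zero_min, draw]
        refine Coupled.pure_right fun m' hm' => ?_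
        rw [PMF.mem_support_bind_iff] at hm'
        obtain ⟨ω, -, hm'⟩ := hm'
        rw [PMF.support_pure, Set.mem_singleton_iff] at hm'
        rw [hm']
        exact G.exec_initCounters m
    | succ i ih =>
        intro hi
        rw [List.range_succ, List.map_append, ← List.cons_append, execLaw_append, size_add,
          draw_add]
        refine (ih (by omega)).bind fun m' β h => ?_
        rw [← map_coins_draws h2 h.mem, PMF.map_comp]
        simp only [List.map_cons, List.map_nil, execLaw]
        change Coupled _ (PMF.map (fun ω => (G.drawStage i).exec ω m') _) _
        refine (Coupled.refl _).map ?_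
        rintro ω _ ⟨rfl, hω⟩
        refine h.step (by omega) ω ?_
        rw [← map_coins_draws h2 h.mem, PMF.mem_support_map_iff]
        exact ⟨ω, hω, rfl⟩
  have := key G.K le_rfl
  rwa [Nat.min_eq_right h2] at this

/-- Permute the places of block `i`: a row gets a destination in its block. -/
noncomputable def permStage (i : ℕ) : Stage P.W :=
  (G.tab 1).stage ((G.blockRows G.N i).flatMap ((G.tab 1).rowAddrs P)) (G.blockRows G.N i)
    (Equiv.Perm (Fin (size P.arrayCells G.r i))) fun ω m p =>
      wrap [((G.tab 1).row m p).getD 1 (P.word 0),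
        P.word ((List.ofFn fun j => i * G.r + (ω j).val).getD (p - i * G.r) p)]

/-- The rows of table 1 after permuting the first `i` blocks. -/
structure Permuted (m : Mem P.W) (i : ℕ) (m' : Mem P.W) (δ : List ℕ) : Prop where
  mem : δ ∈ (permDraw P.arrayCells G.r i).support
  rows : ∀ p < G.N, (G.tab 1).row m' p = if p / G.r < i then
    wrap [((G.tab 1).row m p).getD 1 (P.word 0), P.word (δ.getD p p)] else (G.tab 1).row m p
  frame : (G.tab 1).Frame m m'

theorem Permuted.step {G : Geom P} {m m' : Mem P.W} {i : ℕ} {δ : List ℕ}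
    (h : G.Permuted m i m' δ) (ω : Equiv.Perm (Fin (size P.arrayCells G.r i))) :
    G.Permuted m (i + 1) ((G.permStage i).exec ω m')
      (δ ++ List.ofFn fun j => i * G.r + (ω j).val) := by
  have hrows : ∀ q ∈ G.blockRows G.N i, q < (G.tab 1).len := by
    intro q hq
    have := (G.mem_blockRows.1 hq).1
    grind [tab]
  have hT := G.tab_stop_le (i := 1) (by omega)
  have hlen := (permDraw_support P.arrayCells G.r_pos h.mem).1
  have hsz : size P.arrayCells G.r i = min G.r (P.arrayCells - i * G.r) := rfl
  refine ⟨?_, fun p hp => ?_, h.frame.trans fun a ha =>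
    Table.exec_stage_outside hT hrows _ _ _ ha⟩
  · rw [permDraw, PMF.mem_support_bind_iff]
    refine ⟨δ, h.mem, (PMF.mem_support_map_iff _ _ _).2 ⟨ω, ?_, rfl⟩⟩
    simp
  · refine (Table.row_exec_stage hT hrows ω m' p (fun _ => length_pad _ _)).trans ?_
    by_cases hb : p / G.r = i
    · rw [if_pos (G.mem_blockRows.2 ⟨hp, hb⟩), if_pos (by omega), Table.row_restrict _ fun a ha =>
        List.mem_flatMap.2 ⟨p, G.mem_blockRows.2 ⟨hp, hb⟩, ha⟩, h.rows p hp, if_neg (by omega)]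
      rw [Nat.div_eq_iff G.r_pos] at hb
      grind
    · rw [if_neg (fun h3 => hb (G.mem_blockRows.1 h3).2), h.rows p hp]
      by_cases hpi : p / G.r < i
      · rw [if_pos hpi, if_pos (by omega)]
        have h3 : p < i * G.r := by rwa [← Nat.div_lt_iff_lt_mul G.r_pos]
        grind
      grind

theorem coupled_permStages (m : Mem P.W) :
    Coupled (G.Permuted m G.K) (execLaw ((List.range G.K).map G.permStage) m)
      (permDraw P.arrayCells G.r G.K) := by
  generalize G.K = i
  induction i with
  | zero =>
      simp only [List.range_zero, List.map_nil, execLaw, permDraw]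
      exact Coupled.pure ⟨by simp [permDraw], fun p _ => by simp, Table.Frame.refl _ _⟩
  | succ i ih =>
      rw [List.range_succ, List.map_append, execLaw_append, permDraw]
      refine ih.bind fun m' δ h => ?_
      simp only [List.map_cons, List.map_nil, execLaw]
      change Coupled _ (PMF.map (fun ω => (G.permStage i).exec ω m') _) _
      refine (Coupled.refl _).map ?_
      rintro ω _ ⟨rfl, -⟩
      exact h.step ω

end Geom

end OS

/-! ### The program that builds the tree -/

namespace OS

open BTree

variable {P : Params}

theorem perm_some_none {α : Type*} (L : List (Option α)) :
    L.Perm ((L.filterMap id).map some ++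
      List.replicate (L.length - (L.filterMap id).length) none) := by
  induction L with
  | nil => simp
  | cons a L ih =>
      have h := List.length_filterMap_le id L
      cases a with
      | none =>
          have e : (none :: L).filterMap id = L.filterMap id := rfl
          rw [e, List.length_cons, Nat.succ_sub h, List.replicate_succ]
          exact (ih.cons none).trans List.perm_middle.symm
      | some a =>
          simp_all

namespace Geom

open Shuffle

/-- The cache of the level of the items. -/
noncomputable def itemCache (m : Mem P.W) : List (P.Word × Rec P) :=
  (List.range (2 * P.epoch)).map fun j =>
    Rec.decode ((arr (P := P)).row m (cacheStart P (P.depth + 1) + j))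

/-- Slot `p` of the memory is a cell of the array or, after those, of the cache for the items. This
is the item in the slot, if the slot is the valid version of its cell and holds an item. -/
noncomputable def collected (m : Mem P.W) (p : ℕ) : Option P.Item :=
  if p < P.arrayCells then
    match Rec.decode ((arr (P := P)).row m p), lookup P.epoch (P.word p) (itemCache m) with
    | (_, .item k v), none => some (k, v)
    | _, _ => none
  else match (itemCache m)[p - P.arrayCells]? with
    | some (a, .item k v) =>
        if ((itemCache m).drop (p - P.arrayCells + 1)).any fun c =>
          decide (c.1 = a) && !c.2.isBlank then none else some (k, v)
    | _ => none

/-- A row of table 0: an item after the flag 0, or the flag 1. -/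
noncomputable def itemRow : Option P.Item → List P.Word
  | some x => wrap ([P.word 0, x.1] ++ List.ofFn x.2)
  | none => wrap [P.word 1]

variable (G : Geom P)

theorem two_le_W (g : P.Good) : 2 ≤ P.W := by
  have h1 := arrayCells_lt g
  grind [Params.arrayCells, Params.treeCells]

theorem key2_itemRow_some (x : P.Item) : key2 (itemRow (some x)) = x.1.val := by
  rw [key2, itemRow, wrap_getD (by omega), wrap_getD (by omega)]
  simp [P.word_val P.W_pos]

theorem key2_itemRow_none (g : P.Good) : key2 (itemRow (P := P) none) = P.W := by
  rw [key2, itemRow, wrap_getD (by omega), wrap_getD (by omega)]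
  have := two_le_W g
  simp [P.word_val P.W_pos, P.word_val (show 1 < P.W by omega)]

theorem rows_tab_lt {p : ℕ} (hp : p < G.N) (i : ℕ) : p < (G.tab i).len := by
  grind [tab]

/-- Write the current versions of the items, from the array and the caches, to table 0. -/
noncomputable def collectStages : List (Stage P.W) :=
  G.fill (G.tab 0) G.N (fun i => ((List.range (2 * P.epoch)).map
    (fun j => cacheStart P (P.depth + 1) + j) ++ G.blockRows G.N i).flatMap
      ((arr (P := P)).rowAddrs P)) fun m p => itemRow (collected m p)

/-- Table 0 holds the items in `l` in this order, and no others. -/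
def Holds (l : List P.Item) (m : Mem P.W) : Prop :=
  ∀ p < G.N, (G.tab 0).row m p = itemRow l[p]?

theorem length_itemRow (x : Option P.Item) : (itemRow x).length = P.cellWords + 1 := by
  cases x <;> exact length_pad _ _

theorem holds_of_collect {m : Mem P.W} {l : List P.Item} (hs : l.Pairwise fun x y => x.1 < y.1)
    (hl : ((List.range G.N).filterMap (collected m)).Perm l) :
    ∀ m' ∈ (execLaw (G.collectStages ++ G.sortTable (G.tab 0) key2) m).support, G.Holds l m' := by
  intro m' hm'
  rw [execLaw_append, PMF.mem_support_bind_iff] at hm'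
  obtain ⟨m1, hm1, hm'⟩ := hm'
  obtain ⟨h1, -⟩ := G.execLaw_fill (G.tab_stop_le (by omega)) le_rfl
    (by simp only [tab]; omega) (fun p _ => length_itemRow _) (by
      intro m2 hm2 p hp
      have e1 : ∀ q, (q ∈ (List.range (2 * P.epoch)).map
          (fun j => cacheStart P (P.depth + 1) + j) ++ G.blockRows G.N (p / G.r)) →
          (arr (P := P)).row (Stage.restrict (((List.range (2 * P.epoch)).map
          (fun j => cacheStart P (P.depth + 1) + j) ++ G.blockRows G.N (p / G.r)).flatMap
          ((arr (P := P)).rowAddrs P)) m2) q = (arr (P := P)).row m q := by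
        intro q hq
        rw [Table.row_restrict _ fun a ha => List.mem_flatMap.2 ⟨q, hq, ha⟩, G.frame_row_arr hm2]
      have e2 : itemCache (Stage.restrict (((List.range (2 * P.epoch)).map
          (fun j => cacheStart P (P.depth + 1) + j) ++ G.blockRows G.N (p / G.r)).flatMap
          ((arr (P := P)).rowAddrs P)) m2) = itemCache m := by
        rw [itemCache, itemCache]
        simp_all
      rw [collected, collected, e2,
        e1 p (List.mem_append_right _ (G.mem_blockRows.2 ⟨hp, rfl⟩))]) m1 hm1
  have hlen : l.length ≤ G.N := by
    rw [← hl.length_eq]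
    grind
  set C : List (List P.Word) := l.map (fun x => itemRow (some x)) ++
    List.replicate (G.N - l.length) (itemRow none) with hC
  have hCget : ∀ p < G.N, C.getD p [] = itemRow l[p]? := by grind
  have hsort := G.execLaw_sortTable (G.tab_stop_le (i := 0) (by omega))
    (by simp only [tab]; omega) (κ := key2) (m := m1) (C := C) ?_ ?_ ?_ m' hm'
  · obtain ⟨h2, -⟩ := hsort
    intro p hp
    grind
  · have e : (List.range G.N).map ((G.tab 0).row m1) =
        ((List.range G.N).map (collected m)).map itemRow := by
      simp_all
    have h3 := (perm_some_none ((List.range G.N).map (collected m))).map itemRow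
    rw [List.filterMap_map, List.length_map, List.length_range, List.map_append, List.map_map,
      List.map_map, List.map_replicate] at h3
    have e3 : (List.range G.N).filterMap (id ∘ collected m) =
        (List.range G.N).filterMap (collected m) := rfl
    rw [e3, hl.length_eq] at h3
    rw [e, List.map_map]
    refine (List.Perm.append_right _ ?_).trans h3.symm
    exact (hl.map _).symm
  · rw [hC, List.pairwise_append, List.pairwise_map]
    refine ⟨?_, ?_, ?_⟩
    · grind [key2_itemRow_some]
    · grind
    · intro a ha b hb
      obtain ⟨x, -, rfl⟩ := List.mem_map.1 ha
      rw [List.eq_of_mem_replicate hb, key2_itemRow_some, key2_itemRow_none G.good]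
      omega
  · have hinj : ∀ x ∈ l, ∀ y ∈ l, x.1 = y.1 → x = y := by
      intro x hx y hy hxy
      have hnd : (l.map Prod.fst).Nodup := by grind
      exact List.inj_on_of_nodup_map hnd hx hy hxy
    intro a ha b hb hab
    rcases List.mem_append.1 ha with ha | ha <;> rcases List.mem_append.1 hb with hb | hb
    · grind [key2_itemRow_some]
    · obtain ⟨x, -, rfl⟩ := List.mem_map.1 ha
      rw [List.eq_of_mem_replicate hb, key2_itemRow_some, key2_itemRow_none G.good] at hab
      omega
    · obtain ⟨x, -, rfl⟩ := List.mem_map.1 hb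
      rw [List.eq_of_mem_replicate ha, key2_itemRow_some, key2_itemRow_none G.good] at hab
      omega
    · grind

theorem rK_le_W : G.r * G.K ≤ P.W := by
  have := G.rows_lt
  grind [N]

/-- The permutation given by the coins. -/
noncomputable def perm (β δ : List ℕ) : Equiv.Perm (Fin P.arrayCells) :=
  permOf P.arrayCells G.r G.K P.W β δ

/-- Row `y` of table 1 holds the destination of the cell `y`. -/
def Places (π : Equiv.Perm (Fin P.arrayCells)) (m : Mem P.W) : Prop :=
  ∀ y < P.arrayCells, m ((G.tab 1).addr P y 1) = rename π y

theorem Drawn.sort {G : Geom P} {m m' : Mem P.W} {β : List ℕ} (h : G.Drawn m G.K m' β) :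
    ∀ m2 ∈ (execLaw (G.sortTable (G.tab 1) key2) m').support,
      (∀ p < G.N, ((G.tab 1).row m2 p).getD 1 (P.word 0) =
        P.word ((byBucket G.r G.K P.W β).getD p 0)) ∧ (G.tab 1).Frame m' m2 := by
  intro m2 hm2
  have hrow : ∀ p < G.N, (G.tab 1).row m' p = wrap [P.word (β.getD p G.K), P.word p] :=
    fun p hp => h.rows p hp (G.div_lt_K hp)
  have hA := G.slots_le
  have hmem := h.mem
  rw [Nat.min_eq_right (by rwa [mul_comm])] at hmem
  obtain ⟨hlen, hlt⟩ := length_of_draw hA hmem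
  have hlt' : ∀ p, β.getD p G.K < P.W := by
    intro p
    have := G.rows_lt
    by_cases hp : p < β.length
    · rw [List.getD_eq_getElem _ _ hp]
      have := hlt _ (List.getElem_mem hp)
      omega
    · grind
  have hNW : G.N < P.W := by have := G.rows_lt; omega
  have hkey : ∀ p < G.N, key2 (wrap [P.word (β.getD p G.K), P.word p]) = key G.K P.W β p := by
    intro p hp
    rw [key2, wrap_getD (by omega), wrap_getD (by omega), key]
    simp only [List.getD_cons_zero, List.getD_cons_succ]
    rw [P.word_val (hlt' p), P.word_val (by omega)]
  have hb : ∀ x ∈ byBucket G.r G.K P.W β, x < G.N := fun x hx =>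
    List.mem_range.1 ((byBucket_perm G.r G.K P.W β).mem_iff.1 hx)
  have hsort := G.execLaw_sortTable (G.tab_stop_le (i := 1) (by omega))
    (by simp only [tab]; omega) (κ := key2) (m := m')
    (C := (byBucket G.r G.K P.W β).map fun x => wrap [P.word (β.getD x G.K), P.word x])
    ?_ ?_ ?_ m2 hm2
  · obtain ⟨h1, -, h2⟩ := hsort
    refine ⟨fun p hp => ?_, h2⟩
    have hp' : p < (byBucket G.r G.K P.W β).length := by rw [length_byBucket]; exact hp
    have e : ((byBucket G.r G.K P.W β).map fun x => wrap [P.word (β.getD x G.K), P.word x]).getD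
        p [] = wrap [P.word (β.getD (byBucket G.r G.K P.W β)[p] G.K),
          P.word (byBucket G.r G.K P.W β)[p]] := by grind
    rw [h1 p hp, e, wrap_getD (by omega), List.getD_eq_getElem _ _ hp']
    rfl
  · refine ((byBucket_perm G.r G.K P.W β).map _).trans (List.Perm.of_eq ?_)
    refine List.map_congr_left fun p hp => (hrow p (List.mem_range.1 hp)).symm
  · rw [List.pairwise_map]
    refine List.Pairwise.imp_of_mem ?_ (byBucket_pairwise G.r G.K P.W β)
    grind
  · intro x hx y hy hxy
    obtain ⟨a, ha, rfl⟩ := List.mem_map.1 hx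
    obtain ⟨b, hb', rfl⟩ := List.mem_map.1 hy
    rw [hkey a (hb a ha), hkey b (hb b hb'), key, key] at hxy
    have e := congrArg (· % P.W) hxy
    simp only [Nat.mul_add_mod_self_right] at e
    rw [Nat.mod_eq_of_lt ((hb a ha).trans hNW), Nat.mod_eq_of_lt ((hb b hb').trans hNW)] at e
    rw [e]

theorem Permuted.sort {G : Geom P} {β δ : List ℕ} {m m' : Mem P.W}
    (hβ : β ∈ (draw G.K P.arrayCells (size P.arrayCells G.r)).support)
    (hm : ∀ p < G.N, ((G.tab 1).row m p).getD 1 (P.word 0) =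
      P.word ((byBucket G.r G.K P.W β).getD p 0)) (h : G.Permuted m G.K m' δ) :
    ∀ m2 ∈ (execLaw (G.sortTable (G.tab 1) key1) m').support,
      G.Places (G.perm β δ) m2 ∧ (G.tab 1).Frame m' m2 := by
  intro m2 hm2
  have hA := G.slots_le
  have hlen : (byBucket G.r G.K P.W β).length = G.N := length_byBucket _ _ _ _
  have hidx : ∀ y < G.N, (byBucket G.r G.K P.W β).idxOf y < (byBucket G.r G.K P.W β).length :=
    fun y hy => idxOf_byBucket_lt hy
  have hrow : ∀ y < G.N, (G.tab 1).row m' ((byBucket G.r G.K P.W β).idxOf y) =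
      wrap [P.word y, P.word (δ.getD ((byBucket G.r G.K P.W β).idxOf y)
        ((byBucket G.r G.K P.W β).idxOf y))] := by
    intro y hy
    have h1 := hidx y hy
    rw [h.rows _ (by omega), if_pos (G.div_lt_K (by omega)), hm _ (by omega),
      List.getD_eq_getElem _ _ h1, List.getElem_idxOf h1]
  obtain ⟨h1, -, h2⟩ := G.execLaw_sortTable_of_key_eq (G.tab_stop_le (i := 1) (by omega))
    (by simp only [tab]; omega) (κ := key1) (m := m')
    (τ := fun y => (byBucket G.r G.K P.W β).idxOf y) (fun y hy => by
      have := hidx y hy; omega) (fun y hy => by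
      rw [hrow y hy, key1, wrap_getD (by omega)]
      simp only [List.getD_cons_zero]
      exact P.word_val (by have := G.rows_lt; omega)) m2 hm2
  refine ⟨fun y hy => ?_, h2⟩
  have hw := two_le_cellWords (P := P)
  have hy' : y < G.N := hy.trans_le hA
  rw [← Table.row_getD (m := m2) (G.rows_tab_lt hy' 1)
      (show 1 < (G.tab 1).w by simp only [tab]; omega) (P.word 0), h1 y hy',
    hrow y hy', wrap_getD (by omega), rename, dif_pos hy, perm,
    permOf_apply G.r_pos hA G.rK_le_W hβ h.mem]
  obtain ⟨a1, a2, -⟩ := placeOf_lt G.r_pos hA G.rK_le_W hβ h.mem hy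
  grind

/-! ### Reading the sorted items and the destinations -/

/-- Whether row `i` of the sorted table 0 holds an item. -/
noncomputable def live (m : Mem P.W) (i : ℕ) : Bool :=
  decide (i < P.n ∧ m ((G.tab 0).addr P i 0) = P.word 0)

/-- The key in row `i` of table 0. -/
noncomputable def keyAt (m : Mem P.W) (i : ℕ) : P.Word :=
  if G.live m i then m ((G.tab 0).addr P i 1) else P.word 0

/-- The value in row `i` of table 0. -/
noncomputable def valAt (m : Mem P.W) (i : ℕ) : P.Val :=
  if G.live m i then fun j => m ((G.tab 0).addr P i (2 + j)) else fun _ => P.word 0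

/-- The new name of the cell `y`, from table 1; the names of cells outside of the array stay. -/
noncomputable def ptr (m : Mem P.W) (y : ℕ) : P.Word :=
  if y < P.arrayCells then m ((G.tab 1).addr P y 1) else P.word y

theorem n_le_arrayCells : P.n ≤ P.arrayCells := by
  rw [Params.arrayCells, Params.treeCells]; omega

theorem Holds.eqs {G : Geom P} {l : List P.Item} {m : Mem P.W} (h : G.Holds l m)
    (hl : l.length ≤ P.n) : G.live m = liveOf l ∧ G.keyAt m = keyOf l ∧ G.valAt m = valOf l := by
  have hw : P.branch + 2 < P.cellWords + 1 := by rw [Params.cellWords]; omega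
  have hn := (n_le_arrayCells (P := P)).trans G.slots_le
  have hget : ∀ i < P.n, ∀ j < P.cellWords + 1, m ((G.tab 0).addr P i j) =
      (itemRow l[i]?).getD j (P.word 0) := by
    intro i hi j hj
    rw [← h i (by omega), Table.row_getD (G.rows_tab_lt (by omega) 0) hj]
  have hlive : G.live m = liveOf l := by
    funext i
    rw [live, liveOf]
    congr 1
    rw [eq_iff_iff]
    constructor
    · rintro ⟨h1, h2⟩
      by_contra h3
      rw [hget i h1 0 (by omega), List.getElem?_eq_none (by omega), itemRow,
        wrap_getD (by omega)] at h2
      simp only [List.getD_cons_zero] at h2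
      have := P.word_inj (by have := two_le_W G.good; omega) P.W_pos h2
      omega
    · intro h1
      refine ⟨by omega, ?_⟩
      rw [hget i (by omega) 0 (by omega), List.getElem?_eq_getElem h1, itemRow,
        wrap_getD (by omega)]
      simp
  refine ⟨hlive, ?_, ?_⟩
  · funext i
    rw [keyAt, hlive]
    by_cases h1 : i < l.length
    · rw [if_pos (by simpa [liveOf] using h1), hget i (by omega) 1 (by omega),
        List.getElem?_eq_getElem h1, itemRow, wrap_getD (by omega), keyOf_eq h1]
      simp
    · rw [if_neg (by simpa [liveOf] using h1), keyOf, List.getElem?_eq_none (by omega)]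
      rfl
  · funext i
    rw [valAt, hlive]
    by_cases h1 : i < l.length
    · rw [if_pos (by simpa [liveOf] using h1), valOf_eq h1]
      funext j
      have hj := j.isLt
      rw [hget i (by omega) _ (by omega), List.getElem?_eq_getElem h1, itemRow, wrap,
        pad_getD (by omega), List.getD_eq_getElem _ _ (by simp; omega)]
      grind
    · rw [if_neg (by simpa [liveOf] using h1), valOf, List.getElem?_eq_none (by omega)]
      rfl

theorem Places.ptr_eq {G : Geom P} {π : Equiv.Perm (Fin P.arrayCells)} {m : Mem P.W}
    (h : G.Places π m) : G.ptr m = rename π := by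
  funext y
  rw [ptr]
  split_ifs with hy
  · exact h y hy
  grind [rename]

/-- The new contents of the cell `x` after its new name. -/
noncomputable def placeRow (m : Mem P.W) (x : ℕ) : List P.Word :=
  if x < P.arrayCells then wrap (G.ptr m x :: Rec.encode (G.ptr m x)
    (cellAt (G.live m) (G.keyAt m) (G.valAt m) (G.ptr m) x))
  else wrap [P.word x]

/-- The addresses that `placeRow` depends on. -/
noncomputable def need (x : ℕ) : List P.Word :=
  [(G.tab 1).addr P x 1, (G.tab 1).addr P (x + 1) 1] ++
    match heightOf P x with
    | none => []
    | some 0 => (G.tab 0).rowAddrs P (x - levelOff P 0)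
    | some (h + 1) => (List.range (fan P)).flatMap fun c =>
        [(G.tab 0).addr P (((x - levelOff P (h + 1)) * fan P + c) * fan P ^ h) 0,
          (G.tab 0).addr P (((x - levelOff P (h + 1)) * fan P + c) * fan P ^ h) 1,
          (G.tab 1).addr P (levelOff P h + ((x - levelOff P (h + 1)) * fan P + c)) 1]

theorem length_need_le (x : ℕ) : (G.need x).length ≤ 4 * (P.cellWords + 1) := by
  have hf : 3 * fan P ≤ 2 * P.cellWords := by
    rw [fan, Params.cellWords]; omega
  have hw := two_le_cellWords (P := P)
  rw [need]
  rcases heightOf P x with - | - | h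
  · simp; omega
  · simp [Table.rowAddrs, tab]; omega
  · simp only [List.length_append, List.length_flatMap, List.length_cons, List.length_nil,
      List.map_const', List.length_range, List.sum_replicate, smul_eq_mul]
    omega

theorem placeRow_congr {m m' : Mem P.W} {x : ℕ}
    (h0 : ∀ i < P.n, ∀ j < P.cellWords + 1, (G.tab 0).addr P i j ∈ G.need x →
      m' ((G.tab 0).addr P i j) = m ((G.tab 0).addr P i j))
    (h1 : ∀ y < P.arrayCells, (G.tab 1).addr P y 1 ∈ G.need x →
      m' ((G.tab 1).addr P y 1) = m ((G.tab 1).addr P y 1)) :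
    G.placeRow m' x = G.placeRow m x := by
  have hw : P.branch + 2 < P.cellWords + 1 := by rw [Params.cellWords]; omega
  have hptr : ∀ y, (G.tab 1).addr P y 1 ∈ G.need x → G.ptr m' y = G.ptr m y := by
    grind [ptr]
  have hlive : ∀ i, (G.tab 0).addr P i 0 ∈ G.need x → G.live m' i = G.live m i := by
    grind [live]
  have hkey : ∀ i, (G.tab 0).addr P i 0 ∈ G.need x → (G.tab 0).addr P i 1 ∈ G.need x →
      G.keyAt m' i = G.keyAt m i := by
    intro i hi hi'
    rw [keyAt, keyAt, hlive i hi]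
    split_ifs with h
    · simp only [live, decide_eq_true_eq] at h
      grind
    · rfl
  rw [placeRow, placeRow, hptr x (by simp [need])]
  split_ifs with hx
  · congr 3
    rw [cellAt, cellAt, hptr (x + 1) (by simp [need])]
    split_ifs with ht
    · rfl
    · cases hh : heightOf P x with
      | none => rfl
      | some h =>
          obtain ⟨-, q, -, rfl⟩ := exists_of_heightOf hh
          simp only [Nat.add_sub_cancel_left]
          cases h with
          | zero =>
              have hmem : ∀ j < P.cellWords + 1,
                  (G.tab 0).addr P q j ∈ G.need (levelOff P 0 + q) := by
                intro j hj
                rw [need, hh]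
                refine List.mem_append_right _ ?_
                simp only [Nat.add_sub_cancel_left, Table.rowAddrs]
                exact List.mem_map.2 ⟨j, List.mem_range.2 hj, rfl⟩
              have hv : G.valAt m' q = G.valAt m q := by
                rw [valAt, valAt, hlive q (hmem 0 (by omega))]
                split_ifs with h
                · simp only [live, decide_eq_true_eq] at h
                  grind
                · rfl
              grind [nodeAt]
          | succ h =>
              have hmem : ∀ c < fan P,
                  (G.tab 0).addr P ((q * fan P + c) * fan P ^ h) 0 ∈
                    G.need (levelOff P (h + 1) + q) ∧
                  (G.tab 0).addr P ((q * fan P + c) * fan P ^ h) 1 ∈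
                    G.need (levelOff P (h + 1) + q) ∧
                  (G.tab 1).addr P (levelOff P h + (q * fan P + c)) 1 ∈
                    G.need (levelOff P (h + 1) + q) := by
                intro c hc
                rw [need, hh]
                simp only [Nat.add_sub_cancel_left]
                grind
              have hn : ∀ c < fan P, hasNode P (G.live m') h (q * fan P + c) =
                  hasNode P (G.live m) h (q * fan P + c) := fun c hc => by
                rw [hasNode, hasNode, hlive _ (hmem c hc).1]
              have hn0 : hasNode P (G.live m') (h + 1) q = hasNode P (G.live m) (h + 1) q := by
                have e : q * fan P ^ (h + 1) = (q * fan P + 0) * fan P ^ h := by ring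
                rw [hasNode, hasNode, e, hlive _ (hmem 0 (fan_pos G.good)).1]
              rw [nodeAt, nodeAt, hn0, kids, kids]
              have hfil : (List.range (fan P)).filter
                  (fun c => hasNode P (G.live m') h (q * fan P + c)) =
                  (List.range (fan P)).filter fun c => hasNode P (G.live m) h (q * fan P + c) :=
                List.filter_congr fun c hc => hn c (List.mem_range.1 hc)
              rw [hfil]
              have hmap : ((List.range (fan P)).filter
                  (fun c => hasNode P (G.live m) h (q * fan P + c))).map (fun c =>
                  (sep (G.keyAt m') h (q * fan P + c),
                    G.ptr m' (levelOff P h + (q * fan P + c)))) =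
                  ((List.range (fan P)).filter
                  (fun c => hasNode P (G.live m) h (q * fan P + c))).map (fun c =>
                  (sep (G.keyAt m) h (q * fan P + c),
                    G.ptr m (levelOff P h + (q * fan P + c)))) := by
                refine List.map_congr_left fun c hc => ?_
                grind [sep]
              rw [hmap]
  · rfl

theorem relabel_cellAt (g : P.Good) (π : Equiv.Perm (Fin P.arrayCells)) {l : List P.Item}
    (hl : l.length ≤ P.n) {x : ℕ} (hx : x < P.arrayCells) : relabel π (layout l (P.word x)) =
      cellAt (liveOf l) (keyOf l) (valOf l) (rename π) x := by
  have hW := arrayCells_lt g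
  rw [layout, P.word_val (by omega), cellAt, cellAt]
  split_ifs with ht
  · simp only [relabel]
    rw [P.word_val (by omega)]
  · cases hh : heightOf P x with
    | none => rfl
    | some h =>
        obtain ⟨hD, q, hq, rfl⟩ := exists_of_heightOf hh
        simp only [Nat.add_sub_cancel_left]
        cases h with
        | zero =>
            simp only [nodeAt]
            split_ifs <;> rfl
        | succ h =>
            simp only [nodeAt]
            split_ifs with hn
            · simp only [relabel, kids, List.map_map]
              congr 1
              refine List.map_congr_left fun c hc => ?_
              simp only [Function.comp]
              congr 2
              refine P.word_val ?_
              obtain ⟨hc1, hc2⟩ := List.mem_filter.1 hc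
              rw [List.mem_range] at hc1
              have h1 := levelOff_add_le_treeCells g (h := h + 1) (by omega)
              have h2 := arrayCells_lt g
              have h3 := treeCells_le (P := P)
              have h4 : q * fan P + c < levelLen P h := lt_levelLen g hl hc2
              have h5 := levelOff_add_le_treeCells g (h := h) (by omega)
              omega
            · rfl

end Geom

end OS

/-! ### The law of the program that builds the tree -/

namespace OS

open BTree Prog

variable {P : Params}

theorem cellAddrs_eq (a : ℕ) : cellAddrs P a = (Geom.arr (P := P)).rowAddrs P a := by
  simp [cellAddrs, Table.rowAddrs, Table.addr, Geom.arr]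

theorem length_encode (name : P.Word) (r : Rec P) : (Rec.encode name r).length = P.cellWords := by
  simp [Rec.encode, List.length_take, List.length_append, List.length_replicate]

namespace Geom

open Shuffle

variable (G : Geom P)

/-- Write the cells, with their new names, to table 2. -/
noncomputable def placeStages : List (Stage P.W) :=
  G.fill (G.tab 2) G.N (fun i => (G.blockRows G.N i).flatMap G.need) G.placeRow

/-- Copy the sorted cells to the array. -/
noncomputable def copyStages : List (Stage P.W) :=
  G.fill (arr (P := P)) P.arrayCells (fun i => (G.blockRows P.arrayCells i).flatMap ((G.tab 2).rowAddrs P))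
    fun m p => ((G.tab 2).row m p).tail

theorem length_placeRow (m : Mem P.W) (x : ℕ) :
    (G.placeRow m x).length = P.cellWords + 1 := by
  rw [placeRow]
  split_ifs <;> exact length_pad _ _

theorem addr_frame {i j : ℕ} (hj : j < 3) (hij : i ≠ j) {m m' : Mem P.W}
    (hf : (G.tab i).Frame m m') {p q : ℕ} (hp : p < G.N) (hq : q < P.cellWords + 1) :
    m' ((G.tab j).addr P p q) = m ((G.tab j).addr P p q) := by
  have hq' : q < (G.tab j).w := by simpa only [tab] using hq
  rw [← Table.row_getD (m := m') (G.rows_tab_lt hp j) hq' (P.word 0),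
    ← Table.row_getD (m := m) (G.rows_tab_lt hp j) hq' (P.word 0), G.frame_row_tab hj hij hf]

/-- The array holds the shuffled tree, and the first row of table 1 that the client needs in order
to start is in place. -/
structure Built (l : List P.Item) (π : Equiv.Perm (Fin P.arrayCells)) (m : Mem P.W) : Prop where
  array : arrayOf m = shuffled (layout l) π
  places : G.Places π m

theorem Holds.place {G : Geom P} {l : List P.Item} {π : Equiv.Perm (Fin P.arrayCells)}
    {m : Mem P.W} (h : G.Holds l m) (hl : l.length ≤ P.n) (hπ : G.Places π m) :
    ∀ m' ∈ (execLaw (G.placeStages ++ G.sortTable (G.tab 2) key1 ++ G.copyStages) m).support,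
      G.Built l π m' := by
  intro m3 hm3
  rw [execLaw_append, PMF.mem_support_bind_iff] at hm3
  obtain ⟨m2, hm2, hm3⟩ := hm3
  rw [execLaw_append, PMF.mem_support_bind_iff] at hm2
  obtain ⟨m1, hm1, hm2⟩ := hm2
  have hA := G.slots_le
  have hn := n_le_arrayCells (P := P)
  have hw := two_le_cellWords (P := P)
  have hNW := G.rows_lt
  have htab : G.N ≤ (G.tab 2).len := by simp only [tab]; omega
  obtain ⟨e1, e2, e3⟩ := h.eqs hl
  obtain ⟨h1, f1⟩ := G.execLaw_fill (G.tab_stop_le (by omega)) le_rfl htab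
    (fun p _ => G.length_placeRow _ _) (by
      intro m' hm' p hp
      have hin : ∀ a ∈ G.need p, a ∈ (G.blockRows G.N (p / G.r)).flatMap G.need := fun a ha =>
        List.mem_flatMap.2 ⟨p, G.mem_blockRows.2 ⟨hp, rfl⟩, ha⟩
      refine G.placeRow_congr (fun i hi j hj hmem => ?_) fun y hy hmem => ?_
      · rw [Stage.restrict_of_mem (hin _ hmem)]
        exact G.addr_frame (by omega) (by omega) hm' (by omega) hj
      · rw [Stage.restrict_of_mem (hin _ hmem)]
        exact G.addr_frame (by omega) (by omega) hm' (by omega) (by omega)) m1 hm1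
  have hrow : ∀ p < G.N, (G.tab 2).row m1 p = G.placeRow m p := fun p hp => by
    grind
  have hrowA : ∀ x (hx : x < P.arrayCells), G.placeRow m x =
      P.word (π ⟨x, hx⟩).val :: Rec.encode (P.word (π ⟨x, hx⟩).val)
        (relabel π (layout l (P.word x))) := by
    intro x hx
    rw [placeRow, if_pos hx, relabel_cellAt G.good π hl hx, e1, e2, e3, hπ.ptr_eq]
    grind [wrap, pad_of_length, rename, List.length_cons, length_encode]
  obtain ⟨h2, -, f2⟩ := G.execLaw_sortTable_of_key_eq (G.tab_stop_le (i := 2) (by omega)) htab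
    (κ := key1) (m := m1)
    (τ := fun y => if hy : y < P.arrayCells then (π.symm ⟨y, hy⟩).val else y)
    (fun y hy => by
      grind)
    (fun y hy => by
      split_ifs with h
      · have := (π.symm ⟨y, h⟩).isLt
        rw [hrow _ (by omega), hrowA _ this, key1]
        simp only [Fin.eta, Equiv.apply_symm_apply, List.getD_cons_zero]
        exact P.word_val (by omega)
      · rw [hrow _ hy, placeRow, if_neg h, key1, wrap_getD (by omega)]
        exact P.word_val (by omega)) m2 hm2
  have hrow2 : ∀ a : Fin P.arrayCells, ((G.tab 2).row m2 a).tail = shuffled (layout l) π a := by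
    intro a
    have h3 := (π.symm a).isLt
    rw [h2 _ (by omega), dif_pos a.isLt, hrow _ (by omega), hrowA _ h3]
    simp only [Fin.eta, Equiv.apply_symm_apply, List.tail_cons]
    rfl
  have hlim : P.arrayCells ≤ (arr (P := P)).len := Nat.le_add_right _ _
  obtain ⟨h4, f3⟩ := G.execLaw_fill (arr_limit_le G.good) hA hlim (by
      intro p hp
      rw [List.length_tail, Table.length_row (by omega)]
      rfl) (by
      intro m' hm' p hp
      rw [Table.row_restrict _ fun a ha => List.mem_flatMap.2
        ⟨p, G.mem_blockRows.2 ⟨hp, rfl⟩, ha⟩,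
        hm'.row (G.tab_stop_le (by omega)) (Or.inl (G.arr_disj 2))]) m3 hm3
  refine ⟨?_, fun y hy => ?_⟩
  · grind [arrayOf, cellAddrs_eq, Table.row]
  · rw [← hπ y hy]
    have hq' : 1 < (G.tab 1).w := by simp only [tab]; omega
    rw [← Table.row_getD (m := m3) (G.rows_tab_lt (hy.trans_le hA) 1) hq' (P.word 0),
      f3.row (G.tab_stop_le (by omega)) (Or.inl (G.arr_disj 1)),
      Table.row_getD (m := m2) (G.rows_tab_lt (hy.trans_le hA) 1) hq' (P.word 0),
      G.addr_frame (by omega) (by omega) f2 (by omega) (by omega),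
      G.addr_frame (by omega) (by omega) f1 (by omega) (by omega)]

/-- All stages of the program that builds the tree: collect the valid items and sort them by key;
draw a bucket for each cell, sort by bucket and permute each bucket; look up the destinations of
the cells and their children, and sort the cells by destination. -/
noncomputable def stages : List (Stage P.W) :=
  (G.collectStages ++ G.sortTable (G.tab 0) key2) ++ (G.drawStages ++
    (G.sortTable (G.tab 1) key2 ++ ((List.range G.K).map G.permStage ++
      (G.sortTable (G.tab 1) key1 ++
        (G.placeStages ++ G.sortTable (G.tab 2) key1 ++ G.copyStages)))))

theorem Holds.frame {G : Geom P} {l : List P.Item} {m m' : Mem P.W} (h : G.Holds l m)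
    (hf : (G.tab 1).Frame m m') : G.Holds l m' := fun p hp => by
  rw [G.frame_row_tab (by omega) (by omega) hf]; exact h p hp

theorem coupled_stages {m : Mem P.W} {l : List P.Item} (hs : l.Pairwise fun x y => x.1 < y.1)
    (hl : l.length ≤ P.n) (hm : ((List.range G.N).filterMap (collected m)).Perm l) :
    Coupled (fun m' π => G.Built l π m') (execLaw G.stages m)
      (PMF.uniformOfFintype (Equiv.Perm (Fin P.arrayCells))) := by
  rw [← bind_permOf G.r_pos G.slots_le G.rK_le_W, stages, execLaw_append]
  have e := PMF.pure_bind () fun _ : Unit =>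
    (draw G.K P.arrayCells (size P.arrayCells G.r)).bind fun β =>
      (permDraw P.arrayCells G.r G.K).map (permOf P.arrayCells G.r G.K P.W β)
  rw [← e]
  refine (Coupled.pure_right (Φ := fun m' _ => G.Holds l m')
    (G.holds_of_collect hs hm)).bind fun m1 _ h1 => ?_
  rw [execLaw_append]
  refine (G.coupled_drawStages m1).bind fun m2 β h2 => ?_
  have h2' := h1.frame h2.frame
  rw [execLaw_append]
  have hβ := h2.mem
  rw [Nat.min_eq_right (by have := G.slots_le; rwa [N, mul_comm] at this)] at hβ
  have e := PMF.pure_bind () fun _ : Unit =>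
      (permDraw P.arrayCells G.r G.K).map (permOf P.arrayCells G.r G.K P.W β)
  rw [← e]
  refine (Coupled.pure_right (Φ := fun m3 _ => (∀ p < G.N,
    ((G.tab 1).row m3 p).getD 1 (P.word 0) = P.word ((byBucket G.r G.K P.W β).getD p 0)) ∧
      (G.tab 1).Frame m2 m3) h2.sort).bind fun m3 _ h3 => ?_
  rw [execLaw_append, PMF.map]
  refine (G.coupled_permStages m3).bind fun m4 δ h4 => ?_
  refine Coupled.pure_right fun m6 hm6 => ?_
  rw [execLaw_append, PMF.mem_support_bind_iff] at hm6
  obtain ⟨m5, hm5, hm6⟩ := hm6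
  obtain ⟨h5, f5⟩ := h4.sort hβ h3.1 m5 hm5
  exact (((h2'.frame h3.2).frame h4.frame).frame f5).place hl h5 m6 hm6

/-- The addresses of the new names of the root and of the first dummy. -/
noncomputable def startAddrs : List P.Word :=
  [(G.tab 1).addr P 0 1, (G.tab 1).addr P P.treeCells 1]

/-- The program that builds the tree, at the beginning and at the end of each epoch. -/
noncomputable def build : Prog P.W (State P) :=
  (runStages P.B G.stages).bind fun _ => (fetch G.startAddrs).bind fun l =>
    ret { root := l.getD 0 (P.word 0), next := l.getD 1 (P.word 0), time := P.word 0 }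

/-- What the server observes of the program; it does not depend on the memory or the coins. -/
noncomputable def buildTrace : List (Event P.W) :=
  G.stages.flatMap (Stage.trace P.B) ++ [Event.read G.startAddrs]

theorem two_le_B (g : P.Good) : 2 ≤ P.B := by
  have h1 := g.block
  have h2 := two_le_cellWords (P := P)
  omega

theorem run_build (m : Mem P.W) : G.build.run m = (execLaw G.stages m).map fun m' =>
    ({ root := m' ((G.tab 1).addr P 0 1), next := m' ((G.tab 1).addr P P.treeCells 1),
       time := P.word 0 }, m', G.buildTrace) := by
  rw [build, run_bind, run_runStages (two_le_B G.good), PMF.bind_map, ← PMF.bind_pure_comp]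
  congr 1
  funext m'
  simp only [Function.comp]
  rw [run_bind_of_pure (run_fetch _ _)]
  simp [run, PMF.pure_map, startAddrs, buildTrace]

theorem treeCells_lt (g : P.Good) : P.treeCells < P.arrayCells := by
  rw [Params.arrayCells]
  have := Nat.mul_pos (show 0 < P.levels by rw [Params.levels]; omega) g.epoch_pos
  omega

/-- Building from a memory in which the valid items are `l` gives the tree for `l`, shuffled by a
uniform permutation. -/
theorem coupled_build {m : Mem P.W} {l : List P.Item} (hs : l.Pairwise fun x y => x.1 < y.1)
    (hl : l.length ≤ P.n) (hm : ((List.range G.N).filterMap (collected m)).Perm l) :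
    Coupled (fun y π => y.1 = startState π ∧ arrayOf y.2.1 = shuffled (layout l) π ∧
      y.2.2 = G.buildTrace) (G.build.run m)
      (PMF.uniformOfFintype (Equiv.Perm (Fin P.arrayCells))) := by
  rw [run_build, ← PMF.map_id (PMF.uniformOfFintype (Equiv.Perm (Fin P.arrayCells)))]
  refine (G.coupled_stages hs hl hm).map fun m' π h => ⟨?_, h.array, rfl⟩
  have h1 := treeCells_lt G.good
  simp only [startState, id]
  rw [h.places _ h1, h.places 0 (by omega)]

/-! ### The cost of the program -/

theorem fits_of_le {s : Stage P.W} (hi : s.ins.length ≤ 4 * (G.r + G.K + 2 * P.epoch) * (P.cellWords + 1))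
    (ho : s.outs.length ≤ 4 * (G.r + G.K + 2 * P.epoch) * (P.cellWords + 1)) :
    s.Fits P.B G.Q := ⟨hi.trans G.fits, ho.trans G.fits⟩

theorem length_flatMap_le {α β : Type*} (L : List α) (f : α → List β) (k c : ℕ) (hL : L.length ≤ k)
    (h : ∀ a ∈ L, (f a).length ≤ c) : (L.flatMap f).length ≤ k * c := by
  rw [List.length_flatMap]
  refine (List.sum_le_card_nsmul _ c ?_).trans ?_
  · grind
  · rw [List.length_map, smul_eq_mul]
    exact Nat.mul_le_mul_right _ hL

theorem length_rowAddrs (T : Table) (p : ℕ) : (T.rowAddrs P p).length = T.w := by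
  simp [Table.rowAddrs]

theorem fits_of_mem_fill {T : Table} (hT : T.w ≤ P.cellWords + 1) {lim : ℕ} {ins : ℕ → List P.Word}
    {val : Mem P.W → ℕ → List P.Word}
    (h : ∀ i, (ins i).length ≤ 4 * (G.r + G.K + 2 * P.epoch) * (P.cellWords + 1)) :
    ∀ s ∈ G.fill T lim ins val, s.Fits P.B G.Q := by
  intro s hs
  obtain ⟨i, -, rfl⟩ := List.mem_map.1 hs
  refine G.fits_of_le (h i) ((length_flatMap_le _ _ _ _ (G.length_blockRows_le _ _)
    fun p _ => (length_rowAddrs T p).le.trans hT).trans ?_)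
  grind

theorem fits_of_mem_sortTable {T : Table} (hT : T.w ≤ P.cellWords + 1) {κ : List P.Word → ℕ} :
    ∀ s ∈ G.sortTable T κ, s.Fits P.B G.Q := by
  intro s hs
  obtain ⟨L, hL, rfl⟩ := List.mem_map.1 hs
  have h := (length_flatMap_le L (T.rowAddrs P) _ _ (G.net_spec L hL).1.le
    fun p _ => (length_rowAddrs T p).le.trans hT).trans (Nat.mul_le_mul_right (P.cellWords + 1)
      (show G.r ≤ 4 * (G.r + G.K + 2 * P.epoch) by omega))
  exact G.fits_of_le h h

theorem fits_of_mem_stages : ∀ s ∈ G.stages, s.Fits P.B G.Q := by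
  have hw : ∀ i, (G.tab i).w ≤ P.cellWords + 1 := fun i => le_rfl
  have hc : ((List.range G.K).map fun j => G.N + j).length ≤ G.K := by simp
  intro s hs
  simp only [stages, List.mem_append] at hs
  obtain (hs | hs) | hs | hs | hs | hs | (hs | hs) | hs := hs
  · refine G.fits_of_mem_fill (hw 0) (fun i => ?_) s hs
    refine (length_flatMap_le _ _ (2 * P.epoch + G.r) (P.cellWords + 1) ?_ fun p _ => ?_).trans ?_
    · rw [List.length_append, List.length_map, List.length_range]
      exact Nat.add_le_add_left (G.length_blockRows_le _ _) _
    · exact (length_rowAddrs _ p).le.trans (Nat.le_succ _)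
    grind
  · exact G.fits_of_mem_sortTable (hw 0) s hs
  · rw [drawStages, List.mem_cons] at hs
    rcases hs with rfl | hs
    · refine G.fits_of_le (by simp [initCounters, Table.stage]) ?_
      refine (length_flatMap_le _ _ _ _ hc fun p _ => (length_rowAddrs _ p).le).trans ?_
      exact Nat.mul_le_mul_right _ (by omega)
    · obtain ⟨i, -, rfl⟩ := List.mem_map.1 hs
      refine G.fits_of_le ?_ ?_
      · refine (length_flatMap_le _ _ _ _ hc fun p _ => (length_rowAddrs _ p).le).trans ?_
        exact Nat.mul_le_mul_right _ (by omega)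
      · refine (length_flatMap_le _ _ (G.r + G.K) _ ?_ fun p _ => (length_rowAddrs _ p).le).trans ?_
        · rw [List.length_append]
          exact Nat.add_le_add (G.length_blockRows_le _ _) hc
        · exact Nat.mul_le_mul_right _ (by omega)
  · exact G.fits_of_mem_sortTable (hw 1) s hs
  · obtain ⟨i, -, rfl⟩ := List.mem_map.1 hs
    have h := (length_flatMap_le (G.blockRows G.N i) ((G.tab 1).rowAddrs P) _ _
      (G.length_blockRows_le _ _) fun p _ => (length_rowAddrs _ p).le).trans
        (Nat.mul_le_mul_right (P.cellWords + 1)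
          (show G.r ≤ 4 * (G.r + G.K + 2 * P.epoch) by omega))
    exact G.fits_of_le h h
  · exact G.fits_of_mem_sortTable (hw 1) s hs
  · refine G.fits_of_mem_fill (hw 2) (fun i => ?_) s hs
    refine (length_flatMap_le _ _ _ _ (G.length_blockRows_le _ _)
      fun p _ => G.length_need_le p).trans ?_
    grind
  · exact G.fits_of_mem_sortTable (hw 2) s hs
  · refine G.fits_of_mem_fill (Nat.le_succ _) (fun i => ?_) s hs
    refine (length_flatMap_le _ _ _ _ (G.length_blockRows_le _ _)
      fun p _ => (length_rowAddrs _ p).le).trans ?_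
    exact Nat.mul_le_mul_right _ (by omega)

theorem length_stages_le : G.stages.length ≤ 70 * G.K := by
  have h1 := G.length_net_le
  have h2 := G.K_pos
  simp only [stages, collectStages, sortTable, drawStages, placeStages, copyStages, fill,
    List.length_append, List.length_map, List.length_cons, List.length_range]
  omega

theorem length_buildTrace_le : G.buildTrace.length ≤ 70 * G.K * (2 * G.Q + 2) + 1 := by
  rw [buildTrace, List.length_append, List.length_singleton]
  exact Nat.add_le_add_right (length_flatMap_le _ _ _ _ G.length_stages_le
    fun s hs => (G.fits_of_mem_stages s hs).length_trace_le) 1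

theorem blockBound_build : G.build.BlockBound P.B :=
  BlockBound.bind (blockBound_runStages _ _) fun _ =>
    BlockBound.bind (blockBound_fetch (by simpa [startAddrs] using two_le_B G.good)) fun _ => trivial

theorem small_build : Small G.build (20 * (G.Q + 1) ^ 2 * P.B + 20) 2 := by
  have hW := two_le_W G.good
  have hτ : G.stages.length + 1 ≤ P.W ^ 8 := by
    have h1 := G.length_stages_le
    have h2 := G.rows_lt
    have h3 := G.K_pos
    have h4 : 71 * P.W ≤ P.W ^ 8 := by
      have h5 : 2 ^ 7 ≤ P.W ^ 7 := Nat.pow_le_pow_left hW 7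
      rw [pow_succ]
      exact Nat.mul_le_mul_right _ (by omega)
    omega
  have h1 := small_runStages hW (two_le_B G.good) G.fits_of_mem_stages hτ
  have h2 := Small.bind hW h1 fun _ _ => Small.bind hW (small_fetch hW G.startAddrs) fun l _ =>
    small_ret (State.mk (l.getD 0 (P.word 0)) (l.getD 1 (P.word 0)) (P.word 0)) 0 0 hW
  refine h2.mono hW ?_ ?_
  · simp [startAddrs]
  · simp [startAddrs]

end Geom

end OS

/-! ### Reading cells and caches -/

namespace OS

open BTree Prog

variable {P : Params}

namespace Rec

/-- The cell fits in its words. -/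
def Wf : Rec P → Prop
  | node es => es.length ≤ P.branch
  | _ => True

theorem pairs_flatMap (es : List (P.Word × P.Word)) :
    pairs (es.flatMap fun e => [e.1, e.2]) = es := by
  induction es with
  | nil => rfl
  | cons e es ih =>
      simp only [List.flatMap_cons, List.cons_append, List.nil_append, pairs, ih]

theorem take_pad {α : Type*} (l l' : List α) {k : ℕ} (h : l.length ≤ k) :
    (l ++ l').take k = l ++ l'.take (k - l.length) := by
  rw [List.take_append, List.take_of_length_le h]

theorem decode_encode (g : P.Good) (a : P.Word) {r : Rec P} (h : r.Wf) :
    decode (encode a r) = (a, r) := by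
  have hW : P.branch + 5 < P.W := by
    have h1 := g.words
    have h2 := g.two_le
    have h3 : 5 ≤ P.arrayCells := by rw [Params.arrayCells, Params.treeCells]; omega
    have h4 : P.arrayCells * P.cellWords ≤ P.W :=
      (Nat.mul_le_mul_right _ (Nat.le_add_right _ _)).trans h1
    rw [Params.cellWords] at h4
    nlinarith
  have w0 := P.word_val (show 0 < P.W by omega)
  have w1 := P.word_val (show 1 < P.W by omega)
  have w2 := P.word_val (show 2 < P.W by omega)
  have w3 := P.word_val (show 3 < P.W by omega)
  have w4 := P.word_val (show 4 < P.W by omega)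
  have hc : P.cellWords = 2 * P.branch + 2 + 1 := rfl
  cases r with
  | blank =>
      simp only [encode, hc, List.cons_append, List.nil_append, List.take_succ_cons,
        List.replicate_succ, decode, w0]
      simp
  | node es =>
      simp only [Wf] at h
      have hlen : (es.flatMap fun e => [e.1, e.2]).length = 2 * es.length := by
        simp [List.length_flatMap, mul_comm]
      simp only [encode, hc, List.cons_append, List.nil_append, List.take_succ_cons,
        decode, w1]
      rw [take_pad _ _ (by omega), P.word_val (by omega), List.take_append_of_le_length hlen.ge,
        List.take_of_length_le hlen.le, pairs_flatMap]
      simp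
  | item k v =>
      have hlen : (List.ofFn v).length = P.branch := List.length_ofFn
      simp only [encode, hc, List.cons_append, List.nil_append, List.take_succ_cons,
        decode, w2]
      rw [take_pad _ _ (by omega)]
      simp only [List.getD_eq_getElem?_getD]
      simp only [show ((2 : ℕ) = 1) = False by simp, if_false, if_true]
      congr 2
      grind
  | dummy x =>
      simp only [encode, hc, List.cons_append, List.nil_append, List.take_succ_cons,
        decode, w3]
      simp
  | gone =>
      simp only [encode, hc, List.cons_append, List.nil_append, List.take_succ_cons,
        List.replicate_succ, decode, w4]
      simp

end Rec

/-- The words of a cell in server memory, decoded. -/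
noncomputable def cellOf (m : Mem P.W) (a : ℕ) : P.Word × Rec P :=
  Rec.decode ((cellAddrs P a).map m)

/-- The cache of level `i` in server memory. -/
noncomputable def cacheOf (m : Mem P.W) (i : ℕ) : List (P.Word × Rec P) :=
  (List.range (2 * P.epoch)).map fun j => cellOf m (cacheStart P i + j)

theorem length_cellAddrs (a : ℕ) : (cellAddrs P a).length = P.cellWords := by simp [cellAddrs]

theorem run_readCell (a : ℕ) (m : Mem P.W) :
    (readCell P a).run m = PMF.pure (cellOf m a, m, [Event.read (cellAddrs P a)]) := by
  rw [readCell, monad_bind_eq, run_bind_of_pure (run_fetch _ _)]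
  simp [pure_eq_ret, run, PMF.pure_map, cellOf]

/-- The messages that fetch `len` words from the address `a` on. -/
def rangeAddrs (P : Params) (a len : ℕ) : List (List P.Word) :=
  (List.range ((len + P.B - 1) / P.B)).map fun j =>
    (List.range (min P.B (len - j * P.B))).map fun x => P.word (a + j * P.B + x)

theorem flatten_rangeAddrs (hB : 0 < P.B) (a len : ℕ) :
    (rangeAddrs P a len).flatten = (List.range len).map fun x => P.word (a + x) := by
  have h := flatten_range_chunks P.B ((len + P.B - 1) / P.B)
    ((List.range len).map fun x => P.word (a + x))
  rw [List.take_of_length_le (i := (len + P.B - 1) / P.B * P.B)] at h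
  · rw [← h, rangeAddrs]
    congr 1
    refine List.map_congr_left fun j _ => ?_
    apply List.ext_getElem
    · simp
    simp [add_assoc]
  · rw [List.length_map, List.length_range]
    have := Nat.lt_div_mul_add (a := len + P.B - 1) hB
    omega

theorem run_readRange (hB : 0 < P.B) (a len : ℕ) (m : Mem P.W) :
    (readRange P a len).run m = PMF.pure ((List.range len).map fun x => m (P.word (a + x)), m,
      (rangeAddrs P a len).map Event.read) := by
  have e : ∀ L : List ℕ, forList (fun j => fetch ((List.range (min P.B (len - j * P.B))).map
      fun x => P.word (a + j * P.B + x))) L = forList fetch (L.map fun j =>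
        (List.range (min P.B (len - j * P.B))).map fun x => P.word (a + j * P.B + x)) := by
    intro L
    induction L with
    | nil => rfl
    | cons j L ih => simp only [forList, List.map_cons, ih]
  have h : (forList fetch (rangeAddrs P a len)).run m = PMF.pure
      ((rangeAddrs P a len).map (List.map m), m, (rangeAddrs P a len).map Event.read) := by
    rw [run_forList_read (fun l _ => run_fetch l m)]
    congr 3
    exact List.flatMap_pure_eq_map _ _
  rw [readRange, e, monad_bind_eq, ← rangeAddrs, run_bind_of_pure h]
  simp only [pure_eq_ret, run, PMF.pure_map, List.append_nil]
  rw [← List.map_flatten, flatten_rangeAddrs hB]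
  simp [Function.comp_def]

/-- What the server observes when the cache of level `i` is read. -/
noncomputable def cacheTrace (P : Params) (i : ℕ) : List (Event P.W) :=
  (rangeAddrs P (cacheStart P i * P.cellWords) (2 * P.epoch * P.cellWords)).map Event.read

theorem run_readCache (hB : 0 < P.B) (i : ℕ) (m : Mem P.W) :
    (readCache P i).run m = PMF.pure (cacheOf m i, m, cacheTrace P i) := by
  rw [readCache, monad_bind_eq, run_bind_of_pure (run_readRange hB _ _ m)]
  simp only [pure_eq_ret, run, PMF.pure_map, List.append_nil]
  congr 2
  refine List.map_congr_left fun j hj => ?_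
  rw [List.mem_range] at hj
  rw [cellOf, cellAddrs]
  congr 1
  have hle : (j + 1) * P.cellWords ≤ 2 * P.epoch * P.cellWords := Nat.mul_le_mul_right _ hj
  rw [Nat.succ_mul] at hle
  apply List.ext_getElem
  · simp; omega
  · intro x h1 h2
    simp only [List.getElem_take, List.getElem_drop, List.getElem_map, List.getElem_range]
    grind

/-- The current version of the cell `a`, in a list of versions. -/
def find (a : P.Word) (cache : List (P.Word × Rec P)) : Option (Rec P) :=
  (cache.reverse.find? fun c => decide (c.1 = a) && !c.2.isBlank).map Prod.snd

theorem lookup_eq_find (t : ℕ) (a : P.Word) (cache : List (P.Word × Rec P)) :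
    lookup t a cache = find a (cache.take (2 * t)) := rfl

theorem find_append (a : P.Word) (L L' : List (P.Word × Rec P)) :
    find a (L ++ L') = (find a L').or (find a L) := by
  grind [find, List.reverse_append]

theorem find_singleton (a : P.Word) (c : P.Word × Rec P) :
    find a [c] = if c.1 = a ∧ c.2.isBlank = false then some c.2 else none := by
  simp [find]

/-- Renaming of words; the words that do not name cells of the array are fixed. -/
noncomputable def ren (π : Equiv.Perm (Fin P.arrayCells)) (a : P.Word) : P.Word := rename π a.val

theorem ren_val (g : P.Good) (π : Equiv.Perm (Fin P.arrayCells)) {a : P.Word}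
    (ha : a.val < P.arrayCells) : (ren π a).val = (π ⟨a.val, ha⟩).val := by
  have h1 := (π ⟨a.val, ha⟩).isLt
  have h2 := arrayCells_lt g
  rw [ren, rename, dif_pos ha, P.word_val (by omega)]

theorem ren_of_le (π : Equiv.Perm (Fin P.arrayCells)) {a : P.Word} (ha : P.arrayCells ≤ a.val) :
    ren π a = a := by
  grind [ren, rename, P.word_coe]

theorem ren_injective (g : P.Good) (π : Equiv.Perm (Fin P.arrayCells)) :
    Function.Injective (ren π) := by
  intro a b h
  by_cases ha : a.val < P.arrayCells <;> by_cases hb : b.val < P.arrayCells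
  · have e := congrArg Fin.val h
    rw [ren_val g π ha, ren_val g π hb] at e
    have := π.injective (Fin.ext e)
    grind
  · have e := congrArg Fin.val h
    rw [ren_val g π ha, ren_of_le π (by omega)] at e
    omega
  · have e := congrArg Fin.val h
    rw [ren_val g π hb, ren_of_le π (by omega)] at e
    omega
  · rwa [ren_of_le π (by omega), ren_of_le π (by omega)] at h

theorem relabel_node (π : Equiv.Perm (Fin P.arrayCells)) (es : List (P.Word × P.Word)) :
    relabel π (.node es) = .node (es.map fun e => (e.1, ren π e.2)) := rfl

/-- A cell with its name and all pointers renamed. -/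
noncomputable def relCell (π : Equiv.Perm (Fin P.arrayCells)) (c : P.Word × Rec P) :
    P.Word × Rec P := (ren π c.1, relabel π c.2)

theorem isBlank_relabel (π : Equiv.Perm (Fin P.arrayCells)) (r : Rec P) :
    (relabel π r).isBlank = r.isBlank := by cases r <;> rfl

theorem wf_relabel (π : Equiv.Perm (Fin P.arrayCells)) {r : Rec P} (h : r.Wf) :
    (relabel π r).Wf := by
  cases r <;> simp_all [relabel, Rec.Wf]

/-- The cell `c'` is `c` with its name and all pointers renamed; blank cells may have any names. -/
structure RelCell (π : Equiv.Perm (Fin P.arrayCells)) (c c' : P.Word × Rec P) : Prop where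
  rec_eq : c'.2 = relabel π c.2
  name_eq : c.2.isBlank = false → c'.1 = ren π c.1

theorem relCell_rel (π : Equiv.Perm (Fin P.arrayCells)) (c : P.Word × Rec P) :
    RelCell π c (relCell π c) := ⟨rfl, fun _ => rfl⟩

theorem find_rel (g : P.Good) {π : Equiv.Perm (Fin P.arrayCells)} {L L' : List (P.Word × Rec P)}
    (h : List.Forall₂ (RelCell π) L L') (a : P.Word) :
    find (ren π a) L' = (find a L).map (relabel π) := by
  induction h with
  | nil => rfl
  | @cons c c' L L' hc _ ih =>
      rw [← List.singleton_append, find_append, ih, ← List.singleton_append (l := L), find_append,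
        find_singleton, find_singleton, hc.rec_eq, isBlank_relabel]
      have e : (c'.1 = ren π a ∧ c.2.isBlank = false) ↔ (c.1 = a ∧ c.2.isBlank = false) := by
        constructor
        · rintro ⟨h1, h2⟩
          rw [hc.name_eq h2] at h1
          exact ⟨ren_injective g π h1, h2⟩
        · rintro ⟨h1, h2⟩
          rw [hc.name_eq h2, h1]
          grind
      grind

theorem child_relabel (π : Equiv.Perm (Fin P.arrayCells)) (k : P.Word) (r : Rec P) :
    child k (relabel π r) = (child k r).map (ren π) := by
  cases r with
  | node es =>
      grind [relabel_node, child, Option.map_map]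
  | _ => rfl

/-- A visit of a level in terms of the names before shuffling: the node with its name, the next
unused dummy, and the cell of the array that is read. The array holds `F`. -/
def visitA (F : P.Word → Rec P) (cache : List (P.Word × Rec P)) (cur : Option P.Word)
    (next : P.Word) : Option (P.Word × Rec P) × P.Word × P.Word :=
  match cur.bind fun a => (find a cache).map fun r => (a, r), cur with
  | none, some a => (some (a, F a), next, a)
  | x, _ => (x, (match F next with
      | .dummy y => y
      | _ => next), next)

/-- A search in terms of the names before shuffling. -/
def descendA (F : P.Word → Rec P) (caches : ℕ → List (P.Word × Rec P)) (k : P.Word) :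
    List ℕ → Option P.Word → P.Word → List (Option (P.Word × Rec P)) × P.Word × List P.Word
  | [], _, next => ([], next, [])
  | i :: is, cur, next =>
      let x := visitA F (caches i) cur next
      let rest := descendA F caches k is (x.1.bind fun c => child k c.2) x.2.1
      (x.1 :: rest.1, rest.2.1, x.2.2 :: rest.2.2)

/-- The server memory holds the cells `F`, shuffled by `π`, and caches that have been written `t`
times. -/
structure Rep (π : Equiv.Perm (Fin P.arrayCells)) (F : P.Word → Rec P)
    (caches : ℕ → List (P.Word × Rec P)) (t : ℕ) (m : Mem P.W) : Prop where
  array : ∀ x : P.Word, x.val < P.arrayCells → (cellOf m (ren π x).val).2 = relabel π (F x)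
  cache : ∀ i < P.levels, List.Forall₂ (RelCell π) (caches i) ((cacheOf m i).take (2 * t))

theorem run_readDummy {π : Equiv.Perm (Fin P.arrayCells)} {F : P.Word → Rec P}
    {caches : ℕ → List (P.Word × Rec P)} {t : ℕ} {m : Mem P.W} (h : Rep π F caches t m)
    {next : P.Word} (hn : next.val < P.arrayCells) : (readDummy P (ren π next)).run m =
      PMF.pure (ren π (match F next with
        | .dummy y => y
        | _ => next), m, [Event.read (cellAddrs P (ren π next).val)]) := by
  rw [readDummy, monad_bind_eq, run_bind_of_pure (run_readCell _ _), h.array next hn]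
  cases F next <;> (simp [relabel, pure_eq_ret, run, PMF.pure_map]; try rfl)

/-- What the server observes of a visit in which the cell `x` of the array is read. -/
noncomputable def visitTrace (P : Params) (i : ℕ) (x : P.Word) : List (Event P.W) :=
  cacheTrace P i ++ [Event.read (cellAddrs P x.val)]

theorem run_visit (g : P.Good) {π : Equiv.Perm (Fin P.arrayCells)} {F : P.Word → Rec P}
    {caches : ℕ → List (P.Word × Rec P)} {t : ℕ} {m : Mem P.W} (h : Rep π F caches t m)
    {i : ℕ} (hi : i < P.levels) {cur : Option P.Word} {next : P.Word}
    (hx : (visitA F (caches i) cur next).2.2.val < P.arrayCells) :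
    (visit t i (cur.map (ren π)) (ren π next)).run m =
      PMF.pure (((visitA F (caches i) cur next).1.map (relCell π),
        ren π (visitA F (caches i) cur next).2.1), m,
        visitTrace P i (ren π (visitA F (caches i) cur next).2.2)) := by
  have hB : 0 < P.B := by have := Geom.two_le_B g; omega
  rw [visit, monad_bind_eq, run_bind_of_pure (run_readCache hB _ _)]
  have hl : ∀ a, lookup t (ren π a) (cacheOf m i) = (find a (caches i)).map (relabel π) := by
    intro a
    rw [lookup_eq_find, find_rel g (h.cache i hi)]
  cases cur with
  | none =>
      simp only [Option.map_none, Option.bind_none, visitA] at hx ⊢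
      rw [monad_bind_eq, run_bind_of_pure (run_readDummy h hx)]
      simp [pure_eq_ret, run, PMF.pure_map, visitTrace]
  | some a =>
      simp only [Option.map_some, Option.bind_some, hl, visitA] at hx ⊢
      cases hf : find a (caches i) with
      | none =>
          simp only [hf, Option.map_none] at hx ⊢
          rw [monad_bind_eq, run_bind_of_pure (run_readCell _ _), h.array a hx]
          simp [pure_eq_ret, run, PMF.pure_map, visitTrace, relCell]
      | some r =>
          simp only [hf, Option.map_some] at hx ⊢
          rw [monad_bind_eq, run_bind_of_pure (run_readDummy h hx)]
          simp [pure_eq_ret, run, PMF.pure_map, visitTrace, relCell]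

/-- What the server observes of a search that reads the cells `xs` of the array. -/
noncomputable def descendTrace (P : Params) (is : List ℕ) (xs : List P.Word) : List (Event P.W) :=
  (List.zipWith (visitTrace P) is xs).flatten

theorem run_descend (g : P.Good) {π : Equiv.Perm (Fin P.arrayCells)} {F : P.Word → Rec P}
    {caches : ℕ → List (P.Word × Rec P)} {t : ℕ} {m : Mem P.W} (h : Rep π F caches t m)
    {k : P.Word} {is : List ℕ} (his : ∀ i ∈ is, i < P.levels) {cur : Option P.Word}
    {next : P.Word} (hx : ∀ x ∈ (descendA F caches k is cur next).2.2, x.val < P.arrayCells) :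
    (descend k t is (cur.map (ren π)) (ren π next)).run m =
      PMF.pure (((descendA F caches k is cur next).1.map (Option.map (relCell π)),
        ren π (descendA F caches k is cur next).2.1), m,
        descendTrace P is ((descendA F caches k is cur next).2.2.map (ren π))) := by
  induction is generalizing cur next with
  | nil => simp [descend, descendA, descendTrace, pure_eq_ret, run]
  | cons i is ih =>
      simp only [descendA] at hx ⊢
      have h1 := run_visit g h (his i (by simp)) (cur := cur) (next := next) (hx _ (by simp))
      have e : ((visitA F (caches i) cur next).1.map (relCell π)).bind (fun c => child k c.2) =
          ((visitA F (caches i) cur next).1.bind fun c => child k c.2).map (ren π) := by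
        cases (visitA F (caches i) cur next).1 with
        | none => rfl
        | some c => exact child_relabel π k c.2
      rw [descend, monad_bind_eq, run_bind_of_pure h1]
      simp only [e]
      rw [monad_bind_eq, run_bind_of_pure (ih (fun j hj => his j (by simp [hj]))
        (fun x hx' => hx x (by simp [hx'])))]
      simp [pure_eq_ret, run, PMF.pure_map, descendTrace]

end OS

/-! ### Updating the nodes of a search path -/

namespace OS

open BTree Prog

variable {P : Params}

namespace Change

/-- The change, applied to the entries of a node. -/
def apply : Change P → List (P.Word × P.Word) → List (P.Word × P.Word)
  | keep, es => es
  | remove k, es => es.filter fun e => e.1 ≠ k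
  | insert e, es => es.orderedInsert (fun x y => x.1 ≤ y.1) e

/-- The change with its pointer renamed by `π`. -/
noncomputable def rel (π : Equiv.Perm (Fin P.arrayCells)) : Change P → Change P
  | keep => keep
  | remove k => remove k
  | insert e => insert (e.1, ren π e.2)

theorem orderedInsert_map (f : P.Word → P.Word) (e : P.Word × P.Word)
    (es : List (P.Word × P.Word)) :
    (es.map fun x => (x.1, f x.2)).orderedInsert (fun x y => x.1 ≤ y.1) (e.1, f e.2) =
      (es.orderedInsert (fun x y => x.1 ≤ y.1) e).map fun x => (x.1, f x.2) := by
  induction es with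
  | nil => rfl
  | cons x es ih => grind

theorem apply_rel (π : Equiv.Perm (Fin P.arrayCells)) (ch : Change P)
    (es : List (P.Word × P.Word)) : (ch.rel π).apply (es.map fun e => (e.1, ren π e.2)) =
      (ch.apply es).map fun e => (e.1, ren π e.2) := by
  cases ch with
  | keep => rfl
  | remove k =>
      simp only [rel, apply, List.filter_map]
      rfl
  | insert e => exact orderedInsert_map _ _ _

theorem length_apply_le (ch : Change P) (es : List (P.Word × P.Word)) :
    (ch.apply es).length ≤ es.length + 1 := by
  cases ch with
  | keep => exact Nat.le_succ _
  | remove k => exact (List.length_filter_le _ _).trans (Nat.le_succ _)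
  | insert e => exact (List.orderedInsert_length _ _ _).le

end Change

/-- The two cells that are written to the cache of level `i`, and the change to the level above,
when the change `ch` is made to the visited node `c`. -/
noncomputable def climb1 (t i : ℕ) (c : Option (P.Word × Rec P)) (ch : Change P) :
    ((P.Word × Rec P) × (P.Word × Rec P)) × Change P :=
  match c with
  | some (a, .node es) =>
      if (ch.apply es).length ≤ P.branch then (((a, .node (ch.apply es)), blankCell), .keep)
      else (((a, .node ((ch.apply es).take ((ch.apply es).length / 2))),
        (freshName P i t, .node ((ch.apply es).drop ((ch.apply es).length / 2)))),
          match (ch.apply es).drop ((ch.apply es).length / 2) with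
          | e :: _ => .insert (e.1, freshName P i t)
          | [] => .keep)
  | c => ((c.getD blankCell, blankCell), .keep)

theorem climb_cons (t i : ℕ) (c : Option (P.Word × Rec P))
    (L : List (ℕ × Option (P.Word × Rec P))) (ch : Change P) :
    climb t ((i, c) :: L) ch = (i, (climb1 t i c ch).1) :: climb t L (climb1 t i c ch).2 := by
  rcases c with - | ⟨a, r⟩
  · rfl
  · cases r with
    | node es =>
        simp only [climb, climb1]
        cases ch <;> simp only [Change.apply] <;>
          split_ifs with h <;> (simp only [h, if_true, if_false]; try congr 2)
    | _ => rfl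

theorem climb_fst (t : ℕ) (L : List (ℕ × Option (P.Word × Rec P))) (ch : Change P) :
    (climb t L ch).map Prod.fst = L.map Prod.fst := by
  induction L generalizing ch with
  | nil => rfl
  | cons x L ih => rw [climb_cons, List.map_cons, ih]; rfl

theorem freshName_val (g : P.Good) {i t : ℕ} (hi : i < P.levels) (ht : t < P.epoch) :
    (freshName P i t).val = P.arrayCells + i * P.epoch + t := by
  have h1 := arrayCells_lt g
  have h2 : (i + 1) * P.epoch ≤ P.levels * P.epoch := Nat.mul_le_mul_right _ hi
  have h3 : P.levels * (2 * P.epoch) = 2 * (P.levels * P.epoch) := by ring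
  rw [Nat.succ_mul] at h2
  exact P.word_val (by omega)

theorem ren_freshName (g : P.Good) (π : Equiv.Perm (Fin P.arrayCells)) {i t : ℕ}
    (hi : i < P.levels) (ht : t < P.epoch) : ren π (freshName P i t) = freshName P i t :=
  ren_of_le π (by rw [freshName_val g hi ht]; omega)

theorem relCell_blank (π : Equiv.Perm (Fin P.arrayCells)) : RelCell π (blankCell (P := P)) blankCell :=
  ⟨rfl, fun h => by simp [blankCell, Rec.isBlank] at h⟩

theorem relCell_getD (π : Equiv.Perm (Fin P.arrayCells)) (c : Option (P.Word × Rec P)) :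
    RelCell π (c.getD blankCell) ((c.map (relCell π)).getD blankCell) := by
  cases c with
  | none => exact relCell_blank π
  | some c => exact relCell_rel π c

theorem climb1_rel (g : P.Good) (π : Equiv.Perm (Fin P.arrayCells)) {i t : ℕ} (hi : i < P.levels)
    (ht : t < P.epoch) (c : Option (P.Word × Rec P)) (ch : Change P) :
    RelCell π (climb1 t i c ch).1.1 (climb1 t i (c.map (relCell π)) (ch.rel π)).1.1 ∧
      RelCell π (climb1 t i c ch).1.2 (climb1 t i (c.map (relCell π)) (ch.rel π)).1.2 ∧
      (climb1 t i (c.map (relCell π)) (ch.rel π)).2 = (climb1 t i c ch).2.rel π := by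
  rcases c with - | ⟨a, r⟩
  · exact ⟨relCell_blank π, relCell_blank π, rfl⟩
  · cases r with
    | node es =>
        simp only [Option.map_some, relCell, relabel_node, climb1, Change.apply_rel,
          List.length_map]
        split_ifs with h
        · exact ⟨⟨rfl, fun _ => rfl⟩, relCell_blank π, rfl⟩
        · refine ⟨⟨?_, fun _ => rfl⟩, ⟨?_, fun _ => (ren_freshName g π hi ht).symm⟩, ?_⟩
          · simp only [relabel_node, List.map_take]
          · simp only [relabel_node, List.map_drop]
          · rw [← List.map_drop]
            cases (ch.apply es).drop ((ch.apply es).length / 2) with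
            | nil => rfl
            | cons e L => simp only [List.map_cons, Change.rel, ren_freshName g π hi ht]
    | _ => exact ⟨⟨rfl, fun _ => rfl⟩, relCell_blank π, rfl⟩

theorem climb_rel (g : P.Good) (π : Equiv.Perm (Fin P.arrayCells)) {t : ℕ} (ht : t < P.epoch)
    {L : List (ℕ × Option (P.Word × Rec P))} (hL : ∀ x ∈ L, x.1 < P.levels) (ch : Change P) :
    List.Forall₂ (fun x y => y.1 = x.1 ∧ RelCell π x.2.1 y.2.1 ∧ RelCell π x.2.2 y.2.2)
      (climb t L ch) (climb t (L.map fun x => (x.1, x.2.map (relCell π))) (ch.rel π)) := by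
  induction L generalizing ch with
  | nil => exact List.Forall₂.nil
  | cons x L ih =>
      obtain ⟨h1, h2, h3⟩ := climb1_rel g π (hL x (by simp)) ht x.2 ch
      obtain ⟨i, c⟩ := x
      rw [List.map_cons, climb_cons, climb_cons, h3]
      simp_all

/-- What is visited fits in its cell. -/
def WfCell (c : Option (P.Word × Rec P)) : Prop := ∀ x ∈ c, x.2.Wf

theorem climb1_wf (g : P.Good) {t i : ℕ} {c : Option (P.Word × Rec P)} (hc : WfCell c)
    (ch : Change P) : (climb1 t i c ch).1.1.2.Wf ∧ (climb1 t i c ch).1.2.2.Wf := by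
  rcases c with - | ⟨a, r⟩
  · exact ⟨trivial, trivial⟩
  · have hr : r.Wf := hc _ rfl
    cases r with
    | node es =>
        simp only [climb1]
        split_ifs with h
        · exact ⟨h, trivial⟩
        · have h1 := ch.length_apply_le es
          have h2 := g.fan
          grind [Rec.Wf, List.length_take, List.length_drop]
    | _ => exact ⟨trivial, trivial⟩

theorem climb_wf (g : P.Good) {t : ℕ} {L : List (ℕ × Option (P.Word × Rec P))}
    (hL : ∀ x ∈ L, WfCell x.2) (ch : Change P) :
    ∀ x ∈ climb t L ch, x.2.1.2.Wf ∧ x.2.2.2.Wf := by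
  induction L generalizing ch with
  | nil => simp [climb]
  | cons y L ih =>
      have e : (y :: L : List (ℕ × Option (P.Word × Rec P))) = (y.1, y.2) :: L := rfl
      rw [e, climb_cons]
      intro x hx
      rcases List.mem_cons.1 hx with rfl | hx
      · exact climb1_wf g (hL y (by simp)) ch
      · grind

/-- The item with the given key, if this is what was visited. -/
def hitOf (c : Option (P.Word × Rec P)) (k : P.Word) : Option (P.Word × P.Val) :=
  match c with
  | some (a, .item k' v) => if k' = k then some (a, v) else none
  | _ => none

theorem resolve_eq (t : ℕ) (c : Option (P.Word × Rec P)) (o : Op P) : resolve t c o =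
    match o, hitOf c o.key with
    | .get k, some (a, v) => (.value v, ((a, .gone), blankCell), .remove k)
    | .get _, none => (.notFound, (c.getD blankCell, blankCell), .keep)
    | .put _ _, some _ => (.keyExists, (c.getD blankCell, blankCell), .keep)
    | .put k v, none => (.stored,
        (c.getD blankCell, (freshName P (P.depth + 1) t, .item k v)),
        .insert (k, freshName P (P.depth + 1) t)) := by
  rfl

theorem hitOf_rel (π : Equiv.Perm (Fin P.arrayCells)) (c : Option (P.Word × Rec P)) (k : P.Word) :
    hitOf (c.map (relCell π)) k = (hitOf c k).map fun x => (ren π x.1, x.2) := by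
  rcases c with - | ⟨a, r⟩
  · rfl
  · cases r with
    | item k' v =>
        simp only [hitOf, Option.map_some, relCell, relabel]
        simp
    | _ => rfl

theorem resolve_rel (g : P.Good) (π : Equiv.Perm (Fin P.arrayCells)) {t : ℕ} (ht : t < P.epoch)
    (c : Option (P.Word × Rec P)) (o : Op P) :
    (resolve t (c.map (relCell π)) o).1 = (resolve t c o).1 ∧
      RelCell π (resolve t c o).2.1.1 (resolve t (c.map (relCell π)) o).2.1.1 ∧
      RelCell π (resolve t c o).2.1.2 (resolve t (c.map (relCell π)) o).2.1.2 ∧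
      (resolve t (c.map (relCell π)) o).2.2 = (resolve t c o).2.2.rel π := by
  have hf := ren_freshName g π (i := P.depth + 1) (t := t) (by rw [Params.levels]; omega) ht
  have hs := relCell_getD π c
  rw [resolve_eq, resolve_eq, hitOf_rel]
  cases o <;> cases hitOf c _ <;> first
    | exact ⟨rfl, hs, relCell_blank π, rfl⟩
    | exact ⟨rfl, ⟨rfl, fun _ => rfl⟩, relCell_blank π, rfl⟩
    | exact ⟨rfl, hs, ⟨rfl, fun _ => hf.symm⟩, by simp [Change.rel, hf]⟩

theorem resolve_wf {t : ℕ} {c : Option (P.Word × Rec P)} (hc : WfCell c) (o : Op P) :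
    (resolve t c o).2.1.1.2.Wf ∧ (resolve t c o).2.1.2.2.Wf := by
  have hs : (c.getD blankCell).2.Wf := by
    cases c with
    | none => trivial
    | some c => exact hc c rfl
  rw [resolve_eq]
  cases o <;> cases hitOf c _ <;> first | exact ⟨hs, trivial⟩ | exact ⟨trivial, trivial⟩

/-! ### Writing to the caches -/

theorem foldl_update_of_notMem {W : ℕ} {L : List (Fin W × Fin W)} {m : Mem W} {a : Fin W}
    (h : a ∉ L.map Prod.fst) : (L.foldl (fun m q => Function.update m q.1 q.2) m) a = m a := by
  induction L generalizing m with
  | nil => rfl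
  | cons x L ih =>
      simp_all

theorem foldl_update_of_mem {W : ℕ} {L : List (Fin W × Fin W)} (hL : (L.map Prod.fst).Nodup)
    {m : Mem W} {a v : Fin W} (h : (a, v) ∈ L) :
    (L.foldl (fun m q => Function.update m q.1 q.2) m) a = v := by
  induction L generalizing m with
  | nil => simp at h
  | cons x L ih =>
      rw [List.map_cons, List.nodup_cons] at hL
      rw [List.foldl_cons]
      rcases List.mem_cons.1 h with rfl | h
      · rw [foldl_update_of_notMem hL.1, Function.update_self]
      grind

/-- Number of cells of the array and the caches. -/
noncomputable def allCells (P : Params) : ℕ := P.arrayCells + P.levels * (2 * P.epoch)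

theorem nodup_cellAddrs (g : P.Good) {a : ℕ} (ha : a < allCells P) : (cellAddrs P a).Nodup := by
  rw [cellAddrs]
  refine List.Nodup.map_on ?_ List.nodup_range
  intro x hx y hy h
  rw [List.mem_range] at hx hy
  have hb : ∀ x < P.cellWords, a * P.cellWords + x < P.W := by
    intro x hx
    have h1 : (a + 1) * P.cellWords ≤ allCells P * P.cellWords := Nat.mul_le_mul_right _ ha
    have h2 := g.words
    grind [allCells, Nat.succ_mul]
  have := P.word_inj (hb x hx) (hb y hy) h
  omega

theorem disjoint_cellAddrs (g : P.Good) {a a' : ℕ} (ha : a < allCells P) (ha' : a' < allCells P)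
    (h : a ≠ a') : (cellAddrs P a).Disjoint (cellAddrs P a') := by
  intro x hx hx'
  rw [cellAddrs_eq] at hx hx'
  obtain ⟨j, hj, rfl⟩ := List.mem_map.1 hx
  rw [List.mem_range] at hj
  exact h ((Table.mem_rowAddrs (Geom.arr_limit_le g) ha ha' hj).1 hx')

theorem cacheStart_lt {i t ε : ℕ} (hi : i < P.levels) (ht : t < P.epoch) (hε : ε < 2) :
    cacheStart P i + (2 * t + ε) < allCells P := by
  have h : (i + 1) * (2 * P.epoch) ≤ P.levels * (2 * P.epoch) := Nat.mul_le_mul_right _ hi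
  grind [Nat.succ_mul, cacheStart, allCells]

theorem cacheStart_inj {i i' j j' : ℕ} (hj : j < 2 * P.epoch) (hj' : j' < 2 * P.epoch)
    (h : cacheStart P i + j = cacheStart P i' + j') : i = i' ∧ j = j' := by
  simp only [cacheStart] at h
  have hp : 0 < 2 * P.epoch := by omega
  have e : i * (2 * P.epoch) + j = i' * (2 * P.epoch) + j' := by omega
  have e1 : (i * (2 * P.epoch) + j) / (2 * P.epoch) = i := by
    rw [mul_comm, Nat.mul_add_div hp, Nat.div_eq_of_lt hj, add_zero]
  have e2 : (i' * (2 * P.epoch) + j') / (2 * P.epoch) = i' := by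
    rw [mul_comm, Nat.mul_add_div hp, Nat.div_eq_of_lt hj', add_zero]
  grind

/-- The memory after writing two cells to a cache. -/
noncomputable def putCells (t : ℕ) (m : Mem P.W) (x : ℕ × (P.Word × Rec P) × (P.Word × Rec P)) :
    Mem P.W :=
  ((cellAddrs P (cacheStart P x.1 + 2 * t)).zip (Rec.encode x.2.1.1 x.2.1.2) ++
    (cellAddrs P (cacheStart P x.1 + 2 * t + 1)).zip (Rec.encode x.2.2.1 x.2.2.2)).foldl
      (fun m q => Function.update m q.1 q.2) m

/-- What the server observes when two cells are written to the cache of level `i`. -/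
noncomputable def putEvent (P : Params) (t i : ℕ) : Event P.W :=
  .write (cellAddrs P (cacheStart P i + 2 * t) ++ cellAddrs P (cacheStart P i + 2 * t + 1))

theorem zip_fst (a : ℕ) (c : P.Word × Rec P) :
    ((cellAddrs P a).zip (Rec.encode c.1 c.2)).map Prod.fst = cellAddrs P a := by
  rw [List.map_fst_zip]
  rw [length_cellAddrs, length_encode]

theorem run_writeCache (t : ℕ) (x : ℕ × (P.Word × Rec P) × (P.Word × Rec P)) (m : Mem P.W) :
    (writeCache t x).run m = PMF.pure ((), putCells t m x, [putEvent P t x.1]) := by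
  rw [writeCache, run_store, List.map_append, zip_fst, zip_fst]
  rfl

theorem cellOf_putCells (g : P.Good) {t : ℕ} (ht : t < P.epoch) (m : Mem P.W)
    {x : ℕ × (P.Word × Rec P) × (P.Word × Rec P)} (hx : x.1 < P.levels) (h1 : x.2.1.2.Wf)
    (h2 : x.2.2.2.Wf) :
    cellOf (putCells t m x) (cacheStart P x.1 + 2 * t) = x.2.1 ∧
      cellOf (putCells t m x) (cacheStart P x.1 + 2 * t + 1) = x.2.2 ∧
      ∀ a < allCells P, a ≠ cacheStart P x.1 + 2 * t → a ≠ cacheStart P x.1 + 2 * t + 1 →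
        cellOf (putCells t m x) a = cellOf m a := by
  have b0 : cacheStart P x.1 + 2 * t < allCells P := cacheStart_lt hx ht (ε := 0) (by omega)
  have b1 : cacheStart P x.1 + 2 * t + 1 < allCells P := cacheStart_lt hx ht (ε := 1) (by omega)
  have hfst : ((cellAddrs P (cacheStart P x.1 + 2 * t)).zip (Rec.encode x.2.1.1 x.2.1.2) ++
      (cellAddrs P (cacheStart P x.1 + 2 * t + 1)).zip (Rec.encode x.2.2.1 x.2.2.2)).map Prod.fst =
      cellAddrs P (cacheStart P x.1 + 2 * t) ++ cellAddrs P (cacheStart P x.1 + 2 * t + 1) := by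
    rw [List.map_append, zip_fst, zip_fst]
  have hnd : (((cellAddrs P (cacheStart P x.1 + 2 * t)).zip (Rec.encode x.2.1.1 x.2.1.2) ++
      (cellAddrs P (cacheStart P x.1 + 2 * t + 1)).zip
        (Rec.encode x.2.2.1 x.2.2.2)).map Prod.fst).Nodup := by
    rw [hfst]
    exact (nodup_cellAddrs g b0).append (nodup_cellAddrs g b1)
      (disjoint_cellAddrs g b0 b1 (by omega))
  have key : ∀ (a : ℕ) (c : P.Word × Rec P), c.2.Wf →
      (∀ y ∈ (cellAddrs P a).zip (Rec.encode c.1 c.2),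
        y ∈ (cellAddrs P (cacheStart P x.1 + 2 * t)).zip (Rec.encode x.2.1.1 x.2.1.2) ++
          (cellAddrs P (cacheStart P x.1 + 2 * t + 1)).zip (Rec.encode x.2.2.1 x.2.2.2)) →
      cellOf (putCells t m x) a = c := by
    intro a c hc hmem
    have e : (cellAddrs P a).map (putCells t m x) = Rec.encode c.1 c.2 := by
      apply List.ext_getElem
      · rw [List.length_map, length_cellAddrs, length_encode]
      · intro j hj1 hj2
        rw [List.getElem_map]
        refine foldl_update_of_mem hnd (hmem _ ?_)
        grind [List.mem_iff_getElem]
    rw [cellOf, e, Rec.decode_encode g _ hc]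
  refine ⟨key _ _ h1 fun y hy => List.mem_append_left _ hy,
    key _ _ h2 fun y hy => List.mem_append_right _ hy, fun a ha ha0 ha1 => ?_⟩
  rw [cellOf, cellOf]
  congr 1
  refine List.map_congr_left fun y hy => foldl_update_of_notMem ?_
  rw [hfst, List.mem_append, not_or]
  exact ⟨fun h => disjoint_cellAddrs g ha b0 ha0 hy h, fun h => disjoint_cellAddrs g ha b1 ha1 hy h⟩

theorem cellOf_foldl_putCells (g : P.Good) {t : ℕ} (ht : t < P.epoch)
    {outs : List (ℕ × (P.Word × Rec P) × (P.Word × Rec P))} (hnd : (outs.map Prod.fst).Nodup)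
    (hl : ∀ x ∈ outs, x.1 < P.levels) (hwf : ∀ x ∈ outs, x.2.1.2.Wf ∧ x.2.2.2.Wf) (m : Mem P.W) :
    (∀ x ∈ outs, cellOf (outs.foldl (putCells t) m) (cacheStart P x.1 + 2 * t) = x.2.1 ∧
      cellOf (outs.foldl (putCells t) m) (cacheStart P x.1 + 2 * t + 1) = x.2.2) ∧
      ∀ a < allCells P, (∀ x ∈ outs, a ≠ cacheStart P x.1 + 2 * t ∧
        a ≠ cacheStart P x.1 + 2 * t + 1) → cellOf (outs.foldl (putCells t) m) a = cellOf m a := by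
  induction outs generalizing m with
  | nil => simp
  | cons y outs ih =>
      rw [List.map_cons, List.nodup_cons] at hnd
      obtain ⟨i1, i2⟩ := ih hnd.2 (fun x hx => hl x (by simp [hx])) (fun x hx => hwf x (by simp [hx]))
        (putCells t m y)
      obtain ⟨p1, p2, p3⟩ := cellOf_putCells g ht m (hl y (by simp)) (hwf y (by simp)).1
        (hwf y (by simp)).2
      have hyl := hl y (by simp)
      have hne : ∀ x ∈ outs, y.1 ≠ x.1 := fun x hx h =>
        hnd.1 (h ▸ List.mem_map.2 ⟨x, hx, rfl⟩)
      rw [List.foldl_cons]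
      refine ⟨fun x hx => ?_, fun a ha hne' => ?_⟩
      · rcases List.mem_cons.1 hx with rfl | hx
        · have b0 : cacheStart P x.1 + 2 * t < allCells P :=
            cacheStart_lt hyl ht (ε := 0) (by omega)
          have b1 : cacheStart P x.1 + 2 * t + 1 < allCells P :=
            cacheStart_lt hyl ht (ε := 1) (by omega)
          rw [i2 _ b0, i2 _ b1]
          · grind
          · intro z hz
            constructor <;> intro h
            · exact hne z hz (cacheStart_inj (j := 2 * t + 1) (j' := 2 * t) (by omega) (by omega) h).1
            · exact hne z hz (cacheStart_inj (j := 2 * t + 1) (j' := 2 * t + 1) (by omega)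
                (by omega) h).1
          · intro z hz
            constructor <;> intro h
            · exact hne z hz (cacheStart_inj (j := 2 * t) (j' := 2 * t) (by omega) (by omega) h).1
            · exact hne z hz (cacheStart_inj (j := 2 * t) (j' := 2 * t + 1) (by omega)
                (by omega) h).1
        grind
      · grind

theorem cellOf_foldl_array (g : P.Good) {t : ℕ} (ht : t < P.epoch)
    {outs : List (ℕ × (P.Word × Rec P) × (P.Word × Rec P))} (hnd : (outs.map Prod.fst).Nodup)
    (hl : ∀ x ∈ outs, x.1 < P.levels) (hwf : ∀ x ∈ outs, x.2.1.2.Wf ∧ x.2.2.2.Wf) (m : Mem P.W)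
    {a : ℕ} (ha : a < P.arrayCells) : cellOf (outs.foldl (putCells t) m) a = cellOf m a := by
  refine (cellOf_foldl_putCells g ht hnd hl hwf m).2 a (ha.trans_le (Nat.le_add_right _ _)) ?_
  grind [cacheStart]

/-- Writing cells that correspond to `outs` preserves the representation. -/
theorem Rep.write (g : P.Good) {π : Equiv.Perm (Fin P.arrayCells)} {F : P.Word → Rec P}
    {caches caches' : ℕ → List (P.Word × Rec P)} {t : ℕ} {m : Mem P.W} (h : Rep π F caches t m)
    (ht : t < P.epoch) {outs outs' : List (ℕ × (P.Word × Rec P) × (P.Word × Rec P))}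
    (hrel : List.Forall₂ (fun x y => y.1 = x.1 ∧ RelCell π x.2.1 y.2.1 ∧ RelCell π x.2.2 y.2.2)
      outs outs')
    (hfst : (outs.map Prod.fst).Perm (List.range P.levels))
    (hwf : ∀ x ∈ outs, x.2.1.2.Wf ∧ x.2.2.2.Wf)
    (hc : ∀ x ∈ outs, caches' x.1 = caches x.1 ++ [x.2.1, x.2.2]) :
    Rep π F caches' (t + 1) (outs'.foldl (putCells t) m) := by
  have hfst' : outs'.map Prod.fst = outs.map Prod.fst := by
    clear hfst hwf hc
    induction hrel with
    | nil => rfl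
    | cons h _ ih => rw [List.map_cons, List.map_cons, h.1, ih]
  have hnd : (outs'.map Prod.fst).Nodup := by
    grind
  have hl : ∀ x ∈ outs', x.1 < P.levels := by
    intro x hx
    have : x.1 ∈ outs'.map Prod.fst := List.mem_map.2 ⟨x, hx, rfl⟩
    grind
  have hwf' : ∀ x ∈ outs', x.2.1.2.Wf ∧ x.2.2.2.Wf := by
    intro y hy
    obtain ⟨j, hj, rfl⟩ := List.mem_iff_getElem.1 hy
    have hlen := hrel.length_eq
    obtain ⟨-, r1, r2⟩ := (List.forall₂_iff_get.1 hrel).2 j (by omega) hj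
    obtain ⟨w1, w2⟩ := hwf _ (List.getElem_mem (l := outs) (by omega : j < outs.length))
    simp only [List.get_eq_getElem] at r1 r2
    rw [r1.rec_eq, r2.rec_eq]
    exact ⟨wf_relabel π w1, wf_relabel π w2⟩
  obtain ⟨p1, p2⟩ := cellOf_foldl_putCells g ht hnd hl hwf' m
  refine ⟨fun x hx => ?_, fun i hi => ?_⟩
  · have hlt : (ren π x).val < P.arrayCells := by
      rw [ren_val g π hx]; exact (π _).isLt
    rw [cellOf_foldl_array g ht hnd hl hwf' m hlt]
    exact h.array x hx
  · have hi' : i ∈ outs.map Prod.fst := hfst.mem_iff.2 (List.mem_range.2 hi)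
    obtain ⟨x, hx, rfl⟩ := List.mem_map.1 hi'
    obtain ⟨j, hj, rfl⟩ := List.mem_iff_getElem.1 hx
    have hlen := hrel.length_eq
    obtain ⟨r0, r1, r2⟩ := (List.forall₂_iff_get.1 hrel).2 j hj (by omega)
    simp only [List.get_eq_getElem] at r0 r1 r2
    rw [hc _ hx]
    have hy := List.getElem_mem (l := outs') (by omega : j < outs'.length)
    obtain ⟨q1, q2⟩ := p1 _ hy
    rw [r0] at q1 q2
    have e : (cacheOf (outs'.foldl (putCells t) m) outs[j].1).take (2 * (t + 1)) =
        (cacheOf m outs[j].1).take (2 * t) ++ [outs'[j].2.1, outs'[j].2.2] := by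
      rw [cacheOf, cacheOf, ← List.map_take, ← List.map_take, List.take_range, List.take_range,
        Nat.min_eq_left (by omega), Nat.min_eq_left (by omega), show 2 * (t + 1) = 2 * t + 1 + 1 by
          ring, List.range_succ, List.range_succ, List.map_append, List.map_append,
        List.append_assoc]
      congr 1
      · refine List.map_congr_left fun a ha => ?_
        rw [List.mem_range] at ha
        refine p2 _ ?_ fun x hx => ⟨fun h' => ?_, fun h' => ?_⟩
        · have h1 : (outs[j].1 + 1) * (2 * P.epoch) ≤ P.levels * (2 * P.epoch) :=
            Nat.mul_le_mul_right _ hi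
          grind [Nat.succ_mul, cacheStart, allCells]
        · have := (cacheStart_inj (j' := 2 * t) (by omega) (by omega) h').2
          omega
        · have := (cacheStart_inj (j' := 2 * t + 1) (by omega) (by omega) h').2
          omega
      grind
    rw [e]
    refine List.rel_append (h.cache _ hi) ?_
    exact List.Forall₂.cons r1 (List.Forall₂.cons r2 List.Forall₂.nil)

/-- What the server observes of an access in which the cells `xs` of the array are read, apart from
the rebuild. -/
noncomputable def accessTrace (P : Params) (t : ℕ) (xs : List P.Word) : List (Event P.W) :=
  descendTrace P (List.range P.levels) xs ++
    ((P.depth + 1) :: (List.range (P.depth + 1)).reverse).map (putEvent P t)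

/-- The nodes on the search path, the next unused dummy and the cells of the array that are read. -/
noncomputable def searchA (F : P.Word → Rec P) (caches : ℕ → List (P.Word × Rec P)) (k : P.Word)
    (next : P.Word) : List (Option (P.Word × Rec P)) × P.Word × List P.Word :=
  descendA F caches k (List.range P.levels) (some (P.word 0)) next

/-- The cells that are written after a search. -/
noncomputable def outsOf (t : ℕ) (path : List (Option (P.Word × Rec P))) (o : Op P) :
    List (ℕ × (P.Word × Rec P) × (P.Word × Rec P)) :=
  (P.depth + 1, (resolve t path.getLast?.join o).2.1) ::
    climb t ((List.range (P.depth + 1)).zip path).reverse (resolve t path.getLast?.join o).2.2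

theorem length_descendA (F : P.Word → Rec P) (caches : ℕ → List (P.Word × Rec P)) (k : P.Word)
    (is : List ℕ) (cur : Option P.Word) (next : P.Word) :
    (descendA F caches k is cur next).1.length = is.length ∧
      (descendA F caches k is cur next).2.2.length = is.length := by
  induction is generalizing cur next with
  | nil => exact ⟨rfl, rfl⟩
  | cons i is ih => simp only [descendA, List.length_cons, ih, and_self]

theorem map_getLast?_join {α β : Type} (f : α → β) (L : List (Option α)) :
    (L.map (Option.map f)).getLast?.join = L.getLast?.join.map f := by grind

theorem outsOf_fst (t : ℕ) {path : List (Option (P.Word × Rec P))} (hp : path.length = P.levels)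
    (o : Op P) : (outsOf t path o).map Prod.fst =
      (P.depth + 1) :: (List.range (P.depth + 1)).reverse := by
  rw [outsOf, List.map_cons, climb_fst, List.map_reverse, List.map_fst_zip]
  grind [List.length_range, Params.levels]

theorem outsOf_perm (t : ℕ) {path : List (Option (P.Word × Rec P))} (hp : path.length = P.levels)
    (o : Op P) : ((outsOf t path o).map Prod.fst).Perm (List.range P.levels) := by
  rw [outsOf_fst t hp, Params.levels, List.range_succ (n := P.depth + 1)]
  grind

theorem outsOf_rel (g : P.Good) (π : Equiv.Perm (Fin P.arrayCells)) {t : ℕ} (ht : t < P.epoch)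
    (path : List (Option (P.Word × Rec P))) (o : Op P) :
    List.Forall₂ (fun x y => y.1 = x.1 ∧ RelCell π x.2.1 y.2.1 ∧ RelCell π x.2.2 y.2.2)
      (outsOf t path o) (outsOf t (path.map (Option.map (relCell π))) o) := by
  have h := resolve_rel g π ht path.getLast?.join o
  rw [← map_getLast?_join] at h
  refine List.Forall₂.cons ⟨rfl, h.2.1, h.2.2.1⟩ ?_
  rw [h.2.2.2, List.zip_map_right, ← List.map_reverse]
  refine climb_rel g π ht ?_ _
  intro x hx
  have := (List.of_mem_zip (List.mem_reverse.1 hx : (x.1, x.2) ∈ _)).1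
  grind [Params.levels]

theorem outsOf_wf (g : P.Good) {t : ℕ} {path : List (Option (P.Word × Rec P))}
    (hp : ∀ c ∈ path, WfCell c) (o : Op P) :
    ∀ x ∈ outsOf t path o, x.2.1.2.Wf ∧ x.2.2.2.Wf := by
  have hl : WfCell path.getLast?.join := by
    grind [WfCell]
  intro x hx
  rcases List.mem_cons.1 hx with rfl | hx
  · exact resolve_wf hl o
  · refine climb_wf g (fun y hy => ?_) _ x hx
    exact hp _ (List.of_mem_zip (List.mem_reverse.1 hy : (y.1, y.2) ∈ _)).2

/-- An access is equivariant: it acts in the same way on a shuffled array as on the array before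
shuffling, and reads the renamed cells. -/
theorem run_access (g : P.Good) {π : Equiv.Perm (Fin P.arrayCells)} {F : P.Word → Rec P}
    {caches caches' : ℕ → List (P.Word × Rec P)} {t : ℕ} {m : Mem P.W} (h : Rep π F caches t m)
    (ht : t < P.epoch) {next : P.Word} (o : Op P)
    {path : List (Option (P.Word × Rec P))} {next' : P.Word} {xs : List P.Word}
    (hs : searchA F caches o.key next = (path, next', xs))
    (hx : ∀ x ∈ xs, x.val < P.arrayCells) (hp : ∀ c ∈ path, WfCell c)
    (hc : ∀ x ∈ outsOf t path o, caches' x.1 = caches x.1 ++ [x.2.1, x.2.2])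
    (rebuild : State P → Prog P.W (State P)) :
    ∃ m', Rep π F caches' (t + 1) m' ∧
      (access rebuild o ⟨ren π (P.word 0), ren π next, P.word t⟩).run m =
        if t + 1 = P.epoch then
          ((rebuild ⟨ren π (P.word 0), ren π next', P.word (t + 1)⟩).run m').map fun y =>
            (((resolve t path.getLast?.join o).1, y.1), y.2.1,
              accessTrace P t (xs.map (ren π)) ++ y.2.2)
        else PMF.pure (((resolve t path.getLast?.join o).1,
          ⟨ren π (P.word 0), ren π next', P.word (t + 1)⟩), m',
            accessTrace P t (xs.map (ren π))) := by
  have htv : (P.word t).val = t := by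
    have h1 := arrayCells_lt g
    have h2 := g.epoch_le
    have : P.n ≤ P.arrayCells := by rw [Params.arrayCells, Params.treeCells]; omega
    exact P.word_val (by omega)
  have hlen : path.length = P.levels := by
    have := (length_descendA F caches o.key (List.range P.levels) (some (P.word 0)) next).1
    rw [List.length_range] at this
    rw [← this]
    exact congrArg (fun z => z.1.length) hs.symm
  have hd := run_descend g h (k := o.key) (is := List.range P.levels)
    (fun i hi => List.mem_range.1 hi) (cur := some (P.word 0)) (next := next) (by
      have e : (descendA F caches o.key (List.range P.levels) (some (P.word 0)) next).2.2 = xs :=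
        congrArg (fun z => z.2.2) hs
      rw [e]; exact hx)
  rw [searchA] at hs
  rw [hs, Option.map_some] at hd
  have hr := outsOf_rel g π ht path o
  have hfst : (outsOf t (path.map (Option.map (relCell π))) o).map Prod.fst =
      (P.depth + 1) :: (List.range (P.depth + 1)).reverse := outsOf_fst t (by simpa using hlen) o
  refine ⟨_, h.write g ht hr (outsOf_perm t hlen o) (outsOf_wf g hp o) hc, ?_⟩
  have hw := run_forList_write (f := writeCache (P := P) t) (g := fun x m => putCells t m x)
    (tr := fun x => [putEvent P t x.1]) (l := outsOf t (path.map (Option.map (relCell π))) o)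
    (fun x _ m => run_writeCache t x m) m
  have htr : (outsOf t (path.map (Option.map (relCell π))) o).flatMap
      (fun x => [putEvent P t x.1]) =
        ((P.depth + 1) :: (List.range (P.depth + 1)).reverse).map (putEvent P t) := by
    rw [← hfst, List.map_map]
    exact List.flatMap_pure_eq_map _ _
  rw [htr] at hw
  have hres := (resolve_rel g π ht path.getLast?.join o).1
  rw [← map_getLast?_join] at hres
  rw [access]
  simp only [htv]
  rw [monad_bind_eq, run_bind_of_pure hd]
  simp only []
  rw [monad_bind_eq]
  erw [run_bind_of_pure hw]
  rw [hres]
  split_ifs with he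
  · rw [monad_bind_eq]
    simp only [pure_eq_ret]
    rw [run_bind]
    simp only [run, PMF.map_bind, PMF.pure_map]
    congr 1
    grind [accessTrace]
  · simp [pure_eq_ret, run, PMF.pure_map, accessTrace]

end OS

/-! ### One level of a B-tree -/

namespace OS

open BTree Prog

variable {P : Params}

/-- A separator with the name of a child, or a key with the name of an item. -/
abbrev Entry (P : Params) := P.Word × P.Word

/-- A node with its separator and its name, which form the entry for it on the level above. -/
abbrev LNode (P : Params) := Entry P × List (Entry P)

/-- What holds of a node: its entries are sorted, and not to the left of its separator; above the
leaves, the separator is also that of an entry, so that a search never gets stuck. -/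
structure NodeOK (leaf : Prop) (x : LNode P) : Prop where
  len : x.2.length ≤ P.branch
  ge : ∀ e ∈ x.2, x.1.1 ≤ e.1
  sorted : x.2.Pairwise fun e e' => e.1 < e'.1
  head : ¬ leaf → ∃ e ∈ x.2, e.1 = x.1.1

/-- The node `x` is to the left of `y`. -/
def Before (x y : LNode P) : Prop := x.1.1 < y.1.1 ∧ ∀ e ∈ x.2, e.1 < y.1.1

/-- The list of all nodes of a level. -/
structure Level (leaf : Prop) (N : List (LNode P)) : Prop where
  node : ∀ x ∈ N, NodeOK leaf x
  ord : N.Pairwise Before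

/-- How many entries the nodes have beyond those that they may have after a split. -/
noncomputable def excess (N : List (LNode P)) : ℕ :=
  (N.map fun x => x.2.length - (P.branch / 2 + 1)).sum

namespace Change

/-- A change to the entries `E` of a level during an access to `k`: an entry that is inserted
comes between those that are at most `k` and the others. -/
def Valid (k : P.Word) (leaf : Prop) (E : List (Entry P)) : Change P → Prop
  | keep => True
  | remove k' => leaf ∧ k' = k
  | insert e => (∀ z ∈ E, z.1 ≤ k → z.1 < e.1) ∧ (∀ z ∈ E, k < z.1 → e.1 < z.1) ∧ (leaf → e.1 = k)

/-- The number of entries that a change adds, which are the credits that it brings. -/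
def cost : Change P → ℕ
  | insert _ => 1
  | _ => 0

theorem orderedInsert_append {e : Entry P} {X es Y : List (Entry P)} (hX : ∀ z ∈ X, z.1 < e.1)
    (hY : ∀ z ∈ Y, e.1 < z.1) : (X ++ (es ++ Y)).orderedInsert (fun x y => x.1 ≤ y.1) e =
      X ++ (es.orderedInsert (fun x y => x.1 ≤ y.1) e ++ Y) := by
  induction X with
  | nil =>
      induction es with
      | nil =>
          cases Y with
          | nil => rfl
          | cons y Y => grind
      | cons z es ih => grind
  | cons x X ih => grind

theorem mem_apply {ch : Change P} {es : List (Entry P)} {z : Entry P} (h : z ∈ ch.apply es) :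
    z ∈ es ∨ ch = insert z := by
  cases ch with
  | keep => exact Or.inl h
  | remove k => exact Or.inl (List.mem_of_mem_filter h)
  | insert e =>
      rcases (List.mem_orderedInsert _).1 h with rfl | h
      · simp
      grind

theorem sorted_orderedInsert {e : Entry P} {es : List (Entry P)}
    (hs : es.Pairwise fun x y => x.1 < y.1) (he : ∀ z ∈ es, z.1 ≠ e.1) :
    (es.orderedInsert (fun x y => x.1 ≤ y.1) e).Pairwise fun x y => x.1 < y.1 := by
  induction es with
  | nil => simp
  | cons x es ih =>
      rw [List.orderedInsert_cons]
      rw [List.pairwise_cons] at hs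
      split_ifs with h
      · refine List.pairwise_cons.2 ⟨fun z hz => ?_, List.pairwise_cons.2 hs⟩
        grind
      · refine List.pairwise_cons.2 ⟨fun z hz => ?_, ih hs.2 fun z hz => he z (by simp [hz])⟩
        rcases (List.mem_orderedInsert _).1 hz with rfl | hz
        · grind
        grind

variable {k : P.Word} {leaf : Prop}

theorem Valid.mono {E E' : List (Entry P)} {ch : Change P} (h : ch.Valid k leaf E)
    (hE : ∀ z ∈ E', z ∈ E) : ch.Valid k leaf E' := by
  cases ch with
  | keep => trivial
  | remove k' => exact h
  | insert e => exact ⟨fun z hz => h.1 z (hE z hz), fun z hz => h.2.1 z (hE z hz), h.2.2⟩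

theorem Valid.ne {E : List (Entry P)} {e : Entry P} (h : (insert e).Valid k leaf E) :
    ∀ z ∈ E, z.1 ≠ e.1 := by
  intro z hz
  rcases le_or_gt z.1 k with h' | h'
  · exact (h.1 z hz h').ne
  · exact (h.2.1 z hz h').ne'

theorem sorted_apply {ch : Change P} {es : List (Entry P)} (hv : ch.Valid k leaf es)
    (hs : es.Pairwise fun x y => x.1 < y.1) : (ch.apply es).Pairwise fun x y => x.1 < y.1 := by
  cases ch with
  | keep => exact hs
  | remove k' => exact hs.filter _
  | insert e => exact sorted_orderedInsert hs hv.ne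

theorem apply_append {ch : Change P} {X es Y : List (Entry P)}
    (hv : ch.Valid k leaf (X ++ (es ++ Y))) (hX : ∀ z ∈ X, z.1 < k) (hY : ∀ z ∈ Y, k < z.1) :
    ch.apply (X ++ (es ++ Y)) = X ++ (ch.apply es ++ Y) := by
  cases ch with
  | keep => rfl
  | remove k' =>
      obtain ⟨-, rfl⟩ := hv
      simp only [apply, List.filter_append]
      rw [List.filter_eq_self (l := X) |>.2 fun z hz => by simpa using (hX z hz).ne,
        List.filter_eq_self (l := Y) |>.2 fun z hz => by simpa using (hY z hz).ne']
  | insert e =>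
      exact orderedInsert_append (fun z hz => hv.1 z (by simp [hz]) (hX z hz).le)
        fun z hz => hv.2.1 z (by simp [hz]) (hY z hz)

end Change

variable {leaf : Prop}

theorem Level.replace {N₁ N₂ M : List (LNode P)} {x : LNode P} (h : Level leaf (N₁ ++ x :: N₂))
    (hM : ∀ m ∈ M, NodeOK leaf m) (hx : ∀ m ∈ M, x.1.1 ≤ m.1.1) (hM' : M.Pairwise Before)
    (h2 : ∀ m ∈ M, ∀ y ∈ N₂, Before m y) : Level leaf (N₁ ++ (M ++ N₂)) := by
  have ho := h.ord
  rw [List.pairwise_append, List.pairwise_cons] at ho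
  obtain ⟨o1, ⟨-, o2⟩, o3⟩ := ho
  refine ⟨fun y hy => ?_, ?_⟩
  · simp only [List.mem_append] at hy
    rcases hy with hy | hy | hy
    · exact h.node y (by simp [hy])
    · grind
    · exact h.node y (by simp [hy])
  · rw [List.pairwise_append, List.pairwise_append]
    refine ⟨o1, ⟨hM', o2, h2⟩, fun y hy z hz => ?_⟩
    rcases List.mem_append.1 hz with hz | hz
    · have := o3 y hy x (by simp)
      exact ⟨this.1.trans_le (hx z hz), fun e he => (this.2 e he).trans_le (hx z hz)⟩
    grind

/-- The nodes that replace `x` when the change is made to it; the last one gets the name `nm` if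
the node is split. -/
noncomputable def stepNode (nm : P.Word) (x : LNode P) (ch : Change P) : List (LNode P) :=
  if (ch.apply x.2).length ≤ P.branch then [(x.1, ch.apply x.2)]
  else match (ch.apply x.2).drop ((ch.apply x.2).length / 2) with
    | e :: hi => [(x.1, (ch.apply x.2).take ((ch.apply x.2).length / 2)), ((e.1, nm), e :: hi)]
    | [] => [(x.1, ch.apply x.2)]

/-- The change to the level above. -/
noncomputable def stepUp (nm : P.Word) (x : LNode P) (ch : Change P) : Change P :=
  if (ch.apply x.2).length ≤ P.branch then .keep
  else match (ch.apply x.2).drop ((ch.apply x.2).length / 2) with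
    | e :: _ => .insert (e.1, nm)
    | [] => .keep

theorem flatMap_stepNode (nm : P.Word) (x : LNode P) (ch : Change P) :
    (stepNode nm x ch).flatMap Prod.snd = ch.apply x.2 := by
  grind [stepNode, List.take_append_drop]

section

variable {k : P.Word} {N₁ N₂ : List (LNode P)} {x : LNode P} {ch : Change P}

theorem Level.left_lt (h : Level leaf (N₁ ++ x :: N₂)) (hx : x.1.1 ≤ k) :
    ∀ z ∈ N₁.flatMap Prod.snd, z.1 < k := by
  intro z hz
  obtain ⟨y, hy, hz⟩ := List.mem_flatMap.1 hz
  have ho := h.ord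
  rw [List.pairwise_append] at ho
  exact ((ho.2.2 y hy x (by simp)).2 z hz).trans_le hx

theorem Level.right_lt (h : Level leaf (N₁ ++ x :: N₂)) (hN : ∀ y ∈ N₂, k < y.1.1) :
    ∀ z ∈ N₂.flatMap Prod.snd, k < z.1 := by
  intro z hz
  obtain ⟨y, hy, hz⟩ := List.mem_flatMap.1 hz
  exact (hN y hy).trans_le ((h.node y (by simp [hy])).ge z hz)

/-- The entries of a level after a change. -/
theorem Level.flatMap_step (h : Level leaf (N₁ ++ x :: N₂)) (hx : x.1.1 ≤ k)
    (hN : ∀ y ∈ N₂, k < y.1.1) (hv : ch.Valid k leaf ((N₁ ++ x :: N₂).flatMap Prod.snd))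
    (nm : P.Word) : (N₁ ++ (stepNode nm x ch ++ N₂)).flatMap Prod.snd =
      ch.apply ((N₁ ++ x :: N₂).flatMap Prod.snd) := by
  rw [List.flatMap_append, List.flatMap_append, flatMap_stepNode]
  rw [List.flatMap_append, List.flatMap_cons] at hv ⊢
  exact (Change.apply_append hv (h.left_lt hx) (h.right_lt hN)).symm

theorem mem_apply_bounds (h : Level leaf (N₁ ++ x :: N₂)) (hx : x.1.1 ≤ k)
    (hN : ∀ y ∈ N₂, k < y.1.1) (hv : ch.Valid k leaf ((N₁ ++ x :: N₂).flatMap Prod.snd)) :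
    ∀ e ∈ ch.apply x.2, x.1.1 ≤ e.1 ∧ ∀ y ∈ N₂, e.1 < y.1.1 := by
  intro e he
  have ho := h.ord
  rw [List.pairwise_append, List.pairwise_cons] at ho
  rcases Change.mem_apply he with he | rfl
  · exact ⟨(h.node x (by simp)).ge e he, fun y hy => (ho.2.1.1 y hy).2 e he⟩
  · by_cases hl : leaf
    · rw [hv.2.2 hl]; exact ⟨hx, hN⟩
    · refine ⟨?_, fun y hy => ?_⟩
      · obtain ⟨z, hz, e1⟩ := (h.node x (by simp)).head hl
        rw [← e1]
        exact (hv.1 z (List.mem_flatMap.2 ⟨x, by simp, hz⟩) (e1 ▸ hx)).le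
      · obtain ⟨z, hz, e1⟩ := (h.node y (by simp [hy])).head hl
        rw [← e1]
        exact hv.2.1 z (List.mem_flatMap.2 ⟨y, by simp [hy], hz⟩) (e1 ▸ hN y hy)

theorem head_apply (h : NodeOK leaf x) (hv : ch.Valid k leaf x.2) (hl : ¬ leaf) :
    ∃ e ∈ ch.apply x.2, e.1 = x.1.1 := by
  obtain ⟨e, he, e1⟩ := h.head hl
  refine ⟨e, ?_, e1⟩
  cases ch with
  | keep => exact he
  | remove k' => exact absurd hv.1 hl
  | insert e' => exact (List.mem_orderedInsert _).2 (Or.inr he)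

/-- A level remains well-formed. -/
theorem Level.step (g : P.Good) (h : Level leaf (N₁ ++ x :: N₂)) (hx : x.1.1 ≤ k)
    (hN : ∀ y ∈ N₂, k < y.1.1) (hv : ch.Valid k leaf ((N₁ ++ x :: N₂).flatMap Prod.snd))
    (nm : P.Word) : Level leaf (N₁ ++ (stepNode nm x ch ++ N₂)) ∧
      (N₁ ++ (stepNode nm x ch ++ N₂)).map Prod.fst =
        (stepUp nm x ch).apply ((N₁ ++ x :: N₂).map Prod.fst) ∧
      (stepUp nm x ch).Valid k False ((N₁ ++ x :: N₂).map Prod.fst) ∧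
      (stepUp nm x ch).cost * (P.branch / 2) + excess (N₁ ++ (stepNode nm x ch ++ N₂)) ≤
        excess (N₁ ++ x :: N₂) + ch.cost := by
  have hx0 := h.node x (by simp)
  have hvx : ch.Valid k leaf x.2 := hv.mono fun z hz => by simp [hz]
  have hs := Change.sorted_apply hvx hx0.sorted
  have hb := mem_apply_bounds h hx hN hv
  have hlen := ch.length_apply_le x.2
  have hxl := hx0.len
  have hgf := g.fan
  have ho := h.ord
  rw [List.pairwise_append, List.pairwise_cons] at ho
  obtain ⟨o1, ⟨o2, o3⟩, o4⟩ := ho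
  have hcost : (ch.apply x.2).length ≤ x.2.length + ch.cost := by
    cases ch with
    | keep => exact le_rfl
    | remove k => exact List.length_filter_le _ _
    | insert e => exact (List.orderedInsert_length _ _ _).le
  rw [stepNode, stepUp]
  by_cases hle : (ch.apply x.2).length ≤ P.branch
  · simp only [if_pos hle]
    refine ⟨h.replace ?_ ?_ (by simp) ?_, by simp [Change.apply], trivial, ?_⟩
    · intro m hm
      obtain rfl := List.mem_singleton.1 hm
      exact ⟨hle, fun e he => (hb e he).1, hs, head_apply hx0 hvx⟩
    · grind
    · intro m hm y hy
      obtain rfl := List.mem_singleton.1 hm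
      exact ⟨(o2 y hy).1, fun e he => (hb e he).2 y hy⟩
    · generalize ch.cost = κ at *
      simp only [Change.cost, excess, List.map_append, List.sum_append, List.map_cons,
        List.map_nil, List.sum_cons, List.sum_nil]
      omega
  · simp only [if_neg hle]
    generalize hes : ch.apply x.2 = es at *
    have hsplit := List.take_append_drop (es.length / 2) es
    have hl1 : (es.take (es.length / 2)).length = es.length / 2 := by
      grind
    have hl2 : (es.drop (es.length / 2)).length = es.length - es.length / 2 := List.length_drop
    generalize es.take (es.length / 2) = lo at *
    generalize hhi : es.drop (es.length / 2) = hi at *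
    cases hi with
    | nil => simp only [List.length_nil] at hl2; omega
    | cons e hi =>
        cases lo with
        | nil => simp only [List.length_nil] at hl1; omega
        | cons z lo =>
            have hs' := hs
            rw [← hsplit, List.pairwise_append] at hs'
            obtain ⟨s1, s2, s3⟩ := hs'
            have hze : z.1 < e.1 := s3 z (by simp) e (by simp)
            have hxe : x.1.1 < e.1 := (hb z (by simp [← hsplit])).1.trans_lt hze
            have hmem : ∀ y ∈ N₂, e.1 < y.1.1 := (hb e (by simp [← hsplit])).2
            have hvup : (Change.insert (e.1, nm)).Valid k False ((N₁ ++ x :: N₂).map Prod.fst) := by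
              refine ⟨fun w hw hwk => ?_, fun w hw hwk => ?_, False.elim⟩
              · obtain ⟨y, hy, rfl⟩ := List.mem_map.1 hw
                rcases List.mem_append.1 hy with hy | hy
                · exact (o4 y hy x (by simp)).1.trans hxe
                · grind
              · obtain ⟨y, hy, rfl⟩ := List.mem_map.1 hw
                rcases List.mem_append.1 hy with hy | hy
                · exact absurd (((o4 y hy x (by simp)).1.trans_le hx)) (not_lt.2 hwk.le)
                · grind
            refine ⟨h.replace ?_ ?_ ?_ ?_, ?_, hvup, ?_⟩
            · intro m hm
              simp only [List.mem_cons, List.not_mem_nil, or_false] at hm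
              rcases hm with rfl | rfl
              · refine ⟨by show (z :: lo).length ≤ _; omega,
                  fun w hw => (hb w (by rw [← hsplit]; exact List.mem_append_left _ hw)).1, s1,
                  fun hl => ?_⟩
                obtain ⟨w, hw, hw1⟩ := head_apply hx0 hvx hl
                grind
              · refine ⟨by show (e :: hi).length ≤ _; omega, fun w hw => ?_, s2,
                  fun _ => ⟨e, by simp, rfl⟩⟩
                grind
            · grind
            · simp only [List.pairwise_cons, List.mem_singleton, forall_eq, List.not_mem_nil,
                IsEmpty.forall_iff, implies_true, List.Pairwise.nil, and_true]
              exact ⟨hxe, fun w hw => s3 w hw e (by simp)⟩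
            · intro m hm y hy
              simp only [List.mem_cons, List.not_mem_nil, or_false] at hm
              rcases hm with rfl | rfl
              · exact ⟨(o2 y hy).1, fun w hw =>
                  (hb w (by rw [← hsplit]; exact List.mem_append_left _ hw)).2 y hy⟩
              · exact ⟨hmem y hy, fun w hw =>
                  (hb w (by rw [← hsplit]; exact List.mem_append_right _ hw)).2 y hy⟩
            · have e1 : (N₁ ++ x :: N₂).map Prod.fst =
                  (N₁.map Prod.fst ++ [x.1]) ++ ([] ++ N₂.map Prod.fst) := by simp
              have e2 : (N₁ ++ ([(x.1, z :: lo), ((e.1, nm), e :: hi)] ++ N₂)).map Prod.fst =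
                  (N₁.map Prod.fst ++ [x.1]) ++ ([(e.1, nm)] ++ N₂.map Prod.fst) := by simp
              rw [e2, e1]
              refine (Change.orderedInsert_append (e := (e.1, nm)) (es := []) ?_ ?_).symm
              · intro w hw
                rcases List.mem_append.1 hw with hw | hw
                · obtain ⟨y, hy, rfl⟩ := List.mem_map.1 hw
                  exact (o4 y hy x (by simp)).1.trans hxe
                · grind
              · intro w hw
                obtain ⟨y, hy, rfl⟩ := List.mem_map.1 hw
                grind
            · generalize ch.cost = κ at *
              simp only [List.length_cons] at hl1 hl2
              simp only [Change.cost, excess, List.length_cons, List.map_append, List.sum_append, List.map_cons,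
                List.map_nil, List.sum_cons, List.sum_nil]
              omega

end

/-- The last entry that is not to the right of `k`. -/
def lastLe (k : P.Word) (E : List (Entry P)) : Option (Entry P) :=
  (E.filter fun e => e.1 ≤ k).getLast?

theorem lastLe_eq_some {k : P.Word} {E : List (Entry P)} {e : Entry P} (h : lastLe k E = some e) :
    e ∈ E ∧ e.1 ≤ k := by
  have := List.mem_filter.1 (List.mem_of_getLast? h)
  grind

theorem lastLe_of_mem {k : P.Word} {E : List (Entry P)} (hs : E.Pairwise fun x y => x.1 < y.1)
    {a : P.Word} (h : (k, a) ∈ E) : lastLe k E = some (k, a) := by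
  obtain ⟨X, Y, rfl⟩ := List.append_of_mem h
  grind [List.pairwise_cons, lastLe]

/-- The node that a search for `k` visits on a level, and the nodes to the left and to the right
of it. -/
theorem exists_split {k : P.Word} {N : List (LNode P)} (hN : N.Pairwise Before)
    (h0 : ∃ x ∈ N, x.1.1 ≤ k) : ∃ N₁ x N₂, N = N₁ ++ x :: N₂ ∧ x.1.1 ≤ k ∧ ∀ y ∈ N₂, k < y.1.1 := by
  induction N with
  | nil => simp at h0
  | cons y N ih =>
      rw [List.pairwise_cons] at hN
      by_cases h : ∃ x ∈ N, x.1.1 ≤ k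
      · grind
      · push Not at h
        refine ⟨[], y, N, rfl, ?_, h⟩
        grind

theorem lastLe_split {k : P.Word} {N₁ N₂ : List (LNode P)} {x : LNode P} (hx : x.1.1 ≤ k)
    (hN : ∀ y ∈ N₂, k < y.1.1) : lastLe k ((N₁ ++ x :: N₂).map Prod.fst) = some x.1 := by
  grind [lastLe]

/-- Above the leaves, the last entry of a level that is not to the right of `k` is in the last
node that is not to the right of `k`. -/
theorem Level.lastLe_flatMap {k : P.Word} {N₁ N₂ : List (LNode P)} {x : LNode P}
    (h : Level leaf (N₁ ++ x :: N₂)) (hl : ¬ leaf) (hx : x.1.1 ≤ k) (hN : ∀ y ∈ N₂, k < y.1.1) :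
    lastLe k ((N₁ ++ x :: N₂).flatMap Prod.snd) = lastLe k x.2 := by
  obtain ⟨e, he, e1⟩ := (h.node x (by simp)).head hl
  rw [lastLe, lastLe, List.flatMap_append, List.flatMap_cons, List.filter_append,
    List.filter_append, List.filter_eq_nil_iff (l := N₂.flatMap Prod.snd) |>.2 fun z hz => by
      simpa using h.right_lt hN z hz, List.append_nil, List.getLast?_append]
  grind

theorem Level.mem_of_key {k a : P.Word} {N₁ N₂ : List (LNode P)} {x : LNode P}
    (h : Level leaf (N₁ ++ x :: N₂)) (hx : x.1.1 ≤ k) (hN : ∀ y ∈ N₂, k < y.1.1)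
    (ha : (k, a) ∈ (N₁ ++ x :: N₂).flatMap Prod.snd) : (k, a) ∈ x.2 := by
  rw [List.flatMap_append, List.flatMap_cons, List.mem_append, List.mem_append] at ha
  rcases ha with ha | ha | ha
  · exact absurd (h.left_lt hx _ ha) (lt_irrefl _)
  · exact ha
  · exact absurd (h.right_lt hN _ ha) (lt_irrefl _)

theorem Level.sorted_flatMap {N : List (LNode P)} (h : Level leaf N) :
    (N.flatMap Prod.snd).Pairwise fun e e' => e.1 < e'.1 := by
  rw [List.pairwise_flatMap]
  refine ⟨fun x hx => (h.node x hx).sorted, h.ord.imp_of_mem ?_⟩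
  intro x y hx hy hxy e he e' he'
  exact (hxy.2 e he).trans_le ((h.node y hy).ge e' he')

end OS

/-! ### The invariant of an epoch -/

namespace OS

open BTree Prog

variable {P : Params}

theorem find_append_pair (a : P.Word) (L : List (P.Word × Rec P)) (c c' : P.Word × Rec P) :
    find a (L ++ [c, c']) = if c'.1 = a ∧ c'.2.isBlank = false then some c'.2
      else if c.1 = a ∧ c.2.isBlank = false then some c.2 else find a L := by
  rw [show L ++ [c, c'] = (L ++ [c]) ++ [c'] by simp, find_append, find_append, find_singleton,
    find_singleton]
  grind

/-- The current version of the cell `a` on level `i`. -/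
noncomputable def ver (F : P.Word → Rec P) (caches : ℕ → List (P.Word × Rec P)) (i : ℕ)
    (a : P.Word) : Rec P := (find a (caches i)).getD (F a)

/-- The node that a search for `k` visits on level `i`. -/
noncomputable def curAt (F : P.Word → Rec P) (caches : ℕ → List (P.Word × Rec P)) (k : P.Word) :
    ℕ → Option P.Word
  | 0 => some (P.word 0)
  | i + 1 => (curAt F caches k i).bind fun a => child k (ver F caches i a)

/-- The node that a search for `k` visits on level `i`, with its current contents. -/
noncomputable def cellVisited (F : P.Word → Rec P) (caches : ℕ → List (P.Word × Rec P))
    (k : P.Word) (i : ℕ) : Option (P.Word × Rec P) :=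
  (curAt F caches k i).map fun a => (a, ver F caches i a)

section

variable {F : P.Word → Rec P} {caches : ℕ → List (P.Word × Rec P)} {k : P.Word}

theorem visitA_cases (i : ℕ) (cur : Option P.Word) (next : P.Word) :
    (visitA F (caches i) cur next).1 = cur.map (fun a => (a, ver F caches i a)) ∧
      ((∃ a, cur = some a ∧ find a (caches i) = none ∧
        (visitA F (caches i) cur next).2 = (next, a)) ∨
      ((visitA F (caches i) cur next).2 = ((match F next with
        | .dummy y => y
        | _ => next), next))) := by
  cases cur with
  | none => exact ⟨rfl, Or.inr rfl⟩
  | some a =>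
      cases h : find a (caches i) with
      | none => simp [visitA, h, ver]
      | some r =>
          grind [visitA, ver]

theorem descendA_fst (i n : ℕ) (next : P.Word) :
    (descendA F caches k (List.range' i n) (curAt F caches k i) next).1 =
      (List.range' i n).map (cellVisited F caches k) := by
  induction n generalizing i next with
  | zero => rfl
  | succ n ih =>
      rw [List.range'_succ, descendA, List.map_cons]
      have h := (visitA_cases (F := F) (caches := caches) i (curAt F caches k i) next).1
      have e : ((visitA F (caches i) (curAt F caches k i) next).1.bind fun c => child k c.2) =
          curAt F caches k (i + 1) := by
        rw [h, curAt, Option.bind_map]; rfl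
      simp only [e, ih]
      rw [h]
      rfl

/-- The cells of the array that a search reads: nodes that are not cached, and dummies. -/
theorem descendA_positions {T : ℕ} (hF : ∀ x : P.Word, T ≤ x.val → x.val < P.arrayCells →
      F x = .dummy (P.word (x.val + 1))) (hW : P.arrayCells < P.W) (i n : ℕ) (hn : i + n ≤ P.levels)
    (hcur : ∀ j, ∀ a, curAt F caches k j = some a → j < P.levels → find a (caches j) = none →
      a.val < T ∧ heightOf P a.val = some (P.depth + 1 - j))
    (next : P.Word) (hT : T ≤ next.val) (hA : next.val + n ≤ P.arrayCells)
    {r : List (Option (P.Word × Rec P)) × P.Word × List P.Word}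
    (hr : r = descendA F caches k (List.range' i n) (curAt F caches k i) next) :
    next.val ≤ r.2.1.val ∧ r.2.1.val ≤ next.val + n ∧ r.2.2.Nodup ∧
      ∀ x ∈ r.2.2, (∃ j, i ≤ j ∧ j < i + n ∧ curAt F caches k j = some x ∧
        find x (caches j) = none) ∨ (next.val ≤ x.val ∧ x.val < r.2.1.val) := by
  subst hr
  induction n generalizing i next with
  | zero => simp [descendA]
  | succ n ih =>
      rw [List.range'_succ, descendA]
      obtain ⟨h, hp⟩ := visitA_cases (F := F) (caches := caches) i (curAt F caches k i) next
      have e : ((visitA F (caches i) (curAt F caches k i) next).1.bind fun c => child k c.2) =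
          curAt F caches k (i + 1) := by
        rw [h, curAt, Option.bind_map]; rfl
      simp only [e]
      rcases hp with ⟨a, ha, hfa, hp⟩ | hp
      · rw [hp]
        dsimp only
        obtain ⟨h1, h2, h3, h4⟩ := ih (i + 1) (by omega) next hT (by omega)
        obtain ⟨haT, hah⟩ := hcur i a ha (by omega) hfa
        refine ⟨h1, by omega, List.nodup_cons.2 ⟨fun hmem => ?_, h3⟩, fun x hx => ?_⟩
        · grind [Params.levels]
        · rcases List.mem_cons.1 hx with rfl | hx
          · grind
          grind
      · rw [hp, hF next hT (by omega)]
        have hv : (P.word (next.val + 1)).val = next.val + 1 := P.word_val (by omega)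
        obtain ⟨h1, h2, h3, h4⟩ := ih (i + 1) (by omega) (P.word (next.val + 1)) (by omega)
          (by omega)
        simp only at h1 h2 h3 h4 ⊢
        refine ⟨by omega, by omega, List.nodup_cons.2 ⟨fun hmem => ?_, h3⟩, fun x hx => ?_⟩
        · grind
        · rcases List.mem_cons.1 hx with rfl | hx
          · omega
          · rcases h4 x hx with ⟨j, hj1, hj2, hj3⟩ | h5
            · grind
            omega

end

/-- The changes that an access makes to the levels, from the bottom up. -/
theorem exists_changes (t : ℕ) (c : ℕ → Option (P.Word × Rec P)) (n : ℕ) (ch : Change P) :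
    ∃ chg : ℕ → Change P, chg n = ch ∧
      (∀ i < n, chg i = (climb1 t i (c i) (chg (i + 1))).2) ∧
      ∀ x ∈ climb t ((List.range n).map fun i => (i, c i)).reverse ch,
        x.1 < n ∧ x.2 = (climb1 t x.1 (c x.1) (chg (x.1 + 1))).1 := by
  induction n generalizing ch with
  | zero => exact ⟨fun _ => ch, rfl, by simp, by simp [climb]⟩
  | succ n ih =>
      obtain ⟨chg, h1, h2, h3⟩ := ih (climb1 t n (c n) ch).2
      refine ⟨Function.update chg (n + 1) ch, by simp, fun i hi => ?_, ?_⟩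
      · grind
      · rw [List.range_succ, List.map_append, List.reverse_append]
        simp only [List.map_cons, List.map_nil, List.reverse_singleton, List.singleton_append]
        grind [climb_cons]

theorem climb1_node (t i : ℕ) (x : LNode P) (ch : Change P) :
    (climb1 t i (some (x.1.2, .node x.2)) ch).2 = stepUp (freshName P i t) x ch := by
  grind [climb1, stepUp]

/-- The cells that are written for the node `x`. -/
theorem climb1_cells (t i : ℕ) (x : LNode P) (ch : Change P) :
    ∃ es, (climb1 t i (some (x.1.2, .node x.2)) ch).1.1 = (x.1.2, .node es) ∧
      ((stepNode (freshName P i t) x ch = [(x.1, es)] ∧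
        (climb1 t i (some (x.1.2, .node x.2)) ch).1.2 = blankCell) ∨
      ∃ q es', stepNode (freshName P i t) x ch = [(x.1, es), ((q, freshName P i t), es')] ∧
        (climb1 t i (some (x.1.2, .node x.2)) ch).1.2 = (freshName P i t, .node es')) := by
  grind [climb1, stepNode, List.length_nil]

theorem node_step {F : P.Word → Rec P} {cache : List (P.Word × Rec P)}
    {N₁ N₂ : List (LNode P)} {x : LNode P} {ch : Change P} {t i : ℕ}
    (h : ∀ y ∈ N₁ ++ x :: N₂, (find y.1.2 cache).getD (F y.1.2) = .node y.2)
    (hnd : (((N₁ ++ x :: N₂).map Prod.fst).map Prod.snd).Nodup)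
    (hnew : freshName P i t ∉ ((N₁ ++ x :: N₂).map Prod.fst).map Prod.snd) :
    ∀ y ∈ N₁ ++ (stepNode (freshName P i t) x ch ++ N₂),
      (find y.1.2 (cache ++ [(climb1 t i (some (x.1.2, .node x.2)) ch).1.1,
        (climb1 t i (some (x.1.2, .node x.2)) ch).1.2])).getD (F y.1.2) = .node y.2 := by
  have hmem : ∀ y, y ∈ N₁ ∨ y ∈ N₂ → x.1.2 ≠ y.1.2 ∧ freshName P i t ≠ y.1.2 ∧
      (find y.1.2 cache).getD (F y.1.2) = .node y.2 := by
    intro y hy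
    grind
  have hxn : freshName P i t ≠ x.1.2 := fun e => hnew (by
    rw [e]; exact List.mem_map.2 ⟨x.1, List.mem_map.2 ⟨x, by simp, rfl⟩, rfl⟩)
  obtain ⟨es, h1, ⟨h2, h3⟩ | ⟨q, es', h2, h3⟩⟩ := climb1_cells t i x ch
  · rw [h1, h2, h3]
    intro y hy
    rw [find_append_pair]
    simp only [blankCell, Rec.isBlank, Bool.true_eq_false, and_false, if_false, and_true]
    grind
  · rw [h1, h2, h3]
    intro y hy
    rw [find_append_pair]
    simp only [Rec.isBlank, and_true]
    simp only [List.mem_append, List.mem_cons, List.not_mem_nil, or_false] at hy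
    grind

theorem nodup_apply {ch : Change P} {E : List (Entry P)} (h : (E.map Prod.snd).Nodup)
    (hch : ∀ e, ch = .insert e → e.2 ∉ E.map Prod.snd) : ((ch.apply E).map Prod.snd).Nodup := by
  cases ch with
  | keep => exact h
  | remove k => exact h.sublist (List.filter_sublist.map _)
  | insert e =>
      refine ((List.perm_orderedInsert _ e E).map Prod.snd).nodup_iff.2 ?_
      grind

end OS

namespace OS

open BTree Prog

variable {P : Params}

/-- The state of the storage after `t` accesses of an epoch, in terms of the names before
shuffling, when the array holds the items `l`. On level `i` there are the nodes `N i`, with the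
entries `E i` for them on the level above; `E (depth + 1)` lists the items. Up to now, `s i` nodes
were added on level `i`: since only a full node is split, this takes many new entries, and the root
is never split. The cells of the array that have been read are `used`: a node that has been read is
cached. -/
structure Inv (l : List P.Item) (d : Dict P) (t : ℕ) (next : P.Word)
    (caches : ℕ → List (P.Word × Rec P)) (used : List P.Word) (N : ℕ → List (LNode P))
    (E : ℕ → List (Entry P)) (s : ℕ → ℕ) : Prop where
  level : ∀ i ≤ P.depth, Level (i + 1 = P.depth + 1) (N i)
  node : ∀ i ≤ P.depth, ∀ x ∈ N i, ver (layout l) caches i x.1.2 = .node x.2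
  names : ∀ i ≤ P.depth, (N i).map Prod.fst = E i
  entries : ∀ i ≤ P.depth, (N i).flatMap Prod.snd = E (i + 1)
  root : E 0 = [(P.word 0, P.word 0)]
  lt : ∀ i ≤ P.depth + 1, ∀ e ∈ E i, e.2.val < P.arrayCells + i * P.epoch + t
  height : ∀ i ≤ P.depth + 1, ∀ e ∈ E i, e.2.val < P.arrayCells →
    heightOf P e.2.val = some (P.depth + 1 - i)
  nodup : ∀ i ≤ P.depth + 1, ((E i).map Prod.snd).Nodup
  item_mem : ∀ a k v, ver (layout l) caches (P.depth + 1) a = .item k v → (k, a) ∈ E (P.depth + 1)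
  item : ∀ e ∈ E (P.depth + 1), ∃ v, ver (layout l) caches (P.depth + 1) e.2 = .item e.1 v ∧
    d e.1 = some v
  dict : ∀ k v, d k = some v → ∃ a, (k, a) ∈ E (P.depth + 1)
  credit : ∀ i ≤ P.depth, s i * (P.branch / 2) + excess (N i) ≤ s (i + 1)
  credit_le : s (P.depth + 1) ≤ t
  le_next : P.treeCells ≤ next.val
  next_le : next.val ≤ P.treeCells + P.levels * t
  used_nodup : used.Nodup
  used_spec : ∀ x ∈ used, x.val < P.arrayCells ∧
    ((∃ i ≤ P.depth + 1, heightOf P x.val = some (P.depth + 1 - i) ∧ (find x (caches i)).isSome) ∨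
    (P.treeCells ≤ x.val ∧ x.val < next.val))

theorem layout_dummy {l : List P.Item} {x : P.Word} (h : P.treeCells ≤ x.val) :
    layout l x = .dummy (P.word (x.val + 1)) := by rw [layout, cellAt, if_pos h]

theorem lt_treeCells_of_heightOf (g : P.Good) {x h : ℕ} (hx : heightOf P x = some h) :
    x < P.treeCells := by
  obtain ⟨h1, q, h2, rfl⟩ := exists_of_heightOf hx
  have := levelOff_add_le_treeCells g h1
  omega

/-- A search in terms of the entries of the levels. -/
theorem exists_path {F : P.Word → Rec P} {caches : ℕ → List (P.Word × Rec P)}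
    {N : ℕ → List (LNode P)} {E : ℕ → List (Entry P)}
    (hlev : ∀ i ≤ P.depth, Level (i + 1 = P.depth + 1) (N i))
    (hnode : ∀ i ≤ P.depth, ∀ x ∈ N i, ver F caches i x.1.2 = .node x.2)
    (hnames : ∀ i ≤ P.depth, (N i).map Prod.fst = E i)
    (hent : ∀ i ≤ P.depth, (N i).flatMap Prod.snd = E (i + 1))
    (hroot : E 0 = [(P.word 0, P.word 0)]) (k : P.Word) :
    ∃ (N₁ : ℕ → List (LNode P)) (x : ℕ → LNode P) (N₂ : ℕ → List (LNode P)),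
      (∀ i ≤ P.depth, N i = N₁ i ++ x i :: N₂ i ∧ (x i).1.1 ≤ k ∧ (∀ y ∈ N₂ i, k < y.1.1) ∧
        curAt F caches k i = some (x i).1.2) ∧
      curAt F caches k (P.depth + 1) = (lastLe k (x P.depth).2).map Prod.snd := by
  have hchild : ∀ i ≤ P.depth, ∀ x ∈ N i, curAt F caches k i = some x.1.2 →
      curAt F caches k (i + 1) = (lastLe k x.2).map Prod.snd := by
    intro i hi x hx hc
    rw [curAt, hc, Option.bind_some, hnode i hi x hx]
    rfl
  have key : ∀ i ≤ P.depth, ∃ N₁ x N₂, N i = N₁ ++ x :: N₂ ∧ x.1.1 ≤ k ∧ (∀ y ∈ N₂, k < y.1.1) ∧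
      curAt F caches k i = some x.1.2 := by
    intro i
    induction i with
    | zero =>
        intro hi
        have h0 := hnames 0 hi
        rw [hroot] at h0
        cases hN : N 0 with
        | nil => rw [hN] at h0; simp at h0
        | cons x N' =>
            rw [hN, List.map_cons, List.cons.injEq, List.map_eq_nil_iff] at h0
            obtain ⟨h1, rfl⟩ := h0
            refine ⟨[], x, [], rfl, ?_, by simp, by rw [curAt, h1]⟩
            rw [h1]
            exact Fin.mk_le_of_le_val (by simp)
    | succ i ih =>
        intro hi
        obtain ⟨N₁, x, N₂, h1, h2, h3, h4⟩ := ih (by omega)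
        have hl := hlev i (by omega)
        rw [h1] at hl
        have hx : x ∈ N i := by rw [h1]; simp
        have hleaf : ¬ i + 1 = P.depth + 1 := by omega
        obtain ⟨e, he, e1⟩ := (hl.node x (by simp)).head hleaf
        have heE : e ∈ E (i + 1) := by
          grind
        rw [← hnames (i + 1) hi] at heE
        obtain ⟨y, hy, rfl⟩ := List.mem_map.1 heE
        have hyk : y.1.1 ≤ k := e1.trans_le h2
        obtain ⟨M₁, z, M₂, m1, m2, m3⟩ := exists_split (hlev (i + 1) hi).ord ⟨y, hy, hyk⟩
        refine ⟨M₁, z, M₂, m1, m2, m3, ?_⟩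
        rw [hchild i (by omega) x hx h4, ← hl.lastLe_flatMap hleaf h2 h3, ← h1, hent i (by omega),
          ← hnames (i + 1) hi, m1, lastLe_split m2 m3]
        rfl
  have : Nonempty P.Word := ⟨P.word 0⟩
  choose! N₁ x N₂ h using key
  refine ⟨N₁, x, N₂, h, hchild P.depth le_rfl _ ?_ (h P.depth le_rfl).2.2.2⟩
  grind

section

variable {l : List P.Item} {d : Dict P} {t : ℕ} {next : P.Word}
  {caches : ℕ → List (P.Word × Rec P)} {used : List P.Word} {N : ℕ → List (LNode P)}
  {E : ℕ → List (Entry P)} {s : ℕ → ℕ}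

theorem Inv.sorted (h : Inv l d t next caches used N E s) :
    (E (P.depth + 1)).Pairwise fun e e' => e.1 < e'.1 := by
  rw [← h.entries P.depth le_rfl]
  exact (h.level P.depth le_rfl).sorted_flatMap

theorem Inv.item_unique (h : Inv l d t next caches used N E s) {k a a' : P.Word}
    (ha : (k, a) ∈ E (P.depth + 1)) (ha' : (k, a') ∈ E (P.depth + 1)) : a = a' := by
  have h1 := lastLe_of_mem h.sorted ha
  rw [lastLe_of_mem h.sorted ha'] at h1
  grind

/-- What an access does on the level of the items, when its search ends at `c`. -/
structure ItemStep (l : List P.Item) (d : Dict P) (t : ℕ)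
    (caches caches' : ℕ → List (P.Word × Rec P)) (E : ℕ → List (Entry P))
    (c : Option (P.Word × Rec P)) (o : Op P) : Prop where
  resp : (resolve t c o).1 = (d.step o).1
  valid : (resolve t c o).2.2.Valid o.key True (E (P.depth + 1))
  fresh : ∀ e, (resolve t c o).2.2 = .insert e → e.2 = freshName P (P.depth + 1) t
  cached : ∀ a ∈ c.map Prod.fst, (find a (caches' (P.depth + 1))).isSome
  item_mem : ∀ a k v, ver (layout l) caches' (P.depth + 1) a = .item k v →
    (k, a) ∈ (resolve t c o).2.2.apply (E (P.depth + 1))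
  item : ∀ e ∈ (resolve t c o).2.2.apply (E (P.depth + 1)), ∃ v,
    ver (layout l) caches' (P.depth + 1) e.2 = .item e.1 v ∧ (d.step o).2 e.1 = some v
  dict : ∀ k v, (d.step o).2 k = some v →
    ∃ a, (k, a) ∈ (resolve t c o).2.2.apply (E (P.depth + 1))

theorem Inv.resolve_step (g : P.Good) (h : Inv l d t next caches used N E s) (ht : t < P.epoch)
    (o : Op P) {c : Option (P.Word × Rec P)} {E₀ : List (Entry P)}
    (hE₀ : ∀ e ∈ E₀, e ∈ E (P.depth + 1)) (hk : ∀ a, (o.key, a) ∈ E (P.depth + 1) →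
      (o.key, a) ∈ E₀) (hsort : E₀.Pairwise fun e e' => e.1 < e'.1)
    (hc : c = (lastLe o.key E₀).map fun e => (e.2, ver (layout l) caches (P.depth + 1) e.2))
    {caches' : ℕ → List (P.Word × Rec P)}
    (hcaches : caches' (P.depth + 1) = caches (P.depth + 1) ++
      [(resolve t c o).2.1.1, (resolve t c o).2.1.2]) :
    ItemStep l d t caches caches' E c o := by
  have hfresh := freshName_val g (i := P.depth + 1) (t := t) (by rw [Params.levels]; omega) ht
  have hnew : ∀ e ∈ E (P.depth + 1), freshName P (P.depth + 1) t ≠ e.2 := by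
    intro e he h'
    have := h.lt _ le_rfl e he
    grind
  -- what was visited is an item or nothing
  have hcc : (c = none ∧ ∀ a, (o.key, a) ∉ E (P.depth + 1)) ∨
      ∃ e v, c = some (e.2, .item e.1 v) ∧ e ∈ E (P.depth + 1) ∧
        ver (layout l) caches (P.depth + 1) e.2 = .item e.1 v ∧ d e.1 = some v ∧
        ∀ a, (o.key, a) ∈ E (P.depth + 1) → (o.key, a) = e := by
    have hlast : ∀ a, (o.key, a) ∈ E (P.depth + 1) → lastLe o.key E₀ = some (o.key, a) :=
      fun a ha => lastLe_of_mem hsort (hk a ha)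
    cases hl : lastLe o.key E₀ with
    | none =>
        grind
    | some e =>
        have he := hE₀ e (lastLe_eq_some hl).1
        obtain ⟨v, h1, h2⟩ := h.item e he
        grind
  -- rewriting what was visited changes nothing
  have hsame : ∀ (L' : List (P.Word × Rec P)) (a : P.Word), L' = caches (P.depth + 1) ++
      [c.getD blankCell, blankCell] →
      (find a L').getD (layout l a) = ver (layout l) caches (P.depth + 1) a := by
    intro L' a hL
    rw [hL, find_append_pair]
    rcases hcc with ⟨rfl, -⟩ | ⟨e, v, rfl, -, hv, -⟩
    · simp [blankCell, Rec.isBlank, ver]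
    · simp only [blankCell, Rec.isBlank, Bool.true_eq_false, and_false, if_false, and_true,
        Option.getD_some]
      split_ifs with h'
      · grind
      · rfl
  have hcached : ∀ L' x, L' = caches (P.depth + 1) ++ [c.getD blankCell, x] →
      ∀ a ∈ c.map Prod.fst, (find a L').isSome := by
    intro L' x hL a ha
    rcases hcc with ⟨rfl, -⟩ | ⟨e, v, rfl, -⟩
    · simp at ha
    · simp only [Option.map_some, Option.mem_def, Option.some.injEq] at ha
      rw [hL, find_append_pair]
      simp only [Option.getD_some, ha, Rec.isBlank, and_true, if_true]
      grind
  have hmiss : ∀ k, hitOf c k = none → k = o.key → d k = none := by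
    intro k hh hk'
    subst hk'
    cases hd : d o.key with
    | none => rfl
    | some v =>
        obtain ⟨a, ha⟩ := h.dict _ _ hd
        rcases hcc with ⟨-, h1⟩ | ⟨e, v', rfl, -, -, -, h1⟩
        · grind
        · have := h1 a ha
          rw [← this] at hh
          simp [hitOf] at hh
  have hhit : ∀ k a v, hitOf c k = some (a, v) → (k, a) ∈ E (P.depth + 1) ∧ d k = some v ∧
      c = some (a, .item k v) := by
    intro k a v hh
    rcases hcc with ⟨rfl, -⟩ | ⟨e, v', rfl, he, -, hd, -⟩
    · simp [hitOf] at hh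
    · simp only [hitOf, Option.ite_none_right_eq_some, Option.some.injEq, Prod.mk.injEq] at hh
      grind
  have hkeep : ∀ o' : Op P, (resolve t c o').2 = ((c.getD blankCell, blankCell), .keep) →
      o' = o → (d.step o).2 = d → (resolve t c o).1 = (d.step o).1 →
      ItemStep l d t caches caches' E c o := by
    intro o' h1 h2 h3 h4
    subst h2
    rw [h1] at hcaches
    have hv : ∀ a, ver (layout l) caches' (P.depth + 1) a = ver (layout l) caches (P.depth + 1) a :=
      fun a => hsame _ a hcaches
    refine ⟨h4, by rw [h1]; trivial, by rw [h1]; simp, hcached _ _ hcaches, fun a k v ha => ?_,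
      fun e he => ?_, fun k v hd => ?_⟩
    · rw [h1]; exact h.item_mem a k v (hv a ▸ ha)
    · rw [h1] at he
      rw [hv, h3]; exact h.item e he
    · rw [h3] at hd
      rw [h1]; exact h.dict k v hd
  cases o with
  | get k =>
      have hr := resolve_eq t c (.get k)
      cases hh : hitOf c k with
      | none =>
          simp only [Op.key, hh] at hr
          have hd := hmiss k hh rfl
          refine hkeep _ (by rw [hr]) rfl ?_ ?_
          · simp [Dict.step, hd]
          · simp [hr, Dict.step, hd]
      | some y =>
          simp only [Op.key, hh] at hr
          obtain ⟨a, v⟩ := y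
          obtain ⟨hmem, hd, rfl⟩ := hhit k a v hh
          rw [hr] at hcaches
          have hst : d.step (.get k) = (.value v, Function.update d k none) := by
            simp [Dict.step, hd]
          have hver : ∀ a', ver (layout l) caches' (P.depth + 1) a' =
              if a = a' then .gone else ver (layout l) caches (P.depth + 1) a' := by
            intro a'
            rw [ver, hcaches, find_append_pair]
            simp only [blankCell, Rec.isBlank, Bool.true_eq_false, and_false, if_false, and_true]
            split_ifs <;> rfl
          have hmem' : ∀ e : Entry P, e ∈ (Change.remove k).apply (E (P.depth + 1)) ↔
              e ∈ E (P.depth + 1) ∧ e.1 ≠ k := by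
            simp [Change.apply]
          constructor <;> (try rw [hst]) <;> (try rw [hr]) <;>
            try dsimp only
          · exact ⟨trivial, rfl⟩
          · simp
          · intro a' ha'
            simp only [Option.map_some, Option.mem_def, Option.some.injEq] at ha'
            grind [find_append_pair, blankCell, Rec.isBlank]
          · intro a' k' v' ha'
            rw [hver] at ha'
            split_ifs at ha' with hne
            have h1 := h.item_mem a' k' v' ha'
            refine (hmem' _).2 ⟨h1, fun hkk => hne ?_⟩
            simp only at hkk
            subst hkk
            exact h.item_unique hmem h1
          · intro e he
            obtain ⟨h1, h2⟩ := (hmem' e).1 he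
            obtain ⟨v', h3, h4⟩ := h.item e h1
            grind
          · intro k' v' hd'
            by_cases hkk : k' = k
            · grind
            · rw [Function.update_of_ne hkk] at hd'
              obtain ⟨a', ha'⟩ := h.dict k' v' hd'
              grind
  | put k w =>
      have hr := resolve_eq t c (.put k w)
      cases hh : hitOf c k with
      | some y =>
          simp only [Op.key, hh] at hr
          obtain ⟨a, v⟩ := y
          obtain ⟨hmem, hd, -⟩ := hhit k a v hh
          refine hkeep _ (by rw [hr]) rfl ?_ ?_
          · simp [Dict.step, hd]
          · simp [hr, Dict.step, hd]
      | none =>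
          simp only [Op.key, hh] at hr
          have hd := hmiss k hh rfl
          rw [hr] at hcaches
          have hst : d.step (.put k w) = (.stored, Function.update d k (some w)) := by
            simp [Dict.step, hd]
          have hkE : ∀ e ∈ E (P.depth + 1), e.1 ≠ k := by
            intro e he hek
            obtain ⟨v, -, h2⟩ := h.item e he
            grind
          have hver : ∀ a', ver (layout l) caches' (P.depth + 1) a' =
              if freshName P (P.depth + 1) t = a' then .item k w
              else ver (layout l) caches (P.depth + 1) a' := by
            intro a'
            rw [← hsame _ a' rfl, ver, hcaches, find_append_pair, find_append_pair]
            simp only [blankCell, Rec.isBlank, Bool.true_eq_false, and_false, if_false, and_true]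
            grind
          have hmem' : ∀ e : Entry P, e ∈ (Change.insert (k, freshName P (P.depth + 1) t)).apply
              (E (P.depth + 1)) ↔ e = (k, freshName P (P.depth + 1) t) ∨ e ∈ E (P.depth + 1) :=
            fun e => List.mem_orderedInsert _
          constructor <;> (try rw [hst]) <;> (try rw [hr]) <;>
            try dsimp only
          · exact ⟨fun z hz hzk => lt_of_le_of_ne hzk (hkE z hz), fun z _ hzk => hzk, fun _ => rfl⟩
          · simp
          · grind
          · intro a' k' v' ha'
            rw [hver] at ha'
            rw [hmem']
            split_ifs at ha' with hne
            · grind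
            · right
              exact h.item_mem a' k' v' ha'
          · intro e he
            rcases (hmem' e).1 he with rfl | he
            · grind
            · obtain ⟨v', h3, h4⟩ := h.item e he
              grind
          · intro k' v' hd'
            by_cases hkk : k' = k
            · grind
            · rw [Function.update_of_ne hkk] at hd'
              obtain ⟨a', ha'⟩ := h.dict k' v' hd'
              grind

end

end OS

/-! ### One access preserves the invariant -/

namespace OS

open BTree Prog

variable {P : Params}

/-- The splits `s 0` of the root are paid for by `f ^ (D + 1)` times as many new items. -/
theorem pow_mul_le_of_credit {f D : ℕ} {s q : ℕ → ℕ} (h : ∀ i ≤ D, s i * f + q i ≤ s (i + 1)) :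
    s 0 * f ^ (D + 1) ≤ s (D + 1) := by
  have : ∀ j ≤ D + 1, s 0 * f ^ j ≤ s j := by
    intro j
    induction j with
    | zero => simp
    | succ j ih =>
        intro hj
        have h1 := h j (by omega)
        have h2 := Nat.mul_le_mul_right f (ih (by omega))
        grind
  grind

theorem map_snd_apply_lt {ch : Change P} {E : List (Entry P)} {b : ℕ} {nm : P.Word}
    (h : ∀ e ∈ E, e.2.val < b) (hnm : nm.val < b + 1) (hch : ∀ e, ch = .insert e → e.2 = nm) :
    ∀ e ∈ ch.apply E, e.2.val < b + 1 := by
  intro e he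
  rcases Change.mem_apply he with he | he
  · grind
  grind

/-- One access, in terms of the names before shuffling. -/
theorem Inv.access (g : P.Good) {l : List P.Item} {d : Dict P} {t : ℕ} {next : P.Word}
    {caches : ℕ → List (P.Word × Rec P)} {used : List P.Word} {N : ℕ → List (LNode P)}
    {E : ℕ → List (Entry P)} {s : ℕ → ℕ} (h : Inv l d t next caches used N E s)
    (ht : t < P.epoch) (o : Op P) :
    ∃ (path : List (Option (P.Word × Rec P))) (next' : P.Word) (xs : List P.Word)
      (caches' : ℕ → List (P.Word × Rec P)) (N' : ℕ → List (LNode P)) (E' : ℕ → List (Entry P))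
      (s' : ℕ → ℕ),
      searchA (layout l) caches o.key next = (path, next', xs) ∧
      (∀ x ∈ xs, x.val < P.arrayCells) ∧ (∀ c ∈ path, WfCell c) ∧
      (∀ x ∈ outsOf t path o, caches' x.1 = caches x.1 ++ [x.2.1, x.2.2]) ∧
      (resolve t path.getLast?.join o).1 = (d.step o).1 ∧
      Inv l (d.step o).2 (t + 1) next' caches' (used ++ xs) N' E' s' := by
  have hW := arrayCells_lt g
  have hTA := treeCells_le (P := P)
  have hA : P.treeCells + P.levels * (t + 1) ≤ P.arrayCells := by
    rw [Params.arrayCells]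
    exact Nat.add_le_add_left (Nat.mul_le_mul_left _ ht) _
  set k := o.key with hkdef
  set c := cellVisited (layout l) caches k with hcdef
  obtain ⟨N₁, x, N₂, hpath, hlast⟩ := exists_path h.level h.node h.names h.entries h.root k
  -- the names and contents of what is visited
  have hxmem : ∀ i ≤ P.depth, x i ∈ N i := fun i hi => by rw [(hpath i hi).1]; simp
  have hcnode : ∀ i ≤ P.depth, c i = some ((x i).1.2, .node (x i).2) := by
    intro i hi
    rw [hcdef, cellVisited, (hpath i hi).2.2.2, Option.map_some, h.node i hi _ (hxmem i hi)]
  have hcitem : c (P.depth + 1) = (lastLe k (x P.depth).2).map fun e =>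
      (e.2, ver (layout l) caches (P.depth + 1) e.2) := by
    rw [hcdef, cellVisited, hlast, Option.map_map]; rfl
  have hleafmem : ∀ e ∈ (x P.depth).2, e ∈ E (P.depth + 1) := by
    intro e he
    rw [← h.entries P.depth le_rfl]
    grind
  have hcur : ∀ i ≤ P.depth + 1, ∀ a, curAt (layout l) caches k i = some a →
      (∃ e ∈ E i, e.2 = a) ∧ ((∃ es, ver (layout l) caches i a = .node es) ∨
        ∃ k' v, ver (layout l) caches i a = .item k' v) := by
    intro i hi a ha
    rcases Nat.lt_succ_iff_lt_or_eq.1 (Nat.lt_succ_of_le hi) with hi | rfl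
    · have hi' : i ≤ P.depth := by omega
      rw [(hpath i hi').2.2.2, Option.some.injEq] at ha
      subst ha
      refine ⟨⟨(x i).1, ?_, rfl⟩, Or.inl ⟨_, h.node i hi' _ (hxmem i hi')⟩⟩
      rw [← h.names i hi']
      grind
    · rw [hlast, Option.map_eq_some_iff] at ha
      obtain ⟨e, he, rfl⟩ := ha
      have he' := hleafmem e (lastLe_eq_some he).1
      obtain ⟨v, hv, -⟩ := h.item e he'
      grind
  have huncached : ∀ j, ∀ a, curAt (layout l) caches k j = some a → j < P.levels →
      find a (caches j) = none →
      a.val < P.treeCells ∧ heightOf P a.val = some (P.depth + 1 - j) := by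
    intro j a ha hj hf
    rw [Params.levels] at hj
    obtain ⟨⟨e, he, rfl⟩, hv⟩ := hcur j (by omega) a ha
    have hlt : e.2.val < P.treeCells := by
      by_contra hge
      rw [ver, hf, Option.getD_none, layout_dummy (not_lt.1 hge)] at hv
      grind
    exact ⟨hlt, h.height j (by omega) e he (by omega)⟩
  -- the search
  obtain ⟨r, hr⟩ : ∃ r, r = searchA (layout l) caches k next := ⟨_, rfl⟩
  have hr' : r = descendA (layout l) caches k (List.range' 0 P.levels)
      (curAt (layout l) caches k 0) next := by
    rw [hr, searchA, List.range_eq_range']; rfl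
  have hfst : r.1 = (List.range P.levels).map c := by
    rw [hr', descendA_fst, List.range_eq_range']
  obtain ⟨hn1, hn2, hnd, hxs⟩ := descendA_positions (fun x h1 _ => layout_dummy h1) (by omega)
    0 P.levels (by omega) huncached next h.le_next
    (by have := h.next_le; rw [Nat.mul_succ] at hA; omega) hr'
  obtain ⟨path, next', xs⟩ := r
  simp only at hfst hn1 hn2 hnd hxs
  have hnext' : next'.val ≤ P.treeCells + P.levels * (t + 1) := by
    have := h.next_le
    grind
  have hlastc : path.getLast?.join = c (P.depth + 1) := by
    grind [Params.levels, List.range_succ]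
  -- the changes
  set R := resolve t (c (P.depth + 1)) o with hR
  obtain ⟨chg, hchg0, hchg, hclimb⟩ := exists_changes t c (P.depth + 1) R.2.2
  have hchg' : ∀ i ≤ P.depth, chg i = stepUp (freshName P i t) (x i) (chg (i + 1)) := by
    grind [climb1_node]
  set caches' : ℕ → List (P.Word × Rec P) := fun i => caches i ++
    (if i = P.depth + 1 then [R.2.1.1, R.2.1.2]
      else [(climb1 t i (c i) (chg (i + 1))).1.1, (climb1 t i (c i) (chg (i + 1))).1.2]) with hcaches
  have hc1 : caches' (P.depth + 1) = caches (P.depth + 1) ++ [R.2.1.1, R.2.1.2] := by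
    grind
  have hc2 : ∀ i ≤ P.depth, caches' i = caches i ++
      [(climb1 t i (some ((x i).1.2, .node (x i).2)) (chg (i + 1))).1.1,
        (climb1 t i (some ((x i).1.2, .node (x i).2)) (chg (i + 1))).1.2] := by
    intro i hi
    rw [← hcnode i hi]
    simp only [hcaches]
    rw [if_neg (by omega)]
  have hlevD := h.level P.depth le_rfl
  rw [(hpath P.depth le_rfl).1] at hlevD
  have hstep : ItemStep l d t caches caches' E (c (P.depth + 1)) o := by
    refine h.resolve_step g ht o hleafmem (fun a ha => ?_) (hlevD.node _ (by simp)).sorted hcitem hc1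
    rw [← h.entries P.depth le_rfl, (hpath P.depth le_rfl).1] at ha
    exact hlevD.mem_of_key (hpath P.depth le_rfl).2.1 (hpath P.depth le_rfl).2.2.1 ha
  -- all changes are valid
  have hlvl : ∀ i ≤ P.depth, (chg (i + 1)).Valid k (i + 1 = P.depth + 1) (E (i + 1)) →
      Level (i + 1 = P.depth + 1) (N₁ i ++ (stepNode (freshName P i t) (x i) (chg (i + 1)) ++ N₂ i)) ∧
      (N₁ i ++ (stepNode (freshName P i t) (x i) (chg (i + 1)) ++ N₂ i)).map Prod.fst =
        (chg i).apply (E i) ∧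
      (N₁ i ++ (stepNode (freshName P i t) (x i) (chg (i + 1)) ++ N₂ i)).flatMap Prod.snd =
        (chg (i + 1)).apply (E (i + 1)) ∧
      (chg i).Valid k False (E i) ∧
      (chg i).cost * (P.branch / 2) +
          excess (N₁ i ++ (stepNode (freshName P i t) (x i) (chg (i + 1)) ++ N₂ i)) ≤
        excess (N i) + (chg (i + 1)).cost := by
    intro i hi hv
    obtain ⟨p1, p2, p3, -⟩ := hpath i hi
    have hl := h.level i hi
    have hE1 := h.entries i hi
    have hE0 := h.names i hi
    rw [p1] at hl hE1 hE0
    rw [← hE1] at hv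
    obtain ⟨q1, q2, q3, q4⟩ := hl.step g p2 p3 hv (freshName P i t)
    rw [← hchg' i hi] at q2 q3 q4
    rw [hE0] at q2 q3
    have q5 := hl.flatMap_step p2 p3 hv (freshName P i t)
    grind
  have hvalid : ∀ j ≤ P.depth + 1, (chg (P.depth + 1 - j)).Valid k
      (P.depth + 1 - j = P.depth + 1) (E (P.depth + 1 - j)) := by
    intro j
    induction j with
    | zero =>
        intro _
        simp only [Nat.sub_zero]
        rw [hchg0]
        simpa using hstep.valid
    | succ j ih =>
        intro hj
        have hi := ih (by omega)
        rw [show P.depth + 1 - j = P.depth + 1 - (j + 1) + 1 by omega] at hi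
        have := (hlvl (P.depth + 1 - (j + 1)) (by omega) hi).2.2.2.1
        rwa [show (P.depth + 1 - (j + 1) = P.depth + 1) = False by simp; omega]
  have hvalid' : ∀ i ≤ P.depth, (chg (i + 1)).Valid k (i + 1 = P.depth + 1) (E (i + 1)) := by
    intro i hi
    have := hvalid (P.depth - i) (by omega)
    rwa [show P.depth + 1 - (P.depth - i) = i + 1 by omega] at this
  have hfr : ∀ i ≤ P.depth + 1, (freshName P i t).val = P.arrayCells + i * P.epoch + t :=
    fun i hi => freshName_val g (by rw [Params.levels]; omega) ht
  have hins : ∀ i ≤ P.depth + 1, ∀ e, chg i = .insert e → e.2 = freshName P i t := by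
    intro i hi e he
    rcases Nat.lt_succ_iff_lt_or_eq.1 (Nat.lt_succ_of_le hi) with hi | rfl
    · rw [hchg' i (by omega), stepUp] at he
      split_ifs at he
      split at he
      · injection he with he
        rw [← he]
      grind
    · rw [hchg0] at he
      exact hstep.fresh e he
  have hnew : ∀ i ≤ P.depth + 1, freshName P i t ∉ (E i).map Prod.snd := by
    intro i hi hmem
    obtain ⟨e, he, h1⟩ := List.mem_map.1 hmem
    have := h.lt i hi e he
    grind
  -- the root is not split
  set s' : ℕ → ℕ := fun i => s i + (chg i).cost with hs'
  have hcredit : ∀ i ≤ P.depth, s' i * (P.branch / 2) +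
      excess (N₁ i ++ (stepNode (freshName P i t) (x i) (chg (i + 1)) ++ N₂ i)) ≤ s' (i + 1) := by
    intro i hi
    have h1 := (hlvl i hi (hvalid' i hi)).2.2.2.2
    have h2 := h.credit i hi
    grind
  have hcost1 : ∀ ch : Change P, ch.cost ≤ 1 := by
    intro ch; cases ch <;> simp [Change.cost]
  have hcredit_le : s' (P.depth + 1) ≤ t + 1 := by
    have h1 := h.credit_le
    grind
  have hroot : chg 0 = .keep := by
    have h1 := pow_mul_le_of_credit hcredit
    have h2 := g.cap
    have h3 := g.epoch_le
    have h4 : s' 0 = 0 := by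
      by_contra h0
      have := Nat.le_mul_of_pos_left ((P.branch / 2) ^ (P.depth + 1)) (Nat.pos_of_ne_zero h0)
      omega
    have h5 : (chg 0).cost = 0 := by simp only [hs'] at h4; omega
    have h6 := (hlvl 0 (by omega) (hvalid' 0 (by omega))).2.2.2.1
    cases h7 : chg 0 with
    | keep => rfl
    | remove k' => rw [h7] at h6; exact absurd h6.1 id
    | insert e => rw [h7] at h5; simp [Change.cost] at h5
  -- what was read is cached
  have hcached : ∀ i ≤ P.depth + 1, ∀ a, curAt (layout l) caches k i = some a →
      (find a (caches' i)).isSome := by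
    intro i hi a ha
    rcases Nat.lt_succ_iff_lt_or_eq.1 (Nat.lt_succ_of_le hi) with hi | rfl
    · have hi' : i ≤ P.depth := by omega
      rw [(hpath i hi').2.2.2, Option.some.injEq] at ha
      obtain ⟨es, h1, -⟩ := climb1_cells t i (x i) (chg (i + 1))
      rw [hc2 i hi', find_append_pair, h1, ← ha]
      simp only [Rec.isBlank, and_true, if_true]
      split_ifs <;> rfl
    · refine hstep.cached a ?_
      rw [hcdef, cellVisited, ha]
      simp
  have hold : ∀ i a, (find a (caches i)).isSome → (find a (caches' i)).isSome := by
    grind [find_append]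
  refine ⟨path, next', xs, caches',
    fun i => N₁ i ++ (stepNode (freshName P i t) (x i) (chg (i + 1)) ++ N₂ i),
    fun i => (chg i).apply (E i), s', hr.symm, ?_, ?_, ?_, ?_, ?_⟩
  · intro y hy
    rcases hxs y hy with ⟨j, -, hj2, hj3, hj4⟩ | h1
    · grind
    · omega
  · intro z hz
    rw [hfst] at hz
    obtain ⟨i, hi, rfl⟩ := List.mem_map.1 hz
    rw [List.mem_range, Params.levels] at hi
    intro y hy
    rcases Nat.lt_succ_iff_lt_or_eq.1 hi with hi | rfl
    · rw [hcnode i (by omega), Option.mem_def, Option.some.injEq] at hy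
      rw [← hy]
      exact ((h.level i (by omega)).node _ (hxmem i (by omega))).len
    · rw [hcitem, Option.mem_def, Option.map_eq_some_iff] at hy
      obtain ⟨e, he, rfl⟩ := hy
      obtain ⟨v, hv, -⟩ := h.item e (hleafmem e (lastLe_eq_some he).1)
      rw [hv]; trivial
  · intro y hy
    rw [outsOf, hlastc, hfst] at hy
    have hzip : (List.range (P.depth + 1)).zip ((List.range P.levels).map c) =
        (List.range (P.depth + 1)).map fun i => (i, c i) := by
      apply List.ext_getElem
      · simp [Params.levels]
      simp
    rw [hzip] at hy
    rcases List.mem_cons.1 hy with rfl | hy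
    · exact hc1
    grind
  · rw [hlastc]; exact hstep.resp
  · constructor
    · grind
    · intro i hi
      have hnn : ∀ y ∈ N₁ i ++ x i :: N₂ i,
          (find y.1.2 (caches i)).getD (layout l y.1.2) = .node y.2 := by
        rw [← (hpath i hi).1]; exact h.node i hi
      have hE0 := h.names i hi
      rw [(hpath i hi).1] at hE0
      have := node_step (ch := chg (i + 1)) hnn (by rw [hE0]; exact h.nodup i (by omega))
        (by rw [hE0]; exact hnew i (by omega))
      rw [← hc2 i hi] at this
      exact this
    · grind
    · grind
    · show (chg 0).apply (E 0) = _
      rw [hroot]; exact h.root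
    · intro i hi
      exact map_snd_apply_lt (b := P.arrayCells + i * P.epoch + t) (h.lt i hi)
        (by rw [hfr i hi]; exact Nat.lt_succ_self _) (hins i hi)
    · intro i hi e he hlt
      rcases Change.mem_apply he with he | he
      · exact h.height i hi e he hlt
      grind
    · intro i hi
      exact nodup_apply (h.nodup i hi) fun e he => by rw [hins i hi e he]; exact hnew i hi
    · show ∀ a k v, _ → _ ∈ (chg (P.depth + 1)).apply _
      rw [hchg0]; exact hstep.item_mem
    · show ∀ e ∈ (chg (P.depth + 1)).apply _, _
      rw [hchg0]; exact hstep.item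
    · show ∀ k v, _ → ∃ a, _ ∈ (chg (P.depth + 1)).apply _
      rw [hchg0]; exact hstep.dict
    · omega
    · omega
    · exact h.le_next.trans hn1
    · exact hnext'
    · refine h.used_nodup.append hnd fun y hy hy' => ?_
      obtain ⟨hyA, hy⟩ := h.used_spec y hy
      rcases hxs y hy' with ⟨j, -, hj2, hj3, hj4⟩ | h1
      · obtain ⟨u1, u2⟩ := huncached j y hj3 (by omega) hj4
        rcases hy with ⟨i, hi, hi1, hi2⟩ | hy
        · rw [u2, Option.some.injEq] at hi1
          rw [Params.levels] at hj2
          obtain rfl : i = j := by omega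
          grind
        · omega
      · rcases hy with ⟨i, hi, hi1, hi2⟩ | hy
        · have := lt_treeCells_of_heightOf g hi1
          have := h.le_next
          omega
        · omega
    · intro y hy
      rcases List.mem_append.1 hy with hy | hy
      · obtain ⟨hyA, hy⟩ := h.used_spec y hy
        refine ⟨hyA, ?_⟩
        rcases hy with ⟨i, hi, hi1, hi2⟩ | hy
        · grind
        omega
      · rcases hxs y hy with ⟨j, -, hj2, hj3, hj4⟩ | h1
        · obtain ⟨u1, u2⟩ := huncached j y hj3 (by omega) hj4
          rw [Params.levels] at hj2
          grind
        · have := h.le_next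
          omega

end OS

namespace OS

open BTree Prog

variable {P : Params}

/-! ### The beginning of an epoch -/

theorem filter_range_eq {p : ℕ → Bool} {M M' : ℕ} (h : ∀ x, p x = true → x < M)
    (h' : ∀ x, p x = true → x < M') : (List.range M).filter p = (List.range M').filter p := by
  have key : ∀ m d, (∀ x, p x = true → x < m) →
      (List.range (m + d)).filter p = (List.range m).filter p := by
    intro m d hm
    rw [List.range_add, List.filter_append, List.filter_eq_nil_iff (l := (List.range d).map _)|>.2,
      List.append_nil]
    grind
  rcases le_total M M' with hle | hle
  · obtain ⟨d, rfl⟩ := Nat.exists_eq_add_of_le hle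
    grind
  · obtain ⟨d, rfl⟩ := Nat.exists_eq_add_of_le hle
    grind

theorem flatMap_range_mul (m f : ℕ) :
    ((List.range m).flatMap fun q => (List.range f).map fun c => q * f + c) = List.range (m * f) := by
  induction m with
  | zero => simp
  | succ m ih =>
      simp [List.range_succ, List.flatMap_append, ih, Nat.succ_mul, List.range_add]

/-- The numbers of the nodes at height `h`. -/
noncomputable def nodesAt (l : List P.Item) (h : ℕ) : List ℕ :=
  (List.range (levelLen P h)).filter fun q => hasNode P (liveOf l) h q

/-- The entry for node number `q` at height `h`. -/
noncomputable def entryAt (l : List P.Item) (h q : ℕ) : Entry P :=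
  (sep (keyOf l) h q, P.word (levelOff P h + q))

section

variable {l : List P.Item}

theorem mem_nodesAt (g : P.Good) (hl : l.length ≤ P.n) {h q : ℕ} :
    q ∈ nodesAt l h ↔ hasNode P (liveOf l) h q = true := by
  rw [nodesAt, List.mem_filter, List.mem_range]
  exact ⟨fun h => h.2, fun h => ⟨lt_levelLen g hl h, h⟩⟩

theorem kids_eq (h q : ℕ) : kids (liveOf l) (keyOf l) P.word h q =
    (((List.range (fan P)).filter fun c => hasNode P (liveOf l) h (q * fan P + c)).map
      fun c => entryAt l h (q * fan P + c)) := rfl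

theorem flatMap_kids (g : P.Good) (hl : l.length ≤ P.n) (h : ℕ) :
    (nodesAt l (h + 1)).flatMap (kids (liveOf l) (keyOf l) P.word h) =
      (nodesAt l h).map (entryAt l h) := by
  have e1 : ∀ q, kids (liveOf l) (keyOf l) P.word h q =
      (((List.range (fan P)).map fun c => q * fan P + c).filter
        fun x => hasNode P (liveOf l) h x).map (entryAt l h) := by
    intro q
    rw [kids_eq, List.filter_map, List.map_map]
    rfl
  have e2 : (nodesAt l (h + 1)).flatMap (kids (liveOf l) (keyOf l) P.word h) =
      (List.range (levelLen P (h + 1))).flatMap (kids (liveOf l) (keyOf l) P.word h) := by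
    rw [nodesAt, List.flatMap, List.flatMap, flatten_map_filter]
    intro q hq
    rw [kids_eq, List.map_eq_nil_iff, List.filter_eq_nil_iff]
    intro c hc hn
    exact hq (hasNode_parent g (List.mem_range.1 hc) hn)
  rw [e2]
  simp only [funext e1]
  rw [← List.map_flatMap, ← List.filter_flatMap, flatMap_range_mul, nodesAt]
  congr 1
  refine filter_range_eq (fun x hx => ?_) fun x hx => lt_levelLen g hl hx
  have hf := fan_pos g
  have h1 : x / fan P < levelLen P (h + 1) := by
    have := hasNode_div hx 1
    rw [pow_one] at this
    exact lt_levelLen g hl this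
  exact (Nat.div_lt_iff_lt_mul hf).1 h1

theorem hasNode_mul (g : P.Good) {h q : ℕ} (hq : hasNode P (liveOf l) (h + 1) q = true) (hh : 1 ≤ h ∨ q ≠ 0) :
    hasNode P (liveOf l) h (q * fan P) = true ∧
      sep (keyOf l) h (q * fan P) = sep (keyOf l) (h + 1) q := by
  have e : q * fan P * fan P ^ h = q * fan P ^ (h + 1) := by rw [pow_succ]; ring
  rw [hasNode_iff] at hq ⊢
  rw [e, sep, sep, e]
  by_cases hq0 : q = 0
  · grind
  · have h2 : q * fan P ^ (h + 1) < l.length := by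
      omega
    refine ⟨Or.inl h2, ?_⟩
    rw [if_neg (c := q = 0 ∧ 1 ≤ h + 1) (by tauto), if_neg]
    rintro ⟨h3, h4⟩
    rcases Nat.mul_eq_zero.1 h3 with h3 | h3
    · exact hq0 h3
    · exact (fan_pos g).ne' h3

theorem ge_sep (g : P.Good) (hs : l.Pairwise fun x y => x.1 < y.1) {h q c : ℕ}
    (hq : hasNode P (liveOf l) (h + 1) q = true)
    (hc : hasNode P (liveOf l) h (q * fan P + c) = true) :
    sep (keyOf l) (h + 1) q ≤ sep (keyOf l) h (q * fan P + c) := by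
  by_cases hq0 : q = 0
  · subst hq0
    rw [sep, if_pos (by omega)]
    exact Fin.mk_le_of_le_val (by simp)
  · rw [← (hasNode_mul g hq (Or.inr hq0)).2]
    rcases Nat.eq_zero_or_pos c with rfl | hc0
    · simp
    · exact (sep_lt_sep g hs hc (by omega)).le

/-- The nodes at height `h + 1`. -/
noncomputable def levelAt (l : List P.Item) (h : ℕ) : List (LNode P) :=
  (nodesAt l (h + 1)).map fun q =>
    (entryAt l (h + 1) q, kids (liveOf l) (keyOf l) P.word h q)

theorem level_levelAt (g : P.Good) (hs : l.Pairwise fun x y => x.1 < y.1) (hl : l.length ≤ P.n)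
    (h : ℕ) {leaf : Prop} (hleaf : ¬ leaf → 1 ≤ h) : Level leaf (levelAt l h) := by
  constructor
  · intro x hx
    obtain ⟨q, hq, rfl⟩ := List.mem_map.1 hx
    rw [mem_nodesAt g hl] at hq
    constructor
    · exact (length_kids_le _ _ _ _ _).trans (Nat.div_le_self _ _)
    · intro e he
      simp only [kids_eq, List.mem_map, List.mem_filter] at he
      obtain ⟨c, ⟨-, hc⟩, rfl⟩ := he
      exact ge_sep g hs hq hc
    · simp only [kids_eq]
      rw [List.pairwise_map]
      refine List.Pairwise.imp_of_mem ?_ (List.Pairwise.filter _ List.pairwise_lt_range)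
      intro c c' _ hc' hcc
      exact sep_lt_sep g hs (List.mem_filter.1 hc').2 (by omega)
    · intro hle
      obtain ⟨h1, h2⟩ := hasNode_mul g hq (Or.inl (hleaf hle))
      refine ⟨entryAt l h (q * fan P), ?_, h2⟩
      simp only [kids_eq, List.mem_map, List.mem_filter, List.mem_range]
      exact ⟨0, ⟨fan_pos g, h1⟩, rfl⟩
  · rw [levelAt, List.pairwise_map]
    refine List.Pairwise.imp_of_mem ?_ (List.Pairwise.filter _ List.pairwise_lt_range)
    intro q q' _ hq' hqq
    have hn' := (List.mem_filter.1 hq').2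
    refine ⟨sep_lt_sep g hs hn' hqq, fun e he => ?_⟩
    simp only [kids_eq, List.mem_map, List.mem_filter, List.mem_range] at he
    obtain ⟨c, ⟨hc, -⟩, rfl⟩ := he
    obtain ⟨h1, h2⟩ := hasNode_mul g hn' (Or.inr (by omega))
    show sep (keyOf l) h (q * fan P + c) < sep (keyOf l) (h + 1) q'
    rw [← h2]
    refine sep_lt_sep g hs h1 ?_
    have : (q + 1) * fan P ≤ q' * fan P := Nat.mul_le_mul_right _ hqq
    grind

/-- The invariant holds at the beginning of an epoch. -/
theorem inv_start (g : P.Good) (hs : l.Pairwise fun x y => x.1 < y.1) (hl : l.length ≤ P.n)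
    {d : Dict P} (hd : ∀ k v, (k, v) ∈ l ↔ d k = some v) :
    Inv l d 0 (P.word P.treeCells) (fun _ => []) [] (fun i => levelAt l (P.depth - i))
      (fun i => (nodesAt l (P.depth + 1 - i)).map (entryAt l (P.depth + 1 - i))) (fun _ => 0) := by
  have hW := arrayCells_lt g
  have hT := treeCells_le (P := P)
  have hTv : (P.word P.treeCells).val = P.treeCells := P.word_val (by omega)
  have hent : ∀ i ≤ P.depth + 1, ∀ e ∈ (nodesAt l (P.depth + 1 - i)).map
      (entryAt l (P.depth + 1 - i)), ∃ q, hasNode P (liveOf l) (P.depth + 1 - i) q = true ∧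
        q < levelLen P (P.depth + 1 - i) ∧ e = entryAt l (P.depth + 1 - i) q := by
    intro i hi e he
    obtain ⟨q, hq, rfl⟩ := List.mem_map.1 he
    rw [mem_nodesAt g hl] at hq
    exact ⟨q, hq, lt_levelLen g hl hq, rfl⟩
  have hver : ∀ i a, ver (layout l) (fun _ => []) i a = layout l a := fun i a => rfl
  have hlive : ∀ q, hasNode P (liveOf l) 0 q = true ↔ q < l.length := by
    intro q
    rw [hasNode_iff]
    simp
  have hkey : ∀ q (hq : q < l.length), entryAt l 0 q = (l[q].1, P.word (levelOff P 0 + q)) := by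
    intro q hq
    rw [entryAt, sep, if_neg (by omega), pow_zero, mul_one, keyOf_eq hq]
  have hitem : ∀ q (hq : q < l.length), layout l (P.word (levelOff P 0 + q)) =
      .item l[q].1 l[q].2 := by
    intro q hq
    rw [layout_pos g l (by omega) (lt_levelLen g hl ((hlive q).2 hq)), nodeAt, if_pos (by
      simpa [liveOf] using hq), keyOf_eq hq, valOf_eq hq]
  constructor
  · intro i hi
    exact level_levelAt g hs hl _ (by omega)
  · intro i hi x hx
    obtain ⟨q, hq, rfl⟩ := List.mem_map.1 hx
    rw [mem_nodesAt g hl] at hq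
    rw [hver]
    show layout l (P.word (levelOff P (P.depth - i + 1) + q)) = _
    rw [layout_pos g l (by omega) (lt_levelLen g hl hq), nodeAt, if_pos hq]
  · intro i hi
    simp only [levelAt, List.map_map]
    rw [show P.depth + 1 - i = P.depth - i + 1 by omega]
    rfl
  · intro i hi
    simp only [levelAt, List.flatMap_map]
    rw [flatMap_kids g hl, show P.depth + 1 - (i + 1) = P.depth - i by omega]
  · have : nodesAt l (P.depth + 1) = [0] := by
      rw [nodesAt, levelLen_top g, List.range_one, List.filter_cons_of_pos hasNode_root]
      rfl
    simp [this, entryAt, levelOff_top, sep]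
  · intro i hi e he
    obtain ⟨q, -, hq, rfl⟩ := hent i hi e he
    have h1 := levelOff_add_le_treeCells g (P := P) (h := P.depth + 1 - i) (by omega)
    rw [entryAt, word_pos_val g (by omega) hq]
    omega
  · intro i hi e he _
    obtain ⟨q, -, hq, rfl⟩ := hent i hi e he
    rw [entryAt, word_pos_val g (by omega) hq, heightOf_pos (by omega) hq]
  · intro i hi
    rw [List.map_map]
    refine List.Nodup.map_on ?_ (List.nodup_range.filter _)
    intro q hq q' hq' he
    have h1 := lt_levelLen g hl ((mem_nodesAt g hl).1 hq)
    have h2 := lt_levelLen g hl ((mem_nodesAt g hl).1 hq')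
    exact (word_pos_inj g (by omega) (by omega) h1 h2 he).2
  · intro a k v ha
    rw [hver, layout, cellAt] at ha
    split_ifs at ha with h1
    cases hh : heightOf P a.val with
    | none => rw [hh] at ha; simp at ha
    | some h =>
        rw [hh] at ha
        obtain ⟨h2, q, hq, h3⟩ := exists_of_heightOf hh
        cases h with
        | zero =>
            simp only [nodeAt] at ha
            split_ifs at ha with h4
            have h5 : a.val - levelOff P 0 < l.length := by simpa [liveOf] using h4
            injection ha with h6 h7
            rw [Nat.sub_self, List.mem_map]
            refine ⟨a.val - levelOff P 0, (mem_nodesAt g hl).2 ((hlive _).2 h5), ?_⟩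
            rw [hkey _ h5, ← h6, keyOf_eq h5, show levelOff P 0 + (a.val - levelOff P 0) = a.val by
              omega, P.word_coe]
        | succ h =>
            grind [nodeAt]
  · intro e he
    obtain ⟨q, hn, hq, rfl⟩ := hent _ le_rfl e he
    grind
  · intro k v hk
    rw [← hd] at hk
    obtain ⟨q, hq, he⟩ := List.mem_iff_getElem.1 hk
    refine ⟨P.word (levelOff P 0 + q), ?_⟩
    rw [Nat.sub_self, List.mem_map]
    refine ⟨q, (mem_nodesAt g hl).2 ((hlive _).2 hq), ?_⟩
    grind
  · intro i hi
    have : excess (levelAt l (P.depth - i)) = 0 := by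
      rw [excess, List.sum_eq_zero]
      intro y hy
      obtain ⟨x, hx, rfl⟩ := List.mem_map.1 hy
      obtain ⟨q, -, rfl⟩ := List.mem_map.1 hx
      have := length_kids_le (liveOf l) (keyOf l) P.word (P.depth - i) q
      grind [fan]
    omega
  · simp
  · exact hTv.ge
  · omega
  · simp
  · simp

end

/-- A memory in which the array holds a shuffled tree, at the beginning of an epoch. -/
theorem rep_start (g : P.Good) {l : List P.Item} {m : Mem P.W}
    {π : Equiv.Perm (Fin P.arrayCells)} (hm : arrayOf m = shuffled (layout l) π) :
    Rep π (layout l) (fun _ => []) 0 m := by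
  refine ⟨fun x hx => ?_, fun i _ => by simp⟩
  have h1 := congrFun hm (π ⟨x.val, hx⟩)
  rw [shuffled, Equiv.symm_apply_apply] at h1
  simp only [P.word_coe] at h1
  have hwf : (layout l x).Wf := by
    rw [layout, cellAt]
    split_ifs
    · trivial
    · cases heightOf P x.val with
      | none => trivial
      | some h =>
          cases h with
          | zero => simp only [nodeAt]; split_ifs <;> trivial
          | succ h =>
              simp only [nodeAt]
              split_ifs
              · exact (length_kids_le _ _ _ _ _).trans (Nat.div_le_self _ _)
              · trivial
  rw [cellOf, ren_val g π hx]
  have h2 : (cellAddrs P (π ⟨x.val, hx⟩).val).map m = _ := h1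
  rw [h2, Rec.decode_encode g _ (wf_relabel π hwf)]

end OS

/-! ### The items at the end of an epoch -/

namespace OS

open BTree Prog

variable {P : Params}

/-- Place `j` of the list holds the current version of the cell `a`. -/
def IsLast (L : List (P.Word × Rec P)) (j : ℕ) (a : P.Word) (r : Rec P) : Prop :=
  L[j]? = some (a, r) ∧ r.isBlank = false ∧ ∀ c ∈ L.drop (j + 1), ¬ (c.1 = a ∧ c.2.isBlank = false)

theorem find_eq_none {a : P.Word} {L : List (P.Word × Rec P)}
    (h : ∀ c ∈ L, ¬ (c.1 = a ∧ c.2.isBlank = false)) : find a L = none := by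
  grind [find, Option.map_eq_none_iff]

theorem IsLast.find_eq {L : List (P.Word × Rec P)} {j : ℕ} {a : P.Word} {r : Rec P}
    (h : IsLast L j a r) : find a L = some r := by
  obtain ⟨h1, h2, h3⟩ := h
  obtain ⟨hj, h1⟩ := List.getElem?_eq_some_iff.1 h1
  have e : L = L.take j ++ ([(a, r)] ++ L.drop (j + 1)) := by
    rw [List.singleton_append, ← h1, ← List.drop_eq_getElem_cons hj, List.take_append_drop]
  rw [e, find_append, find_append, find_eq_none h3, find_singleton, if_pos ⟨rfl, h2⟩]
  rfl

theorem exists_isLast {L : List (P.Word × Rec P)} {a : P.Word} {r : Rec P} (h : find a L = some r) :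
    ∃ j < L.length, IsLast L j a r := by
  induction L with
  | nil => simp [find] at h
  | cons c L ih =>
      rw [← List.singleton_append, find_append] at h
      cases h' : find a L with
      | some r' =>
          rw [h'] at h
          obtain ⟨j, hj, h1, h2, h3⟩ := ih (h'.trans h)
          exact ⟨j + 1, by simpa using hj, by simpa using h1, h2, by simpa using h3⟩
      | none =>
          rw [h', Option.none_or, find_singleton] at h
          split_ifs at h with hc
          rw [Option.some.injEq] at h
          refine ⟨0, by simp, ?_, h ▸ hc.2, ?_⟩
          · grind
          · intro c' hc' hh
            grind [find, Option.map_eq_none_iff]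

theorem IsLast.unique {L : List (P.Word × Rec P)} {j j' : ℕ} {a : P.Word} {r r' : Rec P}
    (h : IsLast L j a r) (h' : IsLast L j' a r') : j = j' := by
  have key : ∀ {j j' : ℕ} {r r' : Rec P}, IsLast L j a r → IsLast L j' a r' → ¬ j < j' := by
    intro j j' r r' h h' hlt
    refine h.2.2 (a, r') ?_ ⟨rfl, h'.2.1⟩
    refine List.mem_of_getElem? (i := j' - (j + 1)) ?_
    rw [List.getElem?_drop, ← h'.1]
    grind
  grind

theorem ren_surjective (g : P.Good) (π : Equiv.Perm (Fin P.arrayCells)) :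
    Function.Surjective (ren π) := Finite.surjective_of_injective (ren_injective g π)

theorem ren_lt_iff (g : P.Good) (π : Equiv.Perm (Fin P.arrayCells)) {a : P.Word} :
    (ren π a).val < P.arrayCells ↔ a.val < P.arrayCells := by
  constructor
  · intro h
    by_contra h'
    rw [ren_of_le π (by omega)] at h
    exact h' h
  · intro h
    rw [ren_val g π h]
    omega

theorem relabel_eq_item {π : Equiv.Perm (Fin P.arrayCells)} {r : Rec P} {k : P.Word} {v : P.Val} :
    relabel π r = .item k v ↔ r = .item k v := by
  cases r <;> simp [relabel]

namespace Geom

theorem row_eq_cellOf {m : Mem P.W} {p : ℕ} (hp : p < allCells P) :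
    Rec.decode ((arr (P := P)).row m p) = cellOf m p := by
  rw [cellOf, cellAddrs_eq, Table.row, if_pos (show p < (arr (P := P)).len from hp)]

theorem itemCache_eq (m : Mem P.W) : itemCache m = cacheOf m (P.depth + 1) := by
  rw [itemCache, cacheOf]
  refine List.map_congr_left fun j hj => row_eq_cellOf ?_
  rw [List.mem_range] at hj
  have h : (P.depth + 1 + 1) * (2 * P.epoch) ≤ P.levels * (2 * P.epoch) := le_rfl
  grind [Nat.succ_mul, cacheStart, allCells]

/-- When an item is collected. -/
theorem collected_eq_some_iff {m : Mem P.W} {p : ℕ} {k : P.Word} {v : P.Val} :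
    collected m p = some (k, v) ↔
      (p < P.arrayCells ∧ (cellOf m p).2 = .item k v ∧
        find (P.word p) (cacheOf m (P.depth + 1)) = none) ∨
      (P.arrayCells ≤ p ∧ ∃ a, IsLast (cacheOf m (P.depth + 1)) (p - P.arrayCells) a (.item k v)) := by
  have hlen : (cacheOf m (P.depth + 1)).length = 2 * P.epoch := by simp [cacheOf]
  rw [collected, itemCache_eq, lookup_eq_find, List.take_of_length_le hlen.le]
  split_ifs with hp
  · rw [row_eq_cellOf (hp.trans_le (Nat.le_add_right _ _))]
    grind
  · have : P.arrayCells ≤ p := by omega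
    simp only [hp, false_and, this, true_and, false_or, IsLast]
    cases hc : (cacheOf m (P.depth + 1))[p - P.arrayCells]? with
    | none => simp
    | some c =>
        obtain ⟨a, r⟩ := c
        cases r with
        | item k' v' =>
            simp only [Option.some.injEq, Prod.mk.injEq, Rec.item.injEq]
            split_ifs with h
            · grind
            · simp only [Option.some.injEq, Prod.mk.injEq]
              constructor
              · rintro ⟨rfl, rfl⟩
                refine ⟨a, ⟨rfl, rfl, rfl⟩, rfl, fun c hc1 hc2 => h ?_⟩
                grind
              grind
        | _ => simp

/-- At the end of an epoch, the items that are collected are those of the dictionary. -/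
theorem collected_perm (G : Geom P) {π : Equiv.Perm (Fin P.arrayCells)} {l l' : List P.Item}
    {d : Dict P} {next : P.Word} {caches : ℕ → List (P.Word × Rec P)} {used : List P.Word}
    {N : ℕ → List (LNode P)} {E : ℕ → List (Entry P)} {s : ℕ → ℕ} {m : Mem P.W}
    (h : Inv l d P.epoch next caches used N E s) (hr : Rep π (layout l) caches P.epoch m)
    (hs : l'.Pairwise fun x y => x.1 < y.1) (hd : ∀ k v, (k, v) ∈ l' ↔ d k = some v) :
    ((List.range G.N).filterMap (collected m)).Perm l' := by
  have g := G.good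
  set L := cacheOf m (P.depth + 1) with hL
  have hlen : L.length = 2 * P.epoch := by simp [hL, cacheOf]
  have hrel := hr.cache (P.depth + 1) (by rw [Params.levels]; omega)
  rw [← hL, List.take_of_length_le hlen.le] at hrel
  have hfind := find_rel g hrel
  have hTA := treeCells_le (P := P)
  -- where an item is collected
  have h1 : ∀ p k v, collected m p = some (k, v) → ∃ a,
      ver (layout l) caches (P.depth + 1) a = .item k v ∧
      ((p = (ren π a).val ∧ p < P.arrayCells ∧ find (ren π a) L = none) ∨
        (P.arrayCells ≤ p ∧ ∃ r, IsLast L (p - P.arrayCells) (ren π a) r)) := by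
    intro p k v hp
    rw [collected_eq_some_iff] at hp
    rcases hp with ⟨h1, h2, h3⟩ | ⟨h1, a', h2⟩
    · obtain ⟨a, ha⟩ := ren_surjective g π (P.word p)
      have hv : (P.word p).val = p := P.word_val (by have := arrayCells_lt g; omega)
      have hav : (ren π a).val = p := by rw [ha, hv]
      refine ⟨a, ?_, Or.inl ⟨hav.symm, h1, by rw [ha]; exact h3⟩⟩
      have h4 := hfind a
      rw [ha] at h4
      rw [h3] at h4
      rw [ver, Option.map_eq_none_iff.1 h4.symm, Option.getD_none]
      have h5 := hr.array a ((ren_lt_iff g π).1 (by omega))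
      rw [hav, h2] at h5
      exact relabel_eq_item.1 h5.symm
    · obtain ⟨a, rfl⟩ := ren_surjective g π a'
      refine ⟨a, ?_, Or.inr ⟨h1, _, h2⟩⟩
      have h4 := hfind a
      rw [h2.find_eq] at h4
      obtain ⟨r, h5, h6⟩ := Option.map_eq_some_iff.1 h4.symm
      rw [ver, h5, Option.getD_some]
      exact relabel_eq_item.1 h6
  have hE : ∀ a k v, ver (layout l) caches (P.depth + 1) a = .item k v →
      (k, a) ∈ E (P.depth + 1) ∧ d k = some v := by
    intro a k v hv
    have h2 := h.item_mem a k v hv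
    obtain ⟨v', h3, h4⟩ := h.item _ h2
    grind
  rw [List.perm_ext_iff_of_nodup]
  · rintro ⟨k, v⟩
    rw [hd, List.mem_filterMap]
    constructor
    · grind
    · intro hk
      obtain ⟨a, ha⟩ := h.dict k v hk
      obtain ⟨v', hv, hk'⟩ : ∃ v', ver (layout l) caches (P.depth + 1) a = .item k v' ∧
        d k = some v' := h.item _ ha
      rw [hk, Option.some.injEq] at hk'
      subst hk'
      have hN : P.arrayCells + 2 * P.epoch ≤ G.N := G.slots
      cases hf : find a (caches (P.depth + 1)) with
      | none =>
          have h2 := hfind a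
          rw [hf, Option.map_none] at h2
          rw [ver, hf, Option.getD_none] at hv
          have haT : a.val < P.arrayCells := by
            by_contra hge
            rw [layout_dummy (by omega)] at hv
            simp at hv
          have h3 := (ren_lt_iff g π).2 haT
          refine ⟨(ren π a).val, List.mem_range.2 (by omega), ?_⟩
          rw [collected_eq_some_iff]
          refine Or.inl ⟨h3, ?_, by rw [P.word_coe]; exact h2⟩
          rw [hr.array a haT, hv]
          rfl
      | some r =>
          rw [ver, hf, Option.getD_some] at hv
          have h2 := hfind a
          rw [hf, hv, Option.map_some] at h2
          obtain ⟨j, hj, h3⟩ := exists_isLast h2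
          refine ⟨P.arrayCells + j, List.mem_range.2 (by omega), ?_⟩
          rw [collected_eq_some_iff]
          exact Or.inr ⟨by omega, ren π a, by rw [Nat.add_sub_cancel_left]; exact h3⟩
  · refine List.Nodup.filterMap ?_ List.nodup_range
    rintro p p' ⟨k, v⟩ hp hp'
    obtain ⟨a, ha, h2⟩ := h1 p k v hp
    obtain ⟨a', ha', h3⟩ := h1 p' k v hp'
    obtain rfl := h.item_unique (hE a k v ha).1 (hE a' k v ha').1
    rcases h2 with ⟨h2, -, h4⟩ | ⟨h2, r, h4⟩ <;> rcases h3 with ⟨h3, -, h5⟩ | ⟨h3, r', h5⟩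
    · rw [h2, h3]
    · rw [h5.find_eq] at h4; simp at h4
    · rw [h4.find_eq] at h5; simp at h5
    · have := h4.unique h5
      omega
  · exact hs.imp fun {x y} hxy e => by rw [e] at hxy; exact lt_irrefl _ hxy

/-- The initial memory holds the initial items. -/
theorem collected_initMem (G : Geom P) {S l : List P.Item} (hS : S.length ≤ P.n) (hl : S.Perm l) :
    ((List.range G.N).filterMap (collected (initMem S))).Perm l := by
  have g := G.good
  have hA := arrayCells_lt g
  have hnA := n_le_arrayCells (P := P)
  have hcw : 0 < P.cellWords := by rw [Params.cellWords]; omega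
  have hcell : ∀ a < allCells P, ∀ r : Rec P, r.Wf → (∀ j < P.cellWords,
      initMem S (P.word (a * P.cellWords + j)) = (Rec.encode (P.word 0) r).getD j (P.word 0)) →
      cellOf (initMem S) a = (P.word 0, r) := by
    intro a ha r hwf hr
    rw [cellOf, ← Rec.decode_encode g (P.word 0) hwf]
    congr 1
    apply List.ext_getElem
    · rw [List.length_map, length_cellAddrs, length_encode]
    grind [List.length_map, length_cellAddrs, cellAddrs]
  have hdiv : ∀ a < allCells P, ∀ j < P.cellWords,
      (P.word (a * P.cellWords + j)).val / P.cellWords = a ∧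
        (P.word (a * P.cellWords + j)).val % P.cellWords = j := by
    intro a ha j hj
    have h1 : (a + 1) * P.cellWords ≤ allCells P * P.cellWords := Nat.mul_le_mul_right _ ha
    have h2 := g.words
    rw [allCells] at h1
    rw [Nat.succ_mul] at h1
    rw [P.word_val (by omega), mul_comm a, Nat.mul_add_div hcw, Nat.div_eq_of_lt hj,
      add_zero, Nat.mul_add_mod, Nat.mod_eq_of_lt hj]
    omega
  have hsome : ∀ a < allCells P, ∀ x, S[a]? = some x →
      cellOf (initMem S) a = (P.word 0, .item x.1 x.2) := by
    intro a ha x hx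
    refine hcell a ha _ trivial fun j hj => ?_
    grind [initMem]
  have hnone : ∀ a < allCells P, S[a]? = none → cellOf (initMem S) a = (P.word 0, .blank) := by
    intro a ha hx
    refine hcell a ha _ trivial fun j hj => ?_
    grind [initMem]
  have hSA : ∀ a, P.arrayCells ≤ a → S[a]? = none := fun a ha =>
    List.getElem?_eq_none (by omega)
  have hcache : ∀ c ∈ cacheOf (initMem S) (P.depth + 1), c.2.isBlank = true := by
    intro c hc
    obtain ⟨j, hj, rfl⟩ := List.mem_map.1 hc
    rw [List.mem_range] at hj
    rw [hnone _ _ (hSA _ _)]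
    · rfl
    · have h : (P.depth + 1 + 1) * (2 * P.epoch) ≤ P.levels * (2 * P.epoch) := le_rfl
      grind [Nat.succ_mul, cacheStart, allCells]
    · rw [cacheStart]; omega
  have hcol : ∀ p, collected (initMem S) p = S[p]? := by
    intro p
    apply Option.ext
    rintro ⟨k, v⟩
    rw [collected_eq_some_iff]
    constructor
    · rintro (⟨h1, h2, -⟩ | ⟨-, a, h1, h2, -⟩)
      · grind [allCells, Rec.item.injEq]
      grind
    · intro h
      have hp : p < S.length := (List.getElem?_eq_some_iff.1 h).1
      refine Or.inl ⟨by omega, ?_, find_eq_none fun c hc h' => ?_⟩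
      · rw [hsome p (by rw [allCells]; omega) _ h]
      grind
  have hN := G.slots_le
  have e : (List.range G.N).filterMap (collected (initMem S)) = S := by
    rw [funext hcol]
    obtain ⟨x, hx⟩ := Nat.exists_eq_add_of_le (show S.length ≤ G.N by omega)
    rw [hx, List.range_add, List.filterMap_append, List.filterMap_map]
    have e1 : (List.range S.length).filterMap (fun p => S[p]?) = S := by
      have e3 : (List.range S.length).map (fun p => S[p]?) = S.map some := by
        apply List.ext_getElem
        · simp
        simp
      show (List.range S.length).filterMap (id ∘ fun p => S[p]?) = S
      rw [← List.filterMap_map, e3, List.filterMap_map]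
      simp
    have e2 : (List.range x).filterMap ((fun p => S[p]?) ∘ fun j => S.length + j) = [] := by
      simp
    grind
  grind

end Geom

end OS

/-! ### Epochs -/

namespace OS

open BTree Prog

variable {P : Params}

namespace Geom

variable (G : Geom P)

/-- The scheme with the given programs for building the tree. -/
noncomputable abbrev scheme : Scheme P := bTreeOS G.build fun _ => G.build

/-- What the server observes of `n` accesses from access number `t` of an epoch on, when the cells
`U` of the array are read. -/
noncomputable def epochTrace (t : ℕ) : ℕ → List P.Word → List (List (Event P.W))
  | 0, _ => []
  | n + 1, U =>
      (accessTrace P t (U.take P.levels) ++ (if t + 1 = P.epoch then G.buildTrace else [])) ::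
        epochTrace (t + 1) n (U.drop P.levels)

/-- The state of the client after `t` accesses of an epoch. -/
noncomputable def stateAt (π : Equiv.Perm (Fin P.arrayCells)) (next : P.Word) (t : ℕ) : State P :=
  ⟨ren π (P.word 0), ren π next, P.word t⟩

theorem searchA_length {F : P.Word → Rec P} {caches : ℕ → List (P.Word × Rec P)} {k next : P.Word}
    {path : List (Option (P.Word × Rec P))} {next' : P.Word} {xs : List P.Word}
    (h : searchA F caches k next = (path, next', xs)) : xs.length = P.levels := by
  have h1 := (length_descendA F caches k (List.range P.levels) (some (P.word 0)) next).2
  have h2 : (descendA F caches k (List.range P.levels) (some (P.word 0)) next).2.2 = xs :=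
    congrArg (fun z => z.2.2) h
  grind

/-- The accesses of an epoch: the cells `U` of the array that are read depend on the tree and on the
accesses, but not on the shuffle. -/
theorem exec_epoch {l : List P.Item} (os : List (Op P)) {d : Dict P} {t : ℕ} {next : P.Word}
    {caches : ℕ → List (P.Word × Rec P)} {used : List P.Word} {N : ℕ → List (LNode P)}
    {E : ℕ → List (Entry P)} {s : ℕ → ℕ} (h : Inv l d t next caches used N E s)
    (ht : t + os.length ≤ P.epoch) :
    ∃ U : List P.Word, U.length = P.levels * os.length ∧ (used ++ U).Nodup ∧
      (∀ x ∈ U, x.val < P.arrayCells) ∧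
      (t + os.length < P.epoch → ∃ next', ∀ π m, Rep π (layout l) caches t m →
        ∃ m', G.scheme.runOps os (stateAt π next t) m = PMF.pure (d.responses os,
          G.epochTrace t os.length (U.map (ren π)), stateAt π next' (t + os.length), m')) ∧
      (t + os.length = P.epoch → os ≠ [] → ∀ l' : List P.Item,
        (l'.Pairwise fun x y => x.1 < y.1) → l'.length ≤ P.n →
        (∀ k v, (k, v) ∈ l' ↔ d.after os k = some v) → ∀ π m, Rep π (layout l) caches t m →
        Coupled (fun y π' => y.1 = d.responses os ∧
            y.2.1 = G.epochTrace t os.length (U.map (ren π)) ∧ y.2.2.1 = startState π' ∧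
            arrayOf y.2.2.2 = shuffled (layout l') π')
          (G.scheme.runOps os (stateAt π next t) m)
          (PMF.uniformOfFintype (Equiv.Perm (Fin P.arrayCells)))) := by
  induction os generalizing d t next caches used N E s with
  | nil =>
      refine ⟨[], by simp, by simpa using h.used_nodup, by simp, fun _ => ⟨next, fun π m _ =>
        ⟨m, rfl⟩⟩, fun _ h => absurd rfl h⟩
  | cons o os ih =>
      have g := G.good
      rw [List.length_cons] at ht
      obtain ⟨path, next', xs, caches', N', E', s', h1, h2, h3, h4, h5, h6⟩ :=
        h.access g (by omega) o
      have hxs := searchA_length h1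
      obtain ⟨U, u1, u2, u3, u4, u5⟩ := ih h6 (by omega)
      have hstep : ∀ π m, Rep π (layout l) caches t m → ∃ m', Rep π (layout l) caches' (t + 1) m' ∧
          (G.scheme.access o (stateAt π next t)).run m = if t + 1 = P.epoch then
            (G.build.run m').map fun y => (((d.step o).1, y.1), y.2.1,
              accessTrace P t (xs.map (ren π)) ++ y.2.2)
          else PMF.pure (((d.step o).1, stateAt π next' (t + 1)), m',
            accessTrace P t (xs.map (ren π))) := by
        intro π m hm
        obtain ⟨m', h7, h8⟩ := run_access g hm (by omega) o h1 h2 h3 h4 (fun _ => G.build)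
        rw [h5] at h8
        exact ⟨m', h7, h8⟩
      have htr : ∀ π, G.epochTrace t (o :: os).length ((xs ++ U).map (ren π)) =
          (accessTrace P t (xs.map (ren π)) ++
            (if t + 1 = P.epoch then G.buildTrace else [])) ::
            G.epochTrace (t + 1) os.length (U.map (ren π)) := by
        grind [List.length_cons, epochTrace]
      refine ⟨xs ++ U, ?_, by rwa [← List.append_assoc], ?_, ?_, ?_⟩
      · grind
      · grind
      · intro hlt
        rw [List.length_cons] at hlt
        obtain ⟨next'', u4⟩ := u4 (by omega)
        refine ⟨next'', fun π m hm => ?_⟩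
        obtain ⟨m', h7, h8⟩ := hstep π m hm
        rw [if_neg (by omega)] at h8
        obtain ⟨m'', h9⟩ := u4 π m' h7
        refine ⟨m'', ?_⟩
        rw [Scheme.runOps, h8, PMF.pure_bind]
        simp only
        rw [h9, PMF.pure_map, htr, if_neg (by omega), List.append_nil, List.length_cons,
          show t + (os.length + 1) = t + 1 + os.length by omega]
        rfl
      · intro he _ l' hs hl hd π m hm
        obtain ⟨m', h7, h8⟩ := hstep π m hm
        rw [Scheme.runOps, h8, htr]
        rw [List.length_cons] at he
        by_cases hte : t + 1 = P.epoch
        · have hos : os = [] := List.length_eq_zero_iff.1 (by omega)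
          subst hos
          rw [if_pos hte, if_pos hte, PMF.bind_map]
          have hinv := h6
          rw [hte] at hinv h7
          have hb := G.coupled_build hs hl (collected_perm G hinv h7 hs hd)
          have hc := hb.map (f := fun y => ([(d.step o).1],
            [accessTrace P t (xs.map (ren π)) ++ y.2.2], y.1, y.2.1)) (g := id)
            (Ψ := fun y π' => y.1 = d.responses [o] ∧ y.2.1 =
              (accessTrace P t (xs.map (ren π)) ++ G.buildTrace) ::
                G.epochTrace (t + 1) ([] : List (Op P)).length (U.map (ren π)) ∧
              y.2.2.1 = startState π' ∧ arrayOf y.2.2.2 = shuffled (layout l') π') (by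
              rintro y π' ⟨b1, b2, b3⟩
              exact ⟨rfl, by rw [b3]; rfl, b1, b2⟩)
          rw [PMF.map_id] at hc
          convert hc using 1
          rw [PMF.map]
          congr 1
          grind [Scheme.runOps, PMF.pure_map]
        · rw [if_neg hte, if_neg hte, PMF.pure_bind, List.append_nil]
          have hos : os ≠ [] := by
            grind
          have := u5 (by omega) hos l' hs hl hd π m' h7
          have := this.map (f := fun y => ((d.step o).1 :: y.1,
            accessTrace P t (xs.map (ren π)) :: y.2.1, y.2.2.1, y.2.2.2)) (g := id)
            (Ψ := fun y π' => y.1 = d.responses (o :: os) ∧ y.2.1 =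
              accessTrace P t (xs.map (ren π)) ::
                G.epochTrace (t + 1) os.length (U.map (ren π)) ∧
              y.2.2.1 = startState π' ∧ arrayOf y.2.2.2 = shuffled (layout l') π') (by
              rintro y π' ⟨b1, b2, b3, b4⟩
              exact ⟨by rw [Dict.responses, b1], by rw [b2], b3, b4⟩)
          rwa [PMF.map_id] at this

/-- Since the cells that are read are distinct, reading them in a shuffled array looks like reading
the first cells of an array that is shuffled in another way. -/
theorem exists_perm_extend {U : List P.Word} (hU : U.Nodup) (hA : ∀ x ∈ U, x.val < P.arrayCells) :
    ∃ τ : Equiv.Perm (Fin P.arrayCells),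
      ∀ π, U.map (ren π) = (List.range U.length).map (rename (π * τ)) := by
  classical
  have hlen : U.length ≤ P.arrayCells := by
    have h1 : (U.map Fin.val).Nodup := hU.map Fin.val_injective
    have h2 : (U.map Fin.val).toFinset ⊆ Finset.range P.arrayCells := by
      grind [List.mem_toFinset]
    have h3 := Finset.card_le_card h2
    rwa [List.toFinset_card_of_nodup h1, List.length_map, Finset.card_range] at h3
  set f : Fin P.arrayCells → Fin P.arrayCells := fun i =>
    if h : i.val < U.length then ⟨U[i.val].val, hA _ (List.getElem_mem h)⟩ else i with hf
  obtain ⟨e, he⟩ := Finset.exists_equiv_extend_of_card_eq (α := Fin P.arrayCells)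
    (t := (Finset.univ : Finset (Fin P.arrayCells))) (by simp)
    (s := Finset.univ.filter fun i => i.val < U.length) (f := f) (Finset.subset_univ _) (by
      intro i hi j hj hij
      simp only [Finset.coe_filter, Finset.mem_univ, true_and, Set.mem_ofPred_eq] at hi hj
      simp only [hf, hi, hj, dif_pos, Fin.mk.injEq] at hij
      exact Fin.ext ((hU.getElem_inj_iff).1 (Fin.ext hij)))
  refine ⟨Equiv.ofBijective (fun i => (e i : Fin P.arrayCells)) (Finite.injective_iff_bijective.1
    fun i j hij => e.injective (Subtype.ext hij)), fun π => ?_⟩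
  apply List.ext_getElem
  · simp
  · intro x h1 h2
    rw [List.length_map] at h1
    have hx : x < P.arrayCells := by omega
    have h3 := he ⟨x, hx⟩ (by simpa using h1)
    rw [List.getElem_map, List.getElem_map, List.getElem_range]
    rw [ren, rename, rename, dif_pos hx, dif_pos (hA _ (List.getElem_mem h1))]
    rw [Equiv.Perm.mul_apply, Equiv.ofBijective_apply, h3]
    simp only [hf, dif_pos h1]

/-- The law of what the server observes of the first `n` accesses of an epoch. -/
noncomputable def epochLaw (n : ℕ) : PMF (List (List (Event P.W))) :=
  (PMF.uniformOfFintype (Equiv.Perm (Fin P.arrayCells))).map fun σ =>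
    G.epochTrace 0 n ((List.range (P.levels * n)).map (rename σ))

/-- The law of what the server observes of `q` epochs and `r` accesses. -/
noncomputable def viewLaw : ℕ → ℕ → PMF (List (List (Event P.W)))
  | 0, r => G.epochLaw r
  | q + 1, r => (G.epochLaw P.epoch).bind fun τ => (viewLaw q r).map fun τ' => τ ++ τ'

/-- The tree for the items `l` has been shuffled by `π`, and an epoch begins. -/
def Start (l : List P.Item) (x : State P × Mem P.W) (π : Equiv.Perm (Fin P.arrayCells)) : Prop :=
  x.1 = startState π ∧ arrayOf x.2 = shuffled (layout l) π

/-- The list of the items of a dictionary, sorted by keys. -/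
structure ListOf (d : Dict P) (l : List P.Item) : Prop where
  sorted : l.Pairwise fun x y => x.1 < y.1
  length_le : l.length ≤ P.n
  mem : ∀ k v, (k, v) ∈ l ↔ d k = some v

theorem exists_listOf {d : Dict P} (hd : d.size ≤ P.n) : ∃ l, ListOf d l := by
  classical
  set K : Finset P.Word := Finset.univ.filter fun k => (d k).isSome with hK
  have hmem : ∀ k ∈ K.sort (· ≤ ·), (d k).isSome := by
    simp_all
  refine ⟨(K.sort (· ≤ ·)).filterMap fun k => (d k).map fun v => (k, v), ?_, ?_, ?_⟩
  · rw [List.pairwise_filterMap]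
    refine (Finset.sortedLT_sort K).pairwise.imp ?_
    simp_all
  · refine (List.length_filterMap_le _ _).trans ?_
    rw [Finset.length_sort]
    refine le_trans (le_of_eq ?_) hd
    rw [Dict.size, ← Set.ncard_coe_finset]
    simp_all
  simp_all

theorem ListOf.unique {d : Dict P} {l l' : List P.Item} (h : ListOf d l) (h' : ListOf d l') :
    l = l' := by
  have hn : ∀ {x : List P.Item}, (x.Pairwise fun x y => x.1 < y.1) → x.Nodup := fun hx =>
    hx.imp fun hxy e => absurd (congrArg Prod.fst e) hxy.ne
  refine List.Perm.eq_of_pairwise (le := fun x y => x.1 < y.1) ?_ h.sorted h'.sorted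
    ((List.perm_ext_iff_of_nodup (hn h.sorted) (hn h'.sorted)).2 fun x => ?_)
  · grind
  · rw [h.mem, h'.mem]

theorem startState_eq (g : P.Good) (π : Equiv.Perm (Fin P.arrayCells)) :
    startState π = stateAt π (P.word P.treeCells) 0 := by
  have h1 := arrayCells_lt g
  have h2 := treeCells_le (P := P)
  rw [stateAt, ren, ren, P.word_val (by omega), P.word_val (by omega)]
  rfl

/-- An epoch, from the beginning. -/
theorem exec_start {l : List P.Item} {d : Dict P} (hl : ListOf d l) (os : List (Op P))
    (ho : os.length ≤ P.epoch) : ∃ τ : Equiv.Perm (Fin P.arrayCells), ∀ x π, Start l x π →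
      (os.length < P.epoch → ∃ s' m', G.scheme.runOps os x.1 x.2 = PMF.pure (d.responses os,
        G.epochTrace 0 os.length ((List.range (P.levels * os.length)).map (rename (π * τ))),
          s', m')) ∧
      (os.length = P.epoch → ∀ l', ListOf (d.after os) l' →
        Coupled (fun y π' => y.1 = d.responses os ∧ y.2.1 =
          G.epochTrace 0 os.length ((List.range (P.levels * os.length)).map (rename (π * τ))) ∧
            Start l' y.2.2 π') (G.scheme.runOps os x.1 x.2)
          (PMF.uniformOfFintype (Equiv.Perm (Fin P.arrayCells)))) := by
  have g := G.good
  obtain ⟨U, u1, u2, u3, u4, u5⟩ := G.exec_epoch os (inv_start g hl.sorted hl.length_le hl.mem)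
    (by omega)
  rw [List.nil_append] at u2
  obtain ⟨τ, hτ⟩ := exists_perm_extend u2 u3
  refine ⟨τ, ?_⟩
  rintro ⟨s, m⟩ π ⟨h1, h2⟩
  simp only at h1 h2
  have hm := rep_start g h2
  rw [h1, startState_eq g, ← u1, ← hτ π]
  refine ⟨fun hlt => ?_, fun he l' hl' => ?_⟩
  · grind
  · have hne : os ≠ [] := by
      rintro rfl
      have := g.epoch_pos
      grind
    exact (u5 (by omega) hne l' hl'.sorted hl'.length_le hl'.mem π m hm).mono
      fun y π' h => ⟨h.1, h.2.1, h.2.2.1, h.2.2.2⟩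

theorem runOps_append (A : Scheme P) (a b : List (Op P)) (s : State P) (m : Mem P.W) :
    A.runOps (a ++ b) s m = (A.runOps a s m).bind fun y =>
      (A.runOps b y.2.2.1 y.2.2.2).map fun z => (y.1 ++ z.1, y.2.1 ++ z.2.1, z.2.2) := by
  induction a generalizing s m with
  | nil =>
      rw [Scheme.runOps, PMF.pure_bind, List.nil_append]
      exact (PMF.map_id _).symm
  | cons o a ih =>
      rw [List.cons_append, Scheme.runOps, Scheme.runOps, PMF.bind_bind]
      congr 1
      funext x
      rw [ih, PMF.map_bind, PMF.bind_map]
      congr 1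
      funext y
      rw [PMF.map_comp]
      rfl

theorem uniform_map_mul_right {H β : Type*} [Group H] [Fintype H] (τ : H) (f : H → β) :
    (PMF.uniformOfFintype H).map (fun π => f (π * τ)) = (PMF.uniformOfFintype H).map f := by
  classical
  have := congrArg (PMF.map f) (map_uniformOfFintype_equiv (Equiv.mulRight τ))
  rwa [PMF.map_comp] at this

theorem _root_.OS.Coupled.pure_left {α β : Type*} {Φ : α → β → Prop} {a : α} {q : PMF β}
    (h : ∀ b ∈ q.support, Φ a b) : Coupled Φ (PMF.pure a) q := by
  refine ⟨q.map fun b => (a, b), ?_, ?_, ?_⟩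
  · simp [PMF.map_comp]
  · rw [PMF.map_comp]; exact PMF.map_id _
  simp_all

theorem bind_congr_support {α β : Type*} {p : PMF α} {f f' : α → PMF β}
    (h : ∀ a ∈ p.support, f a = f' a) : p.bind f = p.bind f' := by
  ext b
  rw [PMF.bind_apply, PMF.bind_apply]
  refine tsum_congr fun a => ?_
  by_cases ha : p a = 0
  · simp [ha]
  simp_all

theorem responses_append (d : Dict P) (a b : List (Op P)) :
    d.responses (a ++ b) = d.responses a ++ (d.after a).responses b := by
  induction a generalizing d with
  | nil => rfl
  | cons o a ih => rw [List.cons_append, Dict.responses, ih]; rfl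

theorem after_append (d : Dict P) (a b : List (Op P)) :
    d.after (a ++ b) = (d.after a).after b := by
  induction a generalizing d with
  | nil => rfl
  | cons o a ih => rw [List.cons_append, Dict.after, ih]; rfl

/-- What the server observes, together with the shuffle at the end: a fresh one. -/
noncomputable def jointLaw (q r : ℕ) :
    PMF (List (List (Event P.W)) × Equiv.Perm (Fin P.arrayCells)) :=
  (G.viewLaw q r).bind fun τ =>
    (PMF.uniformOfFintype (Equiv.Perm (Fin P.arrayCells))).map fun π => (τ, π)

theorem jointLaw_succ (q r : ℕ) : G.jointLaw (q + 1) r = (G.epochLaw P.epoch).bind fun τ =>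
    (G.jointLaw q r).map fun z => (τ ++ z.1, z.2) := by
  simp only [jointLaw, viewLaw, PMF.bind_bind, PMF.bind_map, PMF.map_bind, PMF.map_comp]
  rfl

/-- What the server observes of any sequence of accesses has a law that depends only on their
number, all responses are right, and at the end of an epoch the shuffle is independent of
everything that the server has observed. -/
theorem coupled_runOps {r : ℕ} (hr : r < P.epoch) (q : ℕ) (ops : List (Op P)) {d : Dict P}
    (hops : ops.length = q * P.epoch + r) (hd : ∀ j, (d.after (ops.take j)).size ≤ P.n)
    {l : List P.Item} (hl : ListOf d l) {p : PMF (State P × Mem P.W)}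
    (hp : Coupled (Start l) p (PMF.uniformOfFintype (Equiv.Perm (Fin P.arrayCells)))) :
    ∀ l', ListOf (d.after ops) l' → Coupled (fun y z => y.1 = d.responses ops ∧ y.2.1 = z.1 ∧
      (r = 0 → Start l' y.2.2 z.2)) (p.bind fun x => G.scheme.runOps ops x.1 x.2)
      (G.jointLaw q r) := by
  induction q generalizing ops d l p with
  | zero =>
      intro l' hl'
      rw [zero_mul, zero_add] at hops
      obtain ⟨τ, hτ⟩ := G.exec_start hl ops (by omega)
      by_cases h0 : r = 0
      · have hnil : ops = [] := List.length_eq_zero_iff.1 (by omega)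
        subst hnil h0
        obtain rfl := hl.unique hl'
        have e : G.jointLaw 0 0 = (PMF.uniformOfFintype (Equiv.Perm (Fin P.arrayCells))).map
            fun π => ([], π) := by
          have : G.viewLaw 0 0 = PMF.pure [] := PMF.map_const _ _
          rw [jointLaw, this, PMF.pure_bind]
        rw [e]
        exact hp.map (f := fun x => ([], [], x)) fun x π h => ⟨rfl, rfl, fun _ => h⟩
      · have e : G.viewLaw 0 r = (PMF.uniformOfFintype (Equiv.Perm (Fin P.arrayCells))).bind
            fun π => PMF.pure (G.epochTrace 0 r ((List.range (P.levels * r)).map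
              (rename (π * τ)))) :=
          (uniform_map_mul_right τ fun σ => G.epochTrace 0 r
            ((List.range (P.levels * r)).map (rename σ))).symm
        rw [jointLaw, e, PMF.bind_bind]
        refine hp.bind fun x π hx => ?_
        obtain ⟨s', m', h1⟩ := (hτ x π hx).1 (by omega)
        rw [h1, PMF.pure_bind, hops]
        refine Coupled.pure_left ?_
        simp_all
  | succ q ih =>
      obtain ⟨a, b, rfl, ha⟩ : ∃ a b, ops = a ++ b ∧ a.length = P.epoch :=
        ⟨ops.take P.epoch, ops.drop P.epoch, (List.take_append_drop _ _).symm, by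
          grind⟩
      rw [List.length_append, Nat.succ_mul] at hops
      have hda : (d.after a).size ≤ P.n := by
        have := hd a.length
        grind
      have hdb : ∀ j, ((d.after a).after (b.take j)).size ≤ P.n := by
        intro j
        have := hd (a.length + j)
        rwa [List.take_length_add_append, after_append] at this
      obtain ⟨l₁, hl₁⟩ := exists_listOf hda
      obtain ⟨τ, hτ⟩ := G.exec_start hl a (by omega)
      intro l' hl'
      rw [after_append] at hl'
      have e := (uniform_map_mul_right τ fun σ => G.epochTrace 0 P.epoch
        ((List.range (P.levels * P.epoch)).map (rename σ))).symm
      rw [jointLaw_succ, epochLaw, e, PMF.bind_map]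
      refine hp.bind fun x π hx => ?_
      have hc := (hτ x π hx).2 ha l₁ hl₁
      rw [ha] at hc
      have hc' := hc.map (f := fun y => y.2.2) (g := id) (Ψ := Start l₁) fun y π' h => h.2.2
      rw [PMF.map_id] at hc'
      have h1 := (ih b (by omega) hdb hl₁ hc' l' hl').map
        (f := fun y => (d.responses a ++ y.1, G.epochTrace 0 P.epoch
          ((List.range (P.levels * P.epoch)).map (rename (π * τ))) ++ y.2.1, y.2.2))
        (g := fun z => (G.epochTrace 0 P.epoch
          ((List.range (P.levels * P.epoch)).map (rename (π * τ))) ++ z.1, z.2))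
        (Ψ := fun y z => y.1 = d.responses (a ++ b) ∧ y.2.1 = z.1 ∧
          (r = 0 → Start l' y.2.2 z.2)) (by
            rintro y z ⟨h1, h2, h3⟩
            exact ⟨by rw [responses_append, h1], by rw [h2], h3⟩)
      convert h1 using 1
      · rw [runOps_append, PMF.bind_map, PMF.map_bind]
        refine bind_congr_support fun y hy => ?_
        obtain ⟨π', h2, h3, -⟩ := hc.exists_right hy
        grind
      simp

end Geom

end OS

/-! ### The simulation of a workload -/

namespace OS

open BTree Prog

variable {P : Params}

namespace Geom

variable (G : Geom P)

theorem ofList_eq_some {S : List P.Item} (hS : (S.map Prod.fst).Nodup) (k : P.Word) (v : P.Val) :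
    Dict.ofList S k = some v ↔ (k, v) ∈ S := by
  induction S with
  | nil => simp [Dict.ofList]
  | cons x S ih =>
      rw [List.map_cons, List.nodup_cons] at hS
      have ih := ih hS.2
      rw [Dict.ofList] at ih ⊢
      grind

/-- The initial items, sorted by keys. -/
theorem exists_listOf_init {w : Workload P} (hw : w.Valid) :
    ∃ l, ListOf (Dict.ofList w.init) l ∧ w.init.Perm l := by
  have h0 := hw.size_le 0
  rw [List.take_zero, Dict.after] at h0
  obtain ⟨l, hl⟩ := exists_listOf h0
  refine ⟨l, hl, (List.perm_ext_iff_of_nodup (List.Nodup.of_map _ hw.nodup)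
    (hl.sorted.imp fun hxy e => absurd (congrArg Prod.fst e) hxy.ne)).2 fun x => ?_⟩
  rw [hl.mem, ofList_eq_some hw.nodup]

/-- A simulation of a workload: the law of what the server observes depends only on the number of
accesses. -/
theorem coupled_simulate {w : Workload P} (hw : w.Valid) {q r : ℕ} (hr : r < P.epoch)
    (h : w.ops.length = q * P.epoch + r) :
    ∃ l, ListOf ((Dict.ofList w.init).after w.ops) l ∧
      Coupled (fun x z => x.setupTrace = G.buildTrace ∧
        x.responses = (Dict.ofList w.init).responses w.ops ∧ x.traces = z.1 ∧
        (r = 0 → x.state = startState z.2 ∧ arrayOf x.mem = shuffled (layout l) z.2))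
        (G.scheme.simulate w) (G.jointLaw q r) := by
  obtain ⟨l₀, hl₀, hp⟩ := exists_listOf_init hw
  have hl := hw.size_le w.ops.length
  rw [List.take_length] at hl
  obtain ⟨l, hl⟩ := exists_listOf hl
  refine ⟨l, hl, ?_⟩
  have hb := G.coupled_build hl₀.sorted hl₀.length_le
    (G.collected_initMem (hp.length_eq ▸ hl₀.length_le) hp)
  have hb' := hb.map (f := fun y => (y.1, y.2.1)) (g := id) (Ψ := Start l₀)
    fun y π h => ⟨h.1, h.2.1⟩
  rw [PMF.map_id] at hb'
  have h1 := (G.coupled_runOps hr q w.ops h hw.size_le hl₀ hb' l hl).map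
    (f := fun y => (⟨G.buildTrace, y.1, y.2.1, y.2.2.1, y.2.2.2⟩ : Outcome P)) (g := id)
    (Ψ := fun (x : Outcome P) z => x.setupTrace = G.buildTrace ∧
        x.responses = (Dict.ofList w.init).responses w.ops ∧ x.traces = z.1 ∧
        (r = 0 → x.state = startState z.2 ∧ arrayOf x.mem = shuffled (layout l) z.2))
    (by
      rintro y z ⟨h1, h2, h3⟩
      exact ⟨rfl, h1, h2, h3⟩)
  rw [PMF.map_id, PMF.bind_map, PMF.map_bind] at h1
  convert h1 using 1
  refine bind_congr_support fun y hy => ?_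
  obtain ⟨π, -, -, h3⟩ := hb.exists_right hy
  grind

theorem correct : G.scheme.Correct := by
  intro w hw x hx
  obtain ⟨l, -, h⟩ := G.coupled_simulate hw (Nat.mod_lt _ G.good.epoch_pos)
    (Nat.div_add_mod' w.ops.length P.epoch).symm
  obtain ⟨z, -, h, -⟩ := h.exists_right hx
  exact h

theorem shuffles : Shuffles G.scheme := by
  rintro w hw ⟨q, hq⟩
  obtain ⟨l, hl, h⟩ := G.coupled_simulate hw (q := q) G.good.epoch_pos (by rw [hq, mul_comm]; rfl)
  refine ⟨layout l, isLayout_layout G.good hl.sorted hl.length_le hl.mem, ?_⟩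
  rw [h.map_eq (f := fun x => (x.view, arrayOf x.mem, x.state))
      (g := fun z => (G.buildTrace :: z.1, shuffled (layout l) z.2, startState z.2))
      fun x z h => by rw [Outcome.view, h.1, h.2.2.1, (h.2.2.2 rfl).1, (h.2.2.2 rfl).2],
    h.map_eq (f := Outcome.view) (g := fun z => G.buildTrace :: z.1)
      fun x z h => by rw [Outcome.view, h.1, h.2.2.1]]
  simp only [jointLaw, PMF.map_bind, PMF.map_comp, PMF.bind_bind]
  refine congrArg _ (funext fun τ => ?_)
  have : ((fun z : List (List (Event P.W)) × Equiv.Perm (Fin P.arrayCells) =>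
    G.buildTrace :: z.1) ∘ fun π => (τ, π)) = Function.const _ (G.buildTrace :: τ) := rfl
  rw [this, PMF.map_const, PMF.pure_bind]
  rfl

theorem map_fst_jointLaw (q r : ℕ) : (G.jointLaw q r).map Prod.fst = G.viewLaw q r := by
  simp [jointLaw, PMF.map_bind, PMF.map_comp]

theorem map_view {w : Workload P} (hw : w.Valid) : (G.scheme.simulate w).map Outcome.view =
    (G.viewLaw (w.ops.length / P.epoch) (w.ops.length % P.epoch)).map
      fun τ => G.buildTrace :: τ := by
  obtain ⟨l, -, h⟩ := G.coupled_simulate hw (Nat.mod_lt _ G.good.epoch_pos)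
    (Nat.div_add_mod' w.ops.length P.epoch).symm
  rw [← map_fst_jointLaw, PMF.map_comp]
  exact h.map_eq fun x z h => by rw [Outcome.view, h.1, h.2.2.1]; rfl

/-- What the server observes tells it nothing about the coin. -/
theorem secure : G.scheme.Secure := by
  intro w hw hlen guess
  obtain ⟨V, hV⟩ : ∃ V, ∀ c, (G.scheme.simulate (w c)).map Outcome.view = V := by
    refine ⟨(G.scheme.simulate (w true)).map Outcome.view, fun c => ?_⟩
    cases c
    · rw [map_view G (hw _), map_view G (hw _), hlen]
    · rfl
  have h1 : G.scheme.game w guess = V.bind fun τ => (guess τ).bind fun g =>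
      (PMF.uniformOfFintype Bool).map fun c => g == c := by
    rw [Scheme.game]
    have h2 : ∀ c, ((G.scheme.simulate (w c)).bind fun x => (guess x.view).map fun g => g == c) =
        V.bind fun τ => (guess τ).map fun g => g == c := by
      intro c
      rw [← hV c, PMF.bind_map]
      rfl
    simp only [h2]
    rw [PMF.bind_comm]
    refine congrArg _ (funext fun τ => ?_)
    simp only [PMF.map]
    rw [PMF.bind_comm]
    rfl
  have h2 : ∀ g, ((PMF.uniformOfFintype Bool).map fun c => g == c) = PMF.uniformOfFintype Bool := by
    intro g
    cases g
    · exact (congrArg (fun f => PMF.map f _) (by funext c; cases c <;> rfl)).trans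
        (map_uniformOfFintype_equiv Equiv.boolNot)
    · exact (congrArg (fun f => PMF.map f _) (by funext c; cases c <;> rfl)).trans (PMF.map_id _)
  simp_all

theorem le_toOuterMeasure {α : Type*} {p : PMF α} {S : Set α} {x : ℝ} (hx : x ≤ 1)
    (h : ∀ a ∈ p.support, a ∈ S) : ENNReal.ofReal x ≤ p.toOuterMeasure S := by
  rw [(PMF.toOuterMeasure_apply_eq_one_iff p S).2 h]
  simp_all

theorem setupCost {T : ℕ} {x : ℝ} (hx : x ≤ 1) (hT : G.buildTrace.length ≤ T) :
    G.scheme.SetupCost T x := by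
  intro w hw
  refine le_toOuterMeasure hx fun y hy => ?_
  obtain ⟨l, -, h⟩ := G.coupled_simulate hw (Nat.mod_lt _ G.good.epoch_pos)
    (Nat.div_add_mod' w.ops.length P.epoch).symm
  obtain ⟨z, h, -⟩ := h.exists_right hy
  grind

/-- Number of messages of an access, those of a rebuild excluded. -/
noncomputable def accessCost (P : Params) : ℕ :=
  P.levels * ((2 * P.epoch * P.cellWords + P.B - 1) / P.B + 2)

theorem length_accessTrace_le (t : ℕ) (xs : List P.Word) :
    (accessTrace P t xs).length ≤ accessCost P := by
  have h1 : ∀ (is : List ℕ) (xs : List P.Word), (descendTrace P is xs).length ≤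
      is.length * ((2 * P.epoch * P.cellWords + P.B - 1) / P.B + 1) := by
    intro is xs
    induction is generalizing xs with
    | nil => simp [descendTrace]
    | cons i is ih =>
        cases xs with
        | nil => simp [descendTrace]
        | cons x xs =>
            have := ih xs
            simp only [descendTrace, List.zipWith_cons_cons, List.flatten_cons, List.length_append,
              List.length_cons, visitTrace, cacheTrace, rangeAddrs, List.length_map,
              List.length_range, List.length_nil] at this ⊢
            grind
  have h2 := h1 (List.range P.levels) xs
  rw [List.length_range] at h2
  rw [accessTrace, accessCost, List.length_append, List.length_map, List.length_cons,
    List.length_reverse, List.length_range, Nat.mul_succ]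
  have : P.depth + 1 + 1 = P.levels := rfl
  omega

theorem sum_epochTrace_le (t n : ℕ) (U : List P.Word) (h : t + n ≤ P.epoch) :
    ((G.epochTrace t n U).map List.length).sum ≤
      n * accessCost P + if t + n = P.epoch then G.buildTrace.length else 0 := by
  induction n generalizing t U with
  | zero => simp [epochTrace]
  | succ n ih =>
      have h1 := ih (t + 1) (U.drop P.levels) (by omega)
      have h2 := length_accessTrace_le t (U.take P.levels)
      rw [epochTrace, List.map_cons, List.sum_cons, List.length_append, Nat.succ_mul]
      by_cases hn : t + 1 = P.epoch
      · obtain rfl : n = 0 := by omega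
        grind [epochTrace, zero_mul, zero_add]
      grind

theorem sum_viewLaw_le {q r : ℕ} (hr : r < P.epoch) {τ : List (List (Event P.W))}
    (hτ : τ ∈ (G.viewLaw q r).support) : (τ.map List.length).sum ≤
      (q * P.epoch + r) * accessCost P + q * G.buildTrace.length := by
  induction q generalizing τ with
  | zero =>
      rw [viewLaw, epochLaw, PMF.support_map] at hτ
      obtain ⟨σ, -, rfl⟩ := hτ
      have := G.sum_epochTrace_le 0 r ((List.range (P.levels * r)).map (rename σ)) (by omega)
      grind
  | succ q ih =>
      rw [viewLaw, PMF.mem_support_bind_iff] at hτ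
      obtain ⟨τ₁, h1, hτ⟩ := hτ
      rw [PMF.support_map] at hτ
      obtain ⟨τ₂, h2, rfl⟩ := hτ
      rw [epochLaw, PMF.support_map] at h1
      obtain ⟨σ, -, rfl⟩ := h1
      have h1 := G.sum_epochTrace_le 0 P.epoch
        ((List.range (P.levels * P.epoch)).map (rename σ)) (by omega)
      grind

theorem overhead {T k : ℕ} {x : ℝ} (hx : x ≤ 1) (hk : G.buildTrace.length ≤ k * P.epoch)
    (hT : accessCost P + k ≤ T) : G.scheme.Overhead T x := by
  intro w hw
  refine le_toOuterMeasure hx fun y hy => ?_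
  have h1 : y.view ∈ ((G.scheme.simulate w).map Outcome.view).support := by
    grind [PMF.support_map]
  rw [G.map_view hw, PMF.support_map] at h1
  obtain ⟨τ, hτ, h1⟩ := h1
  have h2 := G.sum_viewLaw_le (Nat.mod_lt _ G.good.epoch_pos) hτ
  rw [(List.cons.inj h1).2, Nat.div_add_mod'] at h2
  have h3 : w.ops.length / P.epoch * P.epoch ≤ w.ops.length := Nat.div_mul_le_self _ _
  calc _ ≤ _ := h2
    _ ≤ w.ops.length * accessCost P + w.ops.length / P.epoch * (k * P.epoch) := by gcongr
    _ = w.ops.length * accessCost P + (w.ops.length / P.epoch * P.epoch) * k := by ring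
    _ ≤ w.ops.length * accessCost P + w.ops.length * k := by gcongr
    _ = w.ops.length * (accessCost P + k) := by ring
    _ ≤ w.ops.length * T := by gcongr

end Geom

end OS

/-! ### Messages and private memory of an access -/

namespace OS

open BTree Prog

variable {P : Params}

theorem blockBound_readCell (g : P.Good) (a : ℕ) : (readCell P a).BlockBound P.B :=
  BlockBound.bind (blockBound_fetch (by have := g.block; rw [length_cellAddrs]; omega))
    fun _ => trivial

theorem blockBound_visit (g : P.Good) (t i : ℕ) (cur : Option P.Word) (next : P.Word) :
    (visit t i cur next).BlockBound P.B := by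
  have h1 : (readCache P i).BlockBound P.B :=
    BlockBound.bind (BlockBound.bind (BlockBound.forList fun j _ => blockBound_fetch (by simp))
      fun _ => trivial) fun _ => trivial
  have h2 : (readDummy P next).BlockBound P.B := by
    refine BlockBound.bind (blockBound_readCell g _) fun c => ?_
    split <;> trivial
  refine BlockBound.bind h1 fun cache => ?_
  dsimp only
  split
  · exact BlockBound.bind (blockBound_readCell g _) fun _ => trivial
  · exact BlockBound.bind h2 fun _ => trivial

theorem blockBound_access (g : P.Good) {rebuild : State P → Prog P.W (State P)}
    (hr : ∀ s, (rebuild s).BlockBound P.B) (o : Op P) (s : State P) :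
    (access rebuild o s).BlockBound P.B := by
  have h1 : ∀ (is : List ℕ) (cur : Option P.Word) (next : P.Word),
      (descend o.key s.time.val is cur next).BlockBound P.B := by
    intro is
    induction is with
    | nil => intro _ _; trivial
    | cons i is ih =>
        exact fun _ _ => BlockBound.bind (blockBound_visit g _ _ _ _) fun _ =>
          BlockBound.bind (ih _ _) fun _ => trivial
  refine BlockBound.bind (h1 _ _ _) fun x => ?_
  refine BlockBound.bind (BlockBound.forList fun x _ => blockBound_store ?_) fun _ => ?_
  · have := g.block
    grind [List.length_append, List.length_zip, length_cellAddrs, length_encode]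
  · dsimp only
    split
    · exact BlockBound.bind (hr _) fun _ => trivial
    · trivial

theorem small_readCell (g : P.Good) (a : ℕ) : Small (readCell P a) P.B P.B := by
  have h := g.block
  have hc : 3 ≤ P.cellWords := by rw [Params.cellWords]; omega
  exact (Small.bind (Geom.two_le_W g) (small_fetch (Geom.two_le_W g) (cellAddrs P a)) fun l _ =>
    small_ret (Rec.decode l) 0 0 (Geom.two_le_W g)).mono (Geom.two_le_W g)
      (by rw [length_cellAddrs]; omega) (by rw [length_cellAddrs]; omega)

theorem small_visit (g : P.Good) {R : ℕ}
    (hR : (2 * P.epoch * P.cellWords + P.B - 1) / P.B ≤ R) (t i : ℕ) (cur : Option P.Word)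
    (next : P.Word) : Small (visit t i cur next) ((R + 4) ^ 2 * P.B) ((R + 1) * P.B) := by
  have hW := Geom.two_le_W g
  have hB : 12 ≤ P.B := by
    have := g.block
    grind [Params.cellWords]
  have h1 : Small (readRange P (cacheStart P i * P.cellWords) (2 * P.epoch * P.cellWords))
      (R * (3 * P.B + 3 + R * P.B) + 1) (R * P.B) := by
    have h2 : Small (forList (fun j => Prog.fetch ((List.range
        (min P.B (2 * P.epoch * P.cellWords - j * P.B))).map fun x =>
          P.word (cacheStart P i * P.cellWords + j * P.B + x)))
        (List.range ((2 * P.epoch * P.cellWords + P.B - 1) / P.B))) _ _ :=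
      small_forList (c := P.B + 1) (r := P.B) (Q := R) hW (fun j _ => (small_fetch hW _).mono hW
        (by simp) (by simp)) (by simpa using hR)
    rw [List.length_range] at h2
    refine (Small.bind hW h2 fun l _ => small_ret l.flatten 0 0 hW).mono hW ?_ ?_
    · have h3 := Nat.mul_le_mul_right (P.B + 1 + P.B + R * P.B + 2) hR
      have h4 := Nat.mul_le_mul_right P.B hR
      grind
    · exact Nat.mul_le_mul_right _ hR
  have h2 : Small (readCache P i) (R * (3 * P.B + 3 + R * P.B) + R * P.B + 2) (R * P.B) :=
    (Small.bind hW h1 fun l _ => small_ret _ 0 0 hW).mono hW (by omega) (by omega)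
  have h3 : Small (readDummy P next) (2 * P.B + 1) P.B := by
    refine (Small.bind hW (small_readCell g _) (c' := 0) (r' := 0) fun c _ => ?_).mono hW
      (by omega) (by omega)
    split <;> exact small_ret _ _ _ hW
  refine (Small.bind hW h2 (c' := 3 * P.B + 2) (r' := P.B) fun cache _ => ?_).mono hW ?_ ?_
  · dsimp only
    split
    · exact (Small.bind hW (small_readCell g _) fun _ _ => small_ret _ 0 0 hW).mono hW
        (by omega) (by omega)
    · exact (Small.bind hW h3 fun _ _ => small_ret _ 0 0 hW).mono hW (by omega) (by omega)
  · nlinarith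
  grind

theorem small_access (g : P.Good) {R c L : ℕ} (hL : P.levels ≤ L)
    (hR : (2 * P.epoch * P.cellWords + P.B - 1) / P.B ≤ R)
    {rebuild : State P → Prog P.W (State P)} (hr : ∀ s, Small (rebuild s) c 2) (o : Op P)
    (s : State P) : Small (access rebuild o s)
      (L * ((R + 4) ^ 2 * P.B + (R + 1) * P.B + L * ((R + 1) * P.B) + 2) + L * ((R + 1) * P.B) +
        3 * L + c + 10) (L * ((R + 1) * P.B) + 2) := by
  have hW := Geom.two_le_W g
  have h1 : ∀ (is : List ℕ) (cur : Option P.Word) (next : P.Word), is.length ≤ L →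
      Small (descend o.key s.time.val is cur next)
        (is.length * ((R + 4) ^ 2 * P.B + (R + 1) * P.B + L * ((R + 1) * P.B) + 2))
        (is.length * ((R + 1) * P.B)) := by
    intro is
    induction is with
    | nil => exact fun _ _ _ => small_ret _ _ _ hW
    | cons i is ih =>
        intro cur next hl
        rw [List.length_cons] at hl ⊢
        refine (Small.bind hW (small_visit g hR _ _ _ _) fun _ _ =>
          Small.bind hW (ih _ _ (by omega)) fun _ _ => small_ret _ 0 0 hW).mono hW ?_ ?_
        · have : is.length * ((R + 1) * P.B) ≤ L * ((R + 1) * P.B) :=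
            Nat.mul_le_mul_right _ (by omega)
          grind
        grind
  refine (Small.bind hW (h1 _ _ _ (by simpa using hL)) (c' := 3 * L + c + 7) (r' := 2)
    fun x _ => ?_).mono hW ?_ ?_
  · have hlen : ∀ cells ch, ((P.depth + 1, cells) :: climb s.time.val
        ((List.range (P.depth + 1)).zip x.1).reverse ch).length ≤ L := by
      intro cells ch
      have h2 := congrArg List.length
        (climb_fst s.time.val ((List.range (P.depth + 1)).zip x.1).reverse ch)
      simp only [List.length_map, List.length_reverse, List.length_zip, List.length_range] at h2
      rw [List.length_cons, h2]
      have : P.levels = P.depth + 1 + 1 := rfl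
      omega
    refine (Small.bind hW (small_forList (c := 1) (r := 0) (Q := L) hW
      (fun _ _ => small_store hW _) (hlen _ _)) (c' := c + 3) (r' := 2) fun _ _ => ?_).mono hW ?_ ?_
    · dsimp only
      split
      · exact Small.bind hW (hr _) fun _ _ => small_ret _ 0 0 hW
      · exact small_ret _ _ _ hW
    · grind
    · simp
  · rw [List.length_range]
    have h2 := Nat.mul_le_mul_right
      ((R + 4) ^ 2 * P.B + (R + 1) * P.B + L * ((R + 1) * P.B) + 2) hL
    have h3 := Nat.mul_le_mul_right ((R + 1) * P.B) hL
    omega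
  · rw [List.length_range]
    exact Nat.add_le_add_right (Nat.mul_le_mul_right _ hL) 2

namespace Geom

variable (G : Geom P)

theorem blockBound : G.scheme.BlockBound :=
  ⟨G.blockBound_build, fun _ _ => blockBound_access G.good (fun _ => G.blockBound_build) _ _⟩

theorem privateMemory {R L M : ℕ} (hL : P.levels ≤ L)
    (hR : (2 * P.epoch * P.cellWords + P.B - 1) / P.B ≤ R)
    (hM : L * ((R + 4) ^ 2 * P.B + (R + 1) * P.B + L * ((R + 1) * P.B) + 2) +
      L * ((R + 1) * P.B) + 3 * L + (20 * (G.Q + 1) ^ 2 * P.B + 20) + 10 + (P.branch + 5) ≤ M) :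
    G.scheme.PrivateMemory M := by
  have hW := two_le_W G.good
  constructor
  · exact (G.small_build.mono hW (c' := M) (by omega) le_rfl).1
  · have h1 : (⋃ (o : Op P) (s : State P), (G.scheme.access o s).configs) ⊆
        ⋃ x : (Bool × P.Word × P.Val) × P.Word × P.Word × P.Word, (G.scheme.access
          (if x.1.1 then .get x.1.2.1 else .put x.1.2.1 x.1.2.2) ⟨x.2.1, x.2.2.1, x.2.2.2⟩).configs := by
      refine Set.iUnion_subset fun o => Set.iUnion_subset fun s y hy => Set.mem_iUnion.2 ?_
      cases o with
      | get k => exact ⟨((true, k, fun _ => P.word 0), s.root, s.next, s.time), hy⟩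
      | put k v => exact ⟨((false, k, v), s.root, s.next, s.time), hy⟩
    refine (Set.encard_le_encard h1).trans ?_
    refine (encard_iUnion_le_mul fun x =>
      (small_access G.good hL hR (fun _ => G.small_build) _ _).configs_le).trans ?_
    have h2 : Fintype.card ((Bool × P.Word × P.Val) × P.Word × P.Word × P.Word) =
        2 * P.W ^ (P.branch + 4) := by
      simp only [Fintype.card_prod, Fintype.card_bool, Fintype.card_fin, Fintype.card_fun]
      ring
    rw [h2]
    refine Nat.cast_le.2 ((Nat.mul_le_mul_right _ (two_mul_pow_le hW)).trans ?_)
    rw [← pow_add]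
    exact Nat.pow_le_pow_right (by omega) (by omega)

end Geom

end OS

/-! ### The choice of the dimensions -/

namespace OS

open BTree Prog

variable {P : Params}

namespace Params

theorem branch_pow_le (P : Params) : P.branch ^ 4 ≤ P.B := by
  have h1 : (P.branch : ℝ) ≤ (P.B : ℝ) ^ ((1 : ℝ) / 4) := Nat.floor_le (by positivity)
  have h2 : (P.branch : ℝ) ^ 4 ≤ (P.B : ℝ) := by
    calc (P.branch : ℝ) ^ 4 ≤ ((P.B : ℝ) ^ ((1 : ℝ) / 4)) ^ 4 := by gcongr
      _ = (P.B : ℝ) := by rw [← Real.rpow_natCast, ← Real.rpow_mul (by positivity)]; norm_num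
  exact_mod_cast h2

theorem branch_le (P : Params) : P.branch ≤ P.B :=
  (Nat.le_self_pow (by norm_num) _).trans P.branch_pow_le

theorem lt_branch_pow (P : Params) : P.B < (P.branch + 1) ^ 4 := by
  have h1 : (P.B : ℝ) ^ ((1 : ℝ) / 4) < P.branch + 1 := Nat.lt_floor_add_one _
  have h2 : (P.B : ℝ) < ((P.branch : ℝ) + 1) ^ 4 := by
    calc (P.B : ℝ) = ((P.B : ℝ) ^ ((1 : ℝ) / 4)) ^ 4 := by
          rw [← Real.rpow_natCast, ← Real.rpow_mul (by positivity)]; norm_num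
      _ < _ := by gcongr
  exact_mod_cast h2

theorem le_branch_pow {C : ℝ} {c : ℕ} (hc : 64 * C ≤ c) (hC : 0 < C) (hb : 1 ≤ P.branch)
    (hn : (P.n : ℝ) ≤ C * (P.B : ℝ) ^ ((3 : ℝ) / 2)) : P.n ≤ c * P.branch ^ 6 := by
  have h1 : (P.B : ℝ) ≤ (2 * P.branch) ^ 4 := by
    have h2 := P.lt_branch_pow
    have h3 : (P.branch + 1) ^ 4 ≤ (2 * P.branch) ^ 4 := Nat.pow_le_pow_left (by omega) 4
    exact_mod_cast h2.le.trans h3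
  have h2 : (P.B : ℝ) ^ ((3 : ℝ) / 2) ≤ (2 * P.branch) ^ 6 := by
    calc (P.B : ℝ) ^ ((3 : ℝ) / 2) ≤ (((2 : ℝ) * P.branch) ^ 4) ^ ((3 : ℝ) / 2) := by gcongr
      _ = (2 * P.branch) ^ 6 := by
        rw [← Real.rpow_natCast, ← Real.rpow_mul (by positivity), ← Real.rpow_natCast]
        norm_num
  have h3 : (P.n : ℝ) ≤ c * (P.branch : ℝ) ^ 6 := by
    calc (P.n : ℝ) ≤ C * (2 * P.branch) ^ 6 := hn.trans (by gcongr)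
      _ = (64 * C) * (P.branch : ℝ) ^ 6 := by ring
      _ ≤ _ := by gcongr
  exact_mod_cast h3

theorem ratio_pos (hn : 2 ≤ P.n) (hB : 2 ≤ P.B) : 1 ≤ P.ratio := by
  refine Nat.ceil_pos.2 (div_pos (Real.log_pos ?_) (Real.log_pos ?_)) <;> norm_cast

theorem le_pow_ratio (hn : 2 ≤ P.n) (hB : 2 ≤ P.B) : P.n ≤ P.B ^ P.ratio := by
  have hB' : 0 < Real.log P.B := Real.log_pos (by norm_cast)
  have h1 : Real.log P.n ≤ P.ratio * Real.log P.B :=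
    (div_le_iff₀ hB').1 (Nat.le_ceil (Real.log P.n / Real.log P.B))
  rw [← Real.log_pow] at h1
  have h2 := (Real.log_le_log_iff (by norm_cast; omega) (by positivity)).1 h1
  exact_mod_cast h2

theorem ratio_le_two {C : ℝ} (hCB : C ^ 2 ≤ P.B) (hn2 : 2 ≤ P.n) (hB : 2 ≤ P.B)
    (hn : (P.n : ℝ) ≤ C * (P.B : ℝ) ^ ((3 : ℝ) / 2)) : P.ratio ≤ 2 := by
  have hB' : 0 < Real.log P.B := Real.log_pos (by norm_cast)
  have hB0 : (0 : ℝ) < P.B := by norm_cast; omega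
  refine Nat.ceil_le.2 ((div_le_iff₀ hB').2 ?_)
  have h1 : C ≤ (P.B : ℝ) ^ ((1 : ℝ) / 2) := by
    rw [← Real.sqrt_eq_rpow]
    exact Real.le_sqrt_of_sq_le hCB
  have h2 : (P.n : ℝ) ≤ (P.B : ℝ) ^ 2 := by
    calc (P.n : ℝ) ≤ (P.B : ℝ) ^ ((1 : ℝ) / 2) * (P.B : ℝ) ^ ((3 : ℝ) / 2) :=
          hn.trans (by gcongr)
      _ = (P.B : ℝ) ^ 2 := by rw [← Real.rpow_add hB0, ← Real.rpow_natCast]; norm_num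
  have h3 := Real.log_le_log (by norm_cast; omega) h2
  simp_all

theorem le_epoch_sq (P : Params) : P.n ≤ P.epoch ^ 2 := by
  have h1 : √(P.n : ℝ) ≤ P.epoch := Nat.le_ceil _
  have h2 : (P.n : ℝ) ≤ (P.epoch : ℝ) ^ 2 := (Real.sqrt_le_left (by positivity)).1 h1
  exact_mod_cast h2

theorem epoch_le_of_sq {x : ℕ} (h : P.n ≤ x ^ 2) : P.epoch ≤ x :=
  Nat.ceil_le.2 ((Real.sqrt_le_left (by positivity)).2 (by exact_mod_cast h))

end Params

/-- The hypotheses on the parameters, in terms of the branching factor. -/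
structure Params.Large (P : Params) (c : ℕ) : Prop where
  two_le : 2 ≤ P.n
  words : P.n * P.B ≤ P.W
  branch_ge : 13122 ≤ P.branch
  ratio_pos : 1 ≤ P.ratio
  ratio_le : P.ratio ≤ 2
  n_le : P.n ≤ c * P.branch ^ 6
  c_pos : 1 ≤ c

namespace Params.Large

variable {c : ℕ}

theorem epoch_le (h : P.Large c) : P.epoch ≤ P.n := by
  have := h.two_le
  exact P.epoch_le_of_sq (by nlinarith)

theorem epoch_le_branch (h : P.Large c) : P.epoch ≤ c * P.branch ^ 3 := by
  refine P.epoch_le_of_sq (h.n_le.trans ?_)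
  have := h.c_pos
  rw [mul_pow, ← pow_mul]
  exact Nat.mul_le_mul_right _ (by nlinarith)

theorem levels_le (h : P.Large c) : P.levels ≤ 10 := by
  have := h.ratio_le
  rw [Params.levels, Params.depth]; omega

theorem slots_le (h : P.Large c) : P.arrayCells + 2 * P.epoch ≤ 19 * P.n := by
  have h1 := h.levels_le
  have h2 := h.two_le
  have h3 := h.epoch_le
  have h4 : P.levels * P.epoch ≤ 10 * P.epoch := Nat.mul_le_mul_right _ h1
  have h5 : P.levels = P.depth + 2 := rfl
  rw [Params.arrayCells, Params.treeCells]
  omega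

theorem cap (h : P.Large c) : P.n < (P.branch / 2) ^ (P.depth + 1) := by
  have h1 := h.branch_ge
  have hB : 2 ≤ P.B := le_trans (by omega) P.branch_le
  set f := P.branch / 2 with hf
  calc P.n ≤ P.B ^ P.ratio := P.le_pow_ratio h.two_le hB
    _ < ((P.branch + 1) ^ 4) ^ P.ratio :=
        Nat.pow_lt_pow_left P.lt_branch_pow (by have := h.ratio_pos; omega)
    _ ≤ ((3 * f) ^ 4) ^ P.ratio :=
        Nat.pow_le_pow_left (Nat.pow_le_pow_left (by omega) 4) _
    _ = (3 ^ 4) ^ P.ratio * f ^ P.depth := by rw [mul_pow, mul_pow, ← pow_mul f, Params.depth]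
    _ ≤ f * f ^ P.depth := Nat.mul_le_mul_right _
        ((Nat.pow_le_pow_right (by norm_num) h.ratio_le).trans (by norm_num; omega))
    _ = _ := by rw [pow_succ, mul_comm]

/-- The dimensions. If there are more rows than fit in a block, the number of rows in a block is of
the order of `b ^ 3`, and columnsort is applied twice, with `b` blocks inside. -/
theorem exists_geom (h : P.Large c) : ∃ G : Geom P, G.K ≤ 2 * P.epoch ∧
    G.Q = 36 * (19 * c + 8 + 4 * c) := by
  set b := P.branch with hb
  set T := 19 * c + 8 with hT
  have hb1 : 13122 ≤ b := h.branch_ge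
  have hc := h.c_pos
  set e := P.epoch with he
  have he1 : e ≤ P.n := h.epoch_le
  have he2 : e ≤ c * b ^ 3 := h.epoch_le_branch
  have he3 : P.n ≤ e ^ 2 := P.le_epoch_sq
  have hn := h.two_le
  have hN : P.arrayCells + 2 * e ≤ 19 * P.n := h.slots_le
  have hB : b ^ 4 ≤ P.B := P.branch_pow_le
  have hepos : 1 ≤ e := by
    grind
  have hw : P.cellWords = 2 * b + 3 := rfl
  set N := P.arrayCells + 2 * e with hNdef
  have hNpos : 4 ≤ N := by
    have : P.arrayCells = 2 * P.n + P.depth + 1 + P.levels * P.epoch := rfl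
    omega
  obtain ⟨r, s2, s1, p1, p2, inner, outer, slots, hr, hK, hrK⟩ : ∃ r s2 s1 : ℕ, 0 < s2 ∧ 0 < s1 ∧
      s2 * s2 ≤ r / 2 ∧ s1 * s1 ≤ r * s2 / 2 ∧ N ≤ r * (s2 * s1) ∧ r ≤ T * b ^ 3 ∧
      s2 * s1 ≤ 2 * e ∧ r * (s2 * s1) ≤ N * (b + 1) := by
    by_cases hcase : N ≤ T * b ^ 3
    · exact ⟨N, 1, 1, one_pos, one_pos, by omega, by omega, by omega, hcase, by omega,
        by nlinarith⟩
    · rw [not_le] at hcase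
      have hTb : 0 < T * b ^ 4 := by positivity
      set x := N / (T * b ^ 4) with hx
      have hx1 : x * (T * b ^ 4) ≤ N := Nat.div_mul_le_self _ _
      have hx2 : N < (x + 1) * (T * b ^ 4) := by
        rw [mul_comm]; exact Nat.lt_mul_div_succ _ hTb
      have hxb : x ≤ b ^ 2 := by
        have h1 : x * (T * b ^ 4) ≤ b ^ 2 * (T * b ^ 4) := by
          have h2 := h.n_le
          grind
        simp_all
      have hbe : b * x ≤ e := by
        have h1 : b * x * (T * b ^ 3) ≤ e * (T * b ^ 3) := by
          calc b * x * (T * b ^ 3) = x * (T * b ^ 4) := by ring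
            _ ≤ 19 * (e * e) := by rw [← sq]; omega
            _ ≤ 19 * (e * (c * b ^ 3)) := by gcongr
            _ = e * (19 * c * b ^ 3) := by ring
            _ ≤ e * (T * b ^ 3) := Nat.mul_le_mul_left _ (Nat.mul_le_mul_right _ (by omega))
        exact Nat.le_of_mul_le_mul_right h1 (by positivity)
      have hbe' : b ≤ e := by
        by_contra hlt
        have h1 : e ^ 2 ≤ b ^ 2 := Nat.pow_le_pow_left (by omega) 2
        have h2 : 19 * b ^ 2 ≤ T * b ^ 3 := Nat.mul_le_mul (by omega)
          (Nat.pow_le_pow_right (by omega) (by omega))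
        omega
      refine ⟨T * b ^ 3, b, x + 1, by omega, Nat.succ_pos _, ?_, ?_, ?_, le_rfl, ?_, ?_⟩
      · rw [Nat.le_div_iff_mul_le two_pos]
        calc b * b * 2 = 2 * b ^ 2 := by ring
          _ ≤ T * b ^ 3 := Nat.mul_le_mul (by omega) (Nat.pow_le_pow_right (by omega) (by omega))
      · rw [Nat.le_div_iff_mul_le two_pos]
        have h1 : x + 1 ≤ 2 * b ^ 2 := by
          have : 1 ≤ b ^ 2 := Nat.one_le_pow _ _ (by omega)
          omega
        calc (x + 1) * (x + 1) * 2 ≤ (2 * b ^ 2) * (2 * b ^ 2) * 2 := by gcongr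
          _ = 8 * b ^ 4 := by ring
          _ ≤ T * b ^ 4 := Nat.mul_le_mul_right _ (by omega)
          _ = _ := by ring
      · grind
      · grind
      · have h1 : T * b ^ 4 ≤ N * b := by
          calc T * b ^ 4 = T * b ^ 3 * b := by ring
            _ ≤ _ := Nat.mul_le_mul_right _ hcase.le
        grind
  have hcells : P.arrayCells + P.levels * (2 * P.epoch) ≤ 39 * P.n := by
    have h4 : P.levels * (2 * P.epoch) ≤ 10 * (2 * P.epoch) := Nat.mul_le_mul_right _ h.levels_le
    omega
  have words : (P.arrayCells + P.levels * (2 * P.epoch)) * P.cellWords +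
      3 * ((r * (s2 * s1) + s2 * s1) * (P.cellWords + 1)) ≤ P.W := by
    have h1 : P.cellWords + 1 ≤ 3 * b := by omega
    have h2 : r * (s2 * s1) + s2 * s1 ≤ 40 * P.n * b := by
      have h3 : N * (b + 1) ≤ 19 * P.n * (2 * b) := Nat.mul_le_mul hN (by omega)
      have h4 : 2 * P.n * 1 ≤ 2 * P.n * b := Nat.mul_le_mul_left _ (by omega)
      grind
    calc _ ≤ 39 * P.n * (3 * b) + 3 * (40 * P.n * b * (3 * b)) := by gcongr; omega
      _ ≤ P.n * (477 * b ^ 2) := by nlinarith [Nat.zero_le (P.n * b), Nat.mul_le_mul_left (P.n * b) (show 1 ≤ b by omega)]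
      _ ≤ P.n * b ^ 4 := by
        refine Nat.mul_le_mul_left _ ?_
        calc 477 * b ^ 2 ≤ b ^ 2 * b ^ 2 := Nat.mul_le_mul_right _ (by nlinarith)
          _ = b ^ 4 := by ring
      _ ≤ P.n * P.B := Nat.mul_le_mul_left _ hB
      _ ≤ P.W := h.words
  have hb4 : 13122 ^ 3 * b ≤ b ^ 4 := by
    calc 13122 ^ 3 * b ≤ b ^ 3 * b := Nat.mul_le_mul_right _ (Nat.pow_le_pow_left hb1 3)
      _ = b ^ 4 := by ring
  refine ⟨⟨r, s2, s1, 36 * (T + 4 * c), ⟨hn, by omega, h.cap, hepos, he1,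
    (Nat.le_add_right _ _).trans words, by omega⟩,
    p1, p2, inner, outer, slots, words, ?_⟩, hK, rfl⟩
  have h1 : r + s2 * s1 + 2 * e ≤ (T + 4 * c) * b ^ 3 := by
    grind
  calc 4 * (r + s2 * s1 + 2 * e) * (P.cellWords + 1) ≤ 4 * ((T + 4 * c) * b ^ 3) * (3 * b) := by
        gcongr; omega
    _ = 12 * (T + 4 * c) * b ^ 4 := by ring
    _ ≤ 12 * (T + 4 * c) * (3 * (P.B / 2)) := Nat.mul_le_mul_left _ (by omega)
    _ = _ := by ring

end Params.Large

end OS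

theorem mainTheorem4 (C : ℝ) (hC : 0 < C) :
    ∃ (K B₀ : ℕ) (c : ℝ), 1 < c ∧
      ∀ P : OS.Params, B₀ ≤ P.B → 2 ≤ P.n → (P.n : ℝ) ≤ C * (P.B : ℝ) ^ ((3 : ℝ) / 2) →
        P.n * P.B ≤ P.W →
        P.ratio ≤ K ∧
        ∃ (setup : OS.Prog P.W (OS.State P))
          (rebuild : OS.State P → OS.Prog P.W (OS.State P)),
          (OS.bTreeOS setup rebuild).BlockBound ∧
          (OS.bTreeOS setup rebuild).PrivateMemory (K * P.B) ∧
          (OS.bTreeOS setup rebuild).Correct ∧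
          OS.BTree.Shuffles (OS.bTreeOS setup rebuild) ∧
          (OS.bTreeOS setup rebuild).SetupCost (K * P.epoch) (1 - 1 / (P.n : ℝ) ^ c) ∧
          (OS.bTreeOS setup rebuild).Overhead (K * P.ratio) (1 - 1 / (P.n : ℝ) ^ c) ∧
          (OS.bTreeOS setup rebuild).Secure := by
  obtain ⟨c, hc⟩ : ∃ c : ℕ, 64 * C ≤ c := ⟨_, Nat.le_ceil _⟩
  have hc1 : 1 ≤ c := by
    have : (0 : ℝ) < c := by linarith
    exact_mod_cast this
  obtain ⟨Q, hQ⟩ : ∃ Q, Q = 36 * (19 * c + 8 + 4 * c) := ⟨_, rfl⟩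
  obtain ⟨R, hR⟩ : ∃ R, R = 6 * c := ⟨_, rfl⟩
  obtain ⟨K, hK'⟩ : ∃ K, K = 10 * (R + 4) ^ 2 + 120 * (R + 1) + 20 * (Q + 1) ^ 2 + 10 * (R + 2) +
    280 * (Q + 1) + 90 := ⟨_, rfl⟩
  refine ⟨K, 13122 ^ 4 + ⌈C ^ 2⌉₊, 2, by norm_num, fun P hB hn hnB hW => ?_⟩
  have hb : 13122 ≤ P.branch := by
    have h1 := P.lt_branch_pow
    have h2 := lt_of_pow_lt_pow_left₀ 4 (Nat.zero_le _) ((show 13122 ^ 4 ≤ P.B by omega).trans_lt h1)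
    omega
  have hB2 : 2 ≤ P.B := by omega
  have hCB : C ^ 2 ≤ P.B := (Nat.le_ceil _).trans (by norm_cast; omega)
  have h : P.Large c := ⟨hn, hW, hb, P.ratio_pos hn hB2, P.ratio_le_two hCB hn hB2 hnB,
    P.le_branch_pow hc hC (by omega) hnB, hc1⟩
  obtain ⟨G, hK, hGQ⟩ := h.exists_geom
  rw [← hQ] at hGQ
  have h1 : 1 - 1 / (P.n : ℝ) ^ (2 : ℝ) ≤ 1 := by
    simp
  have h2 : G.buildTrace.length ≤ (280 * (Q + 1) + 1) * P.epoch := by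
    have h3 := G.length_buildTrace_le
    have h4 := G.good.epoch_pos
    rw [hGQ] at h3
    nlinarith [Nat.mul_le_mul_right (2 * Q + 2) hK]
  have h3 : (2 * P.epoch * P.cellWords + P.B - 1) / P.B ≤ R := by
    have h4 : 2 * P.epoch * P.cellWords ≤ R * P.B := by
      calc 2 * P.epoch * P.cellWords ≤ 2 * (c * P.branch ^ 3) * (3 * P.branch) :=
            Nat.mul_le_mul (Nat.mul_le_mul_left _ h.epoch_le_branch) (by
              rw [OS.Params.cellWords]; omega)
        _ = 6 * c * P.branch ^ 4 := by ring
        _ ≤ R * P.B := by rw [hR]; exact Nat.mul_le_mul_left _ P.branch_pow_le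
    rw [← Nat.lt_succ_iff, Nat.div_lt_iff_lt_mul (by omega), Nat.succ_mul R]
    omega
  have h4 : OS.Geom.accessCost P ≤ 10 * (R + 2) := Nat.mul_le_mul h.levels_le (by omega)
  refine ⟨h.ratio_le.trans (by omega), G.build, fun _ => G.build, G.blockBound,
    G.privateMemory h.levels_le h3 ?_, G.correct, G.shuffles, G.setupCost h1 (h2.trans ?_),
    G.overhead h1 h2 ?_, G.secure⟩
  · have hbB := P.branch_le
    rw [hGQ, hK']
    nlinarith
  · exact Nat.mul_le_mul_right _ (by omega)
  · exact (show OS.Geom.accessCost P + (280 * (Q + 1) + 1) ≤ K by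
      rw [hK']; linarith [Nat.zero_le ((R + 4) ^ 2), Nat.zero_le ((Q + 1) ^ 2)]).trans
      (Nat.le_mul_of_pos_right K h.ratio_pos)
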